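/- Let $X$ be a compact complex manifold of dimension $n\ge 1$ and let $D\subset X$ be a smooth hypersurface, i.e. a closed complex submanifold of codimension one. A *local equation* of $D$ on an open set $U\subset X$ is a holomorphic function $f$ on $U$ whose zero set is $D\cap U$ and whose differential does not vanish at any point of $D\cap U$. Integrals over $X$ and $D$ are taken with respect to the orientations given by the complex structures. *Residues.* (a) If a smooth form $\omega$ on $X\smallsetminus D$ can be written near each point of $D$ as $\omega=\frac{df}{f}\wedge\sigma+\tau$, with $f$ a local equation and $\sigma,\tau$ smooth, its Poincaré residue is the form on $D$ given locally by $\sigma|_D$. (b) The Leray residue $\mathrm{Res}\,\omega$ of a closed form $\omega$ on $X\smallsetminus D$ is the de Rham cohomology class on $D$ of the Poincaré residue of any form $\tilde\omega=\omega+d\gamma$, with $\gamma$ smooth on $X\smallsetminus D$, such that $f\tilde\omega$ extends smoothly across $D$ for every local equation $f$. (c) Let $\omega$ be a smooth form of type $(n,0)$ on $X\smallsetminus D$ with poles on $D$ (that is, $f^k\omega$ extends smoothly across $D$ for some $k$ and every local equation $f$). Then $\mathrm{Res}_\partial\,\omega\in\Gamma(D,\mathcal A_D^{n-1,0})/\mathrm{Im}\,\partial$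 is the class of the Poincaré residue of $\tilde\omega$, for any decomposition $\omega=\tilde\omega+\partial\gamma$ in which $\tilde\omega$ is a logarithmic form of type $(n,0)$ (i.e. $f\tilde\omega$ and $df\wedge\tilde\omega$ extend smoothly across $D$ for every local equation $f$) and $\gamma$ is a smooth form of type $(n-1,0)$ on $X\smallsetminus D$ with poles on $D$. A *cut-off function* is a function $\lambda\colon X\to[0,\infty)$ such that $\lambda>0$ on $X\smallsetminus D$ and such that for every local equation $f$ on $U$ one has $\lambda=h\,|f|$ on $U$ with a smooth positive function $h$ on $U$. **Theorem.** Let $m\ge 0$, and let $\alpha,\beta$ be holomorphic $n$-forms on $X\smallsetminus D$ such that $f^m\alpha$ and $f\beta$ extend holomorphically across $D$ for every local equation $f$. Then the Poincaré residue $\mathrm{Res}\,\beta$, the Leray residue $\mathrm{Res}\,\alpha$ and, for every $\varphi\in C^\infty(X,\mathbb R)$, the residue $\mathrm{Res}_\partial(\varphi\alpha)$ exist. For every cut-off function $\lambda$ the form $\alpha\wedge\bar\beta$ is integrable on $\{\lambda\ge\epsilon\}$ for all $\epsilon>0$, and there is a number $I_1(\lambda)\in\mathbb C$ such that, as $\epsilon\to0^+$,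 $$\frac1{2\pi i}\int_{\lambda\ge\epsilon}\alpha\wedge\bar\beta=I_0\log\epsilon+I_1(\lambda)+O(\epsilon),\qquad I_0=2(-1)^{n-1}\int_D\mathrm{Res}\,\alpha\wedge\overline{\mathrm{Res}\,\beta}.$$ Moreover, for every cut-off function $\lambda$ and every $\varphi\in C^\infty(X,\mathbb R)$, $$I_1(e^{\varphi}\lambda)=I_1(\lambda)-2(-1)^{n-1}\int_D\mathrm{Res}_\partial(\varphi\alpha)\wedge\overline{\mathrm{Res}\,\beta}.$$ Here the integrals over $D$ are computed with arbitrary representatives of the classes $\mathrm{Res}\,\alpha$ and $\mathrm{Res}_\partial(\varphi\alpha)$, and do not depend on their choice. -/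

import Mathlib

open Set Filter Topology MeasureTheory Manifold
open scoped ContDiff

noncomputable section

namespace DivInt

/-! ### Alternating forms on a complex vector space, regarded as a real vector space -/

/-- The product of an alternating `p`-form of the first `p` vectors with an alternating `q`-form of
the last `q` vectors. -/
def tensorForm {d p q : ℕ} (a : (Fin d → ℂ) [⋀^Fin p]→L[ℝ] ℂ) (b : (Fin d → ℂ) [⋀^Fin q]→L[ℝ] ℂ) :
    ContinuousMultilinearMap ℝ (fun _ : Fin (p + q) => (Fin d → ℂ)) ℂ where
  toFun v := a (fun i => v (Fin.castAdd q i)) * b (fun j => v (Fin.natAdd p j))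
  map_update_add' := by
    intro inst v k x y
    obtain rfl := Subsingleton.elim inst (instDecidableEqFin (p + q))
    refine Fin.addCases (fun i => ?_) (fun j => ?_) k
    · have h1 : ∀ z, (fun i' => Function.update v (Fin.castAdd q i) z (Fin.castAdd q i')) =
          Function.update (fun i' => v (Fin.castAdd q i')) i z := by
        intro z; ext1 i'; by_cases h : i' = i
        · subst h; simp
        · simp [Function.update, h]
      have h2 : ∀ z, (fun j' => Function.update v (Fin.castAdd q i) z (Fin.natAdd p j')) =
          (fun j' => v (Fin.natAdd p j')) := by
        intro z; ext1 j'
        exact Function.update_of_ne (by intro h; have := congrArg Fin.val h; simp at this; omega) _ _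
      simp only [h1, h2, a.map_update_add, add_mul]
    · have h1 : ∀ z, (fun j' => Function.update v (Fin.natAdd p j) z (Fin.natAdd p j')) =
          Function.update (fun j' => v (Fin.natAdd p j')) j z := by
        intro z; ext1 j'; by_cases h : j' = j
        · subst h; simp
        · simp [Function.update, h]
      have h2 : ∀ z, (fun i' => Function.update v (Fin.natAdd p j) z (Fin.castAdd q i')) =
          (fun i' => v (Fin.castAdd q i')) := by
        intro z; ext1 i'
        exact Function.update_of_ne (by intro h; have := congrArg Fin.val h; simp at this; omega) _ _
      simp only [h1, h2, b.map_update_add, mul_add]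
  map_update_smul' := by
    intro inst v k c x
    obtain rfl := Subsingleton.elim inst (instDecidableEqFin (p + q))
    refine Fin.addCases (fun i => ?_) (fun j => ?_) k
    · have h1 : ∀ z, (fun i' => Function.update v (Fin.castAdd q i) z (Fin.castAdd q i')) =
          Function.update (fun i' => v (Fin.castAdd q i')) i z := by
        intro z; ext1 i'; by_cases h : i' = i
        · subst h; simp
        · simp [Function.update, h]
      have h2 : ∀ z, (fun j' => Function.update v (Fin.castAdd q i) z (Fin.natAdd p j')) =
          (fun j' => v (Fin.natAdd p j')) := by
        intro z; ext1 j'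
        exact Function.update_of_ne (by intro h; have := congrArg Fin.val h; simp at this; omega) _ _
      simp only [h1, h2, a.map_update_smul, smul_mul_assoc]
    · have h1 : ∀ z, (fun j' => Function.update v (Fin.natAdd p j) z (Fin.natAdd p j')) =
          Function.update (fun j' => v (Fin.natAdd p j')) j z := by
        intro z; ext1 j'; by_cases h : j' = j
        · subst h; simp
        · simp [Function.update, h]
      have h2 : ∀ z, (fun i' => Function.update v (Fin.natAdd p j) z (Fin.castAdd q i')) =
          (fun i' => v (Fin.castAdd q i')) := by
        intro z; ext1 i'
        exact Function.update_of_ne (by intro h; have := congrArg Fin.val h; simp at this; omega) _ _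
      simp only [h1, h2, b.map_update_smul, mul_smul_comm]
  cont := by
    refine Continuous.mul (a.cont.comp ?_) (b.cont.comp ?_) <;> fun_prop

theorem tensorForm_apply {d p q : ℕ} (a : (Fin d → ℂ) [⋀^Fin p]→L[ℝ] ℂ)
    (b : (Fin d → ℂ) [⋀^Fin q]→L[ℝ] ℂ) (v : Fin (p + q) → Fin d → ℂ) :
    tensorForm a b v = a (fun i => v (Fin.castAdd q i)) * b (fun j => v (Fin.natAdd p j)) :=
  rfl

/-- The wedge product of alternating forms,
`(a ∧ b)(v) = 1/(p! q!) ∑_s sgn(s) a(v_{s 1}, …, v_{s p}) b(v_{s (p+1)}, …, v_{s (p+q)})`. -/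
def wedge {d p q : ℕ} (a : (Fin d → ℂ) [⋀^Fin p]→L[ℝ] ℂ) (b : (Fin d → ℂ) [⋀^Fin q]→L[ℝ] ℂ) :
    (Fin d → ℂ) [⋀^Fin (p + q)]→L[ℝ] ℂ :=
  ((p.factorial * q.factorial : ℝ))⁻¹ • ContinuousMultilinearMap.alternatization (tensorForm a b)

/-- The wedge product `l ∧ a` of a linear form with an alternating `r`-form,
`(l ∧ a)(v₀, …, v_r) = ∑_i (-1)^i l(v_i) a(v₀, …, v̂_i, …, v_r)`; it is the special case `p = 1` of the
wedge product, valued in forms of degree `r + 1` (rather than `1 + r`). -/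
def wedgeOne {d r : ℕ} (l : (Fin d → ℂ) →L[ℝ] ℂ) (a : (Fin d → ℂ) [⋀^Fin r]→L[ℝ] ℂ) :
    (Fin d → ℂ) [⋀^Fin (r + 1)]→L[ℝ] ℂ :=
  ContinuousAlternatingMap.alternatizeUncurryFin (l.smulRight a)

/-- The complex conjugate of a complex valued form. -/
def conjForm {d r : ℕ} (a : (Fin d → ℂ) [⋀^Fin r]→L[ℝ] ℂ) : (Fin d → ℂ) [⋀^Fin r]→L[ℝ] ℂ :=
  (Complex.conjCLE : ℂ →L[ℝ] ℂ).compContinuousAlternatingMap a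

/-- An alternating `r`-form is of type `(r, 0)` if it is complex linear in each argument. -/
def IsTypeHol {d r : ℕ} (a : (Fin d → ℂ) [⋀^Fin r]→L[ℝ] ℂ) : Prop :=
  ∀ (v : Fin r → Fin d → ℂ) (i : Fin r),
    a (Function.update v i (Complex.I • v i)) = Complex.I * a v

/-- Multiplication by `i`, as a real linear map. -/
def mulI (d : ℕ) : (Fin d → ℂ) →L[ℝ] (Fin d → ℂ) :=
  (Complex.I • ContinuousLinearMap.id ℂ (Fin d → ℂ)).restrictScalars ℝ

/-- The multilinear map underlying `holPart`: in each of the `r` arguments the projection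
`a ↦ (a - i a(i ·)) / 2` to the complex linear part is applied. -/
def holPartML {d r : ℕ} (a : (Fin d → ℂ) [⋀^Fin r]→L[ℝ] ℂ) :
    ContinuousMultilinearMap ℝ (fun _ : Fin r => (Fin d → ℂ)) ℂ :=
  ((2 : ℂ) ^ r)⁻¹ • ∑ S : Finset (Fin r), (-Complex.I) ^ S.card •
    a.toContinuousMultilinearMap.compContinuousLinearMap
      (fun j => if j ∈ S then mulI d else ContinuousLinearMap.id ℝ (Fin d → ℂ))

theorem holPartML_apply {d r : ℕ} (a : (Fin d → ℂ) [⋀^Fin r]→L[ℝ] ℂ) (v : Fin r → Fin d → ℂ) :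
    holPartML a v = ((2 : ℂ) ^ r)⁻¹ * ∑ S : Finset (Fin r), (-Complex.I) ^ S.card *
      a (fun j => if j ∈ S then Complex.I • v j else v j) := by
  have h : ∀ S : Finset (Fin r), (fun j => (if j ∈ S then mulI d else
      ContinuousLinearMap.id ℝ (Fin d → ℂ)) (v j)) =
      (fun j => if j ∈ S then Complex.I • v j else v j) := by
    intro S; ext1 j; split_ifs <;> rfl
  simp only [holPartML, smul_apply, sum_apply,
    smul_eq_mul, ContinuousMultilinearMap.compContinuousLinearMap_apply, h]
  rfl

/-- The component of type `(r, 0)` of an alternating `r`-form. -/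
def holPart {d r : ℕ} (a : (Fin d → ℂ) [⋀^Fin r]→L[ℝ] ℂ) : (Fin d → ℂ) [⋀^Fin r]→L[ℝ] ℂ :=
  { holPartML a with
    map_eq_zero_of_eq' := by
      intro v i j hv hij
      change holPartML a v = 0
      rw [holPartML_apply]
      have key : (∑ S : Finset (Fin r), (-Complex.I) ^ S.card *
          a (fun k => if k ∈ S then Complex.I • v k else v k)) =
          -(∑ S : Finset (Fin r), (-Complex.I) ^ S.card *
          a (fun k => if k ∈ S then Complex.I • v k else v k)) := by
        rw [← Finset.sum_neg_distrib]
        refine Fintype.sum_equiv (Equiv.finsetCongr (Equiv.swap i j)) _ _ (fun S => ?_)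
        have hc : (fun k => if k ∈ (Equiv.finsetCongr (Equiv.swap i j)) S
            then Complex.I • v k else v k) =
            (fun k => if k ∈ S then Complex.I • v k else v k) ∘ Equiv.swap i j := by
          ext1 k
          have hvk : v (Equiv.swap i j k) = v k := by
            rcases eq_or_ne k i with rfl | h1
            · simp [hv]
            · rcases eq_or_ne k j with rfl | h2
              · simp [hv]
              · rw [Equiv.swap_apply_of_ne_of_ne h1 h2]
          have hm : k ∈ (Equiv.finsetCongr (Equiv.swap i j)) S ↔ Equiv.swap i j k ∈ S := by
            simp [Equiv.finsetCongr_apply, Finset.mem_map_equiv]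
          simp only [Function.comp_apply, hvk, hm]
        have hs := a.toAlternatingMap.map_swap
          (fun k => if k ∈ S then Complex.I • v k else v k) hij
        simp only [ContinuousAlternatingMap.coe_toAlternatingMap] at hs
        rw [hc, hs]
        simp
      have h0 := self_eq_neg.mp key
      rw [h0, mul_zero] }

theorem holPart_apply {d r : ℕ} (a : (Fin d → ℂ) [⋀^Fin r]→L[ℝ] ℂ) (v : Fin r → Fin d → ℂ) :
    holPart a v = ((2 : ℂ) ^ r)⁻¹ * ∑ S : Finset (Fin r), (-Complex.I) ^ S.card *
      a (fun j => if j ∈ S then Complex.I • v j else v j) :=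
  holPartML_apply a v

/-! ### Differential forms on a complex manifold -/

/-- A (not necessarily continuous) complex valued differential form of degree `r` on a complex
manifold `M` of dimension `d`: at each point `x` a real multilinear alternating form on the tangent
space of `M` at `x`, which in Mathlib is the model space `ℂᵈ` (the identification is given by the
preferred chart at `x`). Forms on an open subset are represented by forms on `M` whose values outside
of that subset are irrelevant. -/
abbrev DForm (d r : ℕ) (M : Type*) := M → (Fin d → ℂ) [⋀^Fin r]→L[ℝ] ℂ

section Forms

variable {d r : ℕ} {M : Type*} [TopologicalSpace M] [ChartedSpace (Fin d → ℂ) M]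

/-- The expression of a form in a chart `e`: the pull-back by `e⁻¹`, meaningful on `e.target`. -/
def inChart (e : OpenPartialHomeomorph M (Fin d → ℂ)) (a : DForm d r M) (z : Fin d → ℂ) :
    (Fin d → ℂ) [⋀^Fin r]→L[ℝ] ℂ :=
  (a (e.symm z)).compContinuousLinearMap
    (mfderiv 𝓘(ℝ, Fin d → ℂ) 𝓘(ℝ, Fin d → ℂ) e.symm z)

/-- The form is of class `C^∞` (in the real sense) on the open set `U`. -/
def SmoothFormOn (a : DForm d r M) (U : Set M) : Prop :=
  ∀ e ∈ atlas (Fin d → ℂ) M, ContDiffOn ℝ ∞ (inChart e a) (e.target ∩ e.symm ⁻¹' U)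

/-- The form is a holomorphic form of type `(r, 0)` on the open set `U`. -/
def HolFormOn (a : DForm d r M) (U : Set M) : Prop :=
  (∀ x ∈ U, IsTypeHol (a x)) ∧
    ∀ e ∈ atlas (Fin d → ℂ) M, DifferentiableOn ℂ (inChart e a) (e.target ∩ e.symm ⁻¹' U)

/-- The exterior derivative, computed in the preferred chart at each point. -/
def extD (a : DForm d r M) : DForm d (r + 1) M := fun x =>
  (extDeriv (inChart (chartAt (Fin d → ℂ) x) a) (chartAt (Fin d → ℂ) x x)).compContinuousLinearMap
    (mfderiv 𝓘(ℝ, Fin d → ℂ) 𝓘(ℝ, Fin d → ℂ) (chartAt (Fin d → ℂ) x) x)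

/-- The Dolbeault differential `∂ : 𝒜^{r,0} → 𝒜^{r+1,0}`: for a form `a` of type `(r, 0)`, `∂a` is the
component of type `(r+1, 0)` of `da`. -/
def del (a : DForm d r M) : DForm d (r + 1) M := fun x => holPart (extD a x)

/-- The differential of a complex valued function. -/
def dFun (f : M → ℂ) (x : M) : (Fin d → ℂ) →L[ℝ] ℂ :=
  mfderiv 𝓘(ℝ, Fin d → ℂ) 𝓘(ℝ, ℂ) f x

end Forms

/-- The form is exact, i.e. `d` of a global smooth form (there are no nonzero forms of
degree `-1`). -/
def IsDExact {d : ℕ} {M : Type*} [TopologicalSpace M] [ChartedSpace (Fin d → ℂ) M] :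
    {r : ℕ} → DForm d r M → Prop
  | 0, a => a = 0
  | r + 1, a => ∃ b : DForm d r M, SmoothFormOn b univ ∧ a = extD b

/-- The form of type `(r, 0)` is `∂`-exact, i.e. `∂` of a global smooth form of type
`(r - 1, 0)`. -/
def IsDelExact {d : ℕ} {M : Type*} [TopologicalSpace M] [ChartedSpace (Fin d → ℂ) M] :
    {r : ℕ} → DForm d r M → Prop
  | 0, a => a = 0
  | r + 1, a => ∃ b : DForm d r M, SmoothFormOn b univ ∧ (∀ x, IsTypeHol (b x)) ∧ a = del b

/-! ### Integration of top degree forms over compact complex manifolds -/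

theorem exists_chartPOU (d : ℕ) (M : Type*) [TopologicalSpace M] [ChartedSpace (Fin d → ℂ) M]
    [T2Space M] [CompactSpace M] : ∃ f : PartitionOfUnity M M,
    f.IsSubordinate (fun x => (chartAt (Fin d → ℂ) x).source) :=
  PartitionOfUnity.exists_isSubordinate isClosed_univ _
    (fun x => (chartAt (Fin d → ℂ) x).open_source)
    (fun x _ => mem_iUnion.mpr ⟨x, mem_chart_source _ x⟩)

/-- A partition of unity subordinate to the covering by the domains of the charts. -/
def chartPOU (d : ℕ) (M : Type*) [TopologicalSpace M] [ChartedSpace (Fin d → ℂ) M] [T2Space M]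
    [CompactSpace M] : PartitionOfUnity M M :=
  Classical.choose (exists_chartPOU d M)

/-- The real basis `∂/∂x₁, ∂/∂y₁, …, ∂/∂x_d, ∂/∂y_d` of `ℂᵈ`, positive for the complex
orientation. -/
def stdFrame (d : ℕ) : Fin (d + d) → Fin d → ℂ := fun k =>
  Pi.single ⟨k / 2, by omega⟩ (if (k : ℕ) % 2 = 0 then 1 else Complex.I)

section Integration

variable {d : ℕ} {M : Type*} [TopologicalSpace M] [ChartedSpace (Fin d → ℂ) M] [T2Space M]
  [CompactSpace M]

/-- The density with respect to Lebesgue measure on `ℂᵈ` of the expression of a top degree form in the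
preferred chart at `x`, weighted with the member of the partition of unity that belongs to that
chart. -/
def chartDensity (a : DForm d (d + d) M) (x : M) (z : Fin d → ℂ) : ℂ :=
  (chartPOU d M x ((chartAt (Fin d → ℂ) x).symm z) : ℂ) *
    inChart (chartAt (Fin d → ℂ) x) a z (stdFrame d)

/-- The top degree form is (absolutely) integrable on the set `S`. -/
def FormIntegrableOn (a : DForm d (d + d) M) (S : Set M) : Prop :=
  ∀ x : M, IntegrableOn (chartDensity a x)
    ((chartAt (Fin d → ℂ) x).target ∩ (chartAt (Fin d → ℂ) x).symm ⁻¹' S) volume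

/-- The integral `∫_S a` of a top degree form, for the orientation given by the complex structure.
(The partition of unity is locally finite, hence the sum is finite.) -/
def formIntegral (a : DForm d (d + d) M) (S : Set M) : ℂ :=
  ∑ᶠ x : M, ∫ z in (chartAt (Fin d → ℂ) x).target ∩ (chartAt (Fin d → ℂ) x).symm ⁻¹' S,
    chartDensity a x z

end Integration

/-! ### Forms with poles along a hypersurface, and their residues -/

section Poles

variable {d r : ℕ} {X : Type*} [TopologicalSpace X] [ChartedSpace (Fin d → ℂ) X]

/-- `f` is a local equation for the smooth hypersurface `D` on the open set `U`: it is holomorphic,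
vanishes on `U` exactly at the points of `D`, and its differential does not vanish there. -/
structure IsLocalEquation (D U : Set X) (f : X → ℂ) : Prop where
  isOpen : IsOpen U
  holomorphic : MDifferentiableOn 𝓘(ℂ, Fin d → ℂ) 𝓘(ℂ, ℂ) f U
  zero_iff : ∀ x ∈ U, f x = 0 ↔ x ∈ D
  differential_ne_zero : ∀ x ∈ U, x ∈ D → dFun (d := d) f x ≠ 0

/-- `a ∈ Γ(X, 𝒜^r(mD))`: `a` is a smooth form on `X ∖ D` and `f^m a` extends smoothly across `D` for
each local equation `f` (smoothness off `D` is the case `f = 1` on `X ∖ D`). -/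
def HasPoleLE (D : Set X) (m : ℕ) (a : DForm d r X) : Prop :=
  ∀ (U : Set X) (f : X → ℂ), IsLocalEquation (d := d) D U f →
    ∃ b : DForm d r X, SmoothFormOn b U ∧ ∀ x ∈ U, x ∉ D → b x = f x ^ m • a x

/-- `a ∈ Γ(X, Ω^r(mD))`: `a` is a holomorphic form of type `(r, 0)` on `X ∖ D` and `f^m a` extends
holomorphically across `D` for each local equation `f`. -/
def IsMeromorphicForm (D : Set X) (m : ℕ) (a : DForm d r X) : Prop :=
  ∀ (U : Set X) (f : X → ℂ), IsLocalEquation (d := d) D U f →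
    ∃ b : DForm d r X, HolFormOn b U ∧ ∀ x ∈ U, x ∉ D → b x = f x ^ m • a x

/-- `a` is a smooth logarithmic form: `f a` and `df ∧ a` extend smoothly across `D` for each local
equation `f`. -/
def IsLogForm (D : Set X) (a : DForm d r X) : Prop :=
  ∀ (U : Set X) (f : X → ℂ), IsLocalEquation (d := d) D U f →
    (∃ b : DForm d r X, SmoothFormOn b U ∧ ∀ x ∈ U, x ∉ D → b x = f x • a x) ∧
    (∃ b : DForm d (r + 1) X, SmoothFormOn b U ∧
      ∀ x ∈ U, x ∉ D → b x = wedgeOne (dFun f x) (a x))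

/-- A cut-off function for `D`: nonnegative, positive off `D`, and such that for each local equation
`f` on `U` one has `lam = h |f|` with a smooth positive function `h` on `U`. -/
structure IsCutoff (d : ℕ) {X : Type*} [TopologicalSpace X] [ChartedSpace (Fin d → ℂ) X]
    (D : Set X) (lam : X → ℝ) : Prop where
  nonneg : ∀ x, 0 ≤ lam x
  pos : ∀ x, x ∉ D → 0 < lam x
  extends_smoothly : ∀ (U : Set X) (f : X → ℂ), IsLocalEquation (d := d) D U f →
    ∃ h : X → ℝ, ContMDiffOn 𝓘(ℝ, Fin d → ℂ) 𝓘(ℝ, ℝ) ∞ h U ∧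
      ∀ x ∈ U, 0 < h x ∧ lam x = h x * ‖f x‖

end Poles

section Residues

variable {n r : ℕ} {X : Type*} [TopologicalSpace X] [ChartedSpace (Fin (n + 1) → ℂ) X]
  (D : Set X) [ChartedSpace (Fin n → ℂ) D]

/-- The restriction `a|_D` of a form to `D`, i.e. the pull-back by the inclusion. -/
def restrictForm (a : DForm (n + 1) r X) : DForm n r D := fun p =>
  (a (p : X)).compContinuousLinearMap
    (mfderiv 𝓘(ℝ, Fin n → ℂ) 𝓘(ℝ, Fin (n + 1) → ℂ) (Subtype.val : D → X) p)

/-- `ρ` is the Poincaré residue of `a`: locally `a = df/f ∧ s + t` with a local equation `f` and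
smooth forms `s`, `t`, and `ρ = s|_D`. -/
def IsPoincareResidue (a : DForm (n + 1) (r + 1) X) (ρ : DForm n r D) : Prop :=
  ∀ p : D, ∃ (U : Set X) (f : X → ℂ) (s : DForm (n + 1) r X) (t : DForm (n + 1) (r + 1) X),
    (p : X) ∈ U ∧ IsLocalEquation (d := n + 1) D U f ∧ SmoothFormOn s U ∧ SmoothFormOn t U ∧
    (∀ x ∈ U, x ∉ D → a x = (f x)⁻¹ • wedgeOne (dFun f x) (s x) + t x) ∧
    (∀ q : D, (q : X) ∈ U → ρ q = restrictForm D s q)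

/-- `ρ` represents the Leray residue, a de Rham cohomology class on `D`, of the closed form `a` on
`X ∖ D`: up to an exact form on `D`, it is the Poincaré residue of a form with at most a first order
pole which is cohomologous to `a` on `X ∖ D`. -/
def IsLerayResidue (a : DForm (n + 1) (r + 1) X) (ρ : DForm n r D) : Prop :=
  ∃ (a' : DForm (n + 1) (r + 1) X) (c : DForm (n + 1) r X) (ρ' : DForm n r D),
    HasPoleLE D 1 a' ∧ SmoothFormOn c Dᶜ ∧ (∀ x ∉ D, a' x = a x + extD c x) ∧
    IsPoincareResidue D a' ρ' ∧ IsDExact (ρ - ρ')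

/-- `ρ` represents the Dolbeault residue `Res_∂ a ∈ Γ(D, 𝒜^{n,0}) / Im ∂` of a smooth form `a` of
type `(n+1, 0)` with poles on `D`, where `n + 1` is the dimension of `X`: one has `a = a' + ∂c` with
a logarithmic form `a'` of type `(n+1, 0)` and a form `c` of type `(n, 0)` with poles on `D`, and up to
a `∂`-exact form on `D`, `ρ` is the Poincaré residue of `a'`. -/
def IsDolbeaultResidue (a : DForm (n + 1) (n + 1) X) (ρ : DForm n n D) : Prop :=
  ∃ (a' : DForm (n + 1) (n + 1) X) (c : DForm (n + 1) n X) (ρ' : DForm n n D),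
    IsLogForm D a' ∧ (∀ x ∉ D, IsTypeHol (a' x)) ∧
    (∃ k : ℕ, HasPoleLE D k c) ∧ (∀ x ∉ D, IsTypeHol (c x)) ∧
    (∀ x ∉ D, a x = a' x + del c x) ∧
    IsPoincareResidue D a' ρ' ∧ IsDelExact (ρ - ρ')

end Residues

end DivInt

end

open DivInt

/-!
# The divergent integral of `α ∧ β̄` over the complement of a hypersurface

In adapted charts `D` is the hyperplane `z₀ = 0`, a form `α` with a pole of order `k + 1` is `b / z₀ᵏ⁺¹`
with a smooth numerator `b` (`IsNumerator`), and `α ∧ β̄` has a density `G / (z₀ᵏ⁺¹ z̄₀)` with `G` smooth.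
A cut-off function is `λ = |z₀| e^ψ`. The map `z₀ ↦ z₀ e^ψ` turns the tube `λ < ε` into `|z₀| < ε`
(`exists_straighten`), and in polar coordinates only the `k`-th angular moment of `G` matters. It is
`c rᵏ + O(rᵏ⁺¹)`, where `c` is a multiple of `∂ᵏG/∂z₀ᵏ` at `z₀ = 0` (`moment_succ`,
`exists_norm_moment_sub_le`). Integration over `r` gives expansions `-A log ε + B + O(ε)`
(`exists_round_expansion`, `exists_tube_expansion`, `HasExpansion`). They also hold for smoothed
indicators `θ(λ/ε)` of the complement of the tube, up to the shift of `B` by `profileConst θ * A`.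

Rescaling `z₀` by `ε` compares the tubes of two cut-off functions (`tendsto_tube_difference`): `A` does
not depend on `λ`, and passing from `λ` to `e^φ λ` adds to `B` the coefficient `A` of the form `φ α ∧ β̄`
(`HasExpansion.constant_exp_mul`). So both formulas of the theorem compute the coefficient `A` of a
logarithm, for `α` and for `φ α`.

If `α` has a simple pole then `A` is an integral of residues over `D` (`HasExpansion.coeff_eq_residue`).
In general the pole is lowered by adding forms `dc` or `∂c` with poles (`HasPoleLE.exists_reduce`), which
do not change `A` by Stokes' theorem on the smoothed complement of the tube
(`HasPoleLE.coeff_extD_wedge_conj`); `∂c` may be replaced by `dc` in products with `β̄`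
(`wedge_holPart_conj`). This settles the residue for `∂`, whose primitives have poles by definition.

A primitive in the definition of the Leray residue may be arbitrarily singular along `D`. Here the
conjugate of `Res β` is extended to a form `B` on `X` which is closed near `D`, by pulling back along
maps which squash a neighbourhood of a point to `D` (`exists_extension_closed_near`). The integral of
`Res α̃ ∧ B` over `D` is up to a constant the coefficient of `α̃ ∧ dlog λ ∧ B`, and it does not see
exact forms `dc`, because `dlog λ ∧ B` times a function of `λ` supported in a thin shell is exact
(`HasExpansion.coeff_extD_wedge_dlog`, `formIntegral_residue_eq`).
-/

noncomputable section

namespace DivInt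

set_option linter.unusedSectionVars false
open Complex (I ofReal_zero ofReal_one ofReal_sub ofReal_sum ofRealCLM real_smul)
open Real (exp log exp_pos norm_of_nonneg)
open Finset (sum_congr mul_sum)
open ContinuousAlternatingMap (alternatizeUncurryFin alternatizeUncurryFin_apply
  compContinuousLinearMap_apply)
open scoped ComplexConjugate Real

/-! ### Alternating forms and their wedge product -/

/-- The complex coordinate space. -/
notation:max "ℂ^" d:max => (Fin d → ℂ)

/-- The space of alternating real multilinear complex valued `r`-forms on `ℂᵈ`. -/
abbrev AltForm (d r : ℕ) := ℂ^d [⋀^Fin r]→L[ℝ] ℂ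

lemma wedge_apply {d p q : ℕ} (a : AltForm d p) (b : AltForm d q) (v : Fin (p + q) → ℂ^d) :
    wedge a b v = ((p.factorial * q.factorial : ℝ))⁻¹ * ∑ σ : Equiv.Perm (Fin (p + q)),
      ((Equiv.Perm.sign σ : ℤ) : ℂ) * (a (fun i => v (σ (Fin.castAdd q i))) *
        b (fun j => v (σ (Fin.natAdd p j)))) := by
  simp only [wedge, ContinuousAlternatingMap.smul_apply,
    ContinuousMultilinearMap.alternatization_apply_apply, real_smul, tensorForm_apply]
  push_cast
  congr 1
  refine sum_congr rfl fun σ _ => ?_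
  rcases Int.units_eq_one_or (Equiv.Perm.sign σ) with h | h <;> simp [h]

lemma wedge_add_left {d p q : ℕ} (a a' : AltForm d p) (b : AltForm d q) :
    wedge (a + a') b = wedge a b + wedge a' b := by
  ext v; simp only [wedge_apply, ContinuousAlternatingMap.add_apply, add_mul, mul_add,
    Finset.sum_add_distrib]

lemma wedge_add_right {d p q : ℕ} (a : AltForm d p) (b b' : AltForm d q) :
    wedge a (b + b') = wedge a b + wedge a b' := by
  ext v; simp only [wedge_apply, ContinuousAlternatingMap.add_apply, mul_add,
    Finset.sum_add_distrib]

lemma wedge_smul_left {d p q : ℕ} (c : ℂ) (a : AltForm d p) (b : AltForm d q) :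
    wedge (c • a) b = c • wedge a b := by
  ext v; simp only [wedge_apply, ContinuousAlternatingMap.smul_apply, smul_eq_mul, mul_sum]
  exact sum_congr rfl fun σ _ => by ring

lemma wedge_smul_right {d p q : ℕ} (c : ℂ) (a : AltForm d p) (b : AltForm d q) :
    wedge a (c • b) = c • wedge a b := by
  ext v; simp only [wedge_apply, ContinuousAlternatingMap.smul_apply, smul_eq_mul, mul_sum]
  exact sum_congr rfl fun σ _ => by ring

lemma wedge_zero_left {d p q : ℕ} (b : AltForm d q) : wedge (0 : AltForm d p) b = 0 := by
  ext v; simp [wedge_apply]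

lemma wedge_zero_right {d p q : ℕ} (a : AltForm d p) : wedge a (0 : AltForm d q) = 0 := by
  ext v; simp [wedge_apply]

lemma wedge_comp {d d' p q : ℕ} (a : AltForm d p) (b : AltForm d q)
    (A : ℂ^d' →L[ℝ] ℂ^d) :
    wedge (a.compContinuousLinearMap A) (b.compContinuousLinearMap A) =
      (wedge a b).compContinuousLinearMap A := by
  ext v; simp only [wedge_apply, compContinuousLinearMap_apply]; rfl

lemma wedgeOne_apply {d r : ℕ} (l : ℂ^d →L[ℝ] ℂ) (a : AltForm d r)
    (v : Fin (r + 1) → ℂ^d) :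
    wedgeOne l a v = ∑ i : Fin (r + 1), (-1) ^ (i : ℕ) * (l (v i) * a (i.removeNth v)) := by
  simp only [wedgeOne, alternatizeUncurryFin_apply]
  refine sum_congr rfl fun i _ => ?_
  simp [zsmul_eq_mul]

/-! ### Permutations and the product rule for the wedge product -/

/-- A permutation of `n + 1` letters, decomposed into the image of `0` and a permutation of the
remaining letters. -/
def permInsert {n : ℕ} (x : Fin (n + 1) × Equiv.Perm (Fin n)) : Equiv.Perm (Fin (n + 1)) :=
  (Fin.cycleRange x.1)⁻¹ * Equiv.Perm.decomposeFin.symm (0, x.2)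

lemma permInsert_zero {n : ℕ} (x : Fin (n + 1) × Equiv.Perm (Fin n)) : permInsert x 0 = x.1 := by
  rw [permInsert, Equiv.Perm.mul_apply, Equiv.Perm.decomposeFin_symm_apply_zero]
  exact Fin.cycleRange_symm_zero x.1

lemma permInsert_succ {n : ℕ} (x : Fin (n + 1) × Equiv.Perm (Fin n)) (j : Fin n) :
    permInsert x j.succ = x.1.succAbove (x.2 j) := by
  rw [permInsert, Equiv.Perm.mul_apply, Equiv.Perm.decomposeFin_symm_apply_succ]
  simp only [Equiv.swap_self, Equiv.refl_apply]
  exact Fin.cycleRange_symm_succ x.1 _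

lemma sign_permInsert {n : ℕ} (x : Fin (n + 1) × Equiv.Perm (Fin n)) :
    Equiv.Perm.sign (permInsert x) = (-1) ^ (x.1 : ℕ) * Equiv.Perm.sign x.2 := by
  rw [permInsert, Equiv.Perm.sign_mul, Equiv.Perm.sign_inv, Fin.sign_cycleRange,
    Equiv.Perm.decomposeFin.symm_sign]
  simp

lemma permInsert_bijective (n : ℕ) :
    Function.Bijective (permInsert : Fin (n + 1) × Equiv.Perm (Fin n) → _) := by
  rw [Fintype.bijective_iff_injective_and_card]
  constructor
  · intro x y h
    have h1 : x.1 = y.1 := by rw [← permInsert_zero x, ← permInsert_zero y, h]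
    refine Prod.ext h1 (Equiv.ext fun j => ?_)
    have h2 := congrArg (fun σ : Equiv.Perm (Fin (n + 1)) => σ j.succ) h
    simp only [permInsert_succ, h1] at h2
    exact Fin.succAbove_right_injective h2
  · simp [Fintype.card_perm, Nat.factorial_succ]

lemma sum_perm_succ {n : ℕ} (f : Equiv.Perm (Fin (n + 1)) → ℂ) :
    ∑ σ, f σ = ∑ i : Fin (n + 1), ∑ τ : Equiv.Perm (Fin n), f (permInsert (i, τ)) := by
  rw [← Fintype.sum_prod_type']
  exact (Fintype.sum_bijective _ (permInsert_bijective n) _ _ fun _ => rfl).symm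

/-- Moving the vector in position `k` of a signed sum over permutations to the front. -/
lemma sum_perm_move {d m N : ℕ} (hN : N = m + 1) (k : Fin N)
    (F : ℂ^d → (Fin m → ℂ^d) → ℂ) (v : Fin N → ℂ^d) :
    ∑ σ : Equiv.Perm (Fin N), ((Equiv.Perm.sign σ : ℤ) : ℂ) * F (v (σ k))
      (fun j => v (σ (Fin.cast hN.symm ((Fin.cast hN k).succAbove j)))) =
    (-1) ^ (k : ℕ) * ∑ i : Fin (m + 1), (-1) ^ (i : ℕ) * ∑ τ : Equiv.Perm (Fin m),
      ((Equiv.Perm.sign τ : ℤ) : ℂ) * F (v (Fin.cast hN.symm i))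
        (fun j => v (Fin.cast hN.symm (i.succAbove (τ j)))) := by
  subst hN
  have h1 : ∑ i : Fin (m + 1), (-1) ^ (i : ℕ) * ∑ τ : Equiv.Perm (Fin m),
      ((Equiv.Perm.sign τ : ℤ) : ℂ) * F (v i) (fun j => v (i.succAbove (τ j))) =
      ∑ σ : Equiv.Perm (Fin (m + 1)), ((Equiv.Perm.sign σ : ℤ) : ℂ) *
        F (v (σ 0)) (fun j => v (σ j.succ)) := by
    rw [sum_perm_succ]
    refine sum_congr rfl fun i _ => ?_
    rw [mul_sum]
    refine sum_congr rfl fun τ _ => ?_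
    simp only [sign_permInsert, permInsert_zero, permInsert_succ]
    push_cast; ring
  refine Eq.trans ?_ (congrArg _ h1.symm)
  rw [← Equiv.sum_comp (Equiv.mulRight (Fin.cycleRange k)), mul_sum]
  refine sum_congr rfl fun σ _ => ?_
  simp only [Equiv.coe_mulRight, Equiv.Perm.mul_apply, Equiv.Perm.sign_mul, Fin.cast_eq_self,
    Fin.cycleRange_self, Fin.cycleRange_succAbove, Fin.sign_cycleRange]
  push_cast
  ring

/-- The product rule for the second factor: antisymmetrizing `a ∧ T(v)` over `v`. -/
lemma wedge_alternatize_right {d p q : ℕ} (a : AltForm d p)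
    (T : ℂ^d →L[ℝ] AltForm d q) (v : Fin (p + (q + 1)) → ℂ^d) :
    wedge a (alternatizeUncurryFin T) v =
      (-1) ^ p * ∑ i : Fin (p + q + 1), (-1) ^ (i : ℕ) * wedge a (T (v i)) (i.removeNth v) := by
  have hN : p + (q + 1) = p + q + 1 := rfl
  have key := fun j : Fin (q + 1) => sum_perm_move hN (Fin.natAdd p j) (fun x u =>
    a (fun i => u (Fin.castAdd q i)) * T x (fun l => u (Fin.natAdd p l))) v
  have h1 : ∀ (j : Fin (q + 1)) (i : Fin p), Fin.cast hN.symm ((Fin.cast hN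
      (Fin.natAdd p j)).succAbove (Fin.castAdd q i)) = Fin.castAdd (q + 1) i := fun j i => by
    ext; simp only [Fin.succAbove, Fin.lt_def, Fin.val_castSucc, Fin.val_natAdd, Fin.val_cast]
    split_ifs <;> simp at * <;> omega
  have h2 : ∀ (j : Fin (q + 1)) (l : Fin q), Fin.cast hN.symm ((Fin.cast hN
      (Fin.natAdd p j)).succAbove (Fin.natAdd p l)) = Fin.natAdd p (j.succAbove l) := fun j l => by
    ext; simp only [Fin.succAbove, Fin.lt_def, Fin.val_castSucc, Fin.val_natAdd, Fin.val_cast]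
    split_ifs <;> simp at * <;> omega
  simp only [h1, h2, Fin.val_natAdd] at key
  have hR : wedge a (alternatizeUncurryFin T) v =
      ((p.factorial * (q + 1).factorial : ℝ)⁻¹ : ℝ) * ∑ j : Fin (q + 1), (-1) ^ (j : ℕ) *
      ∑ σ : Equiv.Perm (Fin (p + (q + 1))), ((Equiv.Perm.sign σ : ℤ) : ℂ) *
        (a (fun i => v (σ (Fin.castAdd (q + 1) i))) *
          T (v (σ (Fin.natAdd p j))) (fun l => v (σ (Fin.natAdd p (j.succAbove l))))) := by
    rw [wedge_apply]
    simp only [alternatizeUncurryFin_apply, mul_sum]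
    rw [Finset.sum_comm]
    refine sum_congr rfl fun j _ => sum_congr rfl fun σ _ => ?_
    rw [zsmul_eq_mul]; push_cast; ring!
  simp only [hR, key, wedge_apply]
  have h3 : ∀ j : Fin (q + 1), (-1 : ℂ) ^ (j : ℕ) * (-1) ^ (p + (j : ℕ)) = (-1) ^ p := fun j => by
    rw [pow_add, mul_left_comm, ← mul_pow]; simp
  simp only [← mul_assoc, h3, Finset.sum_const, Finset.card_univ, Fintype.card_fin, nsmul_eq_mul]
  simp only [mul_right_comm _ ((_ : ℝ) : ℂ), mul_assoc]
  have : ((q : ℂ) + 1) ≠ 0 := by exact_mod_cast Nat.succ_ne_zero q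
  rw [Nat.factorial_succ]
  push_cast
  field_simp
  rw [Finset.sum_div]
  rfl

/-- The product rule for the first factor. -/
lemma wedge_alternatize_left {d p q : ℕ} (T : ℂ^d →L[ℝ] AltForm d p)
    (b : AltForm d q) (v : Fin (p + 1 + q) → ℂ^d) :
    wedge (alternatizeUncurryFin T) b v =
      ∑ i : Fin (p + q + 1), (-1) ^ (i : ℕ) *
        wedge (T (v (Fin.cast (by omega) i))) b
          (i.removeNth fun k => v (Fin.cast (by omega) k)) := by
  have hN : p + 1 + q = p + q + 1 := by omega
  have key := fun j : Fin (p + 1) => sum_perm_move hN (Fin.castAdd q j) (fun x u =>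
    T x (fun l => u (Fin.castAdd q l)) * b (fun i => u (Fin.natAdd p i))) v
  have h1 : ∀ (j : Fin (p + 1)) (i : Fin q), Fin.cast hN.symm ((Fin.cast hN
      (Fin.castAdd q j)).succAbove (Fin.natAdd p i)) = Fin.natAdd (p + 1) i := fun j i => by
    ext; simp only [Fin.succAbove, Fin.lt_def, Fin.val_castSucc, Fin.val_natAdd, Fin.val_cast,
      Fin.val_castAdd]
    split_ifs <;> simp at * <;> omega
  have h2 : ∀ (j : Fin (p + 1)) (l : Fin p), Fin.cast hN.symm ((Fin.cast hN
      (Fin.castAdd q j)).succAbove (Fin.castAdd q l)) = Fin.castAdd q (j.succAbove l) := fun j l => by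
    ext; simp only [Fin.succAbove, Fin.lt_def, Fin.val_castSucc, Fin.val_cast, Fin.val_castAdd]
    split_ifs <;> simp at *
  simp only [h1, h2, Fin.val_castAdd] at key
  have hR : wedge (alternatizeUncurryFin T) b v =
      (((p + 1).factorial * q.factorial : ℝ)⁻¹ : ℝ) * ∑ j : Fin (p + 1), (-1) ^ (j : ℕ) *
      ∑ σ : Equiv.Perm (Fin (p + 1 + q)), ((Equiv.Perm.sign σ : ℤ) : ℂ) *
        (T (v (σ (Fin.castAdd q j))) (fun l => v (σ (Fin.castAdd q (j.succAbove l)))) *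
          b (fun i => v (σ (Fin.natAdd (p + 1) i)))) := by
    rw [wedge_apply]
    push_cast
    simp only [alternatizeUncurryFin_apply, mul_sum, Finset.sum_mul]
    rw [Finset.sum_comm]
    refine sum_congr rfl fun j _ => sum_congr rfl fun σ _ => ?_
    rw [zsmul_eq_mul]; push_cast; ring!
  simp only [hR, key, wedge_apply]
  have h3 : ∀ j : Fin (p + 1), (-1 : ℂ) ^ (j : ℕ) * (-1) ^ (j : ℕ) = 1 := fun j => by
    rw [← mul_pow]; simp
  simp only [← mul_assoc, h3, Finset.sum_const, Finset.card_univ, Fintype.card_fin, nsmul_eq_mul]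
  simp only [mul_assoc, mul_left_comm _ ((_ : ℝ) : ℂ), ← mul_sum]
  have : ((p : ℂ) + 1) ≠ 0 := by exact_mod_cast Nat.succ_ne_zero p
  rw [Nat.factorial_succ]
  push_cast
  field_simp
  rfl

/-! ### Forms of top degree -/

lemma top_form_comp_real {d : ℕ} (f : ℂ^d [⋀^Fin (d + d)]→ₗ[ℝ] ℝ)
    (A : ℂ^d →ₗ[ℝ] ℂ^d) (v : Fin (d + d) → ℂ^d) :
    f (fun i => A (v i)) = LinearMap.det A * f v := by
  have hfin : Module.finrank ℝ ℂ^d = d + d := by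
    rw [← Module.finrank_mul_finrank ℝ ℂ ℂ^d]; simp; ring
  set B := Module.finBasisOfFinrankEq ℝ ℂ^d hfin
  have := f.eq_smul_basis_det B
  rw [this]
  simp only [AlternatingMap.smul_apply, smul_eq_mul]
  have h2 := B.det_comp A v
  rw [Function.comp_def] at h2
  rw [h2]; ring

/-- A form of top degree is multiplied with the real determinant under a real linear map. -/
lemma top_form_comp {d : ℕ} (f : AltForm d (d + d))
    (A : ℂ^d →ₗ[ℝ] ℂ^d) (v : Fin (d + d) → ℂ^d) :
    f (fun i => A (v i)) = (LinearMap.det A : ℝ) * f v := by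
  have h1 := top_form_comp_real (Complex.reLm.compAlternatingMap f.toAlternatingMap) A v
  have h2 := top_form_comp_real (Complex.imLm.compAlternatingMap f.toAlternatingMap) A v
  apply Complex.ext
  · simpa using h1
  · simpa using h2

lemma det_restrictScalars_complex {d : ℕ} (A : ℂ^d →ₗ[ℂ] ℂ^d) :
    LinearMap.det (A.restrictScalars ℝ) = Complex.normSq (LinearMap.det A) := by
  rw [LinearMap.det_restrictScalars, Algebra.norm_complex_apply]

/-! ### Forms of type `(r, 0)` -/

lemma IsTypeHol.map_update {d r : ℕ} {a : AltForm d r} (h : IsTypeHol a) (v : Fin r → ℂ^d)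
    (i : Fin r) (c : ℂ) (x : ℂ^d) :
    a (Function.update v i (c • x)) = c * a (Function.update v i x) := by
  have hx : c • x = c.re • x + c.im • (I • x) := by
    ext j
    simp only [Pi.smul_apply, Pi.add_apply, smul_eq_mul, real_smul]
    linear_combination (-(x j)) * Complex.re_add_im c
  have := h (Function.update v i x) i
  simp only [Function.update_idem, Function.update_self] at this
  rw [hx, a.map_update_add, a.map_update_smul, a.map_update_smul, this]
  simp only [real_smul]
  linear_combination (a (Function.update v i x)) * Complex.re_add_im c

/-- A form of type `(r, 0)` as a complex multilinear alternating map. -/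
def IsTypeHol.toComplex {d r : ℕ} {a : AltForm d r} (h : IsTypeHol a) :
    ℂ^d [⋀^Fin r]→ₗ[ℂ] ℂ where
  toFun := a
  map_update_add' := by
    intro inst v k x y
    obtain rfl := Subsingleton.elim inst (instDecidableEqFin r)
    exact a.map_update_add v k x y
  map_update_smul' := by
    intro inst v k x y
    obtain rfl := Subsingleton.elim inst (instDecidableEqFin r)
    exact h.map_update v k x y
  map_eq_zero_of_eq' := fun v i j hv hij => a.map_eq_zero_of_eq v hv hij

lemma IsTypeHol.map_smul_univ {d r : ℕ} {a : AltForm d r} (h : IsTypeHol a) (c : ℂ^r)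
    (v : Fin r → ℂ^d) : a (fun i => c i • v i) = (∏ i, c i) * a v :=
  h.toComplex.toMultilinearMap.map_smul_univ c v

lemma IsTypeHol.eq_zero_of_lt {d r : ℕ} {a : AltForm d r} (h : IsTypeHol a) (hr : d < r) :
    a = 0 := by
  ext v
  refine h.toComplex.map_linearDependent v fun hv => ?_
  have := hv.fintype_card_le_finrank
  simp at this; omega

lemma IsTypeHol.comp {d d' r : ℕ} {a : AltForm d r} (h : IsTypeHol a)
    {A : ℂ^d' →L[ℝ] ℂ^d} (hA : ∀ u, A (I • u) = I • A u) :
    IsTypeHol (a.compContinuousLinearMap A) := by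
  intro v i
  simp only [compContinuousLinearMap_apply]
  have e : (A ∘ Function.update v i (I • v i)) =
      Function.update (A ∘ v) i (I • (A ∘ v) i) := by
    rw [Function.comp_update, hA]; rfl
  rw [e]; exact h _ i

lemma IsTypeHol.smul {d r : ℕ} {a : AltForm d r} (h : IsTypeHol a) (c : ℂ) :
    IsTypeHol (c • a) := fun v i => by simp [h v i]; ring

lemma IsTypeHol.add {d r : ℕ} {a b : AltForm d r} (h : IsTypeHol a) (h' : IsTypeHol b) :
    IsTypeHol (a + b) := fun v i => by simp [h v i, h' v i]; ring

lemma isTypeHol_zero {d r : ℕ} : IsTypeHol (0 : AltForm d r) := fun v i => by simp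

lemma IsTypeHol.sum {d r : ℕ} {ι : Type*} {s : Finset ι} {a : ι → AltForm d r}
    (h : ∀ i ∈ s, IsTypeHol (a i)) : IsTypeHol (∑ i ∈ s, a i) := fun v j => by
  simp only [ContinuousAlternatingMap.sum_apply, mul_sum]
  exact sum_congr rfl fun i hi => h i hi v j

/-- The standard complex basis of `ℂᵈ`. -/
def stdBasis (d : ℕ) : Fin d → ℂ^d := fun j => Pi.single j 1

/-- The `(r, 0)`-part as an average over the choices, in each slot, of a vector or of its multiple
by `i`. -/
lemma holPart_apply_bool {d r : ℕ} (a : AltForm d r) (v : Fin r → ℂ^d) :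
    holPart a v = ((2 : ℂ) ^ r)⁻¹ * ∑ s : Fin r → Bool, (∏ j, if s j then -I else 1) *
      a (fun j => if s j then I • v j else v j) := by
  rw [holPart_apply]
  congr 1
  refine Fintype.sum_equiv
    (⟨fun S j => decide (j ∈ S), fun s => Finset.univ.filter fun j => s j = true,
      fun S => by ext; simp, fun s => by ext; simp⟩ : Finset (Fin r) ≃ (Fin r → Bool)) _ _ ?_
  intro S
  simp

/-- The projection `holPart` takes values in the forms of type `(r, 0)`. -/
lemma isTypeHol_holPart {d r : ℕ} (a : AltForm d r) : IsTypeHol (holPart a) := by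
  intro v i
  obtain ⟨r, rfl⟩ : ∃ k, r = k + 1 := ⟨r - 1, by have := i.2; omega⟩
  rw [holPart_apply_bool, holPart_apply_bool, mul_left_comm]
  congr 1
  rw [← Equiv.sum_comp (Fin.insertNthEquiv (fun _ => Bool) i),
    ← Equiv.sum_comp (Fin.insertNthEquiv (fun _ => Bool) i), Fintype.sum_prod_type,
    Fintype.sum_prod_type]
  simp only [Fin.insertNthEquiv_apply, Fintype.sum_bool]
  have hp : ∀ (b : Bool) (s : Fin r → Bool), (∏ j, if (i.insertNth b s : Fin (r + 1) → Bool) j then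
      -I else 1) = (if b then -I else 1) * ∏ j, if s j then -I else 1 := by
    intro b s
    rw [Fin.prod_univ_succAbove _ i]; simp
  have hvec : ∀ (b : Bool) (s : Fin r → Bool) (u : Fin (r + 1) → ℂ^d),
      (fun j => if (i.insertNth b s : Fin (r + 1) → Bool) j then I • u j else u j) =
      i.insertNth (if b then I • u i else u i)
        (fun j => if s j then I • u (i.succAbove j) else u (i.succAbove j)) := by
    intro b s u
    ext1 j
    refine Fin.succAboveCases i ?_ (fun j => ?_) j <;> simp
  simp only [hp, hvec, if_true, Bool.false_eq_true, if_false, Function.update_self, ne_eq,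
    Fin.succAbove_ne, not_false_eq_true, Function.update_of_ne]
  have hneg : ∀ w : Fin r → ℂ^d, a (i.insertNth (I • I • v i) w) =
      - a (i.insertNth (v i) w) := by
    intro w
    have e : (I • I • v i) = (-1 : ℝ) • v i := by
      rw [smul_smul, Complex.I_mul_I]; simp
    have := a.map_update_smul (i.insertNth (v i) w : Fin (r + 1) → ℂ^d) i (-1) (v i)
    rw [Fin.update_insertNth, Fin.update_insertNth] at this
    rw [e, this]; simp
  simp only [hneg, ← Finset.sum_add_distrib, mul_sum]
  refine sum_congr rfl fun s _ => ?_
  linear_combination ((∏ j, if s j then -I else 1) * a (i.insertNth (I • v i)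
    fun j => if s j then I • v (i.succAbove j) else v (i.succAbove j))) * Complex.I_mul_I

lemma holPart_eq_self {d r : ℕ} {a : AltForm d r} (h : IsTypeHol a) : holPart a = a := by
  ext v
  rw [holPart_apply_bool]
  have : ∀ s : Fin r → Bool, (∏ j, if s j then -I else 1) *
      a (fun j => if s j then I • v j else v j) = a v := by
    intro s
    have e : (fun j => if s j then I • v j else v j) =
        fun j => (if s j then I else 1) • v j := by ext1 j; split_ifs <;> simp
    rw [e, h.map_smul_univ, ← mul_assoc, ← Finset.prod_mul_distrib]
    rw [Finset.prod_eq_one, one_mul]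
    intro j _; split_ifs <;> simp
  simp [this]

lemma holPart_add {d r : ℕ} (a b : AltForm d r) : holPart (a + b) = holPart a + holPart b := by
  ext v; simp [holPart_apply, mul_add, Finset.sum_add_distrib]

lemma holPart_smul {d r : ℕ} (c : ℂ) (a : AltForm d r) : holPart (c • a) = c • holPart a := by
  ext v; simp only [holPart_apply, ContinuousAlternatingMap.smul_apply, smul_eq_mul, mul_sum]
  exact sum_congr rfl fun σ _ => by ring

lemma holPart_comp {d d' r : ℕ} (a : AltForm d r) {A : ℂ^d' →L[ℝ] ℂ^d}
    (hA : ∀ u, A (I • u) = I • A u) :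
    holPart (a.compContinuousLinearMap A) = (holPart a).compContinuousLinearMap A := by
  ext v
  simp only [holPart_apply, compContinuousLinearMap_apply]
  congr 1
  refine sum_congr rfl fun S _ => ?_
  congr 2
  ext1 j; simp only [Function.comp_apply]; split_ifs <;> simp [hA]

lemma conjForm_apply {d r : ℕ} (a : AltForm d r) (v : Fin r → ℂ^d) :
    conjForm a v = conj (a v) := rfl

lemma conjForm_smul {d r : ℕ} (c : ℂ) (a : AltForm d r) :
    conjForm (c • a) = conj c • conjForm a := by
  ext v; simp [conjForm_apply]

/-! ### The wedge product of a form with a conjugate holomorphic form -/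

lemma wedge_sum_left {d p q : ℕ} {ι : Type*} (s : Finset ι) (f : ι → AltForm d p)
    (b : AltForm d q) : wedge (∑ i ∈ s, f i) b = ∑ i ∈ s, wedge (f i) b := by
  induction s using Finset.cons_induction with
  | empty => simp [wedge_zero_left]
  | cons a s ha ih => rw [Finset.sum_cons, Finset.sum_cons, wedge_add_left, ih]

/-- By multilinearity, the value on `(1 + iy) v` is a polynomial in `y`. -/
lemma map_add_I_smul {d r : ℕ} (a : AltForm d r) (y : ℝ) (v : Fin r → ℂ^d) :
    a (fun i => (1 + y * I : ℂ) • v i) = ∑ S : Finset (Fin r), (y : ℂ) ^ S.card *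
      a (fun j => if j ∈ S then I • v j else v j) := by
  have h1 : (fun i => (1 + y * I : ℂ) • v i) = (fun i => y • I • v i) + v := by
    ext i j; simp; ring
  rw [h1]
  refine (a.toMultilinearMap.map_add_univ _ _).trans (sum_congr rfl fun S _ => ?_)
  have h2 := a.toMultilinearMap.map_piecewise_smul (fun _ => y)
    (fun j => if j ∈ S then I • v j else v j) S
  rw [Finset.prod_const] at h2
  refine Eq.trans (congrArg _ ?_) (h2.trans (by rw [real_smul, Complex.ofReal_pow]; rfl))
  ext j : 1
  by_cases hj : j ∈ S <;> simp [Finset.piecewise, hj]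

/-- Only the `(d, 0)`-part of a `d`-form on `ℂᵈ` contributes to the product with the conjugate of a
form of type `(d, 0)`: multiplication of all vectors by `1 + iy` multiplies a top degree form by
`|1 + iy|^{2d}`, hence `∑_S y^{|S|} a(i^S ·) ∧ b̄ = (1 + iy)^d a ∧ b̄` for real, hence also for complex
`y`, and `y = -i` gives the assertion. -/
lemma wedge_holPart_conj {d : ℕ} (a : AltForm d d) {b : AltForm d d} (hb : IsTypeHol b) :
    wedge (holPart a) (conjForm b) = wedge a (conjForm b) := by
  ext v
  let Λ : ((Fin d → ℂ^d) → ℂ) → ℂ := fun f => ∑ σ : Equiv.Perm (Fin (d + d)),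
      ((Equiv.Perm.sign σ : ℤ) : ℂ) * (f (fun i => v (σ (Fin.castAdd d i))) *
        conjForm b (fun j => v (σ (Fin.natAdd d j))))
  let F : Finset (Fin d) → (Fin d → ℂ^d) → ℂ := fun S w =>
    a fun j => if j ∈ S then I • w j else w j
  have hs : ∀ c : Finset (Fin d) → ℂ,
      Λ (fun w => ∑ S, c S * F S w) = ∑ S, c S * Λ (F S) := fun c => by
    simp only [Λ, Finset.sum_mul, mul_sum]
    rw [Finset.sum_comm]
    exact sum_congr rfl fun _ _ => sum_congr rfl fun _ _ => by ring
  have h1 : ∀ y : ℝ, Λ (fun w => a fun i => (1 + y * I : ℂ) • w i) =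
      (1 + y * I) ^ d * Λ a := fun y => by
    set c : ℂ := 1 + y * I
    have hc : conj c ^ d ≠ 0 := pow_ne_zero _ fun h => by
      simpa [c] using congrArg Complex.re h
    have h2 := top_form_comp (wedge a (conjForm b))
      ((c • (LinearMap.id : ℂ^d →ₗ[ℂ] _)).restrictScalars ℝ) v
    rw [det_restrictScalars_complex, LinearMap.det_smul, wedge_apply, wedge_apply,
      mul_left_comm] at h2
    have h3 := mul_left_cancel₀ (by simp [Nat.factorial_ne_zero]) h2
    have h4 : ∀ w : Fin d → ℂ^d, conjForm b (fun j => c • w j) =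
        conj c ^ d * conjForm b w := fun w =>
      (congrArg conj (hb.map_smul_univ (fun _ => c) w)).trans (by simp [conjForm_apply])
    refine mul_left_cancel₀ hc (Eq.trans ?_ (h3.trans ?_))
    · rw [mul_sum]
      refine sum_congr rfl fun σ _ => ?_
      have := h4 fun j => v (σ (Fin.natAdd d j))
      simp only [LinearMap.coe_restrictScalars, LinearMap.smul_apply, LinearMap.id_apply]
      rw [this]; ring
    · rw [Complex.normSq_eq_conj_mul_self, LinearMap.det_id, mul_one, Module.finrank_fin_fun, map_pow,
        mul_assoc]
  have h2 : (∑ S : Finset (Fin d), Polynomial.C (Λ (F S)) * Polynomial.X ^ S.card) =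
      (1 + Polynomial.C I * Polynomial.X) ^ d * Polynomial.C (Λ a) := by
    refine Polynomial.eq_of_infinite_eval_eq _ _
      ((infinite_range_of_injective Complex.ofReal_injective).mono ?_)
    rintro _ ⟨y, rfl⟩
    have := h1 y
    simp only [map_add_I_smul] at this
    rw [hs] at this
    simp [Polynomial.eval_finsetSum, mul_comm I, ← this, mul_comm (Λ _)]
  have h3 := congrArg (Polynomial.eval (-I)) h2
  simp [Polynomial.eval_finsetSum, one_add_one_eq_two] at h3
  rw [wedge_apply, wedge_apply]
  congr 1
  change Λ (holPart a) = Λ a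
  have h5 : (holPart a : (Fin d → ℂ^d) → ℂ) = fun w => ∑ S : Finset (Fin d),
      (((2 : ℂ) ^ d)⁻¹ * (-I) ^ S.card) * F S w := by
    ext w; rw [holPart_apply, mul_sum]
    exact sum_congr rfl fun _ _ => (mul_assoc _ _ _).symm
  rw [h5, hs]
  simp only [mul_assoc]
  rw [← mul_sum, sum_congr rfl fun _ _ => mul_comm _ _, h3]
  field_simp

lemma holPart_zero {d r : ℕ} : holPart (0 : AltForm d r) = 0 := by
  ext v; simp [holPart_apply]

/-- The `(r + 1, 0)`-part of an antisymmetrized derivative only involves the complex linear part of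
the derivative and the `(r, 0)`-part of its values. -/
lemma holPart_alternatize {d r : ℕ} (T : ℂ^d →L[ℝ] AltForm d r)
    (v : Fin (r + 1) → ℂ^d) :
    holPart (alternatizeUncurryFin T) v =
      ∑ j : Fin (r + 1), (-1) ^ (j : ℕ) * ((holPart (T (v j)) (j.removeNth v) -
        I * holPart (T (I • v j)) (j.removeNth v)) / 2) := by
  rw [holPart_apply_bool]
  simp only [alternatizeUncurryFin_apply, mul_sum]
  rw [Finset.sum_comm]
  refine sum_congr rfl fun i _ => ?_
  rw [← Equiv.sum_comp (Fin.insertNthEquiv (fun _ => Bool) i), Fintype.sum_prod_type]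
  simp only [Fin.insertNthEquiv_apply, Fintype.sum_bool]
  have hp : ∀ (b : Bool) (s : Fin r → Bool), (∏ j, if (i.insertNth b s : Fin (r + 1) → Bool) j then
      -I else 1) = (if b then -I else 1) * ∏ j, if s j then -I else 1 := by
    intro b s
    rw [Fin.prod_univ_succAbove _ i]; simp
  have hvec : ∀ (b : Bool) (s : Fin r → Bool) (u : Fin (r + 1) → ℂ^d),
      (i.removeNth fun j => if (i.insertNth b s : Fin (r + 1) → Bool) j then
        I • u j else u j) =
        (fun j => if s j then I • (i.removeNth u) j else (i.removeNth u) j) := by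
    intro b s u
    ext1 j
    simp [Fin.removeNth]
  simp only [hp, hvec, Fin.insertNth_apply_same, if_true, Bool.false_eq_true, if_false,
    holPart_apply_bool]
  rw [mul_sum, mul_sum, mul_sum, ← Finset.sum_add_distrib,
    ← Finset.sum_sub_distrib, Finset.sum_div, mul_sum]
  refine sum_congr rfl fun s _ => ?_
  simp only [zsmul_eq_mul]
  push_cast
  rw [pow_succ, mul_inv]
  ring

lemma IsTypeHol.alternatize {d r : ℕ} {T : ℂ^d →L[ℝ] AltForm d r}
    (hT : ∀ u, IsTypeHol (T u)) (hI : ∀ u, T (I • u) = I • T u) :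
    IsTypeHol (alternatizeUncurryFin T) := by
  have : holPart (alternatizeUncurryFin T) =
      alternatizeUncurryFin T := by
    ext v
    rw [holPart_alternatize, alternatizeUncurryFin_apply]
    refine sum_congr rfl fun j _ => ?_
    rw [hI, holPart_smul, holPart_eq_self (hT _), ContinuousAlternatingMap.smul_apply, smul_eq_mul,
      zsmul_eq_mul]
    push_cast
    linear_combination (-(1 / 2) * (-1) ^ (j : ℕ) * T (v j) (j.removeNth v)) * Complex.I_mul_I
  rw [← this]; exact isTypeHol_holPart _

/-- On `ℂᵈ` the product of a form of type `(d, 0)` with a complex linear covector vanishes. -/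
lemma wedgeOne_eq_zero {d : ℕ} {l : ℂ^d →L[ℝ] ℂ}
    (hl : ∀ u, l (I • u) = I * l u) {a : AltForm d d} (ha : IsTypeHol a) :
    wedgeOne l a = 0 := by
  refine IsTypeHol.eq_zero_of_lt (IsTypeHol.alternatize (fun u => ?_) fun u => ?_)
    (Nat.lt_succ_self d)
  · exact ha.smul (l u)
  · ext v; simp [hl]; ring

/-- Interior and exterior multiplication by a vector and a covector anticommute up to the pairing. -/
lemma wedgeOne_curryLeft {d r : ℕ} (l : ℂ^d →L[ℝ] ℂ) (a : AltForm d (r + 1))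
    (u : ℂ^d) :
    wedgeOne l (a.curryLeft u) + (wedgeOne l a).curryLeft u = l u • a := by
  ext v
  simp only [ContinuousAlternatingMap.add_apply, ContinuousAlternatingMap.curryLeft_apply_apply,
    wedgeOne_apply, ContinuousAlternatingMap.smul_apply, smul_eq_mul]
  rw [Fin.sum_univ_succ (n := r + 1)]
  simp only [Fin.val_zero, pow_zero, one_mul, Fin.val_succ]
  have h0 : (0 : Fin (r + 2)).removeNth (Matrix.vecCons u v) = v := by
    ext1 j; simp [Fin.removeNth]
  have h1 : ∀ i : Fin (r + 1), (i.succ : Fin (r + 2)).removeNth (Matrix.vecCons u v) =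
      Matrix.vecCons u (i.removeNth v) := by
    intro i; ext1 j
    refine Fin.cases ?_ (fun j => ?_) j
    · simp [Fin.removeNth]
    · simp [Fin.removeNth]
  simp only [h0, h1, Matrix.cons_val_zero, Matrix.cons_val_succ]
  rw [show (Finset.univ.sum fun i : Fin (r + 1) => (-1 : ℂ) ^ ((i : ℕ) + 1) *
    (l (v i) * a (Matrix.vecCons u (i.removeNth v)))) = - ∑ i : Fin (r + 1), (-1 : ℂ) ^ (i : ℕ) *
    (l (v i) * a (Matrix.vecCons u (i.removeNth v))) from ?_]
  · ring
  · rw [← Finset.sum_neg_distrib]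
    exact sum_congr rfl fun i _ => by rw [pow_succ]; ring

lemma wedgeOne_add_left {d r : ℕ} (l l' : ℂ^d →L[ℝ] ℂ) (a : AltForm d r) :
    wedgeOne (l + l') a = wedgeOne l a + wedgeOne l' a := by
  ext v; simp only [wedgeOne_apply, ContinuousAlternatingMap.add_apply, _root_.add_apply, add_mul,
    mul_add, Finset.sum_add_distrib]

lemma wedgeOne_smul_left {d r : ℕ} (c : ℂ) (l : ℂ^d →L[ℝ] ℂ) (a : AltForm d r) :
    wedgeOne (c • l) a = c • wedgeOne l a := by
  ext v; simp only [wedgeOne_apply, ContinuousAlternatingMap.smul_apply, _root_.smul_apply,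
    smul_eq_mul, mul_sum]
  exact sum_congr rfl fun σ _ => by ring

lemma wedgeOne_smul_right {d r : ℕ} (c : ℂ) (l : ℂ^d →L[ℝ] ℂ) (a : AltForm d r) :
    wedgeOne l (c • a) = c • wedgeOne l a := by
  ext v; simp only [wedgeOne_apply, ContinuousAlternatingMap.smul_apply,
    smul_eq_mul, mul_sum]
  exact sum_congr rfl fun σ _ => by ring

lemma wedgeOne_comp {d d' r : ℕ} (l : ℂ^d →L[ℝ] ℂ) (a : AltForm d r)
    (A : ℂ^d' →L[ℝ] ℂ^d) :
    wedgeOne (l.comp A) (a.compContinuousLinearMap A) =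
      (wedgeOne l a).compContinuousLinearMap A := by
  ext v; simp only [wedgeOne_apply, compContinuousLinearMap_apply]; rfl

/-! ### Forms at a point of the hypersurface `z₀ = 0` -/

/-- The inclusion of the hyperplane `z₀ = 0`. -/
def hyperIncl (n : ℕ) : ℂ^n →L[ℂ] ℂ^(n + 1) :=
  ContinuousLinearMap.pi (Fin.cons 0 fun j => ContinuousLinearMap.proj j)

lemma hyperIncl_apply {n : ℕ} (w : ℂ^n) : hyperIncl n w = Fin.cons 0 w := by
  ext j; refine Fin.cases ?_ (fun j => ?_) j <;> simp [hyperIncl]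

/-- The restriction of a form to the hyperplane `z₀ = 0`. -/
def hyperRestrict {n r : ℕ} (s : AltForm (n + 1) r) : AltForm n r :=
  s.compContinuousLinearMap ((hyperIncl n).restrictScalars ℝ)

lemma stdFrame_succ_zero (n : ℕ) :
    stdFrame (n + 1) ⟨0, by omega⟩ = stdBasis (n + 1) 0 := by
  simp only [stdFrame, stdBasis]
  rfl

lemma stdFrame_succ_one (n : ℕ) :
    stdFrame (n + 1) ⟨1, by omega⟩ = I • stdBasis (n + 1) 0 := by
  ext j
  refine Fin.cases ?_ (fun j => ?_) j <;> simp [stdFrame, stdBasis]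

lemma stdFrame_succ_add_two (n : ℕ) (k : Fin (n + n)) (h : (k : ℕ) + 2 < n + 1 + (n + 1)) :
    stdFrame (n + 1) ⟨k + 2, h⟩ = hyperIncl n (stdFrame n k) := by
  rw [hyperIncl_apply]
  ext j
  refine Fin.cases ?_ (fun j => ?_) j
  · simp only [stdFrame, Fin.cons_zero]
    rw [Pi.single_apply, if_neg]
    simp [Fin.ext_iff]
  · simp only [stdFrame, Fin.cons_succ, Pi.single_apply, Fin.ext_iff, Fin.val_succ]
    have h1 : ((k : ℕ) + 2) / 2 = k / 2 + 1 := by omega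
    have h2 : ((k : ℕ) + 2) % 2 = k % 2 := by omega
    rw [h1, h2]
    simp

/-- The product of two covectors that only depend on `z₀` with two forms, evaluated on the standard
frame, only involves the restrictions of the forms to `z₀ = 0`. -/
lemma wedge_wedgeOne_stdFrame {n : ℕ} (l l' : ℂ^(n + 1) →L[ℝ] ℂ)
    (hl : ∀ w, l (hyperIncl n w) = 0) (hl' : ∀ w, l' (hyperIncl n w) = 0)
    (s b : AltForm (n + 1) n) :
    wedge (wedgeOne l s) (wedgeOne l' b) (stdFrame (n + 1)) =
      (-1) ^ n * (l (stdBasis (n + 1) 0) * l' (I • stdBasis (n + 1) 0) -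
        l (I • stdBasis (n + 1) 0) * l' (stdBasis (n + 1) 0)) *
      wedge (hyperRestrict s) (hyperRestrict b) (stdFrame n) := by
  have hr : ∀ (u : Fin (n + n) → ℂ^(n + 1)),
      (∀ k : Fin (n + n), u k = hyperIncl n (stdFrame n k)) →
      wedge s b u = wedge (hyperRestrict s) (hyperRestrict b) (stdFrame n) := by
    intro u hu
    rw [hyperRestrict, hyperRestrict, wedge_comp,
      compContinuousLinearMap_apply]
    congr 1; ext1 k; exact hu k
  -- the product with the first covector, on a frame whose tail is tangent to the hyperplane
  have hA : ∀ (u : Fin (n + 1 + n) → ℂ^(n + 1)),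
      (∀ k : Fin (n + n), u (Fin.cast (by omega) k.succ) = hyperIncl n (stdFrame n k)) →
      wedge (wedgeOne l s) b u = l (u ⟨0, by omega⟩) *
        wedge (hyperRestrict s) (hyperRestrict b) (stdFrame n) := by
    intro u hu
    rw [wedgeOne, wedge_alternatize_left, Fin.sum_univ_succ, Finset.sum_eq_zero, add_zero]
    · simp only [ContinuousLinearMap.smulRight_apply, wedge_smul_left,
        ContinuousAlternatingMap.smul_apply, smul_eq_mul, Fin.val_zero, pow_zero, one_mul]
      rw [hr]
      · rfl
      · intro k; rw [← hu k]; rfl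
    · intro i _
      simp only [ContinuousLinearMap.smulRight_apply]
      rw [hu, hl]; simp [wedge_zero_left]
  have hf : ∀ i : Fin (n + 1 + n + 1), 2 ≤ (i : ℕ) → l' (stdFrame (n + 1) i) = 0 := by
    intro i hi
    have h := stdFrame_succ_add_two n ⟨i - 2, by omega⟩ (by simp; omega)
    rw [show (⟨(⟨(i : ℕ) - 2, by omega⟩ : Fin (n + n)) + 2, by simp; omega⟩ :
      Fin (n + 1 + (n + 1))) = i from Fin.ext (by simp; omega)] at h
    rw [h, hl']
  rw [show wedgeOne l' b = alternatizeUncurryFin (l'.smulRight b) from rfl,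
    wedge_alternatize_right, Fin.sum_univ_succ,
    show ∀ f : ℂ^(n + 1 + n), ∑ i, f i = f ⟨0, by omega⟩ + ∑ i ∈ Finset.univ.erase ⟨0, by omega⟩,
      f i from fun f => (Finset.add_sum_erase _ f (Finset.mem_univ _)).symm]
  rw [Finset.sum_eq_zero, add_zero]
  · simp only [ContinuousLinearMap.smulRight_apply, wedge_smul_right,
      ContinuousAlternatingMap.smul_apply, smul_eq_mul]
    rw [hA, hA]
    · have e0 : stdFrame (n + 1) (0 : Fin (n + 1 + n + 1)) = stdBasis (n + 1) 0 :=
        stdFrame_succ_zero n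
      have e1 : stdFrame (n + 1) (Fin.succ ⟨0, by omega⟩ : Fin (n + 1 + n + 1)) =
        I • stdBasis (n + 1) 0 := stdFrame_succ_one n
      have e2 : (0 : Fin (n + 1 + n + 1)).removeNth (stdFrame (n + 1)) ⟨0, by omega⟩ =
        I • stdBasis (n + 1) 0 := stdFrame_succ_one n
      have e3 : (Fin.succ ⟨0, by omega⟩ : Fin (n + 1 + n + 1)).removeNth (stdFrame (n + 1))
          ⟨0, by omega⟩ = stdBasis (n + 1) 0 := stdFrame_succ_zero n
      rw [e0, e1, e2, e3]
      simp only [Fin.val_zero, pow_zero, Fin.val_succ, zero_add, pow_succ]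
      ring
    · intro k
      rw [← stdFrame_succ_add_two n k (by omega)]
      simp only [Fin.removeNth]
      congr 1
    · intro k
      rw [← stdFrame_succ_add_two n k (by omega)]
      rfl
  · intro i hi
    have hi0 : (i : ℕ) ≠ 0 := by
      intro h; exact (Finset.mem_erase.mp hi).1 (Fin.ext h)
    simp only [ContinuousLinearMap.smulRight_apply]
    rw [hf i.succ (by simp; omega)]
    simp [wedge_zero_right]

/-- The first coordinate as a real linear map. -/
def coordZero (n : ℕ) : ℂ^(n + 1) →L[ℝ] ℂ :=
  (ContinuousLinearMap.proj (R := ℂ) (φ := fun _ : Fin (n + 1) => ℂ) 0).restrictScalars ℝ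

lemma coordZero_apply {n : ℕ} (v : ℂ^(n + 1)) : coordZero n v = v 0 := rfl

lemma conjForm_wedgeOne {d r : ℕ} (l : ℂ^d →L[ℝ] ℂ) (a : AltForm d r) :
    conjForm (wedgeOne l a) =
      wedgeOne ((Complex.conjCLE : ℂ →L[ℝ] ℂ).comp l) (conjForm a) := by
  ext v; simp [wedgeOne_apply, conjForm_apply]

/-! ### Regularity of families of forms, tested on vectors -/

/-- A form is a linear function of its values on the tuples of basis vectors. -/
lemma exists_leftInverse_eval (d r : ℕ) :
    ∃ g : ((Fin r → (Σ _ : Fin d, Fin 2)) → ℂ) →L[ℂ] AltForm d r, ∀ a : AltForm d r,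
      g (fun κ => a fun j => Pi.basis (fun _ : Fin d => Complex.basisOneI) (κ j)) = a := by
  let L : AltForm d r →ₗ[ℂ] ((Fin r → (Σ _ : Fin d, Fin 2)) → ℂ) :=
    { toFun := fun a κ => a fun j => Pi.basis (fun _ : Fin d => Complex.basisOneI) (κ j)
      map_add' := fun a b => rfl
      map_smul' := fun c a => rfl }
  have hL : LinearMap.ker L = ⊥ := by
    rw [LinearMap.ker_eq_bot']
    intro a ha
    have hB := Module.Basis.ext_alternating (f := a.toAlternatingMap) (g := 0)
      (Pi.basis fun _ : Fin d => Complex.basisOneI) (fun v _ => congrFun ha v)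
    ext v; exact congrArg (fun f => f v) hB
  obtain ⟨g, hg⟩ := L.exists_leftInverse_of_injective hL
  refine ⟨LinearMap.toContinuousLinearMap g, fun a => ?_⟩
  exact congrArg (fun f => f a) hg

lemma contDiffOn_form {d r : ℕ} {F : Type*} [NormedAddCommGroup F] [NormedSpace ℝ F]
    {A : F → AltForm d r} {s : Set F} {k : WithTop ℕ∞}
    (h : ∀ v, ContDiffOn ℝ k (fun z => A z v) s) : ContDiffOn ℝ k A s := by
  obtain ⟨g, hg⟩ := exists_leftInverse_eval d r
  have : A = fun z => (g.restrictScalars ℝ)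
      (fun κ => A z fun j => Pi.basis (fun _ : Fin d => Complex.basisOneI) (κ j)) := by
    ext1 z; exact (hg (A z)).symm
  rw [this]
  exact (g.restrictScalars ℝ).contDiff.comp_contDiffOn (contDiffOn_pi.mpr fun κ => h _)

/-- The evaluation of forms on fixed vectors, as a continuous complex linear map. -/
def evalForm {d r : ℕ} (v : Fin r → ℂ^d) : AltForm d r →L[ℂ] ℂ where
  toFun a := a v
  map_add' _ _ := rfl
  map_smul' _ _ := rfl
  cont := (ContinuousAlternatingMap.apply ℝ ℂ^d ℂ v).cont

/-! ### Holomorphic functions of several variables -/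

/-- Differentiation under an interval integral with a jointly continuous derivative. -/
lemma hasFDerivAt_intervalIntegral {H : Type*} [NormedAddCommGroup H] [NormedSpace ℂ H]
    {a b : ℝ} (hab : a ≤ b) {F : H → ℝ → ℂ} {F' : H → ℝ → H →L[ℂ] ℂ} {U : Set H}
    (hU : IsOpen U) {x₀ : H} (hx₀ : x₀ ∈ U)
    (hF : ∀ x ∈ U, ContinuousOn (F x) (Icc a b))
    (hF' : ContinuousOn (fun p : H × ℝ => F' p.1 p.2) (U ×ˢ Icc a b))
    (hd : ∀ x ∈ U, ∀ t ∈ Icc a b, HasFDerivAt (fun x => F x t) (F' x t) x) :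
    HasFDerivAt (fun x => ∫ t in a..b, F x t) (∫ t in a..b, F' x₀ t) x₀ := by
  have hc0 : ContinuousOn (F' x₀) (Icc a b) :=
    hF'.comp (f := fun t : ℝ => (x₀, t)) (by fun_prop) fun t ht => ⟨hx₀, ht⟩
  obtain ⟨C, hC⟩ := isCompact_Icc.exists_bound_of_continuousOn hc0
  have hev : ∀ᶠ x in 𝓝 x₀, ∀ t ∈ Icc a b, t ∈ Icc a b → x ∈ U → ‖F' x t‖ ≤ C + 1 := by
    refine isCompact_Icc.eventually_forall_of_forall_eventually fun t ht => ?_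
    have h1 := (hF' (x₀, t) ⟨hx₀, ht⟩).norm
    have h2 : ∀ᶠ p in 𝓝[U ×ˢ Icc a b] (x₀, t), ‖F' p.1 p.2‖ < C + 1 :=
      h1.eventually (gt_mem_nhds (by have := hC t ht; simp only; linarith))
    rw [eventually_nhdsWithin_iff] at h2
    filter_upwards [h2] with p hp ht' hpU
    exact (hp ⟨hpU, ht'⟩).le
  have hset : {x | x ∈ U ∧ ∀ t ∈ Icc a b, ‖F' x t‖ ≤ C + 1} ∈ 𝓝 x₀ := by
    filter_upwards [hev, hU.mem_nhds hx₀] with x hx hxU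
    exact ⟨hxU, fun t ht => hx t ht ht hxU⟩
  have hI : uIoc a b ⊆ Icc a b := by rw [uIoc_of_le hab]; exact Ioc_subset_Icc_self
  refine intervalIntegral.hasFDerivAt_integral_of_dominated_of_fderiv_le (bound := fun _ => C + 1)
    hset ?_ ?_ ?_ ?_ ?_ ?_
  · filter_upwards [hU.mem_nhds hx₀] with x hx
    exact ((hF x hx).mono hI).aestronglyMeasurable measurableSet_uIoc
  · exact ((hF x₀ hx₀).mono (by rw [uIcc_of_le hab])).intervalIntegrable
  · exact (hc0.mono hI).aestronglyMeasurable measurableSet_uIoc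
  · exact Eventually.of_forall fun t ht x hx => hx.2 t (hI ht)
  · exact intervalIntegrable_const
  · exact Eventually.of_forall fun t ht x hx => hd x hx.1 t (hI ht)

section Regularity

variable {E : Type*} [NormedAddCommGroup E] [NormedSpace ℂ E]

/-- Discs in the direction of `v`, of a uniform radius near `x₀`. -/
lemma exists_disc_subset {U : Set E} (hU : IsOpen U) {x₀ : E} (hx₀ : x₀ ∈ U) (v : E) :
    ∃ δ > 0, ∃ ρ > 0, ∀ x ∈ Metric.ball x₀ δ, ∀ ζ ∈ Metric.closedBall (0 : ℂ) ρ, x + ζ • v ∈ U := by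
  obtain ⟨R, hR, hRU⟩ := Metric.isOpen_iff.mp hU x₀ hx₀
  refine ⟨R / 2, by positivity, R / (2 * (‖v‖ + 1)), by positivity, fun x hx ζ hζ => hRU ?_⟩
  rw [Metric.mem_ball, dist_eq_norm] at hx ⊢
  rw [mem_closedBall_zero_iff] at hζ
  calc ‖x + ζ • v - x₀‖ = ‖(x - x₀) + ζ • v‖ := by congr 1; abel
    _ ≤ ‖x - x₀‖ + ‖ζ‖ * ‖v‖ := (norm_add_le _ _).trans (by rw [norm_smul])
    _ ≤ ‖x - x₀‖ + R / (2 * (‖v‖ + 1)) * (‖v‖ + 1) := by gcongr; linarith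
    _ = ‖x - x₀‖ + R / 2 := by field_simp
    _ < R := by linarith

lemma hasDerivAt_line {U : Set E} (hU : IsOpen U) {f : E → ℂ} (hf : DifferentiableOn ℂ f U)
    {x v : E} {ζ : ℂ} (h : x + ζ • v ∈ U) :
    HasDerivAt (fun ζ : ℂ => f (x + ζ • v)) (fderiv ℂ f (x + ζ • v) v) ζ := by
  have h1 := (hf.differentiableAt (hU.mem_nhds h)).hasFDerivAt
  have h2 : HasDerivAt (fun ζ : ℂ => x + ζ • v) v ζ := by
    simpa using ((hasDerivAt_id ζ).smul_const v).const_add x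
  exact h1.comp_hasDerivAt ζ h2

lemma diffContOnCl_line {U : Set E} (hU : IsOpen U) {f : E → ℂ} (hf : DifferentiableOn ℂ f U)
    {x v : E} {ρ : ℝ} (hρ : 0 < ρ) (h : ∀ ζ ∈ Metric.closedBall (0 : ℂ) ρ, x + ζ • v ∈ U) :
    DiffContOnCl ℂ (fun ζ : ℂ => f (x + ζ • v)) (Metric.ball 0 ρ) := by
  refine DifferentiableOn.diffContOnCl fun ζ hζ => ?_
  rw [closure_ball _ hρ.ne'] at hζ
  exact (hasDerivAt_line hU hf (h ζ hζ)).differentiableAt.differentiableWithinAt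

/-- Directional derivatives of holomorphic functions are continuous: by the Cauchy integral formula
on discs in the direction of `v`. -/
lemma continuousOn_fderiv_apply {U : Set E} (hU : IsOpen U) {f : E → ℂ}
    (hf : DifferentiableOn ℂ f U) (v : E) : ContinuousOn (fun x => fderiv ℂ f x v) U := by
  intro x₀ hx₀
  refine ContinuousAt.continuousWithinAt ?_
  obtain ⟨δ, hδ, ρ, hρ, hsub⟩ := exists_disc_subset hU hx₀ v
  rw [Metric.continuousAt_iff']
  intro ε hε
  have hev : ∀ᶠ x in 𝓝 x₀, ∀ ζ ∈ Metric.sphere (0 : ℂ) ρ,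
      ‖f (x + ζ • v) - f (x₀ + ζ • v)‖ < ε / 2 * ρ := by
    refine (isCompact_sphere (0 : ℂ) ρ).eventually_forall_of_forall_eventually fun ζ hζ => ?_
    have hc : ContinuousAt f (x₀ + ζ • v) := (hf.differentiableAt (hU.mem_nhds (hsub x₀
      (Metric.mem_ball_self hδ) ζ (Metric.sphere_subset_closedBall hζ)))).continuousAt
    have h1 : ContinuousAt (fun p : E × ℂ => f (p.1 + p.2 • v)) (x₀, ζ) :=
      ContinuousAt.comp (f := fun p : E × ℂ => p.1 + p.2 • v) hc (by fun_prop)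
    have h2 : ContinuousAt (fun p : E × ℂ => f (x₀ + p.2 • v)) (x₀, ζ) :=
      ContinuousAt.comp (f := fun p : E × ℂ => x₀ + p.2 • v) hc (by fun_prop)
    exact (h1.sub h2).norm.eventually (gt_mem_nhds (by simp; positivity))
  filter_upwards [hev, Metric.ball_mem_nhds x₀ hδ] with x hx hxδ
  have hd0 : ∀ y ∈ Metric.ball x₀ δ, HasDerivAt (fun ζ : ℂ => f (y + ζ • v)) (fderiv ℂ f y v) 0 := by
    intro y hy
    have := hasDerivAt_line hU hf (hsub y hy 0 (by simp [hρ.le]))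
    simpa using this
  have hd := (hd0 x hxδ).sub (hd0 x₀ (Metric.mem_ball_self hδ))
  rw [dist_eq_norm, ← hd.deriv]
  have hb := Complex.norm_deriv_le_of_forall_mem_sphere_norm_le hρ
    ((diffContOnCl_line hU hf hρ (hsub x hxδ)).sub
      (diffContOnCl_line hU hf hρ (hsub x₀ (Metric.mem_ball_self hδ))))
    (C := ε / 2 * ρ) (fun ζ hζ => (hx ζ hζ).le)
  refine lt_of_le_of_lt hb ?_
  rw [mul_div_assoc, div_self hρ.ne']; linarith

variable [FiniteDimensional ℂ E]

/-- Directional derivatives of holomorphic functions are holomorphic: differentiate the Cauchy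
integral formula on discs in the direction of `v`. -/
lemma differentiableOn_fderiv_apply {U : Set E} (hU : IsOpen U) {f : E → ℂ}
    (hf : DifferentiableOn ℂ f U) (v : E) : DifferentiableOn ℂ (fun x => fderiv ℂ f x v) U := by
  have hcf : ContinuousOn (fderiv ℂ f) U :=
    continuousOn_clm_apply.mpr fun v => continuousOn_fderiv_apply hU hf v
  intro x₀ hx₀
  refine DifferentiableAt.differentiableWithinAt ?_
  obtain ⟨δ, hδ, ρ, hρ, hsub⟩ := exists_disc_subset hU hx₀ v
  have hmaps : ∀ x ∈ Metric.ball x₀ δ, ∀ θ : ℝ, x + circleMap 0 ρ θ • v ∈ U := fun x hx θ =>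
    hsub x hx _ (circleMap_mem_closedBall 0 hρ.le θ)
  set c : ℝ → ℂ := fun θ => (2 * π * I)⁻¹ * (deriv (circleMap 0 ρ) θ *
    ((circleMap 0 ρ θ) ^ 2)⁻¹) with hc
  have hcc : Continuous c := by
    have h2 : ∀ θ, (circleMap 0 ρ θ) ^ 2 ≠ 0 := fun θ => pow_ne_zero _ (circleMap_ne_center hρ.ne')
    simp only [hc, deriv_circleMap]
    fun_prop (disch := exact h2 _)
  have hform : ∀ x ∈ Metric.ball x₀ δ, fderiv ℂ f x v =
      ∫ θ in (0 : ℝ)..2 * π, c θ * f (x + circleMap 0 ρ θ • v) := by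
    intro x hx
    have h1 := (hasDerivAt_line hU hf (hsub x hx 0 (by simp [hρ.le]))).deriv
    have h2 := (diffContOnCl_line hU hf hρ (hsub x hx)).deriv_eq_smul_circleIntegral hρ
    rw [zero_smul, add_zero] at h1
    have hpi : (2 * π * I : ℂ) ≠ 0 := Complex.two_pi_I_ne_zero
    rw [h1, smul_eq_mul] at h2
    rw [← inv_mul_cancel_left₀ hpi (fderiv ℂ f x v), ← h2, circleIntegral,
      ← intervalIntegral.integral_const_mul]
    refine intervalIntegral.integral_congr fun θ _ => ?_
    simp only [hc, smul_eq_mul, sub_zero, one_div]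
    ring
  have hfd := hasFDerivAt_intervalIntegral (a := 0) (b := 2 * π) (by positivity)
    (F := fun x θ => c θ * f (x + circleMap 0 ρ θ • v))
    (F' := fun x θ => c θ • fderiv ℂ f (x + circleMap 0 ρ θ • v)) Metric.isOpen_ball
    (Metric.mem_ball_self hδ) (U := Metric.ball x₀ δ) ?_ ?_ ?_
  · refine DifferentiableAt.congr_of_eventuallyEq hfd.differentiableAt ?_
    filter_upwards [Metric.ball_mem_nhds x₀ hδ] with x hx using hform x hx
  · intro x hx
    refine hcc.continuousOn.mul (hf.continuousOn.comp (t := U) ?_ fun θ _ => hmaps x hx θ)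
    have : Continuous (circleMap 0 ρ) := continuous_circleMap 0 ρ
    fun_prop
  · refine (hcc.comp continuous_snd).continuousOn.smul (hcf.comp (t := U) ?_
      fun p hp => hmaps p.1 hp.1 p.2)
    have : Continuous (circleMap 0 ρ) := continuous_circleMap 0 ρ
    fun_prop
  · intro x hx θ _
    have h1 := (hf.differentiableAt (hU.mem_nhds (hmaps x hx θ))).hasFDerivAt
    have h2 : HasFDerivAt (fun x : E => x + circleMap 0 ρ θ • v) (ContinuousLinearMap.id ℂ E) x :=
      (hasFDerivAt_id x).add_const _
    have h3 := (h1.comp x h2).const_mul (c θ)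
    simpa using h3

/-- A complex differentiable function of several variables is smooth. -/
lemma contDiffOn_of_differentiableOn {U : Set E} (hU : IsOpen U) {f : E → ℂ}
    (hf : DifferentiableOn ℂ f U) : ContDiffOn ℂ ∞ f U := by
  rw [contDiffOn_infty]
  intro k
  induction k generalizing f with
  | zero => exact contDiffOn_zero.mpr hf.continuousOn
  | succ k ih =>
    push_cast
    rw [contDiffOn_succ_iff_fderiv_of_isOpen hU]
    refine ⟨hf, by simp, ?_⟩
    rw [contDiffOn_clm_apply]
    exact fun v => ih (differentiableOn_fderiv_apply hU hf v)

end Regularity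

/-- A holomorphic function vanishing for `z₀ = 0` is locally divisible by `z₀`, and the quotient
takes the value `∂f/∂z₀` where `z₀ = 0`. -/
lemma exists_eq_coord_mul {n : ℕ} {U : Set ℂ^(n + 1)} (hU : IsOpen U)
    {f : ℂ^(n + 1) → ℂ} (hf : DifferentiableOn ℂ f U)
    (h0 : ∀ z ∈ U, z 0 = 0 → f z = 0) {p : ℂ^(n + 1)} (hp : p ∈ U) (hp0 : p 0 = 0) :
    ∃ V, IsOpen V ∧ p ∈ V ∧ V ⊆ U ∧ ∃ u : ℂ^(n + 1) → ℂ, DifferentiableOn ℂ u V ∧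
      (∀ z ∈ V, f z = z 0 * u z) ∧
      ∀ z ∈ V, z 0 = 0 → u z = fderiv ℂ f z (Pi.single 0 1) := by
  obtain ⟨R, hR, hRU⟩ := Metric.isOpen_iff.mp hU p hp
  set g : ℂ^(n + 1) → ℂ := fun z => fderiv ℂ f z (Pi.single 0 1) with hg
  have hgd : DifferentiableOn ℂ g U := differentiableOn_fderiv_apply hU hf _
  have hgc : ContinuousOn (fderiv ℂ g) U :=
    continuousOn_clm_apply.mpr fun v => continuousOn_fderiv_apply hU hgd v
  -- `A t` multiplies `z₀` by `t`, and `f z = z₀ ∫₀¹ ∂₀f(A t z) dt`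
  set A : ℝ → ℂ^(n + 1) →L[ℂ] ℂ^(n + 1) := fun t =>
    ContinuousLinearMap.id ℂ _ + ((t : ℂ) - 1) • (ContinuousLinearMap.proj (R := ℂ)
      (φ := fun _ : Fin (n + 1) => ℂ) 0).smulRight (Pi.single 0 1) with hA
  have hAap : ∀ t z, A t z = z + ((t : ℂ) - 1) • (z 0 • Pi.single 0 1) := fun t z => by
    simp [hA]
  have hAc : Continuous A := by fun_prop
  have hmaps : ∀ t ∈ Icc (0 : ℝ) 1, ∀ z ∈ Metric.ball p R, A t z ∈ Metric.ball p R := by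
    intro t ht z hz
    rw [Metric.mem_ball, dist_pi_lt_iff hR] at hz ⊢
    intro i
    refine lt_of_le_of_lt ?_ (hz i)
    refine Fin.cases ?_ (fun i => ?_) i
    · rw [hAap, dist_eq_norm, dist_eq_norm, hp0]
      have : (z + ((t : ℂ) - 1) • (z 0 • (Pi.single 0 1 : ℂ^(n + 1)))) 0 - 0 = t * z 0 := by
        simp; ring
      rw [this, norm_mul, sub_zero, Complex.norm_real, norm_of_nonneg ht.1]
      exact mul_le_of_le_one_left (norm_nonneg _) ht.2
    · rw [hAap]; simp
  refine ⟨Metric.ball p R, Metric.isOpen_ball, Metric.mem_ball_self hR, hRU,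
    fun z => ∫ t in (0 : ℝ)..1, g (A t z), ?_, ?_, ?_⟩
  · intro z hz
    refine DifferentiableAt.differentiableWithinAt ?_
    refine (hasFDerivAt_intervalIntegral (F := fun z t => g (A t z)) (F' := fun z t =>
      (fderiv ℂ g (A t z)).comp (A t)) zero_le_one Metric.isOpen_ball hz ?_ ?_ ?_).differentiableAt
    · intro x hx
      refine hgd.continuousOn.comp (t := U) (by fun_prop) fun t ht => hRU (hmaps t ht x hx)
    · refine ContinuousOn.clm_comp (hgc.comp (t := U) ?_ fun q hq => hRU (hmaps q.2 hq.2 q.1 hq.1)) ?_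
      · fun_prop
      · fun_prop
    · intro x hx t ht
      exact (hgd.differentiableAt (hU.mem_nhds (hRU (hmaps t ht x hx)))).hasFDerivAt.comp x
        (A t).hasFDerivAt
  · intro z hz
    have hd : ∀ t ∈ uIcc (0 : ℝ) 1, HasDerivAt (fun t : ℝ => f (A t z)) (z 0 * g (A t z)) t := by
      intro t ht
      rw [uIcc_of_le zero_le_one] at ht
      have h1 := (hf.differentiableAt (hU.mem_nhds (hRU (hmaps t ht z hz)))).hasFDerivAt
      have h2 : HasDerivAt (fun t : ℝ => A t z) (z 0 • Pi.single 0 1) t := by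
        have h3 : HasDerivAt (fun t : ℝ => ((t : ℂ) - 1)) 1 t :=
          (ofRealCLM.hasDerivAt).sub_const 1
        have h4 := (h3.smul_const (z 0 • (Pi.single 0 1 : ℂ^(n + 1)))).const_add z
        simp only [hAap]
        simpa using h4
      have h5 := (h1.restrictScalars ℝ).comp_hasDerivAt t h2
      simpa [hg, Function.comp_def] using h5
    have hint := intervalIntegral.integral_eq_sub_of_hasDerivAt hd ?_
    · rw [intervalIntegral.integral_const_mul] at hint
      have e1 : A 1 z = z := by simp [hAap]
      have e0 : f (A 0 z) = 0 := by
        refine h0 _ (hRU (hmaps 0 (by simp) z hz)) ?_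
        simp [hAap]
      rw [e1, e0, sub_zero] at hint
      exact hint.symm
    · refine ContinuousOn.intervalIntegrable ?_
      rw [uIcc_of_le zero_le_one]
      exact continuousOn_const.mul (hgd.continuousOn.comp (t := U) (by fun_prop)
        fun t ht => hRU (hmaps t ht z hz))
  · intro z hz hz0
    have : ∀ t, A t z = z := fun t => by simp [hAap, hz0]
    simp [this, hg]

/-! ### Forms in holomorphic charts -/

/-- The holomorphic charts of a complex manifold. -/
abbrev holAtlas (d : ℕ) (M : Type*) [TopologicalSpace M] [ChartedSpace ℂ^d M] :
    Set (OpenPartialHomeomorph M ℂ^d) :=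
  IsManifold.maximalAtlas 𝓘(ℂ, ℂ^d) ω M

section ModelSpace

variable {E F : Type*} [NormedAddCommGroup E] [NormedSpace ℝ E] [NormedAddCommGroup F]
  [NormedSpace ℝ F] {N : Type*} [TopologicalSpace N] [ChartedSpace F N]

lemma mdifferentiableAt_model_source {f : E → N} {z : E} (hc : ContinuousAt f z)
    (h : DifferentiableAt ℝ (chartAt F (f z) ∘ f) z) :
    MDifferentiableAt 𝓘(ℝ, E) 𝓘(ℝ, F) f z := by
  rw [mdifferentiableAt_iff]
  exact ⟨hc, h.differentiableWithinAt⟩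

lemma mfderiv_model_source {f : E → N} {z : E} (h : MDifferentiableAt 𝓘(ℝ, E) 𝓘(ℝ, F) f z) :
    mfderiv 𝓘(ℝ, E) 𝓘(ℝ, F) f z = fderiv ℝ (chartAt F (f z) ∘ f) z := by
  rw [h.mfderiv]
  simp only [modelWithCornersSelf_coe, range_id, fderivWithin_univ]
  rfl

lemma mdifferentiableAt_model_target {f : N → E} {x : N} (hc : ContinuousAt f x)
    (h : DifferentiableAt ℝ (f ∘ (chartAt F x).symm) (chartAt F x x)) :
    MDifferentiableAt 𝓘(ℝ, F) 𝓘(ℝ, E) f x := by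
  rw [mdifferentiableAt_iff]
  exact ⟨hc, h.differentiableWithinAt⟩

lemma mfderiv_model_target {f : N → E} {x : N} (h : MDifferentiableAt 𝓘(ℝ, F) 𝓘(ℝ, E) f x) :
    mfderiv 𝓘(ℝ, F) 𝓘(ℝ, E) f x = fderiv ℝ (f ∘ (chartAt F x).symm) (chartAt F x x) := by
  rw [h.mfderiv]
  simp only [modelWithCornersSelf_coe, range_id, fderivWithin_univ]
  rfl

end ModelSpace

lemma contDiffAt_form {d r : ℕ} {F : Type*} [NormedAddCommGroup F] [NormedSpace ℝ F]
    {A : F → AltForm d r} {x : F} {k : WithTop ℕ∞}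
    (h : ∀ v, ContDiffAt ℝ k (fun z => A z v) x) : ContDiffAt ℝ k A x := by
  obtain ⟨g, hg⟩ := exists_leftInverse_eval d r
  have : A = fun z => (g.restrictScalars ℝ)
      (fun κ => A z fun j => Pi.basis (fun _ : Fin d => Complex.basisOneI) (κ j)) := by
    ext1 z; exact (hg (A z)).symm
  rw [this]
  exact (g.restrictScalars ℝ).contDiff.contDiffAt.comp x (contDiffAt_pi.mpr fun κ => h _)

lemma contDiffAt_form_apply {d r : ℕ} {F : Type*} [NormedAddCommGroup F] [NormedSpace ℝ F]
    {A : F → AltForm d r} {x : F} {k : WithTop ℕ∞} (h : ContDiffAt ℝ k A x) (v) :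
    ContDiffAt ℝ k (fun z => A z v) x :=
  ((evalForm v).restrictScalars ℝ).contDiff.contDiffAt.comp x h

lemma contDiffAt_compCLM {d d' r : ℕ} {F : Type*} [NormedAddCommGroup F] [NormedSpace ℝ F]
    {g : F → AltForm d r} {L : F → ℂ^d' →L[ℝ] ℂ^d} {x : F} {k : WithTop ℕ∞}
    (hg : ContDiffAt ℝ k g x) (hL : ContDiffAt ℝ k L x) :
    ContDiffAt ℝ k (fun y => (g y).compContinuousLinearMap (L y)) x := by
  refine contDiffAt_form fun v => ?_
  have h1 : ContDiffAt ℝ k (fun y => (g y).toContinuousMultilinearMap) x :=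
    (ContinuousAlternatingMap.toContinuousMultilinearMapCLM ℝ (E := ℂ^d) (F := ℂ)
      (ι := Fin r) (𝕜 := ℝ)).contDiff.contDiffAt.comp x hg
  have h2 : ContDiffAt ℝ k (fun y => fun _ : Fin r => L y) x := contDiffAt_pi.mpr fun _ => hL
  have h3 := ((ContinuousMultilinearMap.analyticOnNhd_uncurry_compContinuousLinearMap (𝕜 := ℝ)
    (Fm := fun _ : Fin r => ℂ^d') (Em := fun _ : Fin r => ℂ^d) (G := ℂ) (t := univ))
      (fun _ => L x, (g x).toContinuousMultilinearMap) (mem_univ _)).contDiffAt (n := k)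
  have h4 := ContDiffAt.comp x h3 (h2.prodMk h1)
  exact ((ContinuousMultilinearMap.apply ℝ (fun _ : Fin r => ℂ^d') ℂ v).contDiff.contDiffAt).comp
    x h4

variable {d r : ℕ} {M : Type*} [TopologicalSpace M] [ChartedSpace ℂ^d M]
  [IsManifold 𝓘(ℂ, ℂ^d) ω M] {e e' : OpenPartialHomeomorph M ℂ^d}

lemma contDiffAt_transition (he : e ∈ holAtlas d M)
    (he' : e' ∈ holAtlas d M) {z : ℂ^d} (hz : z ∈ e.target) (hz' : e.symm z ∈ e'.source) :
    ContDiffAt ℂ ω (e' ∘ e.symm) z := by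
  have h := (contDiffGroupoid ω 𝓘(ℂ, ℂ^d)).compatible_of_mem_maximalAtlas he he'
  have h1 := h.1
  simp [contDiffPregroupoid] at h1
  refine h1.contDiffAt ?_
  have := (e.symm.trans e').open_source.mem_nhds (x := z) (by simp [hz, hz'])
  simpa using this

lemma contDiffAt_transition_real (he : e ∈ holAtlas d M) (he' : e' ∈ holAtlas d M) {z : ℂ^d} (hz : z ∈ e.target)
    (hz' : e.symm z ∈ e'.source) : ContDiffAt ℝ ∞ (e' ∘ e.symm) z :=
  ((contDiffAt_transition he he' hz hz').of_le le_top).restrict_scalars ℝ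

lemma fderiv_transition (he : e ∈ holAtlas d M) (he' : e' ∈ holAtlas d M) {z : ℂ^d} (hz : z ∈ e.target)
    (hz' : e.symm z ∈ e'.source) :
    fderiv ℝ (e' ∘ e.symm) z = (fderiv ℂ (e' ∘ e.symm) z).restrictScalars ℝ :=
  (((contDiffAt_transition he he' hz hz').differentiableAt (by simp)).fderiv_restrictScalars ℝ)

lemma chartAt_mem_holAtlas (x : M) : chartAt ℂ^d x ∈ holAtlas d M :=
  IsManifold.chart_mem_maximalAtlas x

lemma mdifferentiableAt_symm (he : e ∈ holAtlas d M)
    {z : ℂ^d} (hz : z ∈ e.target) :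
    MDifferentiableAt 𝓘(ℝ, ℂ^d) 𝓘(ℝ, ℂ^d) e.symm z := by
  exact mdifferentiableAt_model_source (e.symm.continuousAt hz)
    ((contDiffAt_transition_real he (chartAt_mem_holAtlas (e.symm z)) hz
    (mem_chart_source _ _)).differentiableAt (by simp))

lemma mfderiv_symm_eq (he : e ∈ holAtlas d M)
    {z : ℂ^d} (hz : z ∈ e.target) :
    mfderiv 𝓘(ℝ, ℂ^d) 𝓘(ℝ, ℂ^d) e.symm z =
      fderiv ℝ (chartAt ℂ^d (e.symm z) ∘ e.symm) z := by
  exact mfderiv_model_source (mdifferentiableAt_symm he hz)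

lemma mdifferentiableAt_chart (he : e ∈ holAtlas d M)
    {x : M} (hx : x ∈ e.source) :
    MDifferentiableAt 𝓘(ℝ, ℂ^d) 𝓘(ℝ, ℂ^d) e x := by
  exact mdifferentiableAt_model_target (e.continuousAt hx)
    ((contDiffAt_transition_real (chartAt_mem_holAtlas x) he
    (z := chartAt ℂ^d x x) (by simp) (by simpa)).differentiableAt (by simp))

lemma mfderiv_chart_eq (he : e ∈ holAtlas d M)
    {x : M} (hx : x ∈ e.source) :
    mfderiv 𝓘(ℝ, ℂ^d) 𝓘(ℝ, ℂ^d) e x =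
      fderiv ℝ (e ∘ (chartAt ℂ^d x).symm) (chartAt ℂ^d x x) := by
  exact mfderiv_model_target (mdifferentiableAt_chart he hx)

/-- In a holomorphic chart, a form is given by its value composed with a complex linear map. -/
lemma inChart_eq_comp_complex (he : e ∈ holAtlas d M)
    {z : ℂ^d} (hz : z ∈ e.target) : ∃ A : ℂ^d →L[ℂ] ℂ^d,
      mfderiv 𝓘(ℝ, ℂ^d) 𝓘(ℝ, ℂ^d) e.symm z = A.restrictScalars ℝ ∧
      ∀ (r : ℕ) (a : DForm d r M), inChart e a z =
        (a (e.symm z)).compContinuousLinearMap (A.restrictScalars ℝ) := by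
  refine ⟨fderiv ℂ (chartAt ℂ^d (e.symm z) ∘ e.symm) z, ?_, fun r a => ?_⟩
  · rw [mfderiv_symm_eq he hz, fderiv_transition he (chartAt_mem_holAtlas _) hz
      (mem_chart_source _ _)]
  · rw [inChart, mfderiv_symm_eq he hz, fderiv_transition he (chartAt_mem_holAtlas _) hz
      (mem_chart_source _ _)]

/-- The transformation rule under a change of charts. -/
lemma inChart_change (he : e ∈ holAtlas d M) (he' : e' ∈ holAtlas d M) (a : DForm d r M) {z : ℂ^d}
    (hz : z ∈ e.target) (hz' : e.symm z ∈ e'.source) :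
    inChart e a z = (inChart e' a (e' (e.symm z))).compContinuousLinearMap
      (fderiv ℝ (e' ∘ e.symm) z) := by
  have hx : e'.symm (e' (e.symm z)) = e.symm z := e'.left_inv hz'
  rw [inChart, inChart, mfderiv_symm_eq he hz, mfderiv_symm_eq he' (e'.map_source hz'), hx]
  have key : fderiv ℝ (chartAt ℂ^d (e.symm z) ∘ e.symm) z =
      (fderiv ℝ (chartAt ℂ^d (e.symm z) ∘ e'.symm) (e' (e.symm z))).comp
        (fderiv ℝ (e' ∘ e.symm) z) := by
    have h1 : DifferentiableAt ℝ (chartAt ℂ^d (e.symm z) ∘ e'.symm) (e' (e.symm z)) :=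
      (contDiffAt_transition_real he' (chartAt_mem_holAtlas _) (e'.map_source hz')
        (by rw [hx]; exact mem_chart_source _ _)).differentiableAt (by simp)
    have h2 := (contDiffAt_transition_real he he' hz hz').differentiableAt (by simp)
    refine Eq.trans ?_ (fderiv_comp z (g := chartAt ℂ^d (e.symm z) ∘ e'.symm) h1 h2)
    refine Filter.EventuallyEq.fderiv_eq ?_
    have h3 := (e.symm.trans e').open_source.mem_nhds (x := z) (by simp [hz, hz'])
    filter_upwards [h3] with w hw
    simp only [OpenPartialHomeomorph.trans_source, OpenPartialHomeomorph.symm_source,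
      mem_inter_iff, mem_preimage] at hw
    simp [e'.left_inv hw.2]
  rw [key]
  rfl

lemma inChart_chartAt_self (a : DForm d r M) (x : M) :
    inChart (chartAt ℂ^d x) a (chartAt ℂ^d x x) = a x := by
  have hx : (chartAt ℂ^d x).symm (chartAt ℂ^d x x) = x := by simp
  rw [inChart, mfderiv_symm_eq (chartAt_mem_holAtlas x) (by simp), hx]
  have : fderiv ℝ (chartAt ℂ^d x ∘ (chartAt ℂ^d x).symm)
      (chartAt ℂ^d x x) = ContinuousLinearMap.id ℝ _ := by
    rw [← fderiv_id (𝕜 := ℝ) (x := chartAt ℂ^d x x)]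
    refine Filter.EventuallyEq.fderiv_eq ?_
    filter_upwards [(chartAt ℂ^d x).open_target.mem_nhds (mem_chart_target _ x)] with w hw
    simp [(chartAt ℂ^d x).right_inv hw]
  rw [this]
  rfl

lemma eq_of_inChart_eq (he : e ∈ holAtlas d M)
    {a b : DForm d r M} {x : M} (hx : x ∈ e.source) (h : inChart e a (e x) = inChart e b (e x)) :
    a x = b x := by
  rw [← inChart_chartAt_self a x, ← inChart_chartAt_self b x,
    inChart_change (chartAt_mem_holAtlas x) he a (by simp) (by simpa),
    inChart_change (chartAt_mem_holAtlas x) he b (by simp) (by simpa)]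
  simp [h]

lemma inChart_congr {e : OpenPartialHomeomorph M ℂ^d} {a b : DForm d r M}
    {z : ℂ^d} (h : a (e.symm z) = b (e.symm z)) : inChart e a z = inChart e b z := by
  rw [inChart, inChart, h]

lemma inChart_eventuallyEq {e : OpenPartialHomeomorph M ℂ^d} {a b : DForm d r M}
    {z : ℂ^d} (hz : z ∈ e.target) (h : a =ᶠ[𝓝 (e.symm z)] b) :
    inChart e a =ᶠ[𝓝 z] inChart e b := by
  filter_upwards [(e.symm.continuousAt hz).eventually h] with w hw using inChart_congr hw

lemma ContDiffAt.inChart_change (he : e ∈ holAtlas d M) (he' : e' ∈ holAtlas d M) {a : DForm d r M} {x : M}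
    (hx : x ∈ e.source) (hx' : x ∈ e'.source) (h : ContDiffAt ℝ ∞ (inChart e a) (e x)) :
    ContDiffAt ℝ ∞ (inChart e' a) (e' x) := by
  have h1 : inChart e' a =ᶠ[𝓝 (e' x)] fun z => (inChart e a (e (e'.symm z))).compContinuousLinearMap
      (fderiv ℝ (e ∘ e'.symm) z) := by
    filter_upwards [(e'.symm.trans e).open_source.mem_nhds (x := e' x) (by simp [hx, hx'])] with z hz
    simp only [OpenPartialHomeomorph.trans_source, OpenPartialHomeomorph.symm_source,
      mem_inter_iff, mem_preimage] at hz
    exact DivInt.inChart_change he' he a hz.1 hz.2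
  have h2 := contDiffAt_transition_real he' he (z := e' x) (by simp [hx']) (by simp [hx, hx'])
  refine ContDiffAt.congr_of_eventuallyEq (contDiffAt_compCLM ?_ ?_) h1
  · exact ContDiffAt.comp (e' x) (g := inChart e a) (f := e ∘ e'.symm) (by simpa [hx'] using h) h2
  · exact h2.fderiv_right (m := ∞) (by simp)

/-- The form is smooth near `x`, tested in the preferred chart at `x`. -/
def SmoothFormAt (a : DForm d r M) (x : M) : Prop :=
  ContDiffAt ℝ ∞ (inChart (chartAt ℂ^d x) a) (chartAt ℂ^d x x)

lemma smoothFormAt_iff (he : e ∈ holAtlas d M)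
    {a : DForm d r M} {x : M} (hx : x ∈ e.source) :
    SmoothFormAt a x ↔ ContDiffAt ℝ ∞ (inChart e a) (e x) :=
  ⟨fun h => ContDiffAt.inChart_change (chartAt_mem_holAtlas x) he (mem_chart_source _ x) hx h,
    fun h => ContDiffAt.inChart_change he (chartAt_mem_holAtlas x) hx (mem_chart_source _ x) h⟩

lemma smoothFormOn_iff {a : DForm d r M} {U : Set M} (hU : IsOpen U) :
    SmoothFormOn a U ↔ ∀ x ∈ U, SmoothFormAt a x := by
  constructor
  · intro h x hx
    refine (h _ (chart_mem_atlas _ x)).contDiffAt ?_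
    refine ((chartAt ℂ^d x).isOpen_inter_preimage_symm hU).mem_nhds ?_
    simp [hx]
  · intro h e he z hz
    have := (smoothFormAt_iff (IsManifold.subset_maximalAtlas he) (x := e.symm z)
      (e.map_target hz.1)).mp (h _ hz.2)
    rw [e.right_inv hz.1] at this
    exact this.contDiffWithinAt

lemma SmoothFormAt.contDiffAt (he : e ∈ holAtlas d M)
    {a : DForm d r M} {z : ℂ^d} (hz : z ∈ e.target) (h : SmoothFormAt a (e.symm z)) :
    ContDiffAt ℝ ∞ (inChart e a) z := by
  have := (smoothFormAt_iff he (e.map_target hz)).mp h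
  rwa [e.right_inv hz] at this

lemma SmoothFormAt.congr {a b : DForm d r M} {x : M} (h : SmoothFormAt a x) (hab : a =ᶠ[𝓝 x] b) :
    SmoothFormAt b x := by
  refine ContDiffAt.congr_of_eventuallyEq h ?_
  have := inChart_eventuallyEq (e := chartAt ℂ^d x) (z := chartAt ℂ^d x x)
    (by simp) (a := b) (b := a) (by simpa using hab.symm)
  exact this

/-- The exterior derivative can be computed in any holomorphic chart. -/
lemma inChart_extD (he : e ∈ holAtlas d M)
    {a : DForm d r M} {z : ℂ^d} (hz : z ∈ e.target) (h : SmoothFormAt a (e.symm z)) :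
    inChart e (extD a) z = extDeriv (inChart e a) z := by
  set x := e.symm z with hx
  set φ := chartAt ℂ^d x with hφ
  have hφm : φ ∈ holAtlas d M := chartAt_mem_holAtlas x
  have h1 : extD a x = extDeriv (inChart φ a) (φ x) := by
    rw [extD, mfderiv_chart_eq hφm (mem_chart_source _ x)]
    have : fderiv ℝ (φ ∘ φ.symm) (φ x) = ContinuousLinearMap.id ℝ _ := by
      rw [← fderiv_id (𝕜 := ℝ) (x := φ x)]
      refine Filter.EventuallyEq.fderiv_eq ?_
      filter_upwards [φ.open_target.mem_nhds (mem_chart_target _ x)] with w hw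
      simp [φ.right_inv hw]
    rw [this]; rfl
  have hxs : e.symm z ∈ φ.source := mem_chart_source _ x
  have h2 : inChart e a =ᶠ[𝓝 z] fun w => (inChart φ a ((φ ∘ e.symm) w)).compContinuousLinearMap
      (fderiv ℝ (φ ∘ e.symm) w) := by
    filter_upwards [(e.symm.trans φ).open_source.mem_nhds (x := z)
      (by simp only [OpenPartialHomeomorph.trans_source, OpenPartialHomeomorph.symm_source]
          exact ⟨hz, hxs⟩)] with w hw
    simp only [OpenPartialHomeomorph.trans_source, OpenPartialHomeomorph.symm_source,
      mem_inter_iff, mem_preimage] at hw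
    exact inChart_change he hφm a hw.1 hw.2
  have h3 : DifferentiableAt ℝ (inChart φ a) ((φ ∘ e.symm) z) :=
    ((smoothFormAt_iff hφm hxs).mp h).differentiableAt (by simp)
  have h4 : fderiv ℝ (chartAt ℂ^d (e.symm z) ∘ e.symm) z = fderiv ℝ (φ ∘ e.symm) z := rfl
  rw [inChart, ← hx, h1, mfderiv_symm_eq he hz, h2.extDeriv_eq,
    extDeriv_pullback h3 (contDiffAt_transition_real he hφm hz hxs)
      (by simp only [minSmoothness_of_isRCLikeNormedField]; exact WithTop.coe_le_coe.2 (le_top : (2 : ℕ∞) ≤ ⊤)), h4]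
  rfl

lemma holAtlas_subset_real (he : e ∈ holAtlas d M)
    (he' : e' ∈ holAtlas d M) : e.symm ≫ₕ e' ∈ contDiffGroupoid ∞ 𝓘(ℝ, ℂ^d) := by
  rw [contDiffGroupoid, mem_groupoid_of_pregroupoid]
  constructor
  · intro z hz
    simp only [OpenPartialHomeomorph.trans_source, OpenPartialHomeomorph.symm_source] at hz
    exact (contDiffAt_transition_real he he' hz.1.1 hz.1.2).contDiffWithinAt
  · intro z hz
    simp only [OpenPartialHomeomorph.trans_target, OpenPartialHomeomorph.symm_target] at hz
    exact (contDiffAt_transition_real he' he hz.1.1 hz.1.2).contDiffWithinAt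

/-- The smooth real manifold underlying a complex manifold. -/
instance isManifold_real : IsManifold 𝓘(ℝ, ℂ^d) ∞ M where
  compatible he he' := holAtlas_subset_real (IsManifold.subset_maximalAtlas he)
    (IsManifold.subset_maximalAtlas he')

lemma mem_realAtlas (he : e ∈ holAtlas d M) :
    e ∈ IsManifold.maximalAtlas 𝓘(ℝ, ℂ^d) ∞ M := by
  rw [IsManifold.mem_maximalAtlas_iff]
  exact fun e' he' => ⟨holAtlas_subset_real he (IsManifold.subset_maximalAtlas he'),
    holAtlas_subset_real (IsManifold.subset_maximalAtlas he') he⟩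

variable {F : Type*} [NormedAddCommGroup F] [NormedSpace ℝ F]

lemma contDiffAt_comp_symm (he : e ∈ holAtlas d M)
    {f : M → F} {z : ℂ^d} (hz : z ∈ e.target)
    (hf : ContMDiffAt 𝓘(ℝ, ℂ^d) 𝓘(ℝ, F) ∞ f (e.symm z)) :
    ContDiffAt ℝ ∞ (f ∘ e.symm) z := by
  rw [← contMDiffAt_iff_contDiffAt]
  exact ContMDiffAt.comp z hf
    (contMDiffOn_symm_of_mem_maximalAtlas (mem_realAtlas he) |>.contMDiffAt
      (e.open_target.mem_nhds hz))

lemma contMDiffAt_of_chart (he : e ∈ holAtlas d M)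
    {f : M → F} {x : M} (hx : x ∈ e.source) (hf : ContDiffAt ℝ ∞ (f ∘ e.symm) (e x)) :
    ContMDiffAt 𝓘(ℝ, ℂ^d) 𝓘(ℝ, F) ∞ f x := by
  have h1 : ContMDiffAt 𝓘(ℝ, ℂ^d) 𝓘(ℝ, F) ∞ ((f ∘ e.symm) ∘ e) x :=
    ContMDiffAt.comp x (contMDiffAt_iff_contDiffAt.mpr hf)
      (contMDiffAt_of_mem_maximalAtlas (mem_realAtlas he) hx)
  refine h1.congr_of_eventuallyEq ?_
  filter_upwards [e.open_source.mem_nhds hx] with y hy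
  simp [e.left_inv hy]

lemma differentiableAt_comp_symm (he : e ∈ holAtlas d M) {f : M → ℂ} {z : ℂ^d} (hz : z ∈ e.target)
    (hf : MDifferentiableAt 𝓘(ℂ, ℂ^d) 𝓘(ℂ, ℂ) f (e.symm z)) :
    DifferentiableAt ℂ (f ∘ e.symm) z := by
  rw [← mdifferentiableAt_iff_differentiableAt]
  exact MDifferentiableAt.comp z hf
    ((contMDiffOn_symm_of_mem_maximalAtlas he |>.contMDiffAt
      (e.open_target.mem_nhds hz)).mdifferentiableAt (by simp))

lemma mdifferentiableAt_of_chart (he : e ∈ holAtlas d M) {f : M → ℂ} {x : M} (hx : x ∈ e.source)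
    (hf : DifferentiableAt ℂ (f ∘ e.symm) (e x)) :
    MDifferentiableAt 𝓘(ℂ, ℂ^d) 𝓘(ℂ, ℂ) f x := by
  have h1 : MDifferentiableAt 𝓘(ℂ, ℂ^d) 𝓘(ℂ, ℂ) ((f ∘ e.symm) ∘ e) x :=
    MDifferentiableAt.comp x (mdifferentiableAt_iff_differentiableAt.mpr hf)
      ((contMDiffAt_of_mem_maximalAtlas he hx).mdifferentiableAt (by simp))
  refine h1.congr_of_eventuallyEq ?_
  filter_upwards [e.open_source.mem_nhds hx] with y hy
  simp [e.left_inv hy]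

lemma dFun_comp_symm (he : e ∈ holAtlas d M)
    {f : M → ℂ} {z : ℂ^d} (hz : z ∈ e.target)
    (hf : MDifferentiableAt 𝓘(ℝ, ℂ^d) 𝓘(ℝ, ℂ) f (e.symm z)) :
    (dFun f (e.symm z)).comp (mfderiv 𝓘(ℝ, ℂ^d) 𝓘(ℝ, ℂ^d) e.symm z) =
      fderiv ℝ (f ∘ e.symm) z := by
  rw [← mfderiv_eq_fderiv]
  exact (mfderiv_comp z hf (mdifferentiableAt_symm he hz)).symm

/-- A function holomorphic near a point is smooth at this point. -/
lemma contMDiffAt_of_holomorphic {f : M → ℂ} {U : Set M} (hU : IsOpen U)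
    (hf : MDifferentiableOn 𝓘(ℂ, ℂ^d) 𝓘(ℂ, ℂ) f U) {x : M} (hx : x ∈ U) :
    ContMDiffAt 𝓘(ℝ, ℂ^d) 𝓘(ℝ, ℂ) ∞ f x := by
  set e := chartAt ℂ^d x
  have he : e ∈ holAtlas d M := chartAt_mem_holAtlas x
  refine contMDiffAt_of_chart he (mem_chart_source _ x) ?_
  have ho := e.isOpen_inter_preimage_symm hU
  have h1 : DifferentiableOn ℂ (f ∘ e.symm) (e.target ∩ e.symm ⁻¹' U) := fun z hz =>
    (differentiableAt_comp_symm he hz.1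
      ((hf _ hz.2).mdifferentiableAt (hU.mem_nhds hz.2))).differentiableWithinAt
  exact ((contDiffOn_of_differentiableOn ho h1).contDiffAt
    (ho.mem_nhds (by simp [e, hx]))).restrict_scalars ℝ

section Operations

variable {d r q : ℕ} {F : Type*} [NormedAddCommGroup F] [NormedSpace ℝ F] {x : F} {k : WithTop ℕ∞}

lemma contDiffAt_form_smul {c : F → ℂ} {A : F → AltForm d r} (hc : ContDiffAt ℝ k c x)
    (hA : ContDiffAt ℝ k A x) : ContDiffAt ℝ k (fun z => c z • A z) x :=
  contDiffAt_form fun v => hc.mul (contDiffAt_form_apply hA v)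

lemma contDiffAt_wedge {A : F → AltForm d r} {B : F → AltForm d q} (hA : ContDiffAt ℝ k A x)
    (hB : ContDiffAt ℝ k B x) : ContDiffAt ℝ k (fun z => wedge (A z) (B z)) x := by
  refine contDiffAt_form fun v => ?_
  simp only [wedge_apply]
  have := fun w => contDiffAt_form_apply hA w
  have := fun w => contDiffAt_form_apply hB w
  fun_prop (disch := assumption)

lemma contDiffAt_conjForm {A : F → AltForm d r} (hA : ContDiffAt ℝ k A x) :
    ContDiffAt ℝ k (fun z => conjForm (A z)) x :=
  contDiffAt_form fun v => Complex.conjCLE.contDiff.contDiffAt.comp x (contDiffAt_form_apply hA v)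

lemma contDiffAt_wedgeOne {l : F → ℂ^d →L[ℝ] ℂ} {A : F → AltForm d r}
    (hl : ContDiffAt ℝ k l x) (hA : ContDiffAt ℝ k A x) :
    ContDiffAt ℝ k (fun z => wedgeOne (l z) (A z)) x := by
  refine contDiffAt_form fun v => ?_
  simp only [wedgeOne_apply]
  have h1 : ∀ w, ContDiffAt ℝ k (fun z => l z w) x := fun w => hl.clm_apply contDiffAt_const
  have := fun w => contDiffAt_form_apply hA w
  fun_prop (disch := assumption)

lemma contDiffAt_holPart {A : F → AltForm d r} (hA : ContDiffAt ℝ k A x) :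
    ContDiffAt ℝ k (fun z => holPart (A z)) x := by
  refine contDiffAt_form fun v => ?_
  simp only [holPart_apply]
  have := fun w => contDiffAt_form_apply hA w
  fun_prop (disch := assumption)

lemma contDiffAt_extDeriv {A : ℂ^d → AltForm d r} {x : ℂ^d}
    (hA : ContDiffAt ℝ ∞ A x) : ContDiffAt ℝ ∞ (extDeriv A) x := by
  have h1 := hA.fderiv_right (m := ∞) (by simp)
  refine contDiffAt_form fun v => ?_
  simp only [extDeriv, alternatizeUncurryFin_apply]
  have h2 : ∀ u w, ContDiffAt ℝ ∞ (fun z => fderiv ℝ A z u w) x := fun u w =>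
    contDiffAt_form_apply (h1.clm_apply contDiffAt_const) w
  exact ContDiffAt.sum fun i _ => (h2 _ _).const_smul ((-1 : ℤ) ^ (i : ℕ))

lemma extDeriv_fun_smul_form {c : ℂ^d → ℂ} {A : ℂ^d → AltForm d r}
    {x : ℂ^d} (hc : DifferentiableAt ℝ c x) (hA : DifferentiableAt ℝ A x) :
    extDeriv (fun z => c z • A z) x = wedgeOne (fderiv ℝ c x) (A x) + c x • extDeriv A x := by
  have h : fderiv ℝ (fun z => c z • A z) x = c x • fderiv ℝ A x + (fderiv ℝ c x).smulRight (A x) :=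
    (hc.hasFDerivAt.smul hA.hasFDerivAt).fderiv
  rw [extDeriv, h, ContinuousAlternatingMap.alternatizeUncurryFin_add,
    ContinuousAlternatingMap.alternatizeUncurryFin_smul]
  exact add_comm _ _

end Operations

section FormOperations

variable {q : ℕ} {z : ℂ^d}

/-- The differential of the inverse of a chart, as a map between coordinate spaces. -/
def symmDeriv (e : OpenPartialHomeomorph M ℂ^d) (z : ℂ^d) :
    ℂ^d →L[ℝ] ℂ^d :=
  mfderiv 𝓘(ℝ, ℂ^d) 𝓘(ℝ, ℂ^d) e.symm z

lemma inChart_def (a : DForm d r M) :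
    inChart e a z = (a (e.symm z)).compContinuousLinearMap (symmDeriv e z) := rfl

lemma inChart_zero : inChart e (fun _ => 0 : DForm d r M) z = 0 := by
  rw [inChart_def]; ext v; simp

lemma inChart_add (a b : DForm d r M) : inChart e (fun x => a x + b x) z =
    inChart e a z + inChart e b z := rfl

lemma inChart_smul (c : M → ℂ) (a : DForm d r M) : inChart e (fun x => c x • a x) z =
    c (e.symm z) • inChart e a z := rfl

lemma inChart_sum {ι : Type*} (s : Finset ι) (a : ι → DForm d r M) :
    inChart e (fun x => ∑ i ∈ s, a i x) z = ∑ i ∈ s, inChart e (a i) z := by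
  simp only [inChart_def]
  ext v; simp

lemma inChart_wedge (a : DForm d r M) (b : DForm d q M) :
    inChart e (fun x => wedge (a x) (b x)) z = wedge (inChart e a z) (inChart e b z) := by
  simp only [inChart_def]
  exact (wedge_comp _ _ _).symm

lemma inChart_conjForm (a : DForm d r M) :
    inChart e (fun x => conjForm (a x)) z = conjForm (inChart e a z) := rfl

lemma inChart_holPart (he : e ∈ holAtlas d M) (hz : z ∈ e.target) (a : DForm d r M) :
    inChart e (fun x => holPart (a x)) z = holPart (inChart e a z) := by
  obtain ⟨A, -, hA⟩ := inChart_eq_comp_complex (M := M) he hz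
  rw [hA, hA, holPart_comp _ fun u => A.map_smul _ _]

lemma inChart_wedgeOne (he : e ∈ holAtlas d M) (hz : z ∈ e.target) {f : M → ℂ}
    (hf : MDifferentiableAt 𝓘(ℝ, ℂ^d) 𝓘(ℝ, ℂ) f (e.symm z)) (a : DForm d r M) :
    inChart e (fun x => wedgeOne (dFun f x) (a x)) z =
      wedgeOne (fderiv ℝ (f ∘ e.symm) z) (inChart e a z) := by
  rw [← dFun_comp_symm he hz hf]
  exact (wedgeOne_comp (dFun f (e.symm z)) (a (e.symm z)) (symmDeriv e z)).symm

lemma IsTypeHol.inChart (he : e ∈ holAtlas d M) (hz : z ∈ e.target) {a : DForm d r M}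
    (h : IsTypeHol (a (e.symm z))) : IsTypeHol (inChart e a z) := by
  obtain ⟨A, -, hA⟩ := inChart_eq_comp_complex (M := M) he hz
  rw [hA]; exact h.comp fun u => A.map_smul _ _

lemma isTypeHol_of_inChart (he : e ∈ holAtlas d M) {a : DForm d r M} {x : M} (hx : x ∈ e.source)
    (h : IsTypeHol (inChart e a (e x))) : IsTypeHol (a x) := by
  rw [← inChart_chartAt_self a x, inChart_change (chartAt_mem_holAtlas x) he a (by simp) (by simpa),
    fderiv_transition (chartAt_mem_holAtlas x) he (by simp) (by simpa)]
  refine IsTypeHol.comp ?_ fun u => ContinuousLinearMap.map_smul _ _ _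
  simpa using h

namespace SmoothFormAt

variable {a b : DForm d r M} {x : M}

lemma add (ha : SmoothFormAt a x) (hb : SmoothFormAt b x) :
    SmoothFormAt (fun x => a x + b x) x := ContDiffAt.add ha hb

lemma zero : SmoothFormAt (fun _ => 0 : DForm d r M) x := by
  have : inChart (chartAt ℂ^d x) (fun _ => 0 : DForm d r M) = fun _ => 0 :=
    funext fun z => inChart_zero
  unfold SmoothFormAt
  rw [this]; exact contDiffAt_const

lemma sum {ι : Type*} {s : Finset ι} {a : ι → DForm d r M} (h : ∀ i ∈ s, SmoothFormAt (a i) x) :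
    SmoothFormAt (fun x => ∑ i ∈ s, a i x) x := by
  have := ContDiffAt.sum (s := s) h
  have h2 : inChart (chartAt ℂ^d x) (fun x => ∑ i ∈ s, a i x) =
      fun z => ∑ i ∈ s, inChart (chartAt ℂ^d x) (a i) z := funext fun z => inChart_sum s a
  unfold SmoothFormAt
  rw [h2]; exact this

lemma smul {c : M → ℂ} (hc : ContMDiffAt 𝓘(ℝ, ℂ^d) 𝓘(ℝ, ℂ) ∞ c x)
    (ha : SmoothFormAt a x) : SmoothFormAt (fun x => c x • a x) x :=
  contDiffAt_form_smul (contDiffAt_comp_symm (chartAt_mem_holAtlas x) (by simp) (by simpa)) ha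

lemma wedge {b : DForm d q M} (ha : SmoothFormAt a x) (hb : SmoothFormAt b x) :
    SmoothFormAt (fun x => DivInt.wedge (a x) (b x)) x := by
  have h2 : inChart (chartAt ℂ^d x) (fun x => DivInt.wedge (a x) (b x)) =
      fun z => DivInt.wedge (inChart (chartAt ℂ^d x) a z)
        (inChart (chartAt ℂ^d x) b z) := funext fun z => inChart_wedge a b
  unfold SmoothFormAt
  rw [h2]; exact contDiffAt_wedge ha hb

lemma conjForm (ha : SmoothFormAt a x) : SmoothFormAt (fun x => DivInt.conjForm (a x)) x :=
  contDiffAt_conjForm ha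

lemma holPart (ha : SmoothFormAt a x) : SmoothFormAt (fun x => DivInt.holPart (a x)) x := by
  refine ContDiffAt.congr_of_eventuallyEq (contDiffAt_holPart ha) ?_
  filter_upwards [(chartAt ℂ^d x).open_target.mem_nhds (mem_chart_target _ x)] with z hz
  exact inChart_holPart (chartAt_mem_holAtlas x) hz a

end SmoothFormAt

lemma SmoothFormOn.wedgeOne_dFun {U : Set M} (hU : IsOpen U) {f : M → ℂ}
    (hf : ∀ x ∈ U, ContMDiffAt 𝓘(ℝ, ℂ^d) 𝓘(ℝ, ℂ) ∞ f x) {a : DForm d r M}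
    (ha : SmoothFormOn a U) : SmoothFormOn (fun x => wedgeOne (dFun f x) (a x)) U := by
  rw [smoothFormOn_iff hU] at ha ⊢
  intro x hx
  set e := chartAt ℂ^d x
  have he : e ∈ holAtlas d M := chartAt_mem_holAtlas x
  have h1 : ContDiffAt ℝ ∞ (fderiv ℝ (f ∘ e.symm)) (e x) :=
    (contDiffAt_comp_symm he (by simp [e]) (by simpa [e] using hf x hx)).fderiv_right
      (m := ∞) (by simp)
  refine ContDiffAt.congr_of_eventuallyEq (contDiffAt_wedgeOne h1 (ha x hx)) ?_
  filter_upwards [(e.isOpen_inter_preimage_symm hU).mem_nhds (x := e x) (by simp [e, hx])] with z hz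
  exact inChart_wedgeOne he hz.1 ((hf _ hz.2).mdifferentiableAt (by simp)) a

lemma SmoothFormOn.extD {U : Set M} (hU : IsOpen U) {a : DForm d r M}
    (ha : SmoothFormOn a U) : SmoothFormOn (extD a) U := by
  rw [smoothFormOn_iff hU] at ha ⊢
  intro x hx
  set e := chartAt ℂ^d x
  have he : e ∈ holAtlas d M := chartAt_mem_holAtlas x
  refine ContDiffAt.congr_of_eventuallyEq (contDiffAt_extDeriv (ha x hx)) ?_
  filter_upwards [(e.isOpen_inter_preimage_symm hU).mem_nhds (x := e x) (by simp [e, hx])] with z hz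
  exact inChart_extD he hz.1 (ha _ hz.2)

lemma extD_congr {a b : DForm d r M} {x : M} (h : a =ᶠ[𝓝 x] b) : extD a x = extD b x := by
  have := inChart_eventuallyEq (e := chartAt ℂ^d x) (z := chartAt ℂ^d x x)
    (a := a) (b := b) (by simp) (by simpa using h)
  rw [extD, extD, this.extDeriv_eq]

lemma extD_apply_chart (a : DForm d r M) (x : M) (h : SmoothFormAt a x) :
    extD a x = extDeriv (inChart (chartAt ℂ^d x) a) (chartAt ℂ^d x x) := by
  rw [← inChart_chartAt_self (extD a) x]
  exact inChart_extD (chartAt_mem_holAtlas x) (by simp) (by simpa)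

lemma extD_add {a b : DForm d r M} {x : M} (ha : SmoothFormAt a x) (hb : SmoothFormAt b x) :
    extD (fun y => a y + b y) x = extD a x + extD b x := by
  rw [extD_apply_chart _ x (ha.add hb), extD_apply_chart _ x ha, extD_apply_chart _ x hb]
  exact extDeriv_add (ha.differentiableAt (by simp)) (hb.differentiableAt (by simp))

lemma extD_zero (x : M) : extD (fun _ => 0 : DForm d r M) x = 0 := by
  rw [extD_apply_chart _ x SmoothFormAt.zero]
  have : inChart (chartAt ℂ^d x) (fun _ => 0 : DForm d r M) = fun _ => 0 :=
    funext fun z => inChart_zero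
  rw [this]
  ext v; simp [extDeriv_apply]

lemma extD_sum {ι : Type*} {s : Finset ι} {a : ι → DForm d r M} {x : M}
    (h : ∀ i ∈ s, SmoothFormAt (a i) x) :
    extD (fun y => ∑ i ∈ s, a i y) x = ∑ i ∈ s, extD (a i) x := by
  classical
  induction s using Finset.induction_on with
  | empty => simpa using extD_zero x
  | insert i s hi ih =>
    simp only [Finset.sum_insert hi]
    rw [extD_add (h i (by simp)) (SmoothFormAt.sum fun j hj => h j (by simp [hj])),
      ih fun j hj => h j (by simp [hj])]

/-- The Leibniz rule for the product of a function with a form. -/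
lemma extD_smul {c : M → ℂ} {a : DForm d r M} {x : M}
    (hc : ContMDiffAt 𝓘(ℝ, ℂ^d) 𝓘(ℝ, ℂ) ∞ c x) (ha : SmoothFormAt a x) :
    extD (fun y => c y • a y) x = wedgeOne (dFun c x) (a x) + c x • extD a x := by
  set e := chartAt ℂ^d x with he0
  have he : e ∈ holAtlas d M := chartAt_mem_holAtlas x
  have hez : e.symm (e x) = x := by simp [e]
  have hzt : e x ∈ e.target := by simp [e]
  refine eq_of_inChart_eq (b := fun y => wedgeOne (dFun c y) (a y) + c y • extD a y) he
    (mem_chart_source _ x) ?_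
  rw [inChart_extD he hzt (by rw [hez]; exact ha.smul hc), inChart_add, inChart_smul,
    inChart_extD he hzt (by rwa [hez]), inChart_wedgeOne he hzt
      (by rw [hez]; exact hc.mdifferentiableAt (by simp)), hez]
  have h1 := (contDiffAt_comp_symm he hzt (by rwa [hez])).differentiableAt (x := e x)
    (f := c ∘ e.symm) (by simp)
  have h2 := extDeriv_fun_smul_form h1 (ContDiffAt.differentiableAt ha (by simp))
  simp only [Function.comp_apply, hez] at h2
  exact h2

end FormOperations

/-! ### Integration of forms in holomorphic charts -/

lemma form_smul_zero {d r : ℕ} (c : ℂ) : c • (0 : AltForm d r) = 0 := by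
  ext v; simp

lemma form_zero_smul {d r : ℕ} (a : AltForm d r) : (0 : ℂ) • a = 0 := by
  ext v; simp

/-- The form has continuous coefficients on `S`. -/
def ContFormOn (a : DForm d r M) (S : Set M) : Prop :=
  ∀ e ∈ holAtlas d M, ContinuousOn (inChart e a) (e.target ∩ e.symm ⁻¹' S)

lemma SmoothFormOn.contFormOn {a : DForm d r M} {U : Set M} (hU : IsOpen U)
    (ha : SmoothFormOn a U) : ContFormOn a U := fun _ he _ hz =>
  (((smoothFormOn_iff hU).mp ha _ hz.2).contDiffAt he hz.1).continuousAt.continuousWithinAt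

lemma ContFormOn.mono {a : DForm d r M} {S T : Set M} (ha : ContFormOn a T) (h : S ⊆ T) :
    ContFormOn a S := fun e he => (ha e he).mono (inter_subset_inter_right _ (preimage_mono h))

lemma ContFormOn.smul {a : DForm d r M} {S : Set M} {c : M → ℂ} (hc : ContinuousOn c S)
    (ha : ContFormOn a S) : ContFormOn (fun x => c x • a x) S := fun e he =>
  (hc.comp (e.continuousOn_symm.mono inter_subset_left) fun _ hz => hz.2).smul (ha e he)

/-- The integral over `S` of a form of top degree, in the coordinates given by a chart. -/
def localIntegral (e : OpenPartialHomeomorph M ℂ^d) (a : DForm d (d + d) M) (S : Set M) :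
    ℂ :=
  ∫ z in e.target ∩ e.symm ⁻¹' S, inChart e a z (stdFrame d)

lemma measurableSet_chart (e : OpenPartialHomeomorph M ℂ^d) {S : Set M} (hS : IsClosed S) :
    MeasurableSet (e.target ∩ e.symm ⁻¹' S) := by
  have : e.target ∩ e.symm ⁻¹' S = e.target \ (e.target ∩ e.symm ⁻¹' Sᶜ) := by
    ext z; simp only [mem_inter_iff, mem_preimage, Set.mem_sdiff, mem_compl_iff]; tauto
  rw [this]
  exact e.open_target.measurableSet.diff
    (e.isOpen_inter_preimage_symm hS.isOpen_compl).measurableSet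

lemma integrableOn_inChart [CompactSpace M] (he : e ∈ holAtlas d M) {a : DForm d (d + d) M} {S K : Set M} (hS : IsClosed S)
    (hK : IsClosed K) (hKe : K ⊆ e.source) (ha : ContFormOn a S) (h0 : ∀ y ∈ S, y ∉ K → a y = 0) :
    IntegrableOn (fun z => inChart e a z (stdFrame d)) (e.target ∩ e.symm ⁻¹' S) := by
  have hcomp : IsCompact (e '' (K ∩ S)) :=
    (hK.inter hS).isCompact.image_of_continuousOn (e.continuousOn.mono (inter_subset_left.trans hKe))
  have hsub : e '' (K ∩ S) ⊆ e.target ∩ e.symm ⁻¹' S := by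
    rintro _ ⟨y, hy, rfl⟩
    exact ⟨e.map_source (hKe hy.1), by simpa [e.left_inv (hKe hy.1)] using hy.2⟩
  have hcont : ContinuousOn (fun z => inChart e a z (stdFrame d)) (e '' (K ∩ S)) :=
    (evalForm (stdFrame d)).continuous.comp_continuousOn ((ha e he).mono hsub)
  refine (hcont.integrableOn_compact hcomp).of_forall_sdiff_eq_zero (measurableSet_chart e hS) ?_
  rintro z ⟨hz, hz'⟩
  have : e.symm z ∉ K := fun h => hz' ⟨e.symm z, ⟨h, hz.2⟩, e.right_inv hz.1⟩
  rw [inChart_def, h0 _ hz.2 this]; simp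

/-- The local integral does not depend on the chart. -/
lemma localIntegral_eq (he : e ∈ holAtlas d M)
    (he' : e' ∈ holAtlas d M) {a : DForm d (d + d) M} {S : Set M} (hS : IsClosed S)
    (h : ∀ y ∈ S, a y ≠ 0 → y ∈ e.source ∧ y ∈ e'.source) :
    localIntegral e a S = localIntegral e' a S := by
  have key : ∀ {e e' : OpenPartialHomeomorph M ℂ^d},
      (∀ y ∈ S, a y ≠ 0 → y ∈ e.source ∧ y ∈ e'.source) →
      localIntegral e a S = ∫ z in (e.target ∩ e.symm ⁻¹' S) ∩ (e.target ∩ e.symm ⁻¹' e'.source),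
        inChart e a z (stdFrame d) := by
    intro e e' h
    refine setIntegral_eq_of_subset_of_forall_sdiff_eq_zero (measurableSet_chart e hS)
      inter_subset_left ?_
    rintro z ⟨hz, hz'⟩
    have : a (e.symm z) = 0 := by
      by_contra hne
      exact hz' ⟨hz, hz.1, (h _ hz.2 hne).2⟩
    rw [inChart_def, this]; simp
  rw [key h, key fun y hy hne => (h y hy hne).symm]
  set A := (e.target ∩ e.symm ⁻¹' S) ∩ (e.target ∩ e.symm ⁻¹' e'.source) with hA
  have hAm : MeasurableSet A := (measurableSet_chart e hS).inter
    (e.isOpen_inter_preimage_symm e'.open_source).measurableSet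
  have hAim : (e'.target ∩ e'.symm ⁻¹' S) ∩ (e'.target ∩ e'.symm ⁻¹' e.source) =
      (e' ∘ e.symm) '' A := by
    ext z
    constructor
    · rintro ⟨⟨h1, h2⟩, -, h3⟩
      refine ⟨e (e'.symm z), ⟨⟨e.map_source h3, ?_⟩, e.map_source h3, ?_⟩, ?_⟩
      · simpa [e.left_inv h3] using h2
      · simpa [e.left_inv h3] using e'.map_target h1
      · simp [e.left_inv h3, e'.right_inv h1]
    · rintro ⟨w, ⟨⟨h1, h2⟩, -, h3⟩, rfl⟩
      simp only [Function.comp_apply, mem_inter_iff, mem_preimage, e'.left_inv h3]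
      exact ⟨⟨e'.map_source h3, h2⟩, e'.map_source h3, e.map_target h1⟩
  rw [hAim, integral_image_eq_integral_abs_det_fderiv_smul volume hAm
    (f' := fun z => fderiv ℝ (e' ∘ e.symm) z)]
  · refine setIntegral_congr_fun hAm fun z hz => ?_
    simp only [Function.comp_apply]
    rw [inChart_change he he' a hz.1.1 hz.2.2, fderiv_transition he he' hz.1.1 hz.2.2]
    have h1 := top_form_comp (inChart e' a (e' (e.symm z)))
      ((fderiv ℂ (e' ∘ e.symm) z).restrictScalars ℝ : ℂ^d →ₗ[ℝ] ℂ^d) (stdFrame d)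
    have h2 : LinearMap.det ((fderiv ℂ (e' ∘ e.symm) z).restrictScalars ℝ :
        ℂ^d →ₗ[ℝ] ℂ^d) = Complex.normSq (LinearMap.det
          (fderiv ℂ (e' ∘ e.symm) z : ℂ^d →ₗ[ℂ] ℂ^d)) :=
      det_restrictScalars_complex _
    rw [ContinuousLinearMap.det, h2, abs_of_nonneg (Complex.normSq_nonneg _), ← h2]
    rw [real_smul]
    exact h1
  · intro z hz
    exact ((contDiffAt_transition_real he he' hz.1.1 hz.2.2).differentiableAt
      (by simp)).hasFDerivAt.hasFDerivWithinAt
  · intro z hz w hw hzw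
    have h1 := e'.injOn hz.2.2 hw.2.2 hzw
    exact e.symm.injOn hz.1.1 hw.1.1 h1

section GlobalIntegral

variable [T2Space M] [CompactSpace M]

lemma chartPOU_subordinate :
    (chartPOU d M).IsSubordinate (fun x => (chartAt ℂ^d x).source) :=
  Classical.choose_spec (exists_chartPOU d M)

lemma continuousOn_chartPOU (x : M) (S : Set M) :
    ContinuousOn (fun y => (chartPOU d M x y : ℂ)) S :=
  (Complex.continuous_ofReal.comp (chartPOU d M x).continuous).continuousOn

lemma chartPOU_smul_eq_zero (a : DForm d (d + d) M) (x : M) {y : M}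
    (hy : y ∉ tsupport (chartPOU d M x)) : (chartPOU d M x y : ℂ) • a y = 0 := by
  rw [image_eq_zero_of_notMem_tsupport hy, ofReal_zero]
  exact zero_smul ℂ (a y)

lemma formIntegrableOn_of_cont {a : DForm d (d + d) M} {S : Set M} (hS : IsClosed S)
    (ha : ContFormOn a S) : FormIntegrableOn a S := fun x =>
  integrableOn_inChart (chartAt_mem_holAtlas x) hS (isClosed_tsupport _) (chartPOU_subordinate x)
    (ha.smul (continuousOn_chartPOU x S)) fun _ _ hy => chartPOU_smul_eq_zero a x hy

lemma exists_finset_chartPOU : ∃ s : Finset M, (∀ x ∉ s, ∀ y, chartPOU d M x y = 0) ∧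
    ∀ y, ∑ x ∈ s, chartPOU d M x y = 1 := by
  have hfin := (chartPOU d M).locallyFinite.finite_nonempty_of_compact
  refine ⟨hfin.toFinset, fun x hx y => ?_, fun y => ?_⟩
  · by_contra h
    exact hx (hfin.mem_toFinset.mpr ⟨y, h⟩)
  · rw [← (chartPOU d M).sum_eq_one (mem_univ y)]
    refine (finsum_eq_sum_of_support_subset _ fun x hx => ?_).symm
    exact hfin.mem_toFinset.mpr ⟨y, hx⟩

/-- By compactness, only finitely many members of the partition of unity contribute. -/
lemma formIntegral_eq_finset (a : DForm d (d + d) M) (S : Set M) {s : Finset M}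
    (hs : ∀ x ∉ s, ∀ y, chartPOU d M x y = 0) :
    formIntegral a S = ∑ x ∈ s, localIntegral (chartAt ℂ^d x)
      (fun y => (chartPOU d M x y : ℂ) • a y) S := by
  refine finsum_eq_sum_of_support_subset _ fun x hx => ?_
  by_contra h
  refine hx ?_
  simp only [chartDensity, hs x h]
  simp

lemma localIntegral_sum {ι : Type*} (s : Finset ι) {a : ι → DForm d (d + d) M}
    {e : OpenPartialHomeomorph M ℂ^d} {S : Set M}
    (h : ∀ i ∈ s, IntegrableOn (fun z => inChart e (a i) z (stdFrame d))
      (e.target ∩ e.symm ⁻¹' S)) :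
    localIntegral e (fun y => ∑ i ∈ s, a i y) S = ∑ i ∈ s, localIntegral e (a i) S := by
  unfold localIntegral
  rw [← integral_finsetSum _ h]
  congr 1; ext z
  rw [inChart_sum]; simp

/-- The integral of a form supported in the domain of a chart. -/
lemma formIntegral_eq_localIntegral (he : e ∈ holAtlas d M) {a : DForm d (d + d) M} {S K : Set M} (hS : IsClosed S)
    (hK : IsClosed K) (hKe : K ⊆ e.source) (ha : ContFormOn a S) (h0 : ∀ y ∈ S, y ∉ K → a y = 0) :
    formIntegral a S = localIntegral e a S := by
  obtain ⟨s, hs, hs1⟩ := exists_finset_chartPOU (d := d) (M := M)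
  rw [formIntegral_eq_finset a S hs]
  have h1 : a = fun y => ∑ x ∈ s, (chartPOU d M x y : ℂ) • a y := by
    ext1 y
    rw [← Finset.sum_smul, ← ofReal_sum, hs1]; simp
  conv_rhs => rw [h1]
  rw [localIntegral_sum]
  · refine sum_congr rfl fun x _ => localIntegral_eq (chartAt_mem_holAtlas x) he hS ?_
    intro y hy hne
    refine ⟨chartPOU_subordinate x ?_, hKe ?_⟩
    · by_contra h
      exact hne (chartPOU_smul_eq_zero a x h)
    · by_contra h
      exact hne (by rw [h0 y hy h, form_smul_zero])
  · intro x _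
    exact integrableOn_inChart he hS hK hKe (ha.smul (continuousOn_chartPOU x S))
      fun y hy hyK => by rw [h0 y hy hyK, form_smul_zero]

lemma formIntegral_sum {ι : Type*} (s : Finset ι) {a : ι → DForm d (d + d) M} {S : Set M}
    (hS : IsClosed S) (h : ∀ i ∈ s, ContFormOn (a i) S) :
    formIntegral (fun y => ∑ i ∈ s, a i y) S = ∑ i ∈ s, formIntegral (a i) S := by
  obtain ⟨t, ht, -⟩ := exists_finset_chartPOU (d := d) (M := M)
  simp only [formIntegral_eq_finset _ S ht]
  rw [Finset.sum_comm]
  refine sum_congr rfl fun x _ => ?_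
  simp only [Finset.smul_sum]
  exact localIntegral_sum s fun i hi => integrableOn_inChart (chartAt_mem_holAtlas x) hS
    (isClosed_tsupport _) (chartPOU_subordinate x) ((h i hi).smul (continuousOn_chartPOU x S))
    fun _ _ hy => chartPOU_smul_eq_zero (a i) x hy

lemma formIntegral_add {a b : DForm d (d + d) M} {S : Set M} (hS : IsClosed S)
    (ha : ContFormOn a S) (hb : ContFormOn b S) :
    formIntegral (fun y => a y + b y) S = formIntegral a S + formIntegral b S := by
  have := formIntegral_sum (Finset.univ : Finset (Fin 2)) (a := ![a, b]) hS
    (by intro i _; fin_cases i <;> simpa)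
  simpa using this

lemma formIntegral_congr {a b : DForm d (d + d) M} {S : Set M} (h : ∀ y ∈ S, a y = b y)
    (hS : IsClosed S) : formIntegral a S = formIntegral b S := by
  obtain ⟨t, ht, -⟩ := exists_finset_chartPOU (d := d) (M := M)
  simp only [formIntegral_eq_finset _ S ht]
  refine sum_congr rfl fun x _ => ?_
  refine setIntegral_congr_fun (measurableSet_chart _ hS) fun z hz => ?_
  simp only [inChart_def, h _ hz.2]

end GlobalIntegral

/-! ### Stokes' theorem on compact complex manifolds -/

/-- Extension by zero of a smooth function with compact support in an open set. -/
lemma contDiff_indicator {E F : Type*} [NormedAddCommGroup E] [NormedSpace ℝ E]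
    [NormedAddCommGroup F] [NormedSpace ℝ F] {V K : Set E} (hV : IsOpen V) (hK : IsCompact K)
    (hKV : K ⊆ V) {f : E → F} {k : WithTop ℕ∞} (hf : ContDiffOn ℝ k f V)
    (h0 : ∀ z ∈ V, z ∉ K → f z = 0) :
    ContDiff ℝ k (V.indicator f) ∧ HasCompactSupport (V.indicator f) := by
  have h1 : ∀ z ∉ K, V.indicator f z = 0 := fun z hz => by
    by_cases hzV : z ∈ V
    · rw [indicator_of_mem hzV, h0 z hzV hz]
    · rw [indicator_of_notMem hzV]
  refine ⟨contDiff_iff_contDiffAt.mpr fun z => ?_, HasCompactSupport.intro hK h1⟩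
  by_cases hz : z ∈ V
  · refine (hf.contDiffAt (hV.mem_nhds hz)).congr_of_eventuallyEq ?_
    filter_upwards [hV.mem_nhds hz] with w hw using indicator_of_mem hw f
  · refine (contDiffAt_const (c := (0 : F))).congr_of_eventuallyEq ?_
    filter_upwards [hK.isClosed.isOpen_compl.mem_nhds fun h => hz (hKV h)] with w hw using h1 w hw

lemma integral_fderiv_apply_eq_zero {E : Type*} [NormedAddCommGroup E] [NormedSpace ℝ E]
    [FiniteDimensional ℝ E] [MeasurableSpace E] [BorelSpace E] (μ : Measure E) [μ.IsAddHaarMeasure]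
    {g : E → ℂ} (hg : ContDiff ℝ 1 g) (hc : HasCompactSupport g) (v : E) :
    ∫ z, fderiv ℝ g z v ∂μ = 0 := by
  have h1 : Continuous fun z => fderiv ℝ g z v :=
    (hg.continuous_fderiv (by simp)).clm_apply continuous_const
  have h2 : HasCompactSupport fun z => fderiv ℝ g z v := (hc.fderiv (𝕜 := ℝ)).comp_left
    (g := fun L : E →L[ℝ] ℂ => L v) (by simp)
  have := integral_mul_fderiv_eq_neg_fderiv_mul_of_integrable (μ := μ) (𝕜 := ℂ) (f := fun _ => (1 : ℂ))
    (g := g) (v := v) (by simp) (by simpa using h1.integrable_of_hasCompactSupport h2)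
    (by simpa using hg.continuous.integrable_of_hasCompactSupport hc)
    (fun x _ => by fun_prop) (fun x _ => hg.differentiable (by simp) x)
  simpa using this

lemma hasFDerivAt_form_apply {d r : ℕ} {F : Type*} [NormedAddCommGroup F] [NormedSpace ℝ F]
    {A : F → AltForm d r} {x : F} (hA : DifferentiableAt ℝ A x) (v : Fin r → ℂ^d) :
    HasFDerivAt (fun z => A z v)
      (((evalForm v).restrictScalars ℝ).comp (fderiv ℝ A x)) x :=
  ((evalForm v).restrictScalars ℝ).hasFDerivAt.comp x hA.hasFDerivAt

lemma fderiv_wedge_apply {d p q : ℕ} {F : Type*} [NormedAddCommGroup F] [NormedSpace ℝ F]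
    {A : F → AltForm d p} {B : F → AltForm d q} {x : F} (hA : DifferentiableAt ℝ A x)
    (hB : DifferentiableAt ℝ B x) (w : Fin (p + q) → ℂ^d) (u : F) :
    fderiv ℝ (fun z => wedge (A z) (B z) w) x u =
      wedge (fderiv ℝ A x u) (B x) w + wedge (A x) (fderiv ℝ B x u) w := by
  simp only [wedge_apply]
  have h := (HasFDerivAt.fun_sum (u := Finset.univ) fun (σ : Equiv.Perm (Fin (p + q))) _ =>
    ((hasFDerivAt_form_apply hA fun i => w (σ (Fin.castAdd q i))).mul
      (hasFDerivAt_form_apply hB fun i => w (σ (Fin.natAdd p i)))).const_mul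
      (((Equiv.Perm.sign σ : ℤ) : ℂ))).const_mul ((((p.factorial * q.factorial : ℝ))⁻¹ : ℝ) : ℂ)
  have hev : ∀ {s : ℕ} (T : F →L[ℝ] AltForm d s) (v : Fin s → ℂ^d),
      (((evalForm v).restrictScalars ℝ).comp T) u = T u v := fun _ _ => rfl
  refine (congrArg (fun L => L u) h.fderiv).trans ?_
  simp only [_root_.smul_apply, _root_.sum_apply, _root_.add_apply, hev, smul_eq_mul]
  rw [← mul_add, ← Finset.sum_add_distrib]
  congr 1
  refine sum_congr rfl fun σ _ => ?_
  ring

/-- Stokes' theorem in coordinates, for a form with compact support. -/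
lemma setIntegral_wedge_extDeriv {r : ℕ} {V K : Set ℂ^(r + 1)} (hV : IsOpen V)
    (hK : IsCompact K) (hKV : K ⊆ V) {C : ℂ^(r + 1) → AltForm (r + 1) r}
    {Y : ℂ^(r + 1) → AltForm (r + 1) (r + 1)} (hC : ContDiffOn ℝ ∞ C V)
    (hY : ContDiffOn ℝ ∞ Y V) (h0 : ∀ z ∈ V, z ∉ K → C z = 0)
    (hdY : ∀ z ∈ V, C z = 0 ∨ extDeriv Y z = 0) :
    ∫ z in V, wedge (extDeriv C z) (Y z) (stdFrame (r + 1)) = 0 := by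
  -- `d(C ∧ Y)` is a sum of derivatives of compactly supported functions, and only `dC ∧ Y` remains
  set v : Fin (r + (r + 1) + 1) → ℂ^(r + 1) := fun k =>
    stdFrame (r + 1) (Fin.cast (by omega) k) with hv
  set G : Fin (r + (r + 1) + 1) → ℂ^(r + 1) → ℂ := fun i =>
    V.indicator fun z => wedge (C z) (Y z) (i.removeNth v) with hG
  have hGs : ∀ i, ContDiff ℝ ∞ (G i) ∧ HasCompactSupport (G i) := by
    refine fun i => contDiff_indicator hV hK hKV ?_ ?_
    · intro z hz
      exact (contDiffAt_form_apply (contDiffAt_wedge (hC.contDiffAt (hV.mem_nhds hz))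
        (hY.contDiffAt (hV.mem_nhds hz))) _).contDiffWithinAt
    · intro z hz hzK
      rw [h0 z hz hzK, wedge_zero_left]; rfl
  have key : V.indicator (fun z => wedge (extDeriv C z) (Y z) (stdFrame (r + 1))) =
      fun z => ∑ i : Fin (r + (r + 1) + 1), (-1 : ℂ) ^ (i : ℕ) * fderiv ℝ (G i) z (v i) := by
    ext1 z
    by_cases hz : z ∈ V
    · rw [indicator_of_mem hz]
      have hCd := (hC.contDiffAt (hV.mem_nhds hz)).differentiableAt (by simp)
      have hYd := (hY.contDiffAt (hV.mem_nhds hz)).differentiableAt (by simp)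
      have h1 : ∀ i, fderiv ℝ (G i) z (v i) = wedge (fderiv ℝ C z (v i)) (Y z) (i.removeNth v) +
          wedge (C z) (fderiv ℝ Y z (v i)) (i.removeNth v) := by
        intro i
        rw [← fderiv_wedge_apply hCd hYd]
        congr 1
        refine Filter.EventuallyEq.fderiv_eq ?_
        filter_upwards [hV.mem_nhds hz] with w hw using indicator_of_mem hw _
      have h2 := wedge_alternatize_left (fderiv ℝ C z) (Y z) (stdFrame (r + 1))
      have h3 := wedge_alternatize_right (C z) (fderiv ℝ Y z) v
      have h4 : wedge (C z) (alternatizeUncurryFin (fderiv ℝ Y z)) v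
          = 0 := by
        rcases hdY z hz with h | h
        · rw [h, wedge_zero_left]; rfl
        · rw [extDeriv] at h
          rw [h, wedge_zero_right]; rfl
      rw [h4] at h3
      have h5 : ∑ i : Fin (r + (r + 1) + 1), (-1 : ℂ) ^ (i : ℕ) * wedge (C z) (fderiv ℝ Y z (v i)) (i.removeNth v) = 0 := by
        rcases mul_eq_zero.mp h3.symm with h | h
        · simp at h
        · exact h
      simp only [h1, mul_add, Finset.sum_add_distrib, h5, add_zero]
      exact h2
    · rw [indicator_of_notMem hz]
      refine (Finset.sum_eq_zero fun i _ => ?_).symm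
      have : fderiv ℝ (G i) z = 0 := by
        refine HasFDerivAt.fderiv ?_
        refine (hasFDerivAt_const (0 : ℂ) z).congr_of_eventuallyEq ?_
        filter_upwards [hK.isClosed.isOpen_compl.mem_nhds fun h => hz (hKV h)] with w hw
        by_cases hwV : w ∈ V
        · rw [hG]; simp only [indicator_of_mem hwV]
          rw [h0 w hwV hw, wedge_zero_left]; rfl
        · rw [hG]; simp only [indicator_of_notMem hwV]
      rw [this]; simp
  rw [← integral_indicator hV.measurableSet, key, integral_finsetSum]
  · refine Finset.sum_eq_zero fun i _ => ?_
    rw [integral_const_mul, integral_fderiv_apply_eq_zero volume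
      ((hGs i).1.of_le (by simp)) (hGs i).2, mul_zero]
  · intro i _
    refine Integrable.const_mul ?_ _
    refine Continuous.integrable_of_hasCompactSupport ?_ ?_
    · exact ((hGs i).1.continuous_fderiv (by simp)).clm_apply continuous_const
    · exact ((hGs i).2.fderiv (𝕜 := ℝ)).comp_left
        (g := fun L : ℂ^(r + 1) →L[ℝ] ℂ => L (v i)) (by simp)

section Manifold

variable [T2Space M] [CompactSpace M]

/-- Finite smooth partitions of unity subordinate to an open cover indexed by the points. -/
lemma exists_finite_partitionOfUnity (U : M → Set M) (hU : ∀ x, IsOpen (U x))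
    (hxU : ∀ x, x ∈ U x) :
    ∃ (s : Finset M) (χ : M → M → ℝ),
      (∀ i, ContMDiff 𝓘(ℝ, ℂ^d) 𝓘(ℝ, ℝ) ∞ (χ i)) ∧ (∀ i y, 0 ≤ χ i y) ∧
      (∀ i, tsupport (χ i) ⊆ U i) ∧ ∀ y, ∑ i ∈ s, χ i y = 1 := by
  obtain ⟨f, hf⟩ := SmoothPartitionOfUnity.exists_isSubordinate 𝓘(ℝ, ℂ^d)
    (isClosed_univ (X := M)) U hU fun x _ => mem_iUnion.mpr ⟨x, hxU x⟩
  have hfin := f.locallyFinite.finite_nonempty_of_compact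
  refine ⟨hfin.toFinset, fun i => f i, fun i => (f i).contMDiff, fun i y => f.nonneg i y,
    fun i => hf i, fun y => ?_⟩
  rw [← f.sum_eq_one (mem_univ y)]
  refine (finsum_eq_sum_of_support_subset _ fun x hx => ?_).symm
  exact hfin.mem_toFinset.mpr ⟨y, hx⟩

lemma contMDiff_ofReal {χ : M → ℝ} {x : M}
    (h : ContMDiffAt 𝓘(ℝ, ℂ^d) 𝓘(ℝ, ℝ) ∞ χ x) :
    ContMDiffAt 𝓘(ℝ, ℂ^d) 𝓘(ℝ, ℂ) ∞ (fun y => (χ y : ℂ)) x :=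
  ofRealCLM.contMDiff.contMDiffAt.comp x h

/-- Stokes' theorem: `∫ dc ∧ Y = 0` if `Y` is closed wherever `c` does not vanish. -/
lemma formIntegral_wedge_extD_eq_zero [ChartedSpace ℂ^(r + 1) M]
    [IsManifold 𝓘(ℂ, ℂ^(r + 1)) ω M] {c : DForm (r + 1) r M} {Y : DForm (r + 1) (r + 1) M}
    (hc : ∀ x, SmoothFormAt c x) (hY : ∀ x, SmoothFormAt Y x)
    (hdY : ∀ x, c x = 0 ∨ extD Y x = 0) :
    formIntegral (fun x => wedge (extD c x) (Y x)) univ = 0 := by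
  obtain ⟨s, χ, hχ, -, hsub, hsum⟩ := exists_finite_partitionOfUnity (d := r + 1) (M := M)
    (fun x => (chartAt ℂ^(r + 1) x).source) (fun x => (chartAt _ x).open_source)
    (mem_chart_source _)
  have hχc : ∀ i x, SmoothFormAt (fun y => (χ i y : ℂ) • c y) x := fun i x =>
    (hc x).smul (contMDiff_ofReal (hχ i x))
  have h1 : (fun x => wedge (extD c x) (Y x)) =
      fun x => ∑ i ∈ s, wedge (extD (fun y => (χ i y : ℂ) • c y) x) (Y x) := by
    ext1 x
    rw [← wedge_sum_left, ← extD_sum fun i _ => hχc i x]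
    congr 2
    ext1 y
    rw [← Finset.sum_smul, ← ofReal_sum, hsum, ofReal_one]
    exact (one_smul ℂ (c y)).symm
  have hd : ∀ i x, SmoothFormAt (extD fun y => (χ i y : ℂ) • c y) x := fun i x =>
    (smoothFormOn_iff isOpen_univ).mp
      (SmoothFormOn.extD isOpen_univ ((smoothFormOn_iff isOpen_univ).mpr fun y _ => hχc i y)) x trivial
  have hcont : ∀ i, ContFormOn (fun x => wedge (extD (fun y => (χ i y : ℂ) • c y) x) (Y x)) univ :=
    fun i => SmoothFormOn.contFormOn isOpen_univ
      ((smoothFormOn_iff isOpen_univ).mpr fun x _ => (hd i x).wedge (hY x))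
  rw [h1, formIntegral_sum s isClosed_univ fun i _ => hcont i]
  refine Finset.sum_eq_zero fun i _ => ?_
  set e := chartAt ℂ^(r + 1) i with he0
  have he : e ∈ holAtlas (r + 1) M := chartAt_mem_holAtlas i
  have hz0 : ∀ y, y ∉ tsupport (χ i) → (fun y => (χ i y : ℂ) • c y) y = 0 := fun y hy => by
    simp only [image_eq_zero_of_notMem_tsupport hy, ofReal_zero]
    exact form_zero_smul _
  rw [formIntegral_eq_localIntegral he isClosed_univ (isClosed_tsupport (χ i)) (hsub i) (hcont i)]
  · rw [localIntegral]
    simp only [preimage_univ, inter_univ]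
    have : ∀ z ∈ e.target, inChart e (fun x => wedge (extD (fun y => (χ i y : ℂ) • c y) x) (Y x)) z
        (stdFrame (r + 1)) = wedge (extDeriv (inChart e fun y => (χ i y : ℂ) • c y) z)
          (inChart e Y z) (stdFrame (r + 1)) := by
      intro z hz
      rw [inChart_wedge, inChart_extD he hz (hχc i _)]
    rw [setIntegral_congr_fun e.open_target.measurableSet this]
    refine setIntegral_wedge_extDeriv e.open_target (K := e '' tsupport (χ i)) ?_ ?_ ?_ ?_ ?_ ?_
    · exact (isClosed_tsupport (χ i)).isCompact.image_of_continuousOn (e.continuousOn.mono (hsub i))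
    · rintro _ ⟨y, hy, rfl⟩
      exact e.map_source (hsub i hy)
    · exact fun z hz => ((hχc i _).contDiffAt he hz).contDiffWithinAt
    · exact fun z hz => ((hY _).contDiffAt he hz).contDiffWithinAt
    · intro z hz hzK
      have h2 : (χ i (e.symm z) : ℂ) • c (e.symm z) = 0 :=
        hz0 _ fun h => hzK ⟨_, h, e.right_inv hz⟩
      rw [inChart_def, h2]
      ext v; simp
    · intro z hz
      rcases hdY (e.symm z) with h | h
      · left
        rw [inChart_smul, inChart_def, h]
        ext v; simp
      · right
        rw [← inChart_extD he hz (hY _), inChart_def, h]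
        ext v; simp
  · intro y _ hy
    have : extD (fun y => (χ i y : ℂ) • c y) y = 0 := by
      rw [← extD_zero y]
      refine extD_congr ?_
      filter_upwards [(isClosed_tsupport (χ i)).isOpen_compl.mem_nhds hy] with w hw using hz0 w hw
    rw [this, wedge_zero_left]

/-- The integral of a form as a sum of integrals in charts, weighted with a partition of unity. -/
lemma formIntegral_eq_sum
    {ι : Type*} {s : Finset ι} {Φ : ι → OpenPartialHomeomorph M ℂ^d}
    (hΦ : ∀ i, Φ i ∈ holAtlas d M) {χ : ι → M → ℝ} (hχ : ∀ i, Continuous (χ i))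
    (hsub : ∀ i, tsupport (χ i) ⊆ (Φ i).source) (hsum : ∀ y, ∑ i ∈ s, χ i y = 1)
    {a : DForm d (d + d) M} {S : Set M} (hS : IsClosed S) (ha : ContFormOn a S) :
    formIntegral a S = ∑ i ∈ s, ∫ z in (Φ i).target ∩ (Φ i).symm ⁻¹' S,
      (χ i ((Φ i).symm z) : ℂ) * inChart (Φ i) a z (stdFrame d) := by
  have h1 : a = fun y => ∑ i ∈ s, (χ i y : ℂ) • a y := by
    ext1 y
    rw [← Finset.sum_smul, ← ofReal_sum, hsum, ofReal_one]
    exact (one_smul ℂ (a y)).symm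
  have hc : ∀ i, ContFormOn (fun y => (χ i y : ℂ) • a y) S := fun i =>
    ha.smul (Complex.continuous_ofReal.comp (hχ i)).continuousOn
  conv_lhs => rw [h1]
  rw [formIntegral_sum s hS fun i _ => hc i]
  refine sum_congr rfl fun i _ => ?_
  refine formIntegral_eq_localIntegral (hΦ i) hS (isClosed_tsupport (χ i)) (hsub i) (hc i) ?_
  intro y _ hy
  rw [image_eq_zero_of_notMem_tsupport hy, ofReal_zero, form_zero_smul]

end Manifold

/-! ### Charts adapted to a smooth hypersurface -/

/-- The composition of a holomorphic chart with a biholomorphic map `T` is a holomorphic chart. -/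
lemma mem_holAtlas_of_comp {d : ℕ} {M : Type*} [TopologicalSpace M]
    [ChartedSpace ℂ^d M] [IsManifold 𝓘(ℂ, ℂ^d) ω M]
    {e e' : OpenPartialHomeomorph M ℂ^d} (he : e ∈ holAtlas d M)
    (hsub : e'.source ⊆ e.source) {T T' : ℂ^d → ℂ^d} (hT : ContDiff ℂ ω T)
    (hT' : ContDiff ℂ ω T') (hTT : ∀ z, T' (T z) = z) (h : ∀ x ∈ e'.source, e' x = T (e x)) :
    e' ∈ holAtlas d M := by
  have hsymm : ∀ z ∈ e'.target, e'.symm z = e.symm (T' z) ∧ T' z ∈ e.target := by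
    intro z hz
    have h1 := h _ (e'.map_target hz)
    rw [e'.right_inv hz] at h1
    have h2 : T' z = e (e'.symm z) := by
      conv_lhs => rw [h1]
      exact hTT _
    rw [h2]
    exact ⟨(e.left_inv (hsub (e'.map_target hz))).symm, e.map_source (hsub (e'.map_target hz))⟩
  rw [holAtlas, IsManifold.mem_maximalAtlas_iff]
  intro e₀ he₀
  have he₀' : e₀ ∈ holAtlas d M := IsManifold.subset_maximalAtlas he₀
  have h1 : ∀ z ∈ e'.target ∩ e'.symm ⁻¹' e₀.source, ContDiffAt ℂ ω (e₀ ∘ e'.symm) z := by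
    intro z hz
    obtain ⟨h3, h4⟩ := hsymm z hz.1
    have h2 := (contDiffAt_transition he he₀' h4 (by rw [← h3]; exact hz.2)).comp z hT'.contDiffAt
    refine h2.congr_of_eventuallyEq ?_
    filter_upwards [e'.open_target.mem_nhds hz.1] with w hw
    simp [(hsymm w hw).1]
  have h2 : ∀ z ∈ e₀.target ∩ e₀.symm ⁻¹' e'.source, ContDiffAt ℂ ω (e' ∘ e₀.symm) z := by
    intro z hz
    have h3 := hT.contDiffAt.comp z (contDiffAt_transition he₀' he hz.1 (hsub hz.2))
    refine h3.congr_of_eventuallyEq ?_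
    filter_upwards [(e₀.isOpen_inter_preimage_symm e'.open_source).mem_nhds hz] with w hw
    simp [h _ hw.2]
  constructor <;> rw [contDiffGroupoid, mem_groupoid_of_pregroupoid] <;> constructor <;>
    intro z hz
  · simp only [OpenPartialHomeomorph.trans_source, OpenPartialHomeomorph.symm_source] at hz
    exact (h1 z hz.1).contDiffWithinAt
  · simp only [OpenPartialHomeomorph.trans_target, OpenPartialHomeomorph.symm_target] at hz
    exact (h2 z hz.1).contDiffWithinAt
  · simp only [OpenPartialHomeomorph.trans_source, OpenPartialHomeomorph.symm_source] at hz
    exact (h2 z hz.1).contDiffWithinAt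
  · simp only [OpenPartialHomeomorph.trans_target, OpenPartialHomeomorph.symm_target] at hz
    exact (h1 z hz.1).contDiffWithinAt

variable {n r : ℕ} {X : Type*} [TopologicalSpace X] [ChartedSpace ℂ^(n + 1) X]
  [T2Space X] [CompactSpace X] [IsManifold 𝓘(ℂ, ℂ^(n + 1)) ω X]
  {D : Set X} [CompactSpace D] [ChartedSpace ℂ^n D] [IsManifold 𝓘(ℂ, ℂ^n) ω D]

/-- A pair of holomorphic charts of `X` and of the hypersurface `D` such that `D` is given by the
vanishing of the coordinate `z₀`, and the chart of `D` consists of the other coordinates. -/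
structure AdaptedChart (n : ℕ) {X : Type*} [TopologicalSpace X]
    [ChartedSpace ℂ^(n + 1) X] (D : Set X) [ChartedSpace ℂ^n D] where
  toX : OpenPartialHomeomorph X ℂ^(n + 1)
  toD : OpenPartialHomeomorph D ℂ^n
  memX : toX ∈ holAtlas (n + 1) X
  memD : toD ∈ holAtlas n D
  zero_iff : ∀ x ∈ toX.source, toX x 0 = 0 ↔ x ∈ D
  source_iff : ∀ q : D, q ∈ toD.source ↔ (q : X) ∈ toX.source
  apply_eq : ∀ q ∈ toD.source, toX (q : X) = hyperIncl n (toD q)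

/-- Every point of `X` lies in the domain of an adapted chart. -/
abbrev HasAdaptedCharts (n : ℕ) {X : Type*} [TopologicalSpace X] [ChartedSpace ℂ^(n + 1) X]
    (D : Set X) [ChartedSpace ℂ^n D] : Prop := ∀ p : X, ∃ Φ : AdaptedChart n D, p ∈ Φ.toX.source

/-- Adapted charts at the points of `D` come from the normal form of an immersion: a linear change
of coordinates moves the complementary direction to `z₀`. -/
lemma exists_adaptedChart_of_mem
    (hD : IsSmoothEmbedding 𝓘(ℂ, ℂ^n) 𝓘(ℂ, ℂ^(n + 1)) ω (Subtype.val : D → X))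
    (p : D) : ∃ Φ : AdaptedChart n D, (p : X) ∈ Φ.toX.source := by
  have h := hD.isImmersion.isImmersionAt p
  set ψ := h.domChart
  set Φ₀ := h.codChart
  have hw : ∀ w ∈ ψ.target, Φ₀ (ψ.symm w : D) = h.equiv (w, 0) := by
    intro w hw
    have := h.writtenInCharts (show w ∈ (h.domChart.extend 𝓘(ℂ, ℂ^n)).target by simpa using hw)
    simpa using this
  have : FiniteDimensional ℂ h.complement :=
    FiniteDimensional.of_injective ((h.equiv : _ →ₗ[ℂ] ℂ^(n + 1)).comp
      (LinearMap.inr ℂ ℂ^n h.complement))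
      (h.equiv.injective.comp LinearMap.inr_injective)
  have hrank : Module.finrank ℂ h.complement = Module.finrank ℂ ℂ := by
    have h1 := h.equiv.toLinearEquiv.finrank_eq
    rw [Module.finrank_prod] at h1
    simp at h1 ⊢
    omega
  let cF : h.complement ≃L[ℂ] ℂ := (LinearEquiv.ofFinrankEq _ _ hrank).toContinuousLinearEquiv
  let L : ℂ^(n + 1) ≃L[ℂ] ℂ^(n + 1) :=
    (h.equiv.symm.trans (ContinuousLinearEquiv.prodComm ℂ ℂ^n h.complement)).trans
      ((cF.prodCongr (ContinuousLinearEquiv.refl ℂ ℂ^n)).trans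
        (Fin.consEquivL ℂ (fun _ : Fin (n + 1) => ℂ)))
  have hL : ∀ w, L (h.equiv (w, 0)) = hyperIncl n w := by
    intro w
    rw [hyperIncl_apply]
    simp only [L, ContinuousLinearEquiv.trans_apply, ContinuousLinearEquiv.symm_apply_apply,
      ContinuousLinearEquiv.prodComm_apply, Prod.swap_prod_mk,
      ContinuousLinearEquiv.prodCongr_apply, map_zero, ContinuousLinearEquiv.coe_refl', id_eq]
    rfl
  obtain ⟨O, hO, hOψ⟩ := isOpen_induced_iff.mp ψ.open_source
  set Φ₁ := Φ₀.trans L.toHomeomorph.toOpenPartialHomeomorph with hΦ₁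
  have hΦ₁s : Φ₁.source = Φ₀.source := by simp [hΦ₁]
  have hΦ₁a : ∀ x, Φ₁ x = L (Φ₀ x) := fun x => by simp [hΦ₁]
  -- the points of the domain of the chart whose last coordinates belong to the chart of `D`
  set W : Set ℂ^(n + 1) := {z | (fun j : Fin n => z j.succ) ∈ ψ.target} with hW
  have hWo : IsOpen W := ψ.open_target.preimage (by fun_prop)
  set Q : Set X := O ∩ (Φ₁.source ∩ Φ₁ ⁻¹' W) with hQ
  have hQo : IsOpen Q := hO.inter (Φ₁.isOpen_inter_preimage hWo)
  set Φ := Φ₁.restrOpen Q hQo with hΦ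
  have hΦs : ∀ x, x ∈ Φ.source ↔ x ∈ Φ₀.source ∧ x ∈ O ∧ Φ₁ x ∈ W := by
    intro x
    simp only [hΦ, OpenPartialHomeomorph.restrOpen_source, hΦ₁s, hQ, mem_inter_iff, mem_preimage]
    tauto
  have hΦa : ∀ x, Φ x = L (Φ₀ x) := fun x => hΦ₁a x
  have hval : ∀ q ∈ ψ.source, Φ₁ (q : X) = hyperIncl n (ψ q) := by
    intro q hq
    have := hw (ψ q) (ψ.map_source hq)
    rw [ψ.left_inv hq] at this
    rw [hΦ₁a, this, hL]
  have hψO : ∀ q : D, q ∈ ψ.source ↔ (q : X) ∈ O := fun q => by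
    rw [← hOψ]; rfl
  have hsrc : ∀ q : D, q ∈ ψ.source ↔ (q : X) ∈ Φ.source := by
    intro q
    rw [hΦs]
    refine ⟨fun hq => ⟨h.source_subset_preimage_source hq, (hψO q).mp hq, ?_⟩,
      fun hq => (hψO q).mpr hq.2.1⟩
    rw [hval q hq, hyperIncl_apply]
    simpa [hW] using ψ.map_source hq
  refine ⟨⟨Φ, ψ, ?_, h.domChart_mem_maximalAtlas, ?_, hsrc, fun q hq => hval q hq⟩,
    (hsrc p).mp h.mem_domChart_source⟩
  · exact mem_holAtlas_of_comp (e := Φ₀) h.codChart_mem_maximalAtlas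
      (fun x hx => ((hΦs x).mp hx).1) L.contDiff L.symm.contDiff (fun z => by simp)
      fun x _ => hΦa x
  · intro x hx
    constructor
    · intro h0
      have hx' := (hΦs x).mp hx
      have hwt : (fun j : Fin n => Φ₁ x j.succ) ∈ ψ.target := hx'.2.2
      have h1 : Φ₁ x = hyperIncl n fun j => Φ₁ x j.succ := by
        rw [hyperIncl_apply]
        ext j
        refine Fin.cases ?_ (fun j => ?_) j
        · exact h0
        · simp
      have h2 : Φ₀ (ψ.symm (fun j : Fin n => Φ₁ x j.succ) : D) = Φ₀ x := by
        refine L.injective ?_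
        rw [hw _ hwt, hL, ← h1, hΦ₁a]
      have h3 := Φ₀.injOn (h.source_subset_preimage_source (ψ.map_target hwt)) hx'.1 h2
      rw [← h3]; exact Subtype.coe_prop _
    · intro hxD
      have hq : (⟨x, hxD⟩ : D) ∈ ψ.source := (hsrc ⟨x, hxD⟩).mpr hx
      have := hval _ hq
      simp only at this
      rw [show Φ x = Φ₁ x from rfl, this, hyperIncl_apply]; simp

/-- At a point off `D`, a chart with `z₀ ≠ 0`, together with an empty chart of `D`, is adapted. The
empty chart is the restriction of a chart of `D`, hence the assumption that `D` is nonempty. -/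
lemma exists_adaptedChart [Nonempty D]
    (hD : IsSmoothEmbedding 𝓘(ℂ, ℂ^n) 𝓘(ℂ, ℂ^(n + 1)) ω (Subtype.val : D → X))
    (p : X) : ∃ Φ : AdaptedChart n D, p ∈ Φ.toX.source := by
  by_cases hp : p ∈ D
  · exact exists_adaptedChart_of_mem hD ⟨p, hp⟩
  have hDc : IsClosed D := (isCompact_iff_compactSpace.mpr inferInstance : IsCompact D).isClosed
  set e := chartAt ℂ^(n + 1) p
  obtain ⟨q₀⟩ := ‹Nonempty D›
  set ψ := chartAt ℂ^n q₀
  -- the translation by `v` moves the coordinate `z₀` of `p` to `1`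
  set v : ℂ^(n + 1) := Pi.single 0 (1 - e p 0) with hv
  set T : ℂ^(n + 1) → ℂ^(n + 1) := fun z => z + v
  have hT : ContDiff ℂ ω T := contDiff_id.add contDiff_const
  set Q : Set X := Dᶜ ∩ (e.source ∩ e ⁻¹' {z | T z 0 ≠ 0}) with hQ
  have hQo : IsOpen Q := hDc.isOpen_compl.inter (e.isOpen_inter_preimage
    (isOpen_ne_fun (by fun_prop) continuous_const))
  set Φ := (e.trans (Homeomorph.addRight v).toOpenPartialHomeomorph).restrOpen Q hQo with hΦ
  have hΦa : ∀ x, Φ x = T (e x) := fun x => rfl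
  have hΦs : ∀ x, x ∈ Φ.source ↔ x ∉ D ∧ x ∈ e.source ∧ T (e x) 0 ≠ 0 := by
    intro x
    simp [hΦ, hQ]
    tauto
  refine ⟨⟨Φ, ψ.restrOpen ∅ isOpen_empty, ?_, ?_, ?_, ?_, ?_⟩, ?_⟩
  · exact mem_holAtlas_of_comp (chartAt_mem_holAtlas p) (fun x hx => ((hΦs x).mp hx).2.1) hT
      (T' := fun z => z - v) (contDiff_id.sub contDiff_const) (fun z => by simp [T])
      fun x _ => hΦa x
  · exact mem_holAtlas_of_comp (chartAt_mem_holAtlas q₀) (fun x hx => by simp at hx) contDiff_id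
      contDiff_id (fun z => rfl) fun x _ => rfl
  · intro x hx
    have := (hΦs x).mp hx
    rw [hΦa]
    exact ⟨fun h => absurd h this.2.2, fun h => absurd h this.1⟩
  · intro q
    rw [hΦs]
    simp
  · intro q hq
    simp at hq
  · rw [hΦs]
    exact ⟨hp, mem_chart_source _ p, by simp [T, hv]⟩

namespace AdaptedChart

variable (Φ : AdaptedChart n D)

lemma mem_D_iff {z : ℂ^(n + 1)} (hz : z ∈ Φ.toX.target) : Φ.toX.symm z ∈ D ↔ z 0 = 0 := by
  rw [← Φ.zero_iff _ (Φ.toX.map_target hz), Φ.toX.right_inv hz]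

/-- The chart of `D` is the whole slice `z₀ = 0` of the chart of `X`. -/
lemma mem_toD_target_iff {w : ℂ^n} : w ∈ Φ.toD.target ↔ hyperIncl n w ∈ Φ.toX.target := by
  constructor
  · intro hw
    have h1 := Φ.toD.map_target hw
    have h2 := Φ.apply_eq _ h1
    rw [Φ.toD.right_inv hw] at h2
    rw [← h2]
    exact Φ.toX.map_source ((Φ.source_iff _).mp h1)
  · intro hw
    have hD : Φ.toX.symm (hyperIncl n w) ∈ D := by
      rw [Φ.mem_D_iff hw, hyperIncl_apply]; simp
    have hs : (⟨_, hD⟩ : D) ∈ Φ.toD.source := (Φ.source_iff _).mpr (Φ.toX.map_target hw)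
    have h2 := Φ.apply_eq _ hs
    simp only at h2
    rw [Φ.toX.right_inv hw] at h2
    have h3 : w = Φ.toD ⟨_, hD⟩ := by
      have h4 := congrArg (fun z : ℂ^(n + 1) => fun j : Fin n => z j.succ) h2
      simpa [hyperIncl_apply] using h4
    rw [h3]
    exact Φ.toD.map_source hs

lemma symm_hyperIncl {w : ℂ^n} (hw : w ∈ Φ.toD.target) :
    Φ.toX.symm (hyperIncl n w) = (Φ.toD.symm w : D) := by
  have h1 := Φ.toD.map_target hw
  have h2 := Φ.apply_eq _ h1
  rw [Φ.toD.right_inv hw] at h2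
  rw [← h2, Φ.toX.left_inv ((Φ.source_iff _).mp h1)]

lemma mdifferentiableAt_val {q : D} (hq : q ∈ Φ.toD.source) :
    MDifferentiableAt 𝓘(ℝ, ℂ^n) 𝓘(ℝ, ℂ^(n + 1)) (Subtype.val : D → X) q := by
  have h1 : MDifferentiableAt 𝓘(ℝ, ℂ^n) 𝓘(ℝ, ℂ^(n + 1))
      (fun q : D => Φ.toX.symm (hyperIncl n (Φ.toD q))) q := by
    have ha := mdifferentiableAt_symm (M := X) Φ.memX
      (z := hyperIncl n (Φ.toD q)) (Φ.mem_toD_target_iff.mp (Φ.toD.map_source hq))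
    have hb : MDifferentiableAt 𝓘(ℝ, ℂ^n) 𝓘(ℝ, ℂ^(n + 1))
        (fun w => hyperIncl n w) (Φ.toD q) :=
      (((hyperIncl n).restrictScalars ℝ).differentiableAt).mdifferentiableAt
    have hc := mdifferentiableAt_chart (M := D) Φ.memD hq
    exact ha.comp q (hb.comp q hc)
  refine h1.congr_of_eventuallyEq ?_
  filter_upwards [Φ.toD.open_source.mem_nhds hq] with y hy
  rw [Φ.symm_hyperIncl (Φ.toD.map_source hy), Φ.toD.left_inv hy]

/-- In adapted charts, the restriction of a form to `D` is the restriction to `z₀ = 0`. -/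
lemma inChart_restrictForm (s : DForm (n + 1) r X) {w : ℂ^n} (hw : w ∈ Φ.toD.target) :
    inChart Φ.toD (restrictForm D s) w = hyperRestrict (inChart Φ.toX s (hyperIncl n w)) := by
  have hwX := Φ.mem_toD_target_iff.mp hw
  have ha := mdifferentiableAt_symm (M := X) Φ.memX hwX
  have hb : MDifferentiableAt 𝓘(ℝ, ℂ^n) 𝓘(ℝ, ℂ^(n + 1))
      (fun w => hyperIncl n w) w :=
    (((hyperIncl n).restrictScalars ℝ).differentiableAt).mdifferentiableAt
  have hc := Φ.mdifferentiableAt_val (Φ.toD.map_target hw)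
  have hd := mdifferentiableAt_symm (M := D) Φ.memD hw
  have h1 := mfderiv_comp w hc hd
  have h2 := mfderiv_comp w ha hb
  have h3 : mfderiv 𝓘(ℝ, ℂ^n) 𝓘(ℝ, ℂ^(n + 1)) ((Subtype.val : D → X) ∘ Φ.toD.symm) w =
      mfderiv 𝓘(ℝ, ℂ^n) 𝓘(ℝ, ℂ^(n + 1)) (Φ.toX.symm ∘ fun w => hyperIncl n w) w := by
    refine Filter.EventuallyEq.mfderiv_eq ?_
    filter_upwards [Φ.toD.open_target.mem_nhds hw] with y hy
    exact (Φ.symm_hyperIncl hy).symm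
  have h4 : mfderiv 𝓘(ℝ, ℂ^n) 𝓘(ℝ, ℂ^(n + 1)) (fun w => hyperIncl n w) w =
      (hyperIncl n).restrictScalars ℝ := by
    rw [mfderiv_eq_fderiv]
    exact ((hyperIncl n).restrictScalars ℝ).fderiv
  have key : (mfderiv 𝓘(ℝ, ℂ^n) 𝓘(ℝ, ℂ^(n + 1)) (Subtype.val : D → X)
      (Φ.toD.symm w) : ℂ^n →L[ℝ] ℂ^(n + 1)).comp (symmDeriv Φ.toD w) =
      (symmDeriv Φ.toX (hyperIncl n w)).comp ((hyperIncl n).restrictScalars ℝ) := by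
    rw [← h4]; exact h1.symm.trans (h3.trans h2)
  rw [hyperRestrict, inChart_def, inChart_def, Φ.symm_hyperIncl hw, restrictForm]
  ext v
  exact congrArg (s (Φ.toD.symm w : D)) (funext fun i => congrArg (fun L => L (v i)) key)

/-- The coordinate `z₀` of an adapted chart is a local equation. -/
lemma isLocalEquation (U : Set X) (hU : IsOpen U) (hUs : U ⊆ Φ.toX.source) :
    IsLocalEquation (d := n + 1) D U (fun x => Φ.toX x 0) := by
  have hloc : ∀ x ∈ Φ.toX.source, DifferentiableAt ℂ ((fun x => Φ.toX x 0) ∘ Φ.toX.symm) (Φ.toX x) ∧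
      ((fun x => Φ.toX x 0) ∘ Φ.toX.symm) =ᶠ[𝓝 (Φ.toX x)] fun z => z 0 := by
    intro x hx
    have : ((fun x => Φ.toX x 0) ∘ Φ.toX.symm) =ᶠ[𝓝 (Φ.toX x)] fun z => z 0 := by
      filter_upwards [Φ.toX.open_target.mem_nhds (Φ.toX.map_source hx)] with z hz
      simp [Φ.toX.right_inv hz]
    refine ⟨DifferentiableAt.congr_of_eventuallyEq (by fun_prop) this, this⟩
  have hmd : MDifferentiableOn 𝓘(ℂ, ℂ^(n + 1)) 𝓘(ℂ, ℂ) (fun x => Φ.toX x 0) Φ.toX.source :=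
    fun x hx => (mdifferentiableAt_of_chart Φ.memX hx (hloc x hx).1).mdifferentiableWithinAt
  refine ⟨hU, hmd.mono hUs, fun x hx => Φ.zero_iff x (hUs hx), fun x hx _ h0 => ?_⟩
  have hxs := hUs hx
  have hr : MDifferentiableAt 𝓘(ℝ, ℂ^(n + 1)) 𝓘(ℝ, ℂ) (fun x => Φ.toX x 0)
      (Φ.toX.symm (Φ.toX x)) := by
    rw [Φ.toX.left_inv hxs]
    exact (contMDiffAt_of_holomorphic Φ.toX.open_source hmd hxs).mdifferentiableAt (by simp)
  have h1 := dFun_comp_symm Φ.memX (Φ.toX.map_source hxs) hr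
  rw [Φ.toX.left_inv hxs, h0, (hloc x hxs).2.fderiv_eq] at h1
  have h2 : fderiv ℝ (fun z : ℂ^(n + 1) => z 0) (Φ.toX x) =
      ContinuousLinearMap.proj (R := ℝ) (φ := fun _ : Fin (n + 1) => ℂ) 0 :=
    (ContinuousLinearMap.proj (R := ℝ) (φ := fun _ : Fin (n + 1) => ℂ) 0).fderiv
  rw [h2] at h1
  have h3 := congrArg (fun L => L (Pi.single 0 1)) h1
  have h4 : ((0 : ℂ^(n + 1) →L[ℝ] ℂ).comp (symmDeriv Φ.toX (Φ.toX x))) (Pi.single 0 1) =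
      (ContinuousLinearMap.proj (R := ℝ) (φ := fun _ : Fin (n + 1) => ℂ) 0) (Pi.single 0 1) := h3
  simp at h4

end AdaptedChart

/-! ### Forms with poles and Poincaré residues in adapted charts -/

/-- Every point is a limit of points off the hyperplane `z₀ = 0`. -/
instance neBot_coord_ne {n : ℕ} (z : ℂ^(n + 1)) : (𝓝[{ζ | ζ 0 ≠ 0}] z).NeBot := by
  rw [← mem_closure_iff_nhdsWithin_neBot]
  have h : ({ζ : ℂ^(n + 1) | ζ 0 ≠ 0} : Set _) = (fun ζ => ζ 0) ⁻¹' {(0 : ℂ)}ᶜ := rfl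
  have ho : IsOpenMap (fun ζ : ℂ^(n + 1) => ζ 0) := isOpenMap_eval 0
  rw [h, ← ho.preimage_closure_eq_closure_preimage (continuous_apply 0)]
  have := (dense_compl_singleton (0 : ℂ)).closure_eq
  rw [this]; trivial

lemma clm_zero_smul {d : ℕ} (L : ℂ^d →L[ℝ] ℂ) : (0 : ℂ) • L = 0 := by
  ext v; simp

lemma contMDiffAt_fun_pow {d : ℕ} {M : Type*} [TopologicalSpace M] [ChartedSpace ℂ^d M]
    [IsManifold 𝓘(ℂ, ℂ^d) ω M] {f : M → ℂ} {x : M}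
    (hf : ContMDiffAt 𝓘(ℝ, ℂ^d) 𝓘(ℝ, ℂ) ∞ f x) (k : ℕ) :
    ContMDiffAt 𝓘(ℝ, ℂ^d) 𝓘(ℝ, ℂ) ∞ (fun y => f y ^ k) x :=
  contMDiffAt_of_chart (chartAt_mem_holAtlas x) (mem_chart_source _ x)
    ((contDiffAt_comp_symm (chartAt_mem_holAtlas x) (by simp) (by simpa)).pow k)

lemma isClosed_hypersurface (D : Set X) [CompactSpace D] : IsClosed D :=
  (isCompact_iff_compactSpace.mpr inferInstance : IsCompact D).isClosed

/-- Off `D` the constant function `1` is a local equation, so that forms with poles are smooth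
there. -/
lemma isLocalEquation_one (D : Set X) [CompactSpace D] :
    IsLocalEquation (d := n + 1) D Dᶜ (fun _ => 1) where
  isOpen := (isClosed_hypersurface D).isOpen_compl
  holomorphic := fun x _ => mdifferentiableWithinAt_const
  zero_iff := fun x hx => by simpa using hx
  differential_ne_zero := fun x hx h => absurd h hx

lemma HasPoleLE.smoothFormOn {k : ℕ} {a : DForm (n + 1) r X} (h : HasPoleLE D k a) :
    SmoothFormOn a Dᶜ := by
  obtain ⟨b, hb, hb'⟩ := h Dᶜ _ (isLocalEquation_one D)
  have ho := (isClosed_hypersurface D).isOpen_compl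
  rw [smoothFormOn_iff ho] at hb ⊢
  refine fun x hx => (hb x hx).congr ?_
  filter_upwards [ho.mem_nhds hx] with y hy
  rw [hb' y hy hy, one_pow]; exact one_smul ℂ (a y)

lemma AdaptedChart.exists_of_hasPoleLE (Φ : AdaptedChart n D) {k : ℕ} {a : DForm (n + 1) r X}
    (h : HasPoleLE D k a) : ∃ b : DForm (n + 1) r X, SmoothFormOn b Φ.toX.source ∧
      ∀ x ∈ Φ.toX.source, x ∉ D → b x = (Φ.toX x 0) ^ k • a x :=
  h _ _ (Φ.isLocalEquation _ Φ.toX.open_source subset_rfl)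

lemma AdaptedChart.eventually_notMem (Φ : AdaptedChart n D) {z : ℂ^(n + 1)}
    (hz : z ∈ Φ.toX.target) : ∀ᶠ ζ in 𝓝[{ζ | ζ 0 ≠ 0}] z, Φ.toX.symm ζ ∉ D := by
  filter_upwards [mem_nhdsWithin_of_mem_nhds (Φ.toX.open_target.mem_nhds hz),
    self_mem_nhdsWithin] with ζ h1 h2
  rw [Φ.mem_D_iff h1]; exact h2

/-- The values on `D` of a smooth form are determined by the values outside of `D`. -/
lemma AdaptedChart.form_eq_of_eq_compl (Φ : AdaptedChart n D) {a b : DForm (n + 1) r X} {x : X}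
    (hx : x ∈ Φ.toX.source) (ha : SmoothFormAt a x) (hb : SmoothFormAt b x)
    (hab : ∀ᶠ y in 𝓝 x, y ∉ D → a y = b y) : a x = b x := by
  refine eq_of_inChart_eq Φ.memX hx ?_
  have h1 := ((smoothFormAt_iff Φ.memX hx).mp ha).continuousAt.tendsto.mono_left
    (nhdsWithin_le_nhds (s := {ζ | ζ 0 ≠ 0}))
  have h2 := ((smoothFormAt_iff Φ.memX hx).mp hb).continuousAt.tendsto.mono_left
    (nhdsWithin_le_nhds (s := {ζ | ζ 0 ≠ 0}))
  refine tendsto_nhds_unique (h1.congr' ?_) h2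
  have hc := (Φ.toX.symm.continuousAt (Φ.toX.map_source hx)).eventually
    (p := fun y => y ∉ D → a y = b y) (by rw [Φ.toX.left_inv hx]; exact hab)
  filter_upwards [mem_nhdsWithin_of_mem_nhds hc, Φ.eventually_notMem (Φ.toX.map_source hx)]
    with ζ h3 h4
  exact inChart_congr (h3 h4)

/-- Local smooth extensions across `D` can be glued. -/
lemma exists_smooth_extension (hA : HasAdaptedCharts n D)
    {a : DForm (n + 1) r X} {U : Set X} (hU : IsOpen U)
    (h : ∀ p ∈ U, ∃ V, IsOpen V ∧ p ∈ V ∧ ∃ b : DForm (n + 1) r X, SmoothFormOn b V ∧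
      ∀ x ∈ V, x ∉ D → b x = a x) :
    ∃ b : DForm (n + 1) r X, SmoothFormOn b U ∧ ∀ x ∈ U, x ∉ D → b x = a x := by
  classical
  choose! V hVo hpV b hb hba using h
  refine ⟨fun x => b x x, ?_, fun x hx hxD => hba x hx x (hpV x hx) hxD⟩
  rw [smoothFormOn_iff hU]
  intro p hp
  refine SmoothFormAt.congr ((smoothFormOn_iff (hVo p hp)).mp (hb p hp) p (hpV p hp)) ?_
  filter_upwards [(hVo p hp).mem_nhds (hpV p hp), hU.mem_nhds hp] with y hy hyU
  obtain ⟨Φ, hΦ⟩ := hA y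
  refine Φ.form_eq_of_eq_compl hΦ ((smoothFormOn_iff (hVo p hp)).mp (hb p hp) y hy)
    ((smoothFormOn_iff (hVo y hyU)).mp (hb y hyU) y (hpV y hyU)) ?_
  filter_upwards [(hVo p hp).mem_nhds hy, (hVo y hyU).mem_nhds (hpV y hyU)] with x hx hx' hxD
  rw [hba p hp x hx hxD, hba y hyU x hx' hxD]

lemma IsLocalEquation.mdifferentiableAt {U : Set X} {f : X → ℂ}
    (hf : IsLocalEquation (d := n + 1) D U f) {x : X} (hx : x ∈ U) :
    MDifferentiableAt 𝓘(ℂ, ℂ^(n + 1)) 𝓘(ℂ, ℂ) f x :=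
  (hf.holomorphic x hx).mdifferentiableAt (hf.isOpen.mem_nhds hx)

lemma IsLocalEquation.contMDiffAt {U : Set X} {f : X → ℂ}
    (hf : IsLocalEquation (d := n + 1) D U f) {x : X} (hx : x ∈ U) :
    ContMDiffAt 𝓘(ℝ, ℂ^(n + 1)) 𝓘(ℝ, ℂ) ∞ f x :=
  contMDiffAt_of_holomorphic hf.isOpen hf.holomorphic hx

/-- A local equation is the product of the coordinate `z₀` and a nonvanishing function. -/
lemma AdaptedChart.exists_unit (Φ : AdaptedChart n D) {U : Set X} {f : X → ℂ}
    (hf : IsLocalEquation (d := n + 1) D U f) {z : ℂ^(n + 1)} (hz : z ∈ Φ.toX.target)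
    (hzU : Φ.toX.symm z ∈ U) (hz0 : z 0 = 0) :
    ∃ V, IsOpen V ∧ z ∈ V ∧ V ⊆ Φ.toX.target ∩ Φ.toX.symm ⁻¹' U ∧
      ∃ u : ℂ^(n + 1) → ℂ, DifferentiableOn ℂ u V ∧ (∀ ζ ∈ V, u ζ ≠ 0) ∧
        (∀ ζ ∈ V, f (Φ.toX.symm ζ) = ζ 0 * u ζ) ∧
        fderiv ℝ (f ∘ Φ.toX.symm) z = u z • coordZero n := by
  have ho := Φ.toX.isOpen_inter_preimage_symm hf.isOpen
  have hd : DifferentiableOn ℂ (f ∘ Φ.toX.symm) (Φ.toX.target ∩ Φ.toX.symm ⁻¹' U) := fun ζ hζ =>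
    (differentiableAt_comp_symm Φ.memX hζ.1 (hf.mdifferentiableAt hζ.2)).differentiableWithinAt
  obtain ⟨V, hVo, hzV, hVU, u, hu, hfu, -⟩ := exists_eq_coord_mul ho hd
    (fun ζ hζ h0 => (hf.zero_iff _ hζ.2).mpr ((Φ.mem_D_iff hζ.1).mpr h0)) ⟨hz, hzU⟩ hz0
  have hder : fderiv ℝ (f ∘ Φ.toX.symm) z = u z • coordZero n := by
    have hud := ((hu z hzV).differentiableAt (hVo.mem_nhds hzV)).restrictScalars ℝ
    have h1 : HasFDerivAt (fun ζ : ℂ^(n + 1) => ζ 0 * u ζ)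
        (z 0 • fderiv ℝ u z + u z • coordZero n) z := by
      have h0 : HasFDerivAt (fun ζ : ℂ^(n + 1) => ζ 0) (coordZero n) z :=
        (coordZero n).hasFDerivAt.congr_of_eventuallyEq
          (Eventually.of_forall fun ζ => (coordZero_apply ζ).symm)
      exact h0.mul hud.hasFDerivAt
    rw [hz0, clm_zero_smul, zero_add] at h1
    refine (h1.congr_of_eventuallyEq ?_).fderiv
    filter_upwards [hVo.mem_nhds hzV] with ζ hζ using hfu ζ hζ
  have huz : u z ≠ 0 := by
    intro h0
    rw [h0, clm_zero_smul] at hder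
    have hxD : Φ.toX.symm z ∈ D := (Φ.mem_D_iff hz).mpr hz0
    refine hf.differential_ne_zero _ hzU hxD ?_
    set x := Φ.toX.symm z
    have hxs : x ∈ Φ.toX.source := Φ.toX.map_target hz
    have hxz : Φ.toX x = z := Φ.toX.right_inv hz
    have hm1 := mdifferentiableAt_chart Φ.memX hxs
    have hm2 : MDifferentiableAt 𝓘(ℝ, ℂ^(n + 1)) 𝓘(ℝ, ℂ) (f ∘ Φ.toX.symm) (Φ.toX x) := by
      rw [hxz]
      exact (((hd z ⟨hz, hzU⟩).differentiableAt (ho.mem_nhds ⟨hz, hzU⟩)).restrictScalars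
        ℝ).mdifferentiableAt
    have h2 := mfderiv_comp x hm2 hm1
    have h3 : mfderiv 𝓘(ℝ, ℂ^(n + 1)) 𝓘(ℝ, ℂ) ((f ∘ Φ.toX.symm) ∘ Φ.toX) x =
        mfderiv 𝓘(ℝ, ℂ^(n + 1)) 𝓘(ℝ, ℂ) f x := by
      refine Filter.EventuallyEq.mfderiv_eq ?_
      filter_upwards [Φ.toX.open_source.mem_nhds hxs] with y hy
      simp [Φ.toX.left_inv hy]
    have h4 : mfderiv 𝓘(ℝ, ℂ^(n + 1)) 𝓘(ℝ, ℂ) (f ∘ Φ.toX.symm) (Φ.toX x) = 0 := by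
      rw [mfderiv_eq_fderiv, hxz]; exact hder
    rw [h4] at h2
    exact (h3.symm.trans h2).trans (ContinuousLinearMap.zero_comp _)
  obtain ⟨V', hV'V, hV'o, hzV'⟩ := mem_nhds_iff.mp
    (((hu.continuousOn.continuousAt (hVo.mem_nhds hzV)).eventually_ne huz).and (hVo.mem_nhds hzV))
  exact ⟨V', hV'o, hzV', fun ζ hζ => hVU (hV'V hζ).2, u, hu.mono fun ζ hζ => (hV'V hζ).2,
    fun ζ hζ => (hV'V hζ).1, fun ζ hζ => hfu ζ (hV'V hζ).2, hder⟩

/-- It suffices to check the order of the pole with coordinates of adapted charts. -/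
lemma hasPoleLE_of_charts (hA : HasAdaptedCharts n D) {k : ℕ}
    {a : DForm (n + 1) r X} (ha : SmoothFormOn a Dᶜ)
    (h : ∀ p ∈ D, ∃ (Φ : AdaptedChart n D) (V : Set X), IsOpen V ∧ p ∈ V ∧ V ⊆ Φ.toX.source ∧
      ∃ b : DForm (n + 1) r X, SmoothFormOn b V ∧
        ∀ x ∈ V, x ∉ D → b x = (Φ.toX x 0) ^ k • a x) : HasPoleLE D k a := by
  intro U f hf
  refine exists_smooth_extension hA (a := fun x => f x ^ k • a x) hf.isOpen fun p hp => ?_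
  by_cases hpD : p ∈ D
  · obtain ⟨Φ, V, hVo, hpV, hVs, b, hb, hba⟩ := h p hpD
    have hps := hVs hpV
    obtain ⟨V', hV'o, hzV', hV'sub, u, hu, -, hfu, -⟩ := Φ.exists_unit hf (Φ.toX.map_source hps)
      (by rwa [Φ.toX.left_inv hps]) ((Φ.zero_iff p hps).mpr hpD)
    have hWo : IsOpen (V ∩ (Φ.toX.source ∩ Φ.toX ⁻¹' V')) :=
      hVo.inter (Φ.toX.isOpen_inter_preimage hV'o)
    refine ⟨_, hWo, ⟨hpV, hps, hzV'⟩, fun x => u (Φ.toX x) ^ k • b x, ?_, ?_⟩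
    · rw [smoothFormOn_iff hWo]
      intro x hx
      refine SmoothFormAt.smul ?_ ((smoothFormOn_iff hVo).mp hb x hx.1)
      have hux : ContDiffAt ℝ ∞ u (Φ.toX x) :=
        ((contDiffOn_of_differentiableOn hV'o hu).contDiffAt
          (hV'o.mem_nhds hx.2.2)).restrict_scalars ℝ
      refine contMDiffAt_of_chart Φ.memX hx.2.1 ?_
      refine (hux.pow k).congr_of_eventuallyEq ?_
      filter_upwards [Φ.toX.open_target.mem_nhds (Φ.toX.map_source hx.2.1)] with ζ hζ
      simp [Φ.toX.right_inv hζ]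
    · intro x hx hxD
      have h1 := hfu _ hx.2.2
      rw [Φ.toX.left_inv hx.2.1] at h1
      simp only []
      rw [hba x hx.1 hxD, h1, smul_smul, mul_pow, mul_comm]
  · have ho := (isClosed_hypersurface D).isOpen_compl
    refine ⟨U ∩ Dᶜ, hf.isOpen.inter ho, ⟨hp, hpD⟩, fun x => f x ^ k • a x, ?_, fun _ _ _ => rfl⟩
    rw [smoothFormOn_iff (hf.isOpen.inter ho)]
    intro x hx
    exact SmoothFormAt.smul (contMDiffAt_fun_pow (hf.contMDiffAt hx.1) k) ((smoothFormOn_iff ho).mp ha x hx.2)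

/-- The Poincaré residue is determined by the limit of `z₀ a` at the points of `D`. -/
lemma AdaptedChart.tendsto_coord_smul (Φ : AdaptedChart n D) {a : DForm (n + 1) (r + 1) X}
    {U : Set X} {f : X → ℂ} {s : DForm (n + 1) r X} {t : DForm (n + 1) (r + 1) X}
    (hf : IsLocalEquation (d := n + 1) D U f) (hs : SmoothFormOn s U) (ht : SmoothFormOn t U)
    (h : ∀ x ∈ U, x ∉ D → a x = (f x)⁻¹ • wedgeOne (dFun f x) (s x) + t x)
    {z : ℂ^(n + 1)} (hz : z ∈ Φ.toX.target) (hzU : Φ.toX.symm z ∈ U) (hz0 : z 0 = 0) :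
    Tendsto (fun ζ => ζ 0 • inChart Φ.toX a ζ) (𝓝[{ζ | ζ 0 ≠ 0}] z)
      (𝓝 (wedgeOne (coordZero n) (inChart Φ.toX s z))) := by
  obtain ⟨V, hVo, hzV, hVsub, u, hu, hu0, hfu, hder⟩ := Φ.exists_unit hf hz hzU hz0
  have hsz := ((smoothFormOn_iff hf.isOpen).mp hs _ hzU).contDiffAt Φ.memX hz
  have htz := ((smoothFormOn_iff hf.isOpen).mp ht _ hzU).contDiffAt Φ.memX hz
  have hfz := contDiffAt_comp_symm Φ.memX hz (hf.contMDiffAt hzU)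
  have huz : ContDiffAt ℝ ∞ u z := ((contDiffOn_of_differentiableOn hVo hu).contDiffAt
    (hVo.mem_nhds hzV)).restrict_scalars ℝ
  have hcont : ContinuousAt (fun ζ : ℂ^(n + 1) => (u ζ)⁻¹ • wedgeOne
      (fderiv ℝ (f ∘ Φ.toX.symm) ζ) (inChart Φ.toX s ζ) + ζ 0 • inChart Φ.toX t ζ) z := by
    refine ContinuousAt.add (ContinuousAt.smul (huz.continuousAt.inv₀ (hu0 z hzV)) ?_) ?_
    · exact (contDiffAt_wedgeOne (hfz.fderiv_right (m := ∞) (by simp)) hsz).continuousAt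
    · exact ContinuousAt.smul (continuous_apply 0).continuousAt htz.continuousAt
  have hval : (u z)⁻¹ • wedgeOne (fderiv ℝ (f ∘ Φ.toX.symm) z) (inChart Φ.toX s z) +
      z 0 • inChart Φ.toX t z = wedgeOne (coordZero n) (inChart Φ.toX s z) := by
    rw [hder, hz0, form_zero_smul, add_zero, wedgeOne_smul_left, smul_smul,
      inv_mul_cancel₀ (hu0 z hzV)]
    exact one_smul ℂ _
  rw [← hval]
  refine (hcont.tendsto.mono_left nhdsWithin_le_nhds).congr' ?_
  filter_upwards [mem_nhdsWithin_of_mem_nhds (hVo.mem_nhds hzV), self_mem_nhdsWithin,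
    Φ.eventually_notMem hz] with ζ hζV hζ0 hζD
  have hζ := hVsub hζV
  have hfm : MDifferentiableAt 𝓘(ℝ, ℂ^(n + 1)) 𝓘(ℝ, ℂ) f (Φ.toX.symm ζ) :=
    (hf.contMDiffAt hζ.2).mdifferentiableAt (by simp)
  have h1 : inChart Φ.toX a ζ = (f (Φ.toX.symm ζ))⁻¹ • wedgeOne
      (fderiv ℝ (f ∘ Φ.toX.symm) ζ) (inChart Φ.toX s ζ) + inChart Φ.toX t ζ := by
    rw [← inChart_wedgeOne Φ.memX hζ.1 hfm]
    rw [inChart_congr (b := fun x => (f x)⁻¹ • wedgeOne (dFun f x) (s x) + t x) (h _ hζ.2 hζD)]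
    rfl
  rw [h1, smul_add, smul_smul, hfu ζ hζV]
  congr 2
  have : ζ 0 ≠ 0 := hζ0
  have := hu0 ζ hζV
  field_simp

lemma hyperRestrict_apply (s : AltForm (n + 1) r) (v : Fin r → ℂ^n) :
    hyperRestrict s v =
      wedgeOne (coordZero n) s (Fin.cons (Pi.single 0 1) fun i => hyperIncl n (v i)) := by
  rw [wedgeOne_apply, Fin.sum_univ_succ, Finset.sum_eq_zero]
  · simp [coordZero_apply, hyperRestrict]
    rfl
  · intro i _
    simp [coordZero_apply, hyperIncl_apply]

lemma hyperRestrict_eq_of_wedgeOne_eq {s s' : AltForm (n + 1) r}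
    (h : wedgeOne (coordZero n) s = wedgeOne (coordZero n) s') :
    hyperRestrict s = hyperRestrict s' := by
  ext v
  rw [hyperRestrict_apply, hyperRestrict_apply, h]

/-- In adapted charts, `z₀ a` restricts to `dz₀ ∧ s` at the points of `D`, where `s|_D` is the
Poincaré residue of `a`. -/
lemma AdaptedChart.residue_eq (Φ : AdaptedChart n D) {a b : DForm (n + 1) (r + 1) X}
    {ρ : DForm n r D} (hρ : IsPoincareResidue D a ρ) {w : ℂ^n} (hw : w ∈ Φ.toD.target)
    (hb : SmoothFormAt b (Φ.toD.symm w : D))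
    (hba : ∀ᶠ x in 𝓝 ((Φ.toD.symm w : D) : X), x ∉ D → b x = Φ.toX x 0 • a x) :
    ∃ S, inChart Φ.toX b (hyperIncl n w) = wedgeOne (coordZero n) S ∧
      hyperRestrict S = inChart Φ.toD ρ w := by
  have hwX := Φ.mem_toD_target_iff.mp hw
  obtain ⟨U, f, s, t, hpU, hf, hs, ht, h, hρs⟩ := hρ (Φ.toD.symm w)
  have hsy := Φ.symm_hyperIncl hw
  refine ⟨inChart Φ.toX s (hyperIncl n w), ?_, ?_⟩
  · have h1 := Φ.tendsto_coord_smul hf hs ht h hwX (by rwa [hsy])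
      (by rw [hyperIncl_apply]; simp)
    rw [← hsy] at hb hba
    have h2 := (hb.contDiffAt Φ.memX hwX).continuousAt.tendsto.mono_left
      (nhdsWithin_le_nhds (s := {ζ | ζ 0 ≠ 0}))
    refine tendsto_nhds_unique (h2.congr' ?_) h1
    have h3 := (Φ.toX.symm.continuousAt hwX).eventually hba
    filter_upwards [mem_nhdsWithin_of_mem_nhds h3, Φ.eventually_notMem hwX,
      mem_nhdsWithin_of_mem_nhds (Φ.toX.open_target.mem_nhds hwX)] with ζ h4 h5 h6
    rw [inChart_congr (b := fun x => Φ.toX x 0 • a x) (h4 h5), inChart_smul, Φ.toX.right_inv h6]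
  · rw [← Φ.inChart_restrictForm s hw]
    exact inChart_congr (hρs _ hpU).symm

/-- Local decompositions suffice for the existence of the Poincaré residue, which is smooth. -/
lemma exists_poincareResidue {a : DForm (n + 1) (r + 1) X}
    (h : ∀ p : D, ∃ (Φ : AdaptedChart n D) (U : Set X) (f : X → ℂ) (s : DForm (n + 1) r X)
      (t : DForm (n + 1) (r + 1) X), (p : X) ∈ U ∧ U ⊆ Φ.toX.source ∧
      IsLocalEquation (d := n + 1) D U f ∧ SmoothFormOn s U ∧ SmoothFormOn t U ∧
      ∀ x ∈ U, x ∉ D → a x = (f x)⁻¹ • wedgeOne (dFun f x) (s x) + t x) :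
    ∃ ρ : DForm n r D, IsPoincareResidue D a ρ := by
  choose Φ U f s t hpU hUs hf hs ht hd using h
  refine ⟨fun q => restrictForm D (s q) q, fun p => ⟨U p, f p, s p, t p, hpU p, hf p, hs p, ht p,
    hd p, fun q hq => ?_⟩⟩
  have hqs : q ∈ (Φ q).toD.source := ((Φ q).source_iff q).mpr (hUs q (hpU q))
  have hw := (Φ q).toD.map_source hqs
  have hsy := (Φ q).symm_hyperIncl hw
  rw [(Φ q).toD.left_inv hqs] at hsy
  have hwX := (Φ q).mem_toD_target_iff.mp hw
  have h0 : hyperIncl n ((Φ q).toD q) 0 = 0 := by rw [hyperIncl_apply]; simp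
  have h1 := (Φ q).tendsto_coord_smul (hf q) (hs q) (ht q) (hd q) hwX (by rw [hsy]; exact hpU q) h0
  have h2 := (Φ q).tendsto_coord_smul (hf p) (hs p) (ht p) (hd p) hwX (by rw [hsy]; exact hq) h0
  refine eq_of_inChart_eq (Φ q).memD hqs (a := restrictForm D (s q)) (b := restrictForm D (s p)) ?_
  rw [(Φ q).inChart_restrictForm _ hw, (Φ q).inChart_restrictForm _ hw]
  exact hyperRestrict_eq_of_wedgeOne_eq (tendsto_nhds_unique h1 h2)

lemma smoothFormAt_restrictForm (Φ : AdaptedChart n D) {s : DForm (n + 1) r X} {q : D}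
    (hq : q ∈ Φ.toD.source) (hs : SmoothFormAt s (q : X)) : SmoothFormAt (restrictForm D s) q := by
  rw [smoothFormAt_iff Φ.memD hq]
  have h1 := (smoothFormAt_iff Φ.memX ((Φ.source_iff q).mp hq)).mp hs
  rw [Φ.apply_eq q hq] at h1
  have h2 : ContDiffAt ℝ ∞ (fun w => hyperRestrict (inChart Φ.toX s (hyperIncl n w)))
      (Φ.toD q) := contDiffAt_compCLM
    (h1.comp (Φ.toD q) ((hyperIncl n).restrictScalars ℝ).contDiff.contDiffAt) contDiffAt_const
  refine h2.congr_of_eventuallyEq ?_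
  filter_upwards [Φ.toD.open_target.mem_nhds (Φ.toD.map_source hq)] with w hw
  exact Φ.inChart_restrictForm s hw

lemma IsPoincareResidue.smoothFormAt
    (hA : HasAdaptedCharts n D) (hDe : IsEmbedding (Subtype.val : D → X))
    {a : DForm (n + 1) (r + 1) X} {ρ : DForm n r D} (h : IsPoincareResidue D a ρ) (q : D) :
    SmoothFormAt ρ q := by
  obtain ⟨U, f, s, t, hpU, hf, hs, -, -, hρ⟩ := h q
  obtain ⟨Φ, hΦ⟩ := hA q
  refine (smoothFormAt_restrictForm Φ ((Φ.source_iff q).mpr hΦ)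
    ((smoothFormOn_iff hf.isOpen).mp hs _ hpU)).congr ?_
  filter_upwards [(hf.isOpen.preimage hDe.continuous).mem_nhds hpU] with y hy
  exact (hρ y hy).symm

/-! ### Angular moments of smooth functions -/

section Moments

variable {P : Type*} [NormedAddCommGroup P] [NormedSpace ℝ P]

/-- The Wirtinger derivative `∂S/∂z` of a function `S(z, p)` of a complex variable `z` and of
parameters `p`. -/
def wirt (S : ℂ × P → ℂ) (x : ℂ × P) : ℂ :=
  (fderiv ℝ S x (1, 0) - I * fderiv ℝ S x (I, 0)) / 2

/-- The Wirtinger derivative `∂S/∂z̄` of a function `S(z, p)`. -/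
def wirtBar (S : ℂ × P → ℂ) (x : ℂ × P) : ℂ :=
  (fderiv ℝ S x (1, 0) + I * fderiv ℝ S x (I, 0)) / 2

/-- A smooth function with compact support. -/
def IsTest (S : ℂ × P → ℂ) : Prop := ContDiff ℝ ∞ S ∧ HasCompactSupport S

/-- The differential in the direction of `z` in terms of the Wirtinger derivatives. -/
lemma fderiv_fst_eq (S : ℂ × P → ℂ) (x : ℂ × P) (v : ℂ) :
    fderiv ℝ S x (v, 0) = wirt S x * v + wirtBar S x * conj v := by
  have h : ((v, 0) : ℂ × P) = v.re • ((1, 0) : ℂ × P) + v.im • ((I, 0) : ℂ × P) := by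
    ext <;> simp
  rw [h, map_add, map_smul, map_smul, wirt, wirtBar]
  have hc : conj v = v.re - v.im * I := by
    apply Complex.ext <;> simp
  rw [hc, real_smul, real_smul]
  nth_rw 3 [← Complex.re_add_im v]
  linear_combination (fderiv ℝ S x (I, 0) * v.im) * Complex.I_mul_I

lemma isTest_fderiv {S : ℂ × P → ℂ} (hS : IsTest S) (v : ℂ × P) :
    IsTest (fun x => fderiv ℝ S x v) :=
  ⟨(hS.1.fderiv_right (m := ∞) (by simp)).clm_apply contDiff_const,
    (hS.2.fderiv (𝕜 := ℝ)).comp_left (g := fun L : (ℂ × P) →L[ℝ] ℂ => L v) (by simp)⟩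

lemma IsTest.wirt {S : ℂ × P → ℂ} (hS : IsTest S) : IsTest (wirt S) := by
  have h1 := isTest_fderiv hS (1, 0)
  have h2 := isTest_fderiv hS (I, 0)
  refine ⟨(h1.1.sub (contDiff_const.mul h2.1)).div_const 2, ?_⟩
  exact h1.2.comp₂_left (m := fun a b => (a - I * b) / 2) h2.2 (by simp)

lemma IsTest.wirtBar {S : ℂ × P → ℂ} (hS : IsTest S) : IsTest (wirtBar S) := by
  have h1 := isTest_fderiv hS (1, 0)
  have h2 := isTest_fderiv hS (I, 0)
  refine ⟨(h1.1.add (contDiff_const.mul h2.1)).div_const 2, ?_⟩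
  exact h1.2.comp₂_left (m := fun a b => (a + I * b) / 2) h2.2 (by simp)

lemma IsTest.wirt_iterate {S : ℂ × P → ℂ} (hS : IsTest S) (k : ℕ) : IsTest (DivInt.wirt^[k] S) := by
  induction k generalizing S with
  | zero => exact hS
  | succ k ih => exact ih hS.wirt

lemma IsTest.exists_bound {S : ℂ × P → ℂ} (hS : IsTest S) : ∃ C, 0 ≤ C ∧ ∀ x, ‖S x‖ ≤ C := by
  obtain ⟨C, hC⟩ := hS.1.continuous.bounded_above_of_compact_support hS.2
  exact ⟨C, (norm_nonneg _).trans (hC 0), hC⟩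

/-- The `k`-th angular moment `∫ e^{-ikθ} S(r e^{iθ}, p) dθ`. -/
def moment (k : ℕ) (S : ℂ × P → ℂ) (r : ℝ) (p : P) : ℂ :=
  ∫ θ in (-π)..Real.pi, Complex.exp (-(θ * I)) ^ k * S (circleMap 0 r θ, p)

lemma continuous_moment_integrand {S : ℂ × P → ℂ} (hS : Continuous S) (k : ℕ) :
    Continuous fun q : (ℝ × P) × ℝ =>
      Complex.exp (-(q.2 * I)) ^ k * S (circleMap 0 q.1.1 q.2, q.1.2) := by
  unfold circleMap
  fun_prop

lemma continuous_moment {S : ℂ × P → ℂ} (hS : Continuous S) (k : ℕ) :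
    Continuous fun q : ℝ × P => moment k S q.1 q.2 :=
  intervalIntegral.continuous_parametric_intervalIntegral_of_continuous'
    (f := fun (q : ℝ × P) θ => Complex.exp (-(θ * I)) ^ k * S (circleMap 0 q.1 θ, q.2))
    (continuous_moment_integrand hS k) _ _

lemma norm_exp_neg_mul_I (θ : ℝ) : ‖Complex.exp (-(θ * I))‖ = 1 := by
  have : -((θ : ℂ) * I) = ((-θ : ℝ) : ℂ) * I := by push_cast; ring
  rw [this, Complex.norm_exp_ofReal_mul_I]

lemma norm_moment_le {S : ℂ × P → ℂ} {C : ℝ} {r : ℝ} {p : P} (k : ℕ)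
    (hC : ∀ θ, ‖S (circleMap 0 r θ, p)‖ ≤ C) : ‖moment k S r p‖ ≤ 2 * π * C := by
  have h := intervalIntegral.norm_integral_le_of_norm_le_const (a := -π) (b := π)
    (f := fun θ : ℝ => Complex.exp (-(θ * I)) ^ k * S (circleMap 0 r θ, p)) (C := C)
    fun θ _ => by rw [norm_mul, norm_pow, norm_exp_neg_mul_I, one_pow, one_mul]; exact hC θ
  rw [moment]
  refine h.trans (le_of_eq ?_)
  rw [abs_of_pos (by linarith [Real.pi_pos])]
  ring

/-- The `k`-th Taylor coefficient at `z = 0` in the direction of `zᵏ`, multiplied by `2π`. -/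
def wirtCoeff (k : ℕ) (S : ℂ × P → ℂ) (p : P) : ℂ := 2 * π / (k.factorial : ℂ) * (wirt^[k] S) (0, p)

lemma norm_le_of_succ_mul_eq {A U V : ℂ} {C₁ C₂ r : ℝ} (hr : 0 ≤ r) {i m : ℕ}
    (h : ((i + 1 : ℕ) : ℂ) * A = r * (U - V)) (hU : ‖U‖ ≤ C₁ * r ^ m) (hV : ‖V‖ ≤ C₂ * r ^ m) :
    ‖A‖ ≤ (C₁ + C₂) * r ^ (m + 1) := by
  have h1 := congrArg norm h
  rw [norm_mul, norm_mul, Complex.norm_natCast, Complex.norm_real, norm_of_nonneg hr] at h1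
  have h2 := le_mul_of_one_le_left (norm_nonneg A) (a := ((i + 1 : ℕ) : ℝ)) (by simp)
  exact h2.trans (h1.le.trans ((mul_le_mul_of_nonneg_left ((norm_sub_le U V).trans
    (add_le_add hU hV)) hr).trans (le_of_eq (by ring))))

/-- Integration by parts in the angular variable. -/
lemma moment_succ {S : ℂ × P → ℂ} (hS : IsTest S) (k : ℕ) (r : ℝ) (p : P) :
    ((k + 1 : ℕ) : ℂ) * moment (k + 1) S r p =
      r * (moment k (wirt S) r p - moment (k + 2) (wirtBar S) r p) := by
  set u : ℝ → ℂ := fun θ => Complex.exp (-(θ * I)) with hu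
  have huc : ∀ θ : ℝ, u θ * Complex.exp (θ * I) = 1 := by
    intro θ; rw [hu, ← Complex.exp_add]; simp
  have hder : ∀ θ : ℝ, HasDerivAt (fun θ : ℝ => u θ ^ (k + 1) * S (circleMap 0 r θ, p))
      (-I * ((k + 1 : ℕ) * (u θ ^ (k + 1) * S (circleMap 0 r θ, p)) -
        r * (u θ ^ k * wirt S (circleMap 0 r θ, p) -
          u θ ^ (k + 2) * wirtBar S (circleMap 0 r θ, p)))) θ := by
    intro θ
    have h1 : HasDerivAt u (u θ * (-I)) θ := by
      have : HasDerivAt (fun θ : ℝ => -((θ : ℂ) * I)) (-(1 * I)) θ :=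
        ((ofRealCLM.hasDerivAt (x := θ)).mul_const I).neg
      simpa using this.cexp
    have h2 : HasDerivAt (fun θ : ℝ => ((circleMap 0 r θ, p) : ℂ × P))
        (circleMap 0 r θ * I, 0) θ :=
      (hasDerivAt_circleMap 0 r θ).prodMk (hasDerivAt_const θ p)
    have h3 := ((hS.1.differentiable (by simp)) (circleMap 0 r θ, p)).hasFDerivAt.comp_hasDerivAt θ h2
    rw [fderiv_fst_eq] at h3
    refine ((h1.pow (k + 1)).mul h3).congr_deriv ?_
    have hc : conj (circleMap 0 r θ * I) = -I * (r * u θ) := by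
      rw [map_mul, Complex.conj_I, circleMap_zero, map_mul, Complex.conj_ofReal, ← Complex.exp_conj]
      simp [hu]; ring
    have h4 := huc θ
    rw [hc]
    simp only [Function.comp_apply]
    generalize S (circleMap 0 r θ, p) = S₀, wirt S (circleMap 0 r θ, p) = S₁,
      wirtBar S (circleMap 0 r θ, p) = S₂
    rw [circleMap_zero]
    simp only [Nat.add_sub_cancel, Pi.pow_apply]
    push_cast
    linear_combination (I * r * u θ ^ k * S₁) * h4
  have hcont : ∀ (j : ℕ) {T : ℂ × P → ℂ}, IsTest T → Continuous fun θ : ℝ =>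
      u θ ^ j * T (circleMap 0 r θ, p) := fun j T hT =>
    (continuous_moment_integrand hT.1.continuous j).comp
      (by fun_prop : Continuous fun θ : ℝ => (((r, p), θ) : (ℝ × P) × ℝ))
  have hint := intervalIntegral.integral_eq_sub_of_hasDerivAt (a := -π) (b := π)
    (fun θ _ => hder θ) (Continuous.intervalIntegrable (continuous_const.mul
      (((hcont (k + 1) hS).const_mul _).sub
        (((hcont k hS.wirt).sub (hcont (k + 2) hS.wirtBar)).const_mul _))) _ _)
  have h1 : u π = u (-π) := by
    simp only [hu, Complex.ofReal_neg, neg_mul, Complex.exp_neg, Complex.exp_pi_mul_I]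
    norm_num
  have h2 : circleMap 0 r π = circleMap 0 r (-π) := by
    simp only [circleMap_zero, Complex.ofReal_neg, neg_mul, Complex.exp_neg, Complex.exp_pi_mul_I]
    norm_num
  rw [h1, h2, sub_self, intervalIntegral.integral_const_mul] at hint
  have h0 := (mul_eq_zero.mp hint).resolve_left (by simp)
  rw [intervalIntegral.integral_sub, intervalIntegral.integral_const_mul,
    intervalIntegral.integral_const_mul, intervalIntegral.integral_sub] at h0
  · exact sub_eq_zero.mp h0
  · exact (hcont k hS.wirt).intervalIntegrable _ _
  · exact (hcont (k + 2) hS.wirtBar).intervalIntegrable _ _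
  · exact (hcont (k + 1) hS).intervalIntegrable _ _ |>.const_mul _
  · exact (((hcont k hS.wirt).sub (hcont (k + 2) hS.wirtBar)).intervalIntegrable _ _).const_mul _

/-- Angular moments of order `j ≥ k` vanish to order `k` at the origin. -/
lemma exists_norm_moment_le (k : ℕ) {j : ℕ} (hj : k ≤ j) {S : ℂ × P → ℂ} (hS : IsTest S) :
    ∃ C, 0 ≤ C ∧ ∀ r, 0 ≤ r → ∀ p, ‖moment j S r p‖ ≤ C * r ^ k := by
  induction k generalizing j S with
  | zero =>
    obtain ⟨C, hC0, hC⟩ := hS.exists_bound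
    exact ⟨2 * π * C, by positivity, fun r _ p => by
      simpa using norm_moment_le j fun θ => hC _⟩
  | succ k ih =>
    obtain ⟨i, rfl⟩ : ∃ i, j = i + 1 := ⟨j - 1, by omega⟩
    obtain ⟨C₁, h1, hC₁⟩ := ih (j := i) (by omega) hS.wirt
    obtain ⟨C₂, h2, hC₂⟩ := ih (j := i + 2) (by omega) hS.wirtBar
    exact ⟨C₁ + C₂, by positivity, fun r hr p =>
      norm_le_of_succ_mul_eq hr (moment_succ hS i r p) (hC₁ r hr p) (hC₂ r hr p)⟩

/-- The angular moment of order `k` sees the derivative `∂_z^k S` at the origin. -/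
lemma exists_norm_moment_sub_le (k : ℕ) {S : ℂ × P → ℂ} (hS : IsTest S) :
    ∃ C, 0 ≤ C ∧ ∀ r, 0 ≤ r → ∀ p, ‖moment k S r p - r ^ k * wirtCoeff k S p‖ ≤ C * r ^ (k + 1) := by
  induction k generalizing S with
  | zero =>
    obtain ⟨K, hK⟩ := hS.1.lipschitzWith_of_hasCompactSupport hS.2 (by simp)
    refine ⟨2 * π * K, by positivity, fun r hr p => ?_⟩
    have h1 : moment 0 S r p - r ^ 0 * wirtCoeff 0 S p =
        moment 0 (fun x => S x - S (0, x.2)) r p := by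
      have := (continuous_moment_integrand hS.1.continuous 0).comp
        (by fun_prop : Continuous fun θ : ℝ => (((r, p), θ) : (ℝ × P) × ℝ))
      simp only [moment, wirtCoeff, pow_zero, one_mul, Nat.factorial_zero, Nat.cast_one, div_one,
        Function.iterate_zero, id_eq, Function.comp_def] at this ⊢
      rw [intervalIntegral.integral_sub (this.intervalIntegrable _ _) intervalIntegrable_const]
      simp; left; ring
    rw [h1]
    refine (norm_moment_le (C := K * r) 0 fun θ => ?_).trans (le_of_eq (by ring))
    refine (hK.norm_sub_le (circleMap 0 r θ, p) (0, p)).trans (le_of_eq ?_)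
    simp [Prod.norm_def, abs_of_nonneg hr]
    exact Or.inl hr
  | succ k ih =>
    obtain ⟨C₁, h1, hC₁⟩ := ih hS.wirt
    obtain ⟨C₂, h2, hC₂⟩ := exists_norm_moment_le (k + 1) (j := k + 2) (by omega) hS.wirtBar
    refine ⟨C₁ + C₂, by positivity, fun r hr p =>
      norm_le_of_succ_mul_eq hr (i := k) ?_ (hC₁ r hr p) (hC₂ r hr p)⟩
    have hk : ((k + 1 : ℕ) : ℂ) ≠ 0 := by exact_mod_cast Nat.succ_ne_zero k
    have hf : (k.factorial : ℂ) ≠ 0 := by exact_mod_cast k.factorial_ne_zero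
    rw [mul_sub, moment_succ hS, wirtCoeff, wirtCoeff, Nat.factorial_succ,
      Function.iterate_succ_apply]
    push_cast at hk ⊢
    field_simp
    ring

end Moments

/-! ### Logarithmic expansion of integrals over the complement of a round tube -/

lemma tendsto_mul_nhdsGT_zero (C : ℝ) : Tendsto (fun ε : ℝ => C * ε) (𝓝[>] 0) (𝓝 0) := by
  simpa using ((continuous_const_mul C).tendsto 0).mono_left nhdsWithin_le_nhds

lemma integrable_of_bounded_support {α E : Type*} [MeasurableSpace α] [NormedAddCommGroup E]
    {μ : Measure α} {f : α → E} (hm : AEStronglyMeasurable f μ) {C : ℝ} (hC : ∀ x, ‖f x‖ ≤ C)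
    {K : Set α} (hμ : μ K < ⊤) (h0 : ∀ x, x ∉ K → f x = 0) :
    Integrable f μ := by
  exact (integrableOn_iff_integrable_of_support_subset fun x hx => by_contra fun h => hx (h0 x h)).mp
    (Measure.integrableOn_of_bounded (M := C) hμ.ne hm (Eventually.of_forall hC))

/-- A profile: a bounded function of `s` which vanishes for `s < 1/2` and equals `1` for `s ≥ 1`. -/
structure IsProfile (θ : ℝ → ℝ) : Prop where
  measurable : Measurable θ
  bdd : ∃ C, ∀ s, |θ s| ≤ C
  eq_zero : ∀ s, s < 1 / 2 → θ s = 0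
  eq_one : ∀ s, 1 ≤ s → θ s = 1

/-- The profile which gives the integral over the superlevel set of a cut-off function. -/
lemma isProfile_indicator : IsProfile ((Ici (1 : ℝ)).indicator 1) where
  measurable := measurable_one.indicator measurableSet_Ici
  bdd := ⟨1, fun s => by by_cases h : 1 ≤ s <;> simp [h]⟩
  eq_zero s hs := indicator_of_notMem (by simp; linarith) _
  eq_one s hs := indicator_of_mem (by simpa using hs) _

/-- The contribution `∫₀¹ θ(s) ds/s` of a profile to the constant term of the expansion. -/
def profileConst (θ : ℝ → ℝ) : ℝ := ∫ s in Ioc (0 : ℝ) 1, θ s / s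

lemma profileConst_indicator : profileConst ((Ici (1 : ℝ)).indicator 1) = 0 := by
  rw [profileConst, integral_Ioc_eq_integral_Ioo]
  refine setIntegral_eq_zero_of_forall_eq_zero fun s hs => ?_
  rw [indicator_of_notMem (by simpa using hs.2), zero_div]

lemma IsProfile.measurable_div {θ : ℝ → ℝ} (h : IsProfile θ) (ε : ℝ) :
    Measurable fun r : ℝ => θ (r / ε) := h.measurable.comp (measurable_id.div_const ε)

lemma IsProfile.exists_bound {θ : ℝ → ℝ} (h : IsProfile θ) :
    ∃ C, 0 ≤ C ∧ (∀ s, |θ s| ≤ C) ∧ ∀ ε r : ℝ, 0 < ε → 0 < r → ‖θ (r / ε) / r‖ ≤ 2 * C / ε := by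
  obtain ⟨C, hC⟩ := h.bdd
  have hC0 : 0 ≤ C := (abs_nonneg _).trans (hC 0)
  refine ⟨C, hC0, hC, fun ε r hε hr => ?_⟩
  rw [norm_div, Real.norm_eq_abs, norm_of_nonneg hr.le]
  by_cases hs : r / ε < 1 / 2
  · rw [h.eq_zero _ hs, abs_zero, zero_div]; positivity
  · rw [not_lt, le_div_iff₀ hε] at hs
    rw [div_le_div_iff₀ hr hε]
    nlinarith [hC (r / ε), abs_nonneg (θ (r / ε))]

lemma IsProfile.integrableOn_div {θ : ℝ → ℝ} (h : IsProfile θ) {ε : ℝ} (hε : 0 < ε) (b : ℝ) :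
    IntegrableOn (fun r : ℝ => θ (r / ε) / r) (Ioc 0 b) := by
  obtain ⟨C, -, -, hC⟩ := h.exists_bound
  refine Measure.integrableOn_of_bounded (M := 2 * C / ε) (by simp)
    ((h.measurable_div ε).div measurable_id).aestronglyMeasurable ?_
  filter_upwards [ae_restrict_mem measurableSet_Ioc] with r hr using hC ε r hε hr.1

/-- Since `θ = 1` on `[1, ∞)`, the scaled profile contributes `log b - log ε` outside of the tube.
-/
lemma integral_profile_div {θ : ℝ → ℝ} (h : IsProfile θ) {ε b : ℝ} (hε : 0 < ε) (hb : ε ≤ b) :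
    ∫ r in Ioc (0 : ℝ) b, θ (r / ε) / r = profileConst θ + log b - log ε := by
  rw [← Ioc_union_Ioc_eq_Ioc hε.le hb, setIntegral_union (Ioc_disjoint_Ioc_of_le le_rfl)
    measurableSet_Ioc (h.integrableOn_div hε _)
    ((h.integrableOn_div hε b).mono_set (Ioc_subset_Ioc_left hε.le))]
  have h1 : ∫ r in Ioc 0 ε, θ (r / ε) / r = profileConst θ := by
    rw [profileConst, ← intervalIntegral.integral_of_le hε.le,
      ← intervalIntegral.integral_of_le zero_le_one]
    have := intervalIntegral.integral_comp_div (a := 0) (b := ε) (fun s => θ s / s) hε.ne'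
    rw [zero_div, div_self hε.ne'] at this
    have h2 : (fun r => θ (r / ε) / (r / ε)) = fun r => ε * (θ (r / ε) / r) := by
      funext r
      rcases eq_or_ne r 0 with rfl | hr
      · simp
      · field_simp
    rw [h2, intervalIntegral.integral_const_mul, smul_eq_mul] at this
    exact mul_left_cancel₀ hε.ne' this
  have h2 : ∫ r in Ioc ε b, θ (r / ε) / r = ∫ r in Ioc ε b, r⁻¹ := by
    refine setIntegral_congr_fun measurableSet_Ioc fun r hr => ?_
    rw [h.eq_one _ ((one_le_div hε).mpr hr.1.le), one_div]
  rw [h1, h2, ← intervalIntegral.integral_of_le hb, integral_inv_of_pos hε (hε.trans_le hb),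
    Real.log_div (hε.trans_le hb).ne' hε.ne', add_sub_assoc]

/-- The one-dimensional expansion, for a radial function with a Lipschitz bound at the origin. -/
lemma exists_radial_expansion {N : ℝ → ℂ} (hN : Measurable N) {L : ℂ} {C R : ℝ}
    (hC : ∀ r, 0 < r → ‖N r - L‖ ≤ C * r) (hR : ∀ r, R < r → N r = 0) :
    ∃ B : ℂ, ∀ θ, IsProfile θ → ∃ C', ∀ ε, 0 < ε → ε ≤ 1 →
      ‖(∫ r in Ioi (0 : ℝ), ((θ (r / ε) / r : ℝ) : ℂ) * N r) + L * log ε -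
        (B + profileConst θ * L)‖ ≤ C' * ε := by
  set b := max R 1
  have hbd : ∀ c A : ℝ, |c| ≤ A → ∀ r, 0 < r → ‖((c / r : ℝ) : ℂ) * (N r - L)‖ ≤ A * C := by
    intro c A hc r hr
    rw [norm_mul, Complex.norm_real, norm_div, Real.norm_eq_abs, norm_of_nonneg hr.le,
      div_mul_eq_mul_div, div_le_iff₀ hr, mul_assoc]
    exact mul_le_mul hc (hC r hr) (norm_nonneg _) ((abs_nonneg _).trans hc)
  have hint : ∀ g : ℝ → ℝ, Measurable g → ∀ A, (∀ r, |g r| ≤ A) →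
      IntegrableOn (fun r => ((g r / r : ℝ) : ℂ) * (N r - L)) (Ioc 0 b) := by
    intro g hg A hA
    refine Measure.integrableOn_of_bounded (M := A * C) (by simp) ((Complex.measurable_ofReal.comp
      (hg.div measurable_id)).mul (hN.sub_const L)).aestronglyMeasurable ?_
    filter_upwards [ae_restrict_mem measurableSet_Ioc] with r hr using hbd _ _ (hA r) r hr.1
  refine ⟨(∫ r in Ioc 0 b, ((1 / r : ℝ) : ℂ) * (N r - L)) + log b * L, fun θ hθ => ?_⟩
  obtain ⟨A, hA0, hA, -⟩ := hθ.exists_bound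
  refine ⟨(A + 1) * C, fun ε hε hε1 => ?_⟩
  have hεb : ε ≤ b := hε1.trans (le_max_right _ _)
  have hθi := hint _ (hθ.measurable_div ε) A fun r => hA _
  have hθL : IntegrableOn (fun r => ((θ (r / ε) / r : ℝ) : ℂ) * L) (Ioc 0 b) :=
    (hθ.integrableOn_div hε b).ofReal.mul_const L
  have h1 : (∫ r in Ioi (0 : ℝ), ((θ (r / ε) / r : ℝ) : ℂ) * N r) =
      (∫ r in Ioc 0 b, ((θ (r / ε) / r : ℝ) : ℂ) * (N r - L)) +
        ((profileConst θ + log b - log ε : ℝ) : ℂ) * L := by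
    rw [← integral_profile_div hθ hε hεb, ← integral_complex_ofReal, ← integral_mul_const,
      ← integral_add hθi hθL]
    simp only [← mul_add, sub_add_cancel]
    refine setIntegral_eq_of_subset_of_forall_sdiff_eq_zero measurableSet_Ioi
      (fun r hr => hr.1) fun r hr => ?_
    rw [hR r (lt_of_not_ge fun h => hr.2 ⟨hr.1, h.trans (le_max_left _ _)⟩), mul_zero]
  have h2 : (∫ r in Ioc 0 b, ((θ (r / ε) / r : ℝ) : ℂ) * (N r - L)) -
      (∫ r in Ioc 0 b, ((1 / r : ℝ) : ℂ) * (N r - L)) =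
      ∫ r in Ioc 0 ε, (((θ (r / ε) - 1) / r : ℝ) : ℂ) * (N r - L) := by
    rw [← integral_sub hθi (hint (fun _ => 1) measurable_const 1 (by simp))]
    simp only [← sub_mul, ← ofReal_sub, ← sub_div]
    refine setIntegral_eq_of_subset_of_forall_sdiff_eq_zero measurableSet_Ioc
      (Ioc_subset_Ioc_right hεb) fun r hr => ?_
    rw [hθ.eq_one _ ((one_le_div hε).mpr (le_of_not_ge fun h => hr.2 ⟨hr.1.1, h⟩))]
    simp
  have h3 := norm_setIntegral_le_of_norm_le_const (μ := volume) (s := Ioc 0 ε)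
    (f := fun r : ℝ => (((θ (r / ε) - 1) / r : ℝ) : ℂ) * (N r - L)) (by simp) fun r hr =>
      hbd _ (A + 1) ((abs_sub _ _).trans (add_le_add (hA _) (by simp))) r hr.1
  rw [← h2, Real.volume_real_Ioc_of_le hε.le, sub_zero] at h3
  refine (le_of_eq ?_).trans h3
  rw [h1]
  congr 1
  push_cast
  ring

/-! ### Polar coordinates and angular moments -/

lemma div_pole_circleMap (k : ℕ) {r : ℝ} (hr : 0 < r) (θ : ℝ) (c : ℂ) :
    (r : ℂ) * (c / ((circleMap 0 r θ) ^ (k + 1) * conj (circleMap 0 r θ))) =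
      ((r : ℂ) ^ (k + 1))⁻¹ * (Complex.exp (-(θ * I)) ^ k * c) := by
  have hr0 : (r : ℂ) ≠ 0 := by exact_mod_cast hr.ne'
  have he : Complex.exp (θ * I) ≠ 0 := Complex.exp_ne_zero _
  have hc : conj (circleMap 0 r θ) = r * (Complex.exp (θ * I))⁻¹ := by
    rw [circleMap_zero, map_mul, Complex.conj_ofReal, ← Complex.exp_conj, ← Complex.exp_neg]
    simp
  rw [hc, circleMap_zero, Complex.exp_neg]
  field_simp
  rw [mul_pow, one_div, inv_pow]
  field_simp
  ring

/-- Polar coordinates for an integrand which depends on `z` and on `|z|`. The powers of `z` and `z̄`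
turn the angular integral into a moment. -/
lemma integral_polar {H : ℂ × ℝ → ℂ} (hH : Measurable H) {C a b : ℝ} (ha : 0 < a)
    (hC : ∀ x, ‖H x‖ ≤ C) (h0 : ∀ z r, r ∉ Icc a b → H (z, r) = 0) (k : ℕ) :
    ∫ z : ℂ, H (z, ‖z‖) / (z ^ (k + 1) * conj z) =
      ∫ r in Icc a b, ((r : ℂ) ^ (k + 1))⁻¹ * moment k H r r := by
  set g : ℝ × ℝ → ℂ := fun q => ((q.1 : ℂ) ^ (k + 1))⁻¹ *
    (Complex.exp (-(q.2 * I)) ^ k * H (circleMap 0 q.1 q.2, q.1)) with hg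
  have h1 : ∫ q in polarCoord.target, q.1 •
      (fun z : ℂ => H (z, ‖z‖) / (z ^ (k + 1) * conj z)) (Complex.polarCoord.symm q) =
      ∫ q in polarCoord.target, g q := by
    refine setIntegral_congr_fun polarCoord.open_target.measurableSet fun q hq => ?_
    have hq1 : 0 < q.1 := by
      rw [polarCoord_target] at hq; exact hq.1
    have h2 : Complex.polarCoord.symm q = circleMap 0 q.1 q.2 := by
      rw [Complex.polarCoord_symm_apply, circleMap_zero, Complex.exp_mul_I]
      push_cast; ring
    simp only [h2]
    rw [real_smul, div_pole_circleMap k hq1]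
    simp [hg, abs_of_pos hq1]
  rw [← Complex.integral_comp_polarCoord_symm, h1, polarCoord_target,
    setIntegral_eq_of_subset_of_forall_sdiff_eq_zero (s := Icc a b ×ˢ Ioo (-π) π)
      (measurableSet_Ioi.prod measurableSet_Ioo) (prod_mono (fun r hr => ha.trans_le hr.1) le_rfl)
      fun q hq => ?_, Measure.volume_eq_prod, setIntegral_prod]
  · refine setIntegral_congr_fun measurableSet_Icc fun r hr => ?_
    simp only [hg]
    rw [integral_const_mul, moment, intervalIntegral.integral_of_le (by linarith [Real.pi_pos]),
      integral_Ioc_eq_integral_Ioo]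
  · refine Measure.integrableOn_of_bounded (M := (a ^ (k + 1))⁻¹ * C) ?_ ?_ ?_
    · rw [Measure.prod_prod]
      exact ENNReal.mul_ne_top (by simp) (by simp)
    · refine Measurable.aestronglyMeasurable ?_
      simp only [hg, circleMap]
      fun_prop
    · filter_upwards [ae_restrict_mem (measurableSet_Icc.prod measurableSet_Ioo)] with q hq
      have h1 : a ≤ q.1 := hq.1.1
      simp only [hg]
      rw [norm_mul, norm_inv, norm_pow, Complex.norm_real, norm_of_nonneg (ha.le.trans h1),
        norm_mul, norm_pow, norm_exp_neg_mul_I, one_pow, one_mul]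
      exact mul_le_mul (by gcongr) (hC _) (norm_nonneg _) (by positivity)
  · simp only [hg]
    rw [h0 _ _ (fun h => hq.2 ⟨h, hq.1.2⟩), mul_zero, mul_zero]

section Round

variable {P : Type*} [NormedAddCommGroup P] [NormedSpace ℝ P] [MeasureSpace P] [BorelSpace P]
  [SecondCountableTopology P] [SigmaFinite (volume : Measure P)]
  [IsFiniteMeasureOnCompacts (volume : Measure P)]

/-- Minus the coefficient of `log ε` in the integral of `G / (z^{k+1} z̄)` over `{|z| ≥ ε}`. -/
def logCoeff (k : ℕ) (G : ℂ × P → ℂ) : ℂ := ∫ p, wirtCoeff k G p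

lemma IsTest.exists_support {S : ℂ × P → ℂ} (hS : IsTest S) : ∃ R, 0 < R ∧ ∃ K : Set P,
    IsCompact K ∧ ∀ z p, (R < ‖z‖ ∨ p ∉ K) → S (z, p) = 0 := by
  obtain ⟨R, hR⟩ := (hS.2.isCompact.isBounded.subset_closedBall (0 : ℂ × P))
  refine ⟨|R| + 1, by positivity, Prod.snd '' tsupport S, hS.2.isCompact.image continuous_snd, ?_⟩
  intro z p h
  by_contra hne
  have hm : (z, p) ∈ tsupport S := subset_tsupport _ hne
  rcases h with h | h
  · have := hR hm
    rw [mem_closedBall_zero_iff, Prod.norm_def] at this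
    have h2 := (le_max_left _ _).trans this
    simp only at h2
    linarith [le_abs_self R]
  · exact h ⟨_, hm, rfl⟩

lemma moment_eq_zero {S : ℂ × P → ℂ} {R r : ℝ} {K : Set P} {p : P} (hr : 0 < r)
    (h0 : ∀ z p, (R < ‖z‖ ∨ p ∉ K) → S (z, p) = 0) (h : R < r ∨ p ∉ K) (k : ℕ) :
    moment k S r p = 0 := by
  have : ∀ t, S (circleMap 0 r t, p) = 0 := fun t =>
    h0 _ _ (by rwa [norm_circleMap_zero, abs_of_pos hr])
  simp [moment, this]

/-- The asymptotics of the moments determine the coefficient `wirtCoeff`. -/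
lemma eq_wirtCoeff {G : ℂ × P → ℂ} (hG : IsTest G) {k : ℕ} {p : P} {c : ℂ} {C : ℝ}
    (h : ∀ᶠ r : ℝ in 𝓝[>] 0, ‖moment k G r p - r ^ k * c‖ ≤ C * r ^ (k + 1)) :
    wirtCoeff k G p = c := by
  obtain ⟨C', -, hC⟩ := exists_norm_moment_sub_le k hG
  refine sub_eq_zero.mp (norm_le_zero_iff.mp (ge_of_tendsto (tendsto_mul_nhdsGT_zero (C + C')) ?_))
  filter_upwards [self_mem_nhdsWithin, h] with r hr hm
  have hr0 : 0 < r := hr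
  have := (norm_sub_le _ _).trans (add_le_add hm (hC r hr0.le p))
  rw [sub_sub_sub_cancel_left, ← mul_sub, norm_mul, norm_pow, Complex.norm_real,
    norm_of_nonneg hr0.le, ← add_mul, pow_succ', ← mul_assoc, mul_comm] at this
  exact le_of_mul_le_mul_right this (pow_pos hr0 k)

lemma wirtCoeff_eq_zero {G : ℂ × P → ℂ} (hG : IsTest G) {k : ℕ} {p : P}
    (h : ∀ᶠ r in 𝓝[>] 0, moment k G r p = 0) : wirtCoeff k G p = 0 :=
  eq_wirtCoeff hG (C := 0) (h.mono fun r hr => by simp [hr])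

lemma continuous_wirtCoeff {G : ℂ × P → ℂ} (hG : IsTest G) (k : ℕ) :
    Continuous (wirtCoeff k G) :=
  continuous_const.mul ((hG.wirt_iterate k).1.continuous.comp (by fun_prop))

lemma integrable_pole {H : ℂ × P → ℂ} (hH : Measurable H) {C a : ℝ} (ha : 0 < a)
    (hC : ∀ x, ‖H x‖ ≤ C) {K : Set (ℂ × P)} (hK : IsCompact K) (h0 : ∀ x, x ∉ K → H x = 0)
    (h1 : ∀ x, ‖x.1‖ < a → H x = 0) (k : ℕ) :
    Integrable fun x : ℂ × P => H x / (x.1 ^ (k + 1) * conj x.1) := by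
  refine integrable_of_bounded_support (C := C / a ^ (k + 2)) ?_ ?_ (K := K) hK.measure_lt_top ?_
  · refine Measurable.aestronglyMeasurable (hH.div ?_)
    exact (measurable_fst.pow_const _).mul (Complex.continuous_conj.measurable.comp measurable_fst)
  · intro x
    have hC0 : 0 ≤ C := (norm_nonneg _).trans (hC 0)
    by_cases hx : ‖x.1‖ < a
    · rw [h1 x hx]; simp; positivity
    · rw [norm_div, norm_mul, norm_pow, RCLike.norm_conj]
      have : a ^ (k + 2) ≤ ‖x.1‖ ^ (k + 1) * ‖x.1‖ := by
        rw [← pow_succ]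
        exact pow_le_pow_left₀ ha.le (not_lt.mp hx) _
      exact div_le_div₀ hC0 (hC x) (by positivity) this
  · intro x hx
    rw [h0 x hx, zero_div]

/-- Polar coordinates in the first variable, with parameters. -/
lemma integral_pole_eq {H : ℂ × (ℝ × P) → ℂ} (hH : Measurable H) {C a b : ℝ} (ha : 0 < a)
    (hC : ∀ x, ‖H x‖ ≤ C) {K : Set P} (hK : IsCompact K)
    (h0 : ∀ z r p, (r ∉ Icc a b ∨ p ∉ K) → H (z, (r, p)) = 0) (k : ℕ) :
    ∫ x : ℂ × P, H (x.1, (‖x.1‖, x.2)) / (x.1 ^ (k + 1) * conj x.1) =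
      ∫ p in K, ∫ r in Icc a b, ((r : ℂ) ^ (k + 1))⁻¹ * moment k H r (r, p) := by
  have hint := integrable_pole (H := fun x : ℂ × P => H (x.1, (‖x.1‖, x.2))) (by fun_prop) ha
    (fun x => hC _) ((isCompact_closedBall (0 : ℂ) b).prod hK) (fun x hx => by
      refine h0 _ _ _ ?_
      by_contra h
      push Not at h
      exact hx ⟨by simpa using h.1.2, h.2⟩)
    (fun x hx => h0 _ _ _ (Or.inl fun h => not_lt.mpr h.1 hx)) k
  rw [Measure.volume_eq_prod] at hint ⊢
  rw [integral_prod_symm _ hint, ← setIntegral_eq_integral_of_forall_compl_eq_zero (s := K)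
    fun p hp => by simp [h0 _ _ p (Or.inr hp)]]
  exact integral_congr_ae (Eventually.of_forall fun p => integral_polar
    (H := fun y : ℂ × ℝ => H (y.1, (y.2, p))) (by fun_prop) ha (fun x => hC _)
    (fun z r hr => h0 z r p (Or.inl hr)) k)

/-- The integral weighted with a profile `θ(|z|/ε)`, as a radial integral of moments. -/
lemma integral_profile_eq_radial {G : ℂ × P → ℂ} (hG : IsTest G) {θ : ℝ → ℝ} (hθ : IsProfile θ)
    {ε : ℝ} (hε : 0 < ε) (k : ℕ) :
    (∫ x : ℂ × P, ((θ (‖x.1‖ / ε) : ℝ) : ℂ) * G x / (x.1 ^ (k + 1) * conj x.1)) =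
      ∫ r in Ioi (0 : ℝ), ((θ (r / ε) / r : ℝ) : ℂ) *
        (((r : ℂ) ^ k)⁻¹ * ∫ p, moment k G r p) := by
  obtain ⟨R, hR, K, hK, h0⟩ := hG.exists_support
  obtain ⟨C, hC0, hC⟩ := hG.exists_bound
  obtain ⟨C₁, hC₁0, hC₁, -⟩ := hθ.exists_bound
  have hε2 := half_pos hε
  have hsmall : ∀ r, r < ε / 2 → θ (r / ε) = 0 := fun r hr =>
    hθ.eq_zero _ (by rw [div_lt_iff₀ hε]; linarith)
  -- the indicator makes the radial variable of `H` range over a compact interval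
  set H : ℂ × (ℝ × P) → ℂ := fun x => ((θ (x.2.1 / ε) : ℝ) : ℂ) *
    (Iic R).indicator (fun _ => G (x.1, x.2.2)) x.2.1 with hH
  have hHe : ∀ z r p, r ≤ R → H (z, (r, p)) = ((θ (r / ε) : ℝ) : ℂ) * G (z, p) := fun z r p h => by
    simp only [hH]; rw [indicator_of_mem (mem_Iic.mpr h)]
  have hH0 : ∀ z r p, (r ∉ Icc (ε / 2) R ∨ p ∉ K) → H (z, (r, p)) = 0 := by
    intro z r p h
    rcases lt_or_ge R r with hr | hr
    · simp only [hH]; rw [indicator_of_notMem (show r ∉ Iic R from not_le.mpr hr), mul_zero]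
    rw [hHe z r p hr]
    rcases h with h | h
    · rw [hsmall r (not_le.mp fun h' => h ⟨h', hr⟩)]; simp
    · rw [h0 z p (Or.inr h), mul_zero]
  have hpole := integral_pole_eq (H := H) (C := C₁ * C) ?_ hε2 (fun x => ?_) hK hH0 k
  · have h1 : ∀ x : ℂ × P, H (x.1, (‖x.1‖, x.2)) = ((θ (‖x.1‖ / ε) : ℝ) : ℂ) * G x := by
      intro x
      rcases le_or_gt ‖x.1‖ R with hx | hx
      · exact hHe _ _ _ hx
      · simp only [hH]
        rw [h0 x.1 x.2 (Or.inl hx), indicator_of_notMem (show ‖x.1‖ ∉ Iic R from not_le.mpr hx)]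
    have h2 : ∀ (p : P), ∀ r ∈ Icc (ε / 2) R, ((r : ℂ) ^ (k + 1))⁻¹ * moment k H r (r, p) =
        ((r : ℂ) ^ (k + 1))⁻¹ * (((θ (r / ε) : ℝ) : ℂ) * moment k G r p) := by
      intro p r hr
      congr 1
      rw [moment, moment, ← intervalIntegral.integral_const_mul]
      simp only [hHe _ r p hr.2, mul_left_comm]
    simp only [h1] at hpole
    rw [hpole, integral_congr_ae (Eventually.of_forall fun p =>
      setIntegral_congr_fun measurableSet_Icc (h2 p)), integral_integral_swap,
      setIntegral_eq_of_subset_of_forall_sdiff_eq_zero measurableSet_Ioi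
        (show Icc (ε / 2) R ⊆ Ioi 0 from fun r hr => hε2.trans_le hr.1) fun r hr => ?_]
    · refine setIntegral_congr_fun measurableSet_Icc fun r hr => ?_
      have hr0 : 0 < r := hε2.trans_le hr.1
      rw [integral_const_mul, integral_const_mul, setIntegral_eq_integral_of_forall_compl_eq_zero
        fun p hp => moment_eq_zero hr0 h0 (Or.inr hp) k]
      push_cast
      rw [pow_succ]
      field_simp
    · rcases lt_or_ge r (ε / 2) with h | h
      · rw [hsmall r h]; simp
      · simp [moment_eq_zero hr.1 h0 (Or.inl (not_le.mp fun h' => hr.2 ⟨h, h'⟩))]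
    · rw [Measure.prod_restrict]
      refine Measure.integrableOn_of_bounded (M := ((ε / 2) ^ (k + 1))⁻¹ * (C₁ * (2 * π * C))) ?_ ?_
        ?_
      · rw [Measure.prod_prod]
        exact ENNReal.mul_ne_top hK.measure_lt_top.ne (by simp)
      · have hm : Measurable fun q : P × ℝ => moment k G q.2 q.1 :=
          ((continuous_moment hG.1.continuous k).comp continuous_swap).measurable
        exact (Measurable.mul (by fun_prop) ((Complex.measurable_ofReal.comp
          ((hθ.measurable_div ε).comp measurable_snd)).mul hm)).aestronglyMeasurable
      · filter_upwards [ae_restrict_mem (hK.measurableSet.prod measurableSet_Icc)] with q hq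
        have hq1 : ε / 2 ≤ q.2 := hq.2.1
        rw [Function.uncurry, norm_mul, norm_mul, norm_inv, norm_pow, Complex.norm_real,
          Complex.norm_real, norm_of_nonneg (hε2.le.trans hq1)]
        have hM := norm_moment_le (r := q.2) (p := q.1) k fun t => hC _
        have := hC₁ (q.2 / ε)
        gcongr
        exact this
  · have := hG.1.continuous.measurable
    exact Measurable.mul (Complex.measurable_ofReal.comp ((hθ.measurable_div ε).comp (by fun_prop)))
      (Measurable.ite (measurableSet_Iic.preimage (by fun_prop)) (by fun_prop) measurable_const)
  · rw [norm_mul, Complex.norm_real]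
    exact mul_le_mul (hC₁ _) ((norm_indicator_le_norm_self _ _).trans (hC _)) (norm_nonneg _) hC₁0

/-- The radial density tends to `logCoeff k G` at a linear rate. -/
lemma exists_norm_radial_sub_le {G : ℂ × P → ℂ} (hG : IsTest G) (k : ℕ) : ∃ C, ∀ r : ℝ, 0 < r →
    ‖((r : ℂ) ^ k)⁻¹ * (∫ p, moment k G r p) - logCoeff k G‖ ≤ C * r := by
  obtain ⟨R, hR, K, hK, h0⟩ := hG.exists_support
  obtain ⟨C₂, hC₂0, hC₂⟩ := exists_norm_moment_sub_le k hG
  refine ⟨C₂ * volume.real K, fun r hr => ?_⟩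
  have hr0 : (r : ℂ) ≠ 0 := by exact_mod_cast hr.ne'
  have hi : ∀ f : P → ℂ, Continuous f → IntegrableOn f K := fun f hf =>
    hf.continuousOn.integrableOn_compact hK
  have h3 := norm_setIntegral_le_of_norm_le_const (μ := volume) hK.measure_lt_top
    fun p _ => hC₂ r hr.le p
  rw [integral_sub (hi (moment k G r) ((continuous_moment hG.1.continuous k).comp
    (by fun_prop : Continuous fun p : P => (r, p))))
    ((hi _ (continuous_wirtCoeff hG k)).const_mul _), integral_const_mul,
    setIntegral_eq_integral_of_forall_compl_eq_zero
      fun p hp => moment_eq_zero hr h0 (Or.inr hp) k,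
    setIntegral_eq_integral_of_forall_compl_eq_zero fun p hp => wirtCoeff_eq_zero hG
      (eventually_nhdsWithin_of_forall fun r hr => moment_eq_zero hr h0 (Or.inr hp) k)] at h3
  have h1 : ((r : ℂ) ^ k)⁻¹ * (∫ p, moment k G r p) - logCoeff k G =
      ((r : ℂ) ^ k)⁻¹ * ((∫ p, moment k G r p) - r ^ k * ∫ p, wirtCoeff k G p) := by
    rw [logCoeff]; field_simp
  rw [h1, norm_mul, norm_inv, norm_pow, Complex.norm_real, norm_of_nonneg hr.le]
  refine (mul_le_mul_of_nonneg_left h3 (by positivity)).trans (le_of_eq ?_)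
  field_simp
  ring

/-- The expansion of the integral of `G / (z^{k+1} z̄)` over the complement of a tube `|z| < ε`. The
constant term `B` does not depend on the profile. -/
lemma exists_round_expansion {G : ℂ × P → ℂ} (hG : IsTest G) (k : ℕ) :
    ∃ B : ℂ, ∀ θ, IsProfile θ → ∃ C', ∀ ε, 0 < ε → ε ≤ 1 →
      ‖(∫ x : ℂ × P, ((θ (‖x.1‖ / ε) : ℝ) : ℂ) * G x / (x.1 ^ (k + 1) * conj x.1)) +
        logCoeff k G * log ε - (B + profileConst θ * logCoeff k G)‖ ≤ C' * ε := by
  obtain ⟨R, hR, K, hK, h0⟩ := hG.exists_support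
  obtain ⟨C, hC⟩ := exists_norm_radial_sub_le hG k
  have hNm : Measurable fun r : ℝ => ((r : ℂ) ^ k)⁻¹ * ∫ p, moment k G r p :=
    Measurable.mul (by fun_prop) ((continuous_moment hG.1.continuous
      k).stronglyMeasurable.integral_prod_right' (ν := (volume : Measure P))).measurable
  obtain ⟨B, hB⟩ := exists_radial_expansion hNm hC (R := R) fun r hr => by
    simp [moment_eq_zero (hR.trans hr) h0 (Or.inl hr)]
  refine ⟨B, fun θ hθ => (hB θ hθ).imp fun C' hC' ε hε hε1 => ?_⟩
  rw [integral_profile_eq_radial hG hθ hε]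
  exact hC' ε hε hε1

end Round

/-! ### Dependence of the constant term on the tube -/

/-- A Frullani integral. -/
lemma integral_profile_sub {θ : ℝ → ℝ} (h : IsProfile θ) (α β : ℝ) :
    ∫ r : ℝ, (θ (r * exp α) - θ (r * exp β)) / r = α - β := by
  have hγ : ∀ γ r : ℝ, r * exp γ = r / exp (-γ) := fun γ r => by rw [Real.exp_neg, div_inv_eq_mul]
  have hp : ∀ γ : ℝ, 0 < exp (-γ) := fun γ => exp_pos _
  set b := max (exp (-α)) (exp (-β))
  have hα : exp (-α) ≤ b := le_max_left _ _
  have hβ : exp (-β) ≤ b := le_max_right _ _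
  simp only [hγ, sub_div]
  rw [← setIntegral_eq_integral_of_forall_compl_eq_zero (s := Ioc 0 b),
    integral_sub (h.integrableOn_div (hp α) b) (h.integrableOn_div (hp β) b),
    integral_profile_div h (hp α) hα, integral_profile_div h (hp β) hβ]
  · simp only [Real.log_exp]; ring
  · intro r hr
    rcases le_or_gt r 0 with h0 | h0
    · have : ∀ γ, θ (r / exp (-γ)) = 0 := fun γ => h.eq_zero _
        ((div_nonpos_of_nonpos_of_nonneg h0 (hp γ).le).trans_lt (by norm_num))
      rw [this, this, sub_self]
    · have hbr : b ≤ r := le_of_not_ge fun h' => hr ⟨h0, h'⟩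
      rw [h.eq_one _ ((one_le_div (hp α)).mpr (hα.trans hbr)),
        h.eq_one _ ((one_le_div (hp β)).mpr (hβ.trans hbr)), sub_self]

/-- A smooth profile. -/
def smoothProfile (s : ℝ) : ℝ := Real.smoothTransition (2 * s - 1)

lemma contDiff_smoothProfile : ContDiff ℝ ∞ smoothProfile :=
  Real.smoothTransition.contDiff.comp (by fun_prop)

lemma isProfile_smoothProfile : IsProfile smoothProfile where
  measurable := contDiff_smoothProfile.continuous.measurable
  bdd := ⟨1, fun _ => by
    rw [smoothProfile, abs_of_nonneg (Real.smoothTransition.nonneg _)]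
    exact Real.smoothTransition.le_one _⟩
  eq_zero _ hs := Real.smoothTransition.zero_of_nonpos (by linarith)
  eq_one _ hs := Real.smoothTransition.one_of_one_le (by linarith)

/-- The smooth function `s Θ'(s)`, where `Θ` is the smooth profile. -/
def logDerivProfile (s : ℝ) : ℝ := s * deriv smoothProfile s

lemma contDiff_logDerivProfile : ContDiff ℝ ∞ logDerivProfile :=
  contDiff_id.mul ((contDiff_infty_iff_deriv.mp contDiff_smoothProfile).2)

lemma logDerivProfile_eq_zero {s : ℝ} (hs : s < 1 / 2 ∨ 1 ≤ s) : logDerivProfile s = 0 := by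
  rw [logDerivProfile]
  suffices h : deriv smoothProfile s = 0 by rw [h, mul_zero]
  rcases hs with hs | hs
  · have h1 : smoothProfile =ᶠ[𝓝 s] fun _ => 0 := by
      filter_upwards [Iio_mem_nhds hs] with t ht using isProfile_smoothProfile.eq_zero t ht
    rw [h1.deriv_eq]; simp
  · have h2 : IsLocalMax smoothProfile s := Eventually.of_forall fun t => by
      rw [isProfile_smoothProfile.eq_one s hs]
      exact Real.smoothTransition.le_one _
    exact h2.deriv_eq_zero

lemma isProfile_add_logDerivProfile : IsProfile fun s => smoothProfile s + logDerivProfile s where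
  measurable := (contDiff_smoothProfile.add contDiff_logDerivProfile).continuous.measurable
  bdd := by
    obtain ⟨C₁, h1⟩ := isProfile_smoothProfile.bdd
    obtain ⟨C₂, h2⟩ := isCompact_Icc.exists_bound_of_continuousOn (s := Icc (1 / 2 : ℝ) 1)
      contDiff_logDerivProfile.continuous.continuousOn
    refine ⟨C₁ + max C₂ 0, fun s => (abs_add_le _ _).trans (add_le_add (h1 s) ?_)⟩
    by_cases hs : s < 1 / 2 ∨ 1 ≤ s
    · rw [logDerivProfile_eq_zero hs, abs_zero]; exact le_max_right _ _
    · push Not at hs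
      exact (h2 s ⟨hs.1, hs.2.le⟩).trans (le_max_left _ _)
  eq_zero s hs := by
    rw [isProfile_smoothProfile.eq_zero s hs, logDerivProfile_eq_zero (Or.inl hs), add_zero]
  eq_one s hs := by
    rw [isProfile_smoothProfile.eq_one s hs, logDerivProfile_eq_zero (Or.inr hs), add_zero]

/-- Integration of `Θ'` from `0` to `1`; this is why shells around `D` detect the coefficient of the
logarithm. -/
lemma profileConst_add_logDerivProfile :
    profileConst (fun s => smoothProfile s + logDerivProfile s) - profileConst smoothProfile = 1 := by
  have hint : ∀ θ, IsProfile θ → IntegrableOn (fun s => θ s / s) (Ioc 0 1) := fun θ hθ => by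
    simpa using hθ.integrableOn_div one_pos 1
  rw [profileConst, profileConst, ← integral_sub (hint _ isProfile_add_logDerivProfile)
    (hint _ isProfile_smoothProfile)]
  have h1 : ∀ s ∈ Ioc (0 : ℝ) 1, (smoothProfile s + logDerivProfile s) / s - smoothProfile s / s =
      deriv smoothProfile s := by
    intro s hs
    rw [logDerivProfile]
    have := hs.1.ne'
    field_simp
    ring
  rw [setIntegral_congr_fun measurableSet_Ioc h1, ← intervalIntegral.integral_of_le zero_le_one,
    intervalIntegral.integral_deriv_eq_sub]
  · rw [isProfile_smoothProfile.eq_one 1 le_rfl, isProfile_smoothProfile.eq_zero 0 (by norm_num),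
      sub_zero]
  · exact fun x _ => (contDiff_smoothProfile.differentiable (by simp)).differentiableAt
  · exact (contDiff_smoothProfile.continuous_deriv (by simp)).intervalIntegrable _ _

section Comparison

variable {P : Type*} [NormedAddCommGroup P] [NormedSpace ℝ P] [MeasureSpace P] [BorelSpace P]
  [SecondCountableTopology P] [SigmaFinite (volume : Measure P)]
  [IsFiniteMeasureOnCompacts (volume : Measure P)]

/-- Polar coordinates followed by the substitution `|z| = ε r`. -/
lemma scaled_integral_eq {Q : ℂ × (ℝ × P) → ℂ} (hQ : IsTest Q) {a b : ℝ} (ha : 0 < a)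
    (hab : a ≤ b) {K : Set P} (hK : IsCompact K)
    (h0 : ∀ z r p, (r ∉ Icc a b ∨ p ∉ K) → Q (z, (r, p)) = 0) (k : ℕ) {ε : ℝ} (hε : 0 < ε) :
    ∫ x : ℂ × P, Q (x.1, (‖x.1‖ / ε, x.2)) / (x.1 ^ (k + 1) * conj x.1) =
    ∫ p in K, ∫ r in Icc a b, (((ε * r : ℝ) : ℂ) ^ k * r)⁻¹ * moment k Q (ε * r) (r, p) := by
  obtain ⟨C, hC0, hC⟩ := hQ.exists_bound
  have hQm := hQ.1.continuous.measurable
  have hε0 : (ε : ℂ) ≠ 0 := by exact_mod_cast hε.ne'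
  have h1 := integral_pole_eq (H := fun x : ℂ × (ℝ × P) => Q (x.1, (x.2.1 / ε, x.2.2))) (a := ε * a)
    (b := ε * b) (by fun_prop) (by positivity) (fun x => hC _) hK (fun z r p h =>
      h0 _ _ _ (h.imp_left fun h h' => h ⟨(le_div_iff₀' hε).mp h'.1, (div_le_iff₀' hε).mp h'.2⟩)) k
  refine h1.trans (integral_congr_ae (Eventually.of_forall fun p => ?_))
  beta_reduce
  rw [integral_Icc_eq_integral_Ioc, integral_Icc_eq_integral_Ioc,
    ← intervalIntegral.integral_of_le hab, ← intervalIntegral.integral_of_le (by gcongr),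
    ← intervalIntegral.smul_integral_comp_mul_left, ← intervalIntegral.integral_smul]
  refine intervalIntegral.integral_congr fun r hr => ?_
  rw [uIcc_of_le hab] at hr
  have hr0 : (r : ℂ) ≠ 0 := by exact_mod_cast (ha.trans_le hr.1).ne'
  have h3 : moment k (fun x : ℂ × (ℝ × P) => Q (x.1, (x.2.1 / ε, x.2.2))) (ε * r) (ε * r, p) =
      moment k Q (ε * r) (r, p) := by
    simp only [moment, mul_div_cancel_left₀ r hε.ne']
  rw [h3, real_smul, pow_succ]
  push_cast
  field_simp

/-- The Wirtinger coefficient of a superposition of test functions. -/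
lemma wirtCoeff_superposition {Q : ℂ × (ℝ × P) → ℂ} (hQ : IsTest Q) {a b : ℝ} (ha : 0 < a) (k : ℕ)
    {S : ℂ × P → ℂ} (hS : IsTest S)
    (hQS : ∀ x, S x = ∫ r in Icc a b, (r : ℂ)⁻¹ * Q (x.1, (r, x.2))) (p : P) :
    wirtCoeff k S p = ∫ r in Icc a b, (r : ℂ)⁻¹ * wirtCoeff k Q (r, p) := by
  obtain ⟨C, hC0, hC⟩ := exists_norm_moment_sub_le k hQ
  have hinv : ContinuousOn (fun r : ℝ => (r : ℂ)⁻¹) (Icc a b) :=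
    Complex.continuous_ofReal.continuousOn.inv₀ fun r hr =>
      Complex.ofReal_ne_zero.mpr (ha.trans_le hr.1).ne'
  have hi : ∀ f : ℝ → ℂ, Continuous f → IntegrableOn (fun r : ℝ => (r : ℂ)⁻¹ * f r) (Icc a b) :=
    fun f hf => (hinv.mul hf.continuousOn).integrableOn_compact isCompact_Icc
  refine eq_wirtCoeff hS (C := a⁻¹ * C * volume.real (Icc a b)) ?_
  filter_upwards [self_mem_nhdsWithin] with s hs
  have hm : moment k S s p = ∫ r in Icc a b, (r : ℂ)⁻¹ * moment k Q s (r, p) := by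
    have h1 : ∀ t : ℝ, Complex.exp (-(t * I)) ^ k * S (circleMap 0 s t, p) = ∫ r in Icc a b,
        (r : ℂ)⁻¹ * (Complex.exp (-(t * I)) ^ k * Q (circleMap 0 s t, (r, p))) := fun t => by
      rw [hQS, ← integral_const_mul]
      simp only [mul_left_comm]
    rw [moment]
    simp only [h1]
    rw [intervalIntegral_integral_swap]
    · simp only [intervalIntegral.integral_const_mul, moment]
    · have hQc := hQ.1.continuous
      rw [Measure.prod_restrict]
      refine IntegrableOn.mono_set (t := uIcc (-π) π ×ˢ Icc a b) ?_ (prod_mono uIoc_subset_uIcc le_rfl)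
      refine ContinuousOn.integrableOn_compact (isCompact_uIcc.prod isCompact_Icc) ?_
      refine (hinv.comp continuousOn_snd fun q hq => hq.2).mul (Continuous.continuousOn ?_)
      unfold circleMap
      fun_prop
  have hi₁ := hi (fun r => moment k Q s (r, p)) ((continuous_moment hQ.1.continuous k).comp
    (by fun_prop : Continuous fun r : ℝ => (s, (r, p))))
  have hi₂ := hi (fun r => wirtCoeff k Q (r, p)) ((continuous_wirtCoeff hQ k).comp
    (by fun_prop : Continuous fun r : ℝ => (r, p)))
  rw [hm, ← integral_const_mul, ← integral_sub hi₁ (hi₂.const_mul _)]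
  refine (norm_setIntegral_le_of_norm_le_const (C := a⁻¹ * (C * s ^ (k + 1)))
    isCompact_Icc.measure_lt_top fun r hr => ?_).trans (le_of_eq (by ring))
  have := hC s (le_of_lt hs) (r, p)
  rw [mul_left_comm, ← mul_sub, norm_mul, norm_inv, Complex.norm_real,
    norm_of_nonneg (ha.le.trans hr.1)]
  exact mul_le_mul (by gcongr; exact hr.1) this (norm_nonneg _) (by positivity)

/-- The scaling limit: as `ε → 0`, the substitution `z = ε ζ` reduces the integral of
`Q(z, |z|/ε, p) / (z^{k+1} z̄)` to the `k`-th angular moments of `Q`. -/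
lemma tendsto_scaled_integral {Q : ℂ × (ℝ × P) → ℂ} (hQ : IsTest Q) {a b : ℝ} (ha : 0 < a)
    (hab : a ≤ b) {K : Set P} (hK : IsCompact K)
    (h0 : ∀ z r p, (r ∉ Icc a b ∨ p ∉ K) → Q (z, (r, p)) = 0) (k : ℕ) {S : ℂ × P → ℂ}
    (hS : IsTest S) (hQS : ∀ x, S x = ∫ r in Icc a b, (r : ℂ)⁻¹ * Q (x.1, (r, x.2))) :
    Tendsto (fun ε : ℝ => ∫ x : ℂ × P, Q (x.1, (‖x.1‖ / ε, x.2)) / (x.1 ^ (k + 1) * conj x.1))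
      (𝓝[>] 0) (𝓝 (logCoeff k S)) := by
  obtain ⟨C, hC0, hC⟩ := exists_norm_moment_sub_le k hQ
  have hpos : ∀ q ∈ K ×ˢ Icc a b, 0 < q.2 := fun q hq => ha.trans_le hq.2.1
  have hprod : ∀ c f : P × ℝ → ℂ, Continuous c → Continuous f → (∀ q ∈ K ×ˢ Icc a b, c q ≠ 0) →
      IntegrableOn (fun q => (c q)⁻¹ * f q) (K ×ˢ Icc a b) := fun c f hc hf hc0 =>
    ((hc.continuousOn.inv₀ hc0).mul hf.continuousOn).integrableOn_compact (hK.prod isCompact_Icc)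
  have hL := hprod (fun q => q.2) (fun q => wirtCoeff k Q (q.2, q.1)) (by fun_prop)
    ((continuous_wirtCoeff hQ k).comp continuous_swap)
    fun q hq => Complex.ofReal_ne_zero.mpr (hpos q hq).ne'
  have hlog : logCoeff k S = ∫ q in K ×ˢ Icc a b, (q.2 : ℂ)⁻¹ * wirtCoeff k Q (q.2, q.1) := by
    rw [Measure.volume_eq_prod, setIntegral_prod _ hL, logCoeff,
      ← setIntegral_eq_integral_of_forall_compl_eq_zero (s := K)]
    · simp only [wirtCoeff_superposition hQ ha k hS hQS]
    · intro p hp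
      refine wirtCoeff_eq_zero hS (Eventually.of_forall fun r => ?_)
      simp [moment, hQS, h0 _ _ p (Or.inr hp)]
  rw [tendsto_iff_norm_sub_tendsto_zero]
  refine squeeze_zero' (Eventually.of_forall fun _ => norm_nonneg _) ?_
    (tendsto_mul_nhdsGT_zero (C * volume.real (K ×ˢ Icc a b)))
  filter_upwards [self_mem_nhdsWithin] with ε hε
  have hε0 : 0 < ε := hε
  have hJ := hprod (fun q => ((ε * q.2 : ℝ) : ℂ) ^ k * q.2) (fun q => moment k Q (ε * q.2) (q.2, q.1))
    (by fun_prop) ((continuous_moment hQ.1.continuous k).comp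
      (by fun_prop : Continuous fun q : P × ℝ => (ε * q.2, (q.2, q.1)))) fun q hq => by
        have := hpos q hq
        exact_mod_cast (by positivity : (ε * q.2) ^ k * q.2 ≠ 0)
  rw [scaled_integral_eq hQ ha hab hK h0 k hε, hlog]
  rw [Measure.volume_eq_prod] at hJ hL ⊢
  rw [← setIntegral_prod _ hJ, ← integral_sub hJ hL]
  refine (norm_setIntegral_le_of_norm_le_const (C := C * ε) (hK.prod isCompact_Icc).measure_lt_top
    fun q hq => ?_).trans (le_of_eq (by ring))
  have hq0 := hpos q hq
  have hq1 : (q.2 : ℂ) ≠ 0 := by exact_mod_cast hq0.ne'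
  have hε1 : (ε : ℂ) ≠ 0 := by exact_mod_cast hε0.ne'
  have h1 : (((ε * q.2 : ℝ) : ℂ) ^ k * q.2)⁻¹ * moment k Q (ε * q.2) (q.2, q.1) -
      (q.2 : ℂ)⁻¹ * wirtCoeff k Q (q.2, q.1) = (((ε * q.2) ^ k * q.2 : ℝ) : ℂ)⁻¹ *
        (moment k Q (ε * q.2) (q.2, q.1) - ((ε * q.2 : ℝ) : ℂ) ^ k * wirtCoeff k Q (q.2, q.1)) := by
    push_cast
    field_simp
  rw [h1, norm_mul, norm_inv, Complex.norm_real, norm_of_nonneg (by positivity),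
    inv_mul_le_iff₀ (by positivity)]
  exact (hC _ (by positivity) _).trans (le_of_eq (by ring))

/-- Comparison of two tubes `|z| e^{ψ₁} < ε` and `|z| e^{ψ₂} < ε`. -/
lemma tendsto_tube_difference {G : ℂ × P → ℂ} (hG : IsTest G) {ψ₁ ψ₂ : ℂ × P → ℝ}
    (h₁ : ContDiff ℝ ∞ ψ₁) (h₂ : ContDiff ℝ ∞ ψ₂) (k : ℕ) :
    Tendsto (fun ε : ℝ => ∫ x : ℂ × P, ((smoothProfile (‖x.1‖ / ε * exp (ψ₂ x)) -
        smoothProfile (‖x.1‖ / ε * exp (ψ₁ x)) : ℝ) : ℂ) * G x /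
        (x.1 ^ (k + 1) * conj x.1)) (𝓝[>] 0)
      (𝓝 (logCoeff k fun x => ((ψ₂ x - ψ₁ x : ℝ) : ℂ) * G x)) := by
  obtain ⟨R, hR, K, hK, hGK⟩ := hG.exists_support
  obtain ⟨M, hM0, hM⟩ : ∃ M : ℝ, 0 ≤ M ∧ ∀ x ∈ tsupport G, |ψ₁ x| ≤ M ∧ |ψ₂ x| ≤ M := by
    obtain ⟨M₁, h1⟩ := hG.2.isCompact.exists_bound_of_continuousOn h₁.continuous.continuousOn
    obtain ⟨M₂, h2⟩ := hG.2.isCompact.exists_bound_of_continuousOn h₂.continuous.continuousOn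
    exact ⟨max 0 (max M₁ M₂), le_max_left _ _, fun x hx => ⟨(h1 x hx).trans (by simp),
      (h2 x hx).trans (by simp)⟩⟩
  set T : ℂ × (ℝ × P) → ℝ := fun x => smoothProfile (x.2.1 * exp (ψ₂ (x.1, x.2.2))) -
    smoothProfile (x.2.1 * exp (ψ₁ (x.1, x.2.2))) with hT
  -- the two profiles only differ for `|z|/ε` in `[a, b]`
  set a := exp (-M) / 2 with ha
  set b := exp M with hb
  have ha0 : 0 < a := by positivity
  have hMM : exp (-M) * exp M = 1 := by rw [← Real.exp_add]; simp
  have hab : a ≤ b := (half_le_self (exp_pos _).le).trans (Real.exp_le_exp.mpr (by linarith))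
  have hsmall : ∀ r < a, ∀ ψ : ℝ, |ψ| ≤ M → smoothProfile (r * exp ψ) = 0 := by
    intro r hr ψ hψ
    refine isProfile_smoothProfile.eq_zero _ ?_
    rcases le_or_gt r 0 with h | h
    · nlinarith [exp_pos ψ]
    · calc r * exp ψ ≤ r * exp M :=
            mul_le_mul_of_nonneg_left (Real.exp_le_exp.mpr (le_of_abs_le hψ)) h.le
        _ < a * exp M := mul_lt_mul_of_pos_right hr (exp_pos _)
        _ = 1 / 2 := by rw [ha]; linear_combination hMM / 2
  have hbig : ∀ r, b < r → ∀ ψ : ℝ, |ψ| ≤ M → smoothProfile (r * exp ψ) = 1 := by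
    intro r hr ψ hψ
    refine isProfile_smoothProfile.eq_one _ ?_
    calc (1 : ℝ) = b * exp (-M) := by rw [hb]; linear_combination -hMM
      _ ≤ r * exp ψ := mul_le_mul hr.le (Real.exp_le_exp.mpr (neg_le_of_abs_le hψ))
          (exp_pos _).le ((exp_pos _).le.trans hr.le)
  set Q : ℂ × (ℝ × P) → ℂ := fun x => ((T x : ℝ) : ℂ) * G (x.1, x.2.2) with hQ
  have hQr : ∀ z r p, r ∉ Icc a b → Q (z, (r, p)) = 0 := by
    intro z r p hr
    simp only [hQ]
    by_cases hx : (z, p) ∈ tsupport G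
    · have : T (z, (r, p)) = 0 := by
        simp only [hT]
        rcases lt_or_ge r a with h | h
        · rw [hsmall r h _ (hM _ hx).1, hsmall r h _ (hM _ hx).2, sub_self]
        · have h' : b < r := not_le.mp fun h' => hr ⟨h, h'⟩
          rw [hbig r h' _ (hM _ hx).1, hbig r h' _ (hM _ hx).2, sub_self]
      rw [this]; simp
    · rw [image_eq_zero_of_notMem_tsupport hx, mul_zero]
  have hQ0 : ∀ z r p, (r ∉ Icc a b ∨ p ∉ K) → Q (z, (r, p)) = 0 := fun z r p h =>
    h.elim (hQr z r p) fun h => by simp only [hQ]; rw [hGK z p (Or.inr h), mul_zero]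
  have hθ := contDiff_smoothProfile
  have hG1 := hG.1
  have hQt : IsTest Q := by
    refine ⟨ofRealCLM.contDiff.comp (by fun_prop : ContDiff ℝ ∞ T) |>.mul (by fun_prop),
      HasCompactSupport.intro ((isCompact_closedBall (0 : ℂ) R).prod
        ((isCompact_Icc (a := a) (b := b)).prod hK)) ?_⟩
    rintro ⟨z, r, p⟩ hx
    by_cases hz : ‖z‖ ≤ R
    · refine hQ0 z r p ?_
      by_contra h
      push Not at h
      exact hx ⟨by simpa using hz, h.1, h.2⟩
    · simp only [hQ]
      rw [hGK z p (Or.inl (not_le.mp hz)), mul_zero]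
  refine tendsto_scaled_integral hQt ha0 hab hK hQ0 k
    ⟨(ofRealCLM.contDiff.comp (h₂.sub h₁)).mul hG1, hG.2.mul_left⟩ fun x => ?_
  rw [setIntegral_eq_integral_of_forall_compl_eq_zero fun r hr => by rw [hQr _ _ _ hr, mul_zero],
    ← integral_profile_sub isProfile_smoothProfile, ← integral_complex_ofReal, ← integral_mul_const]
  refine integral_congr_ae (Eventually.of_forall fun r => ?_)
  simp only [hQ, hT]
  push_cast
  ring

end Comparison

/-! ### Straightening a tube -/

lemma contDiff_clm_det {E : Type*} [NormedAddCommGroup E] [NormedSpace ℝ E]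
    [FiniteDimensional ℝ E] {k : WithTop ℕ∞} : ContDiff ℝ k fun f : E →L[ℝ] E => f.det := by
  set b := Module.finBasis ℝ E
  have h : (fun f : E →L[ℝ] E => f.det) = fun f : E →L[ℝ] E =>
      ∑ s : Equiv.Perm (Fin (Module.finrank ℝ E)), ((Equiv.Perm.sign s : ℤ) : ℝ) *
        ∏ i, b.coord (s i) (f (b i)) := by
    funext f
    rw [ContinuousLinearMap.det, ← LinearMap.det_toMatrix b, Matrix.det_apply']
    simp [LinearMap.toMatrix_apply]
  rw [h]
  refine ContDiff.sum fun s _ => contDiff_const.mul (contDiff_prod fun i _ => ?_)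
  exact (LinearMap.toContinuousLinearMap (b.coord (s i))).contDiff.comp
    (ContinuousLinearMap.apply ℝ E (b i)).contDiff

section Tube

variable {P : Type*} [NormedAddCommGroup P] [NormedSpace ℝ P] [MeasureSpace P] [BorelSpace P]
  [FiniteDimensional ℝ P] [SecondCountableTopology P] [ProperSpace P]
  [SigmaFinite (volume : Measure P)] [(volume : Measure P).IsAddHaarMeasure]

/-- The map `(z, p) ↦ (z e^{ψ(z, p)}, p)`, which straightens the tube `|z| e^ψ < ε`. -/
def straighten (ψ : ℂ × P → ℝ) (x : ℂ × P) : ℂ × P := (x.1 * exp (ψ x), x.2)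

lemma contDiff_exp_ofReal {ψ : ℂ × P → ℝ} (hψ : ContDiff ℝ ∞ ψ) :
    ContDiff ℝ ∞ fun x => ((exp (ψ x) : ℝ) : ℂ) :=
  ofRealCLM.contDiff.comp hψ.exp

lemma contDiff_straighten {ψ : ℂ × P → ℝ} (hψ : ContDiff ℝ ∞ ψ) :
    ContDiff ℝ ∞ (straighten ψ) :=
  (contDiff_fst.mul (contDiff_exp_ofReal hψ)).prodMk contDiff_snd

/-- At the points of `{0} × P` the differential of the straightening is invertible. -/
lemma hasFDerivAt_straighten {ψ : ℂ × P → ℝ} (hψ : ContDiff ℝ ∞ ψ) (p : P) :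
    ∃ L : (ℂ × P) ≃L[ℝ] (ℂ × P), HasFDerivAt (straighten ψ) (L : (ℂ × P) →L[ℝ] (ℂ × P)) (0, p) := by
  set c : ℂ := ((exp (ψ (0, p)) : ℝ) : ℂ) with hc
  have hc0 : c ≠ 0 := by rw [hc]; exact_mod_cast (exp_pos _).ne'
  refine ⟨((ContinuousLinearEquiv.unitsEquivAut ℂ (Units.mk0 c hc0)).restrictScalars ℝ).prodCongr
    (ContinuousLinearEquiv.refl ℝ P), ?_⟩
  have h1 := ((hasFDerivAt_fst (𝕜 := ℝ) (p := ((0 : ℂ), p))).mul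
    (((contDiff_exp_ofReal hψ).differentiable (by simp)) ((0 : ℂ), p)).hasFDerivAt).prodMk
    (hasFDerivAt_snd (𝕜 := ℝ) (p := ((0 : ℂ), p)))
  refine HasFDerivAt.congr_fderiv h1 ?_
  refine ContinuousLinearMap.ext fun x => Prod.ext ?_ ?_
  · simp [← hc, mul_comm]
  · simp

/-- Around each point of `{0} × P` the tube can be straightened. -/
lemma exists_straighten {ψ : ℂ × P → ℝ} (hψ : ContDiff ℝ ∞ ψ) (p : P) :
    ∃ e : OpenPartialHomeomorph (ℂ × P) (ℂ × P), (0, p) ∈ e.source ∧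
      (∀ x, e x = straighten ψ x) ∧ ContDiffOn ℝ ∞ e.symm e.target ∧
      ∀ y ∈ e.target, (fderiv ℝ e.symm y).det ≠ 0 := by
  obtain ⟨L, hL⟩ := hasFDerivAt_straighten hψ p
  have hT := contDiff_straighten hψ
  set e₀ := hT.contDiffAt.toOpenPartialHomeomorph (straighten ψ) hL (by simp) with he₀
  have hV : IsOpen {x | (fderiv ℝ (straighten ψ) x).det ≠ 0} :=
    isOpen_ne.preimage (ContinuousLinearMap.continuous_det.comp (hT.continuous_fderiv (by simp)))
  set e := e₀.restrOpen _ hV with he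
  have hmem : (0, p) ∈ e.source := by
    rw [he, OpenPartialHomeomorph.restrOpen_source]
    refine ⟨hT.contDiffAt.mem_toOpenPartialHomeomorph_source hL (by simp), ?_⟩
    rw [mem_ofPred_eq, hL.fderiv]
    exact (L.toLinearEquiv.isUnit_det').ne_zero
  have heT : ∀ x, e x = straighten ψ x := fun x => rfl
  have hkey : ∀ y ∈ e.target, ∃ L : (ℂ × P) ≃L[ℝ] (ℂ × P),
      HasFDerivAt e (L : (ℂ × P) →L[ℝ] (ℂ × P)) (e.symm y) := by
    intro y hy
    have h1 := e.map_target hy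
    rw [he, OpenPartialHomeomorph.restrOpen_source] at h1
    refine ⟨(fderiv ℝ (straighten ψ) (e.symm y)).toContinuousLinearEquivOfDetNeZero h1.2, ?_⟩
    rw [ContinuousLinearMap.coe_toContinuousLinearEquivOfDetNeZero]
    exact ((hT.differentiable (by simp)).differentiableAt).hasFDerivAt
  refine ⟨e, hmem, heT, fun y hy => ?_, fun y hy => ?_⟩
  · obtain ⟨L, hL⟩ := hkey y hy
    exact (e.contDiffAt_symm hy hL hT.contDiffAt).contDiffWithinAt
  · obtain ⟨L, hL⟩ := hkey y hy
    rw [(e.hasFDerivAt_symm hy hL).fderiv]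
    exact (L.symm.toLinearEquiv.isUnit_det').ne_zero

/-- The density `G` transported by the straightening. -/
def straightenDensity (e : OpenPartialHomeomorph (ℂ × P) (ℂ × P)) (ψ : ℂ × P → ℝ) (k : ℕ)
    (G : ℂ × P → ℂ) : ℂ × P → ℂ :=
  e.target.indicator fun y => ((|(fderiv ℝ e.symm y).det| * exp ((k + 2) * ψ (e.symm y)) : ℝ) : ℂ) *
    G (e.symm y)

variable {e : OpenPartialHomeomorph (ℂ × P) (ℂ × P)} {ψ : ℂ × P → ℝ} {G : ℂ × P → ℂ}

lemma isTest_straightenDensity (hψ : ContDiff ℝ ∞ ψ)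
    (hs : ContDiffOn ℝ ∞ e.symm e.target) (hd : ∀ y ∈ e.target, (fderiv ℝ e.symm y).det ≠ 0)
    (hG : IsTest G) (hGe : tsupport G ⊆ e.source) (k : ℕ) :
    IsTest (straightenDensity e ψ k G) := by
  refine contDiff_indicator (K := e '' tsupport G) e.open_target
    (hG.2.isCompact.image_of_continuousOn (e.continuousOn.mono hGe)) ?_ ?_ ?_
  · rintro _ ⟨x, hx, rfl⟩
    exact e.map_source (hGe hx)
  · intro y hy
    have h1 : ContDiffAt ℝ ∞ e.symm y := hs.contDiffAt (e.open_target.mem_nhds hy)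
    have h2 : ContDiffAt ℝ ∞ (fun y => (fderiv ℝ e.symm y).det) y :=
      contDiff_clm_det.contDiffAt.comp y (h1.fderiv_right (by simp))
    have h3 : ContDiffAt ℝ ∞ (fun y => exp ((k + 2) * ψ (e.symm y))) y :=
      Real.contDiff_exp.contDiffAt.comp y (contDiffAt_const.mul (hψ.contDiffAt.comp y h1))
    exact ((ofRealCLM.contDiff.contDiffAt.comp y ((h2.abs (hd y hy)).mul h3)).mul
      (hG.1.contDiffAt.comp y h1)).contDiffWithinAt
  · intro y hy hyK
    have : G (e.symm y) = 0 := by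
      by_contra h
      exact hyK ⟨e.symm y, subset_tsupport G h, e.right_inv hy⟩
    rw [this, mul_zero]

/-- Change of variables by the straightening map. -/
lemma integral_straighten (he : ∀ x, e x = straighten ψ x)
    (hs : ContDiffOn ℝ ∞ e.symm e.target)
    (hGe : tsupport G ⊆ e.source) (k : ℕ) (θ : ℝ → ℝ) (ε : ℝ) :
    ∫ x : ℂ × P, ((θ (‖x.1‖ / ε * exp (ψ x)) : ℝ) : ℂ) * G x /
        (x.1 ^ (k + 1) * conj x.1) =
      ∫ y : ℂ × P, ((θ (‖y.1‖ / ε) : ℝ) : ℂ) * straightenDensity e ψ k G y /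
        (y.1 ^ (k + 1) * conj y.1) := by
  have hsymm : ∀ y ∈ e.target, y.1 = (e.symm y).1 * exp (ψ (e.symm y)) := by
    intro y hy
    have h := he (e.symm y)
    rw [e.right_inv hy] at h
    exact congrArg Prod.fst h
  have h1 : ∀ x, x ∉ e.source → ((θ (‖x.1‖ / ε * exp (ψ x)) : ℝ) : ℂ) * G x /
      (x.1 ^ (k + 1) * conj x.1) = 0 := fun x hx => by
    rw [image_eq_zero_of_notMem_tsupport fun h => hx (hGe h)]; simp
  have h2 : ∀ y, y ∉ e.target → ((θ (‖y.1‖ / ε) : ℝ) : ℂ) * straightenDensity e ψ k G y /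
      (y.1 ^ (k + 1) * conj y.1) = 0 := fun y hy => by
    have : straightenDensity e ψ k G y = 0 := indicator_of_notMem hy _
    rw [this]; simp
  have : (volume : Measure (ℂ × P)).IsAddHaarMeasure := by
    rw [Measure.volume_eq_prod]; infer_instance
  rw [← setIntegral_eq_integral_of_forall_compl_eq_zero h1,
    ← setIntegral_eq_integral_of_forall_compl_eq_zero h2]
  nth_rw 1 [← e.symm_image_target_eq_source]
  rw [integral_image_eq_integral_abs_det_fderiv_smul volume e.open_target.measurableSet
      (fun y hy => (((hs.contDiffAt (e.open_target.mem_nhds hy)).differentiableAt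
        (by simp)).hasFDerivAt).hasFDerivWithinAt) e.symm.injOn]
  refine setIntegral_congr_fun e.open_target.measurableSet fun y hy => ?_
  have hpos := exp_pos (ψ (e.symm y))
  have hn : ‖y.1‖ / ε = ‖(e.symm y).1‖ / ε * exp (ψ (e.symm y)) := by
    rw [hsymm y hy, norm_mul, Complex.norm_real, norm_of_nonneg hpos.le]; ring
  have hexp : exp ((k + 2) * ψ (e.symm y)) = exp (ψ (e.symm y)) ^ (k + 2) := by
    rw [← Real.exp_nat_mul]; push_cast; ring_nf
  have hden : straightenDensity e ψ k G y = ((|(fderiv ℝ e.symm y).det| *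
      exp ((k + 2) * ψ (e.symm y)) : ℝ) : ℂ) * G (e.symm y) := indicator_of_mem hy _
  rw [hden, hn, hexp]
  generalize θ (‖(e.symm y).1‖ / ε * exp (ψ (e.symm y))) = t
  rw [hsymm y hy, map_mul, Complex.conj_ofReal, real_smul]
  have h0 : ((exp (ψ (e.symm y)) : ℝ) : ℂ) ≠ 0 := by exact_mod_cast hpos.ne'
  rcases eq_or_ne (e.symm y).1 0 with hz | hz
  · simp [hz]
  · have hz' : conj (e.symm y).1 ≠ 0 := by simpa using hz
    push_cast
    rw [mul_pow, pow_succ _ (k + 1)]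
    field_simp

lemma integrable_tube (hψ : ContDiff ℝ ∞ ψ) (hG : IsTest G) (k : ℕ) {θ : ℝ → ℝ}
    (hθ : IsProfile θ) {ε : ℝ} (hε : 0 < ε) :
    Integrable fun x : ℂ × P => ((θ (‖x.1‖ / ε * exp (ψ x)) : ℝ) : ℂ) * G x /
      (x.1 ^ (k + 1) * conj x.1) := by
  obtain ⟨C, hC0, hC⟩ := hG.exists_bound
  obtain ⟨M, hM⟩ := hG.2.isCompact.exists_bound_of_continuousOn hψ.continuous.continuousOn
  obtain ⟨C₁, hC₁0, hC₁, -⟩ := hθ.exists_bound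
  have hψc := hψ.continuous
  have h1 : Measurable fun x : ℂ × P => θ (‖x.1‖ / ε * exp (ψ x)) :=
    hθ.measurable.comp (Continuous.measurable (by fun_prop))
  refine integrable_pole (H := fun x => ((θ (‖x.1‖ / ε * exp (ψ x)) : ℝ) : ℂ) * G x) (C := C₁ * C)
    (a := ε / 2 * exp (-M))
    ((Complex.measurable_ofReal.comp h1).mul hG.1.continuous.measurable) (by positivity)
    (fun x => ?_) hG.2.isCompact (fun x hx => ?_) (fun x hx => ?_) k
  · rw [norm_mul, Complex.norm_real]
    exact mul_le_mul (hC₁ _) (hC x) (norm_nonneg _) hC₁0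
  · rw [image_eq_zero_of_notMem_tsupport hx, mul_zero]
  · by_cases hxG : x ∈ tsupport G
    · rw [hθ.eq_zero _ ?_, ofReal_zero, zero_mul]
      calc ‖x.1‖ / ε * exp (ψ x) ≤ ‖x.1‖ / ε * exp M := mul_le_mul_of_nonneg_left
            (Real.exp_le_exp.mpr (le_of_abs_le (hM x hxG))) (by positivity)
        _ < ε / 2 * exp (-M) / ε * exp M := by gcongr
        _ = 1 / 2 := by rw [Real.exp_neg]; field_simp
    · rw [image_eq_zero_of_notMem_tsupport hxG, mul_zero]

/-- Expansion of the integral over the complement of the tube `|z| e^ψ < ε`, for densities supported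
near a given point. The coefficient of `log ε` does not depend on `ψ`. -/
lemma exists_tube_expansion (hψ : ContDiff ℝ ∞ ψ) (x₀ : ℂ × P) :
    ∃ V : Set (ℂ × P), IsOpen V ∧ x₀ ∈ V ∧ ∀ G : ℂ × P → ℂ, IsTest G → tsupport G ⊆ V → ∀ k,
      ∃ B : ℂ, ∀ θ, IsProfile θ → ∃ C' ε₀, 0 < ε₀ ∧ ∀ ε, 0 < ε → ε ≤ ε₀ →
        ‖(∫ x : ℂ × P, ((θ (‖x.1‖ / ε * exp (ψ x)) : ℝ) : ℂ) * G x /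
            (x.1 ^ (k + 1) * conj x.1)) +
          logCoeff k G * log ε - (B + profileConst θ * logCoeff k G)‖ ≤ C' * ε := by
  rcases eq_or_ne x₀.1 0 with h0 | h0
  · obtain ⟨z, p⟩ := x₀
    obtain rfl : z = 0 := h0
    obtain ⟨e, hp, he, hs, hd⟩ := exists_straighten hψ p
    refine ⟨e.source, e.open_source, hp, fun G hG hGe k => ?_⟩
    have hG' := isTest_straightenDensity hψ hs hd hG hGe k
    obtain ⟨B, hB⟩ := exists_round_expansion hG' k
    have hint := fun θ ε => integral_straighten he hs hGe k θ ε
    -- comparison of the tubes for `ψ` and `ψ + 1` determines the coefficient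
    have hcoef : logCoeff k (straightenDensity e ψ k G) = logCoeff k G := by
      obtain ⟨C', hC'⟩ := hB smoothProfile isProfile_smoothProfile
      have h1 := tendsto_tube_difference hG hψ (hψ.add (contDiff_const (c := (1 : ℝ)))) k
      set L := logCoeff k (straightenDensity e ψ k G) with hL
      set F : ℝ → ℂ := fun ε => ∫ x : ℂ × P, ((smoothProfile (‖x.1‖ / ε * exp (ψ x)) : ℝ) : ℂ) *
        G x / (x.1 ^ (k + 1) * conj x.1) with hF
      have h2 : Tendsto (fun ε => F ε + L * log ε) (𝓝[>] 0)
          (𝓝 (B + profileConst smoothProfile * L)) := by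
        rw [tendsto_iff_norm_sub_tendsto_zero]
        refine squeeze_zero' (Eventually.of_forall fun _ => norm_nonneg _) ?_
          (tendsto_mul_nhdsGT_zero C')
        filter_upwards [Ioc_mem_nhdsGT zero_lt_one] with ε hε
        simp only [hF, hint]
        exact hC' ε hε.1 hε.2
      have h3 : Tendsto (fun ε : ℝ => exp (-1) * ε) (𝓝[>] 0) (𝓝[>] 0) := by
        refine tendsto_nhdsWithin_iff.mpr ⟨tendsto_mul_nhdsGT_zero _, ?_⟩
        filter_upwards [self_mem_nhdsWithin] with ε hε using mul_pos (exp_pos _) hε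
      have h4 := ((h2.comp h3).sub h2).add (tendsto_const_nhds (x := L))
      rw [sub_self, zero_add] at h4
      refine tendsto_nhds_unique h4 ?_
      have h5 : logCoeff k G =
          logCoeff k fun x => ((ψ x + 1 - ψ x : ℝ) : ℂ) * G x := by
        congr 1; funext x; simp
      rw [h5]
      refine h1.congr' ?_
      filter_upwards [self_mem_nhdsWithin] with ε hε
      have hε' : (0 : ℝ) < ε := hε
      have h6 : 0 < exp (-1) * ε := mul_pos (exp_pos _) hε'
      rw [Function.comp_apply, Real.log_mul (exp_pos _).ne' hε'.ne', Real.log_exp]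
      have h7 : F (exp (-1) * ε) + L * ((-1 + log ε : ℝ) : ℂ) - (F ε + L * log ε) + L =
          F (exp (-1) * ε) - F ε := by push_cast; ring
      rw [h7]
      simp only [hF]
      rw [← integral_sub (integrable_tube hψ hG k isProfile_smoothProfile h6)
        (integrable_tube hψ hG k isProfile_smoothProfile hε')]
      refine integral_congr_ae (Eventually.of_forall fun x => ?_)
      have h8 : ‖x.1‖ / (exp (-1) * ε) * exp (ψ x) = ‖x.1‖ / ε * exp (ψ x + 1) := by
        rw [Real.exp_add, Real.exp_neg]; field_simp
      beta_reduce
      rw [h8]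
      push_cast
      ring
    refine ⟨B, fun θ hθ => ?_⟩
    obtain ⟨C', hC'⟩ := hB θ hθ
    refine ⟨C', 1, one_pos, fun ε hε hε1 => ?_⟩
    rw [hint, ← hcoef]
    exact hC' ε hε hε1
  · refine ⟨{x | ‖x₀.1‖ / 2 < ‖x.1‖}, isOpen_lt (by fun_prop) (by fun_prop), ?_,
      fun G hG hGV k => ?_⟩
    · have := norm_pos_iff.mpr h0
      rw [mem_ofPred_eq]; linarith
    · have hx₀ := norm_pos_iff.mpr h0
      have hco : logCoeff k G = 0 := by
        refine integral_eq_zero_of_ae (Eventually.of_forall fun p => wirtCoeff_eq_zero hG ?_)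
        filter_upwards [Ioo_mem_nhdsGT (half_pos hx₀)] with r hr
        have : ∀ t, G (circleMap 0 r t, p) = 0 := fun t =>
          image_eq_zero_of_notMem_tsupport fun h => by
            have h2 : ‖x₀.1‖ / 2 < ‖circleMap 0 r t‖ := hGV h
            rw [norm_circleMap_zero, abs_of_pos hr.1] at h2
            exact lt_asymm h2 hr.2
        simp [moment, this]
      obtain ⟨M, hM⟩ := hG.2.isCompact.exists_bound_of_continuousOn hψ.continuous.continuousOn
      refine ⟨∫ x : ℂ × P, G x / (x.1 ^ (k + 1) * conj x.1), fun θ hθ =>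
        ⟨0, ‖x₀.1‖ / 2 * exp (-M), by positivity, fun ε hε hε0 => ?_⟩⟩
      rw [hco]
      have : (∫ x : ℂ × P, ((θ (‖x.1‖ / ε * exp (ψ x)) : ℝ) : ℂ) * G x /
            (x.1 ^ (k + 1) * conj x.1)) =
          ∫ x : ℂ × P, G x / (x.1 ^ (k + 1) * conj x.1) := by
        refine integral_congr_ae (Eventually.of_forall fun x => ?_)
        beta_reduce
        by_cases hx : x ∈ tsupport G
        · rw [hθ.eq_one, ofReal_one, one_mul]
          have h1 : ‖x₀.1‖ / 2 < ‖x.1‖ := hGV hx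
          have h2 : exp (-M) ≤ exp (ψ x) := Real.exp_le_exp.mpr
            (by have := abs_le.mp (hM x hx); linarith)
          rw [div_mul_eq_mul_div, le_div_iff₀ hε, one_mul]
          exact hε0.trans (mul_le_mul h1.le h2 (exp_pos _).le (norm_nonneg _))
        · rw [image_eq_zero_of_notMem_tsupport hx]; simp
      rw [this]
      simp

end Tube

/-! ### Polar densities in adapted charts -/

/-- The coordinates `(z, w)` on `ℂⁿ⁺¹`. -/
def consL (n : ℕ) : (ℂ × ℂ^n) ≃L[ℝ] ℂ^(n + 1) := Fin.consEquivL ℝ fun _ => ℂ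

lemma consL_apply {n : ℕ} (x : ℂ × ℂ^n) : consL n x = Fin.cons x.1 x.2 := rfl

@[simp] theorem consL_apply_zero {n : ℕ} (x : ℂ × ℂ^n) : consL n x 0 = x.1 := by
  rw [consL_apply, Fin.cons_zero]

/-- In these coordinates the hyperplane `z₀ = 0` is `{0} × ℂⁿ`. -/
lemma consL_zero_left {n : ℕ} (w : ℂ^n) : consL n (0, w) = hyperIncl n w := by
  rw [consL_apply, hyperIncl_apply]

lemma integral_consL {n : ℕ} (f : ℂ^(n + 1) → ℂ) :
    ∫ x : ℂ × ℂ^n, f (consL n x) = ∫ z, f z := by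
  have h := (volume_preserving_piFinSuccAbove (fun _ : Fin (n + 1) => ℂ) 0).symm
  rw [← h.integral_comp (MeasurableEquiv.measurableEmbedding _)]
  refine integral_congr_ae (Eventually.of_forall fun x => ?_)
  exact congrArg f (Fin.insertNth_zero' x.1 x.2).symm

/-- `G` is a smooth function with `Ω = G / (z₀^{k+1} z̄₀)` (with respect to the standard volume form)
in the given adapted chart. -/
def IsPolarDensity (Φ : AdaptedChart n D) (k : ℕ) (Ω : DForm (n + 1) (n + 1 + (n + 1)) X)
    (G : ℂ^(n + 1) → ℂ) : Prop :=
  ContDiffOn ℝ ∞ G Φ.toX.target ∧ ∀ z ∈ Φ.toX.target, z 0 ≠ 0 →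
    inChart Φ.toX Ω z (stdFrame (n + 1)) = G z / (z 0 ^ (k + 1) * conj (z 0))

/-- A top degree form which is smooth off `D` and is of the form `G / (z₀^{k+1} z̄₀)` with a smooth
function `G` in each adapted chart. -/
def IsPolar (D : Set X) [ChartedSpace ℂ^n D] (k : ℕ)
    (Ω : DForm (n + 1) (n + 1 + (n + 1)) X) : Prop :=
  SmoothFormOn Ω Dᶜ ∧ ∀ Φ : AdaptedChart n D, ∃ G, IsPolarDensity Φ k Ω G

/-- The density of `χ Ω` in coordinates `(z, w)`, without its pole. -/
def localDensity (e : OpenPartialHomeomorph X ℂ^(n + 1)) (χ : X → ℝ)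
    (G : ℂ^(n + 1) → ℂ) (x : ℂ × ℂ^n) : ℂ :=
  e.target.indicator (fun z => (χ (e.symm z) : ℂ) * G z) (consL n x)

lemma localDensity_of_mem {e : OpenPartialHomeomorph X ℂ^(n + 1)} {χ : X → ℝ}
    {G : ℂ^(n + 1) → ℂ} {x : ℂ × ℂ^n} (hx : consL n x ∈ e.target) :
    localDensity e χ G x = (χ (e.symm (consL n x)) : ℂ) * G (consL n x) :=
  indicator_of_mem hx _

lemma localDensity_of_notMem {e : OpenPartialHomeomorph X ℂ^(n + 1)} {χ : X → ℝ}
    {G : ℂ^(n + 1) → ℂ} {x : ℂ × ℂ^n} (hx : consL n x ∉ e.target) :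
    localDensity e χ G x = 0 :=
  indicator_of_notMem hx _

lemma isTest_localDensity {e : OpenPartialHomeomorph X ℂ^(n + 1)}
    (he : e ∈ holAtlas (n + 1) X) {χ : X → ℝ}
    (hχ : ContMDiff 𝓘(ℝ, ℂ^(n + 1)) 𝓘(ℝ, ℝ) ∞ χ) (hsub : tsupport χ ⊆ e.source)
    {G : ℂ^(n + 1) → ℂ} (hG : ContDiffOn ℝ ∞ G e.target) :
    IsTest (localDensity e χ G) ∧
      tsupport (localDensity e χ G) ⊆ consL n ⁻¹' (e '' tsupport χ) := by
  have hK : IsCompact (e '' tsupport χ) :=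
    (isClosed_tsupport χ).isCompact.image_of_continuousOn (e.continuousOn.mono hsub)
  have h0 : ∀ z ∈ e.target, z ∉ e '' tsupport χ → (χ (e.symm z) : ℂ) * G z = 0 := by
    intro z hz hzK
    rw [image_eq_zero_of_notMem_tsupport fun h => hzK ⟨_, h, e.right_inv hz⟩]
    simp
  have h1 := contDiff_indicator (k := ∞) e.open_target hK
    (by rintro _ ⟨y, hy, rfl⟩; exact e.map_source (hsub hy))
    (f := fun z => (χ (e.symm z) : ℂ) * G z)
    ((fun z hz => (((ofRealCLM.contDiff.contDiffAt.comp z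
      (contDiffAt_comp_symm he hz (hχ _))).mul
      (hG.contDiffAt (e.open_target.mem_nhds hz))).contDiffWithinAt))) h0
  refine ⟨⟨h1.1.comp (consL n).contDiff, h1.2.comp_homeomorph (consL n).toHomeomorph⟩, ?_⟩
  refine closure_minimal ?_ (hK.isClosed.preimage (consL n).continuous)
  intro x hx
  by_contra hxK
  refine hx ?_
  by_cases hxt : consL n x ∈ e.target
  · rw [localDensity_of_mem hxt]
    exact h0 _ hxt hxK
  · exact localDensity_of_notMem hxt

/-- In an adapted chart a cut-off function is locally of the form `|z₀| e^ψ`. -/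
lemma exists_log_factor (Φ : AdaptedChart n D) {lam : X → ℝ} (hlam : IsCutoff (n + 1) D lam)
    {p : X} (hp : p ∈ Φ.toX.source) :
    ∃ N : Set X, IsOpen N ∧ p ∈ N ∧ N ⊆ Φ.toX.source ∧ ∃ ψ : ℂ × ℂ^n → ℝ,
      ContDiff ℝ ∞ ψ ∧
      ∀ y ∈ N, lam y = ‖Φ.toX y 0‖ * exp (ψ ((consL n).symm (Φ.toX y))) := by
  obtain ⟨h, hh, hpos⟩ := hlam.extends_smoothly _ _
    (Φ.isLocalEquation _ Φ.toX.open_source subset_rfl)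
  obtain ⟨r, hr, hball⟩ := Metric.nhds_basis_closedBall.mem_iff.mp
    (Φ.toX.open_target.mem_nhds (Φ.toX.map_source hp))
  let f : ContDiffBump (Φ.toX p) := ⟨r / 2, r, half_pos hr, half_lt_self hr⟩
  have h1 := contDiff_indicator (k := ∞) Φ.toX.open_target f.hasCompactSupport
    (f := fun z => f z * log (h (Φ.toX.symm z))) (by rw [f.tsupport_eq]; exact hball)
    (fun z hz => by
      have h2 := Φ.toX.map_target hz
      refine (f.contDiff.contDiffAt.mul ((contDiffAt_comp_symm Φ.memX hz
        (hh.contMDiffAt (Φ.toX.open_source.mem_nhds h2))).log ?_)).contDiffWithinAt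
      exact (hpos _ h2).1.ne')
    (fun z _ hz => by rw [image_eq_zero_of_notMem_tsupport hz, zero_mul])
  refine ⟨Φ.toX.source ∩ Φ.toX ⁻¹' Metric.ball (Φ.toX p) (r / 2),
    Φ.toX.isOpen_inter_preimage Metric.isOpen_ball, ⟨hp, Metric.mem_ball_self (half_pos hr)⟩,
    inter_subset_left, _, h1.1.comp (consL n).contDiff, fun y hy => ?_⟩
  rw [Function.comp_apply, ContinuousLinearEquiv.apply_symm_apply,
    indicator_of_mem (Φ.toX.map_source hy.1), Φ.toX.left_inv hy.1,
    f.one_of_mem_closedBall (Metric.ball_subset_closedBall hy.2), one_mul,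
    Real.exp_log (hpos y hy.1).1, (hpos y hy.1).2, mul_comm]

lemma IsCutoff.continuous (hA : HasAdaptedCharts n D)
    {lam : X → ℝ} (hlam : IsCutoff (n + 1) D lam) : Continuous lam := by
  rw [continuous_iff_continuousAt]
  intro p
  obtain ⟨Φ, hp⟩ := hA p
  obtain ⟨N, hN, hpN, hNs, ψ, hψ, h⟩ := exists_log_factor Φ hlam hp
  have h1 : ContinuousAt (fun y => ‖Φ.toX y 0‖ * exp (ψ ((consL n).symm (Φ.toX y)))) p := by
    have h2 := Φ.toX.continuousAt hp
    refine ContinuousAt.mul ?_ ?_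
    · exact ((continuous_apply 0).continuousAt.comp h2).norm
    · exact Real.continuous_exp.continuousAt.comp (hψ.continuous.continuousAt.comp
        ((consL n).symm.continuous.continuousAt.comp h2))
  refine h1.congr ?_
  filter_upwards [hN.mem_nhds hpN] with y hy
  exact (h y hy).symm

lemma IsCutoff.eq_zero {lam : X → ℝ}
    (hlam : IsCutoff (n + 1) D lam) (hA : HasAdaptedCharts n D)
    {x : X} (hx : x ∈ D) : lam x = 0 := by
  obtain ⟨Φ, hp⟩ := hA x
  obtain ⟨N, hN, hpN, hNs, ψ, hψ, h⟩ := exists_log_factor Φ hlam hp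
  rw [h x hpN, (Φ.zero_iff x hp).mpr hx, norm_zero, zero_mul]

/-- The integral of `θ(λ/ε) χ Ω` in coordinates. -/
lemma chart_integral_eq (Φ : AdaptedChart n D) {k : ℕ} {Ω : DForm (n + 1) (n + 1 + (n + 1)) X}
    {G : ℂ^(n + 1) → ℂ} (hG : IsPolarDensity Φ k Ω G) {lam χ : X → ℝ}
    {ψ : ℂ × ℂ^n → ℝ}
    (hψ : ∀ y ∈ tsupport χ, y ∈ Φ.toX.source ∧
      lam y = ‖Φ.toX y 0‖ * exp (ψ ((consL n).symm (Φ.toX y))))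
    {θ : ℝ → ℝ} (hθ : IsProfile θ) (ε : ℝ) :
    ∫ z in Φ.toX.target, (χ (Φ.toX.symm z) : ℂ) *
        inChart Φ.toX (fun y => ((θ (lam y / ε) : ℝ) : ℂ) • Ω y) z (stdFrame (n + 1)) =
      ∫ x : ℂ × ℂ^n, ((θ (‖x.1‖ / ε * exp (ψ x)) : ℝ) : ℂ) *
        localDensity Φ.toX χ G x / (x.1 ^ (k + 1) * conj x.1) := by
  rw [← integral_indicator Φ.toX.open_target.measurableSet, ← integral_consL]
  refine integral_congr_ae (Eventually.of_forall fun x => ?_)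
  beta_reduce
  by_cases hx : consL n x ∈ Φ.toX.target
  · rw [indicator_of_mem hx, localDensity_of_mem hx, inChart_smul]
    set y := Φ.toX.symm (consL n x) with hy
    have hyx : Φ.toX y = consL n x := Φ.toX.right_inv hx
    by_cases hyχ : y ∈ tsupport χ
    · obtain ⟨-, hl⟩ := hψ y hyχ
      rw [hyx, consL_apply_zero, ContinuousLinearEquiv.symm_apply_apply] at hl
      rw [hl, ContinuousAlternatingMap.smul_apply, smul_eq_mul]
      rcases eq_or_ne x.1 0 with h0 | h0
      · rw [h0, norm_zero, zero_mul, zero_div, hθ.eq_zero 0 (by norm_num)]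
        simp
      · rw [hG.2 _ hx (by rwa [consL_apply_zero]), consL_apply_zero]
        rw [mul_div_right_comm ‖x.1‖]
        ring
    · rw [image_eq_zero_of_notMem_tsupport hyχ]; simp
  · rw [indicator_of_notMem hx, localDensity_of_notMem hx]; simp

/-! ### The logarithmic expansion on a compact manifold -/

/-- The integral of a form over `X`, cut off near `D` by `θ(λ/ε)`. -/
def tubeIntegral (θ : ℝ → ℝ) (lam : X → ℝ) (ε : ℝ) (Ω : DForm (n + 1) (n + 1 + (n + 1)) X) : ℂ :=
  formIntegral (fun y => ((θ (lam y / ε) : ℝ) : ℂ) • Ω y) univ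

/-- The asymptotic expansion, with coefficients `-A` and `B`, of the integral of `Ω` over the complement
of the tube `λ < ε`, and of its smoothed versions. -/
def HasExpansion (lam : X → ℝ) (Ω : DForm (n + 1) (n + 1 + (n + 1)) X) (A B : ℂ) : Prop :=
  ((fun ε : ℝ => formIntegral Ω {y | ε ≤ lam y} + A * log ε - B)
    =O[𝓝[>] (0 : ℝ)] fun ε : ℝ => ε) ∧
  ∀ θ, IsProfile θ → Continuous θ →
    ((fun ε : ℝ => tubeIntegral θ lam ε Ω + A * log ε - (B + profileConst θ * A))
      =O[𝓝[>] (0 : ℝ)] fun ε : ℝ => ε)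

lemma contFormOn_profile_smul (hA : HasAdaptedCharts n D)
    {Ω : DForm (n + 1) (n + 1 + (n + 1)) X} (hΩ : SmoothFormOn Ω Dᶜ) {lam : X → ℝ}
    (hlam : IsCutoff (n + 1) D lam) {θ : ℝ → ℝ} (hθ : IsProfile θ) (hθc : Continuous θ) {ε : ℝ}
    (hε : 0 < ε) : ContFormOn (fun y => ((θ (lam y / ε) : ℝ) : ℂ) • Ω y) univ := by
  have hD := (isClosed_hypersurface D).isOpen_compl
  have hc := hlam.continuous hA
  intro e he z hz
  rw [preimage_univ, inter_univ] at hz ⊢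
  refine ContinuousAt.continuousWithinAt ?_
  by_cases hzD : e.symm z ∈ D
  · have h1 : ∀ᶠ ζ in 𝓝 z, inChart e (fun y => ((θ (lam y / ε) : ℝ) : ℂ) • Ω y) ζ = 0 := by
      have h2 : ContinuousAt (fun ζ => lam (e.symm ζ)) z :=
        hc.continuousAt.comp (e.continuousAt_symm hz)
      have h3 : lam (e.symm z) < ε / 2 := by rw [hlam.eq_zero hA hzD]; positivity
      filter_upwards [h2.eventually_lt continuousAt_const h3] with ζ hζ
      rw [inChart_smul, hθ.eq_zero _ (by rw [div_lt_iff₀ hε]; linarith), ofReal_zero]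
      exact form_zero_smul _
    exact (continuousAt_const (y := (0 : AltForm (n + 1) (n + 1 + (n + 1))))).congr
      (h1.mono fun _ h => h.symm)
  · have h1 : ContFormOn (fun y => ((θ (lam y / ε) : ℝ) : ℂ) • Ω y) Dᶜ :=
      (hΩ.contFormOn hD).smul (Complex.continuous_ofReal.comp (hθc.comp
        (hc.div_const ε))).continuousOn
    exact (h1 e he).continuousAt ((e.symm.isOpen_inter_preimage hD).mem_nhds ⟨hz, hzD⟩)

/-- A finite partition of unity subordinate to adapted charts in which the tubes of two cut-off
functions can be straightened. -/
structure TubeCover (n : ℕ) {X : Type*} [TopologicalSpace X] [ChartedSpace ℂ^(n + 1) X]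
    (D : Set X) [ChartedSpace ℂ^n D] (lam : Fin 2 → X → ℝ) where
  s : Finset X
  χ : X → X → ℝ
  Φ : X → AdaptedChart n D
  ψ : X → Fin 2 → ℂ × ℂ^n → ℝ
  smooth : ∀ i, ContMDiff 𝓘(ℝ, ℂ^(n + 1)) 𝓘(ℝ, ℝ) ∞ (χ i)
  sum_eq_one : ∀ y, ∑ i ∈ s, χ i y = 1
  subset_source : ∀ i, tsupport (χ i) ⊆ (Φ i).toX.source
  contDiff : ∀ i j, ContDiff ℝ ∞ (ψ i j)
  lam_eq : ∀ i j, ∀ y ∈ tsupport (χ i),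
    lam j y = ‖(Φ i).toX y 0‖ * exp (ψ i j ((consL n).symm ((Φ i).toX y)))
  expansion : ∀ i j, ∀ G : ℂ × ℂ^n → ℂ, IsTest G →
    tsupport G ⊆ consL n ⁻¹' ((Φ i).toX '' tsupport (χ i)) → ∀ k,
      ∃ B : ℂ, ∀ θ, IsProfile θ → ∃ C' ε₀, 0 < ε₀ ∧ ∀ ε, 0 < ε → ε ≤ ε₀ →
        ‖(∫ x : ℂ × ℂ^n, ((θ (‖x.1‖ / ε * exp (ψ i j x)) : ℝ) : ℂ) * G x /
            (x.1 ^ (k + 1) * conj x.1)) +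
          logCoeff k G * log ε - (B + profileConst θ * logCoeff k G)‖ ≤ C' * ε

/-- Around each point `exists_log_factor` and `exists_tube_expansion` apply; take a partition of
unity. -/
lemma nonempty_tubeCover (hA : HasAdaptedCharts n D)
    {lam : Fin 2 → X → ℝ} (hlam : ∀ j, IsCutoff (n + 1) D (lam j)) :
    Nonempty (TubeCover n D lam) := by
  choose Φ hΦ using hA
  choose N hN hpN hNs ψ hψ hl using fun (p : X) (j : Fin 2) => exists_log_factor (Φ p) (hlam j) (hΦ p)
  choose V hV hpV hexp using fun (p : X) (j : Fin 2) =>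
    exists_tube_expansion (hψ p j) ((consL n).symm ((Φ p).toX p))
  set U : X → Set X := fun p => ⋂ j, (N p j ∩ ((Φ p).toX.source ∩
    (Φ p).toX ⁻¹' ((consL n).symm ⁻¹' V p j))) with hU
  obtain ⟨s, χ, hχ, -, hsub, hsum⟩ := exists_finite_partitionOfUnity (d := n + 1) (M := X) U
    (fun p => isOpen_iInter_of_finite fun j => (hN p j).inter
      ((Φ p).toX.isOpen_inter_preimage ((hV p j).preimage (consL n).symm.continuous)))
    (fun p => mem_iInter.mpr fun j => ⟨hpN p j, hΦ p, hpV p j⟩)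
  have hmem : ∀ i j, ∀ y ∈ tsupport (χ i), y ∈ N i j ∧ y ∈ (Φ i).toX.source ∧
      (consL n).symm ((Φ i).toX y) ∈ V i j := fun i j y hy => by
    have := mem_iInter.mp (hsub i hy) j
    exact ⟨this.1, this.2.1, this.2.2⟩
  refine ⟨⟨s, χ, Φ, ψ, hχ, hsum, fun i y hy => (hmem i 0 y hy).2.1, hψ,
    fun i j y hy => hl i j y (hmem i j y hy).1, fun i j G hG hGs k => hexp i j G hG ?_ k⟩⟩
  intro x hx
  obtain ⟨y, hy, hyx⟩ := hGs hx
  have := (hmem i j y hy).2.2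
  rwa [hyx, ContinuousLinearEquiv.symm_apply_apply] at this

namespace TubeCover

variable {lam : Fin 2 → X → ℝ} (c : TubeCover n D lam)

/-- The test function given by the `i`-th member of the cover. -/
def density (G : X → ℂ^(n + 1) → ℂ) (i : X) : ℂ × ℂ^n → ℂ :=
  localDensity (c.Φ i).toX (c.χ i) (G i)

/-- The coefficient of the logarithm, computed with the cover. -/
def coeff (k : ℕ) (G : X → ℂ^(n + 1) → ℂ) : ℂ :=
  ∑ i ∈ c.s, logCoeff k (c.density G i)

variable {k : ℕ} {Ω : DForm (n + 1) (n + 1 + (n + 1)) X} {G : X → ℂ^(n + 1) → ℂ}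

lemma isTest_density (hG : ∀ i, IsPolarDensity (c.Φ i) k Ω (G i)) (i : X) :
    IsTest (c.density G i) :=
  (isTest_localDensity (c.Φ i).memX (c.smooth i) (c.subset_source i) (hG i).1).1

/-- The integral over a smoothed complement of a tube is a sum of integrals in coordinates. -/
lemma tubeIntegral_eq_sum (hA : HasAdaptedCharts n D)
    (hlam : ∀ j, IsCutoff (n + 1) D (lam j)) (hΩ : SmoothFormOn Ω Dᶜ)
    (hG : ∀ i, IsPolarDensity (c.Φ i) k Ω (G i)) (j : Fin 2) {θ : ℝ → ℝ} (hθ : IsProfile θ)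
    (hθc : Continuous θ) {ε : ℝ} (hε : 0 < ε) :
    tubeIntegral θ (lam j) ε Ω = ∑ i ∈ c.s, ∫ x : ℂ × ℂ^n,
      ((θ (‖x.1‖ / ε * exp (c.ψ i j x)) : ℝ) : ℂ) * c.density G i x /
        (x.1 ^ (k + 1) * conj x.1) := by
  rw [tubeIntegral, formIntegral_eq_sum (fun i => (c.Φ i).memX) (fun i => (c.smooth i).continuous)
    c.subset_source c.sum_eq_one isClosed_univ
    (contFormOn_profile_smul hA hΩ (hlam j) hθ hθc hε)]
  refine sum_congr rfl fun i _ => ?_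
  rw [preimage_univ, inter_univ]
  exact chart_integral_eq (c.Φ i) (hG i)
    (fun y hy => ⟨c.subset_source i hy, c.lam_eq i j y hy⟩) hθ ε

/-- The integral over the complement of the tube itself is a sum of integrals in coordinates. -/
lemma formIntegral_superlevel_eq_sum
    (hA : HasAdaptedCharts n D)
    (hlam : ∀ j, IsCutoff (n + 1) D (lam j)) (hΩ : SmoothFormOn Ω Dᶜ)
    (hG : ∀ i, IsPolarDensity (c.Φ i) k Ω (G i)) (j : Fin 2) {ε : ℝ} (hε : 0 < ε) :
    formIntegral Ω {y | ε ≤ lam j y} = ∑ i ∈ c.s, ∫ x : ℂ × ℂ^n,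
      (((Ici (1 : ℝ)).indicator 1 (‖x.1‖ / ε * exp (c.ψ i j x)) : ℝ) : ℂ) * c.density G i x /
        (x.1 ^ (k + 1) * conj x.1) := by
  have hc := (hlam j).continuous hA
  have hS : IsClosed {y | ε ≤ lam j y} := isClosed_le continuous_const hc
  have hSD : {y | ε ≤ lam j y} ⊆ Dᶜ := fun y hy hyD => by
    have h : ε ≤ lam j y := hy
    rw [(hlam j).eq_zero hA hyD] at h
    exact absurd h (not_le.mpr hε)
  rw [formIntegral_eq_sum (fun i => (c.Φ i).memX) (fun i => (c.smooth i).continuous)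
    c.subset_source c.sum_eq_one hS
    ((hΩ.contFormOn (isClosed_hypersurface D).isOpen_compl).mono hSD)]
  refine sum_congr rfl fun i _ => ?_
  refine Eq.trans ?_ (chart_integral_eq (c.Φ i) (hG i)
    (fun y hy => ⟨c.subset_source i hy, c.lam_eq i j y hy⟩) isProfile_indicator ε)
  symm
  rw [setIntegral_eq_of_subset_of_forall_sdiff_eq_zero (c.Φ i).toX.open_target.measurableSet
    (inter_subset_left (t := (c.Φ i).toX.symm ⁻¹' {y | ε ≤ lam j y}))]
  · refine setIntegral_congr_fun (measurableSet_chart _ hS) fun z hz => ?_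
    have h1 : (1 : ℝ) ≤ lam j ((c.Φ i).toX.symm z) / ε := (one_le_div hε).mpr hz.2
    rw [inChart_smul, indicator_of_mem (show _ ∈ Ici (1 : ℝ) from h1)]
    simp
  · intro z hz
    have h1 : ¬ (1 : ℝ) ≤ lam j ((c.Φ i).toX.symm z) / ε := fun h =>
      hz.2 ⟨hz.1, (one_le_div hε).mp h⟩
    rw [inChart_smul, indicator_of_notMem (show _ ∉ Ici (1 : ℝ) from h1)]
    simp

/-- The coefficient of the logarithm is the same for the two cut-off functions. -/
lemma exists_hasExpansion (hA : HasAdaptedCharts n D)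
    (hlam : ∀ j, IsCutoff (n + 1) D (lam j)) (hΩ : SmoothFormOn Ω Dᶜ)
    (hG : ∀ i, IsPolarDensity (c.Φ i) k Ω (G i)) (j : Fin 2) :
    ∃ B, HasExpansion (lam j) Ω (c.coeff k G) B := by
  choose B hB using fun i => c.expansion i j (c.density G i) (c.isTest_density hG i)
    (isTest_localDensity (c.Φ i).memX (c.smooth i) (c.subset_source i) (hG i).1).2 k
  have key : ∀ θ, IsProfile θ → ((fun ε : ℝ => (∑ i ∈ c.s, ∫ x : ℂ × ℂ^n,
      ((θ (‖x.1‖ / ε * exp (c.ψ i j x)) : ℝ) : ℂ) * c.density G i x /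
        (x.1 ^ (k + 1) * conj x.1)) + c.coeff k G * log ε -
          (∑ i ∈ c.s, B i + profileConst θ * c.coeff k G))
      =O[𝓝[>] (0 : ℝ)] fun ε : ℝ => ε) := by
    intro θ hθ
    have h1 : ∀ i ∈ c.s, (fun ε : ℝ => (∫ x : ℂ × ℂ^n,
      ((θ (‖x.1‖ / ε * exp (c.ψ i j x)) : ℝ) : ℂ) * c.density G i x /
        (x.1 ^ (k + 1) * conj x.1)) + logCoeff k (c.density G i) * log ε -
          (B i + profileConst θ * logCoeff k (c.density G i)))
      =O[𝓝[>] (0 : ℝ)] fun ε : ℝ => ε := by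
      intro i _
      obtain ⟨C', ε₀, hε₀, h⟩ := hB i θ hθ
      refine Asymptotics.IsBigO.of_bound C' ?_
      filter_upwards [Ioc_mem_nhdsGT hε₀] with ε hε
      rw [norm_of_nonneg hε.1.le]
      exact h ε hε.1 hε.2
    refine (Asymptotics.IsBigO.sum h1).congr_left fun ε => ?_
    rw [Finset.sum_apply, Finset.sum_sub_distrib, Finset.sum_add_distrib, Finset.sum_add_distrib, ← Finset.sum_mul,
      ← mul_sum, coeff]
  refine ⟨∑ i ∈ c.s, B i, ?_, fun θ hθ hθc => ?_⟩
  · refine (key _ isProfile_indicator).congr' ?_ EventuallyEq.rfl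
    filter_upwards [self_mem_nhdsWithin] with ε hε
    rw [c.formIntegral_superlevel_eq_sum hA hlam hΩ hG j hε, profileConst_indicator]
    simp
  · refine (key θ hθ).congr' ?_ EventuallyEq.rfl
    filter_upwards [self_mem_nhdsWithin] with ε hε
    rw [c.tubeIntegral_eq_sum hA hlam hΩ hG j hθ hθc hε]

end TubeCover

section Expansion

variable {lam : X → ℝ} {Ω : DForm (n + 1) (n + 1 + (n + 1)) X} {k : ℕ}

/-- An expansion with a logarithmic and a constant term is unique. -/
lemma coeff_log_unique {F : ℝ → ℂ} {A B A' B' : ℂ}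
    (h : Tendsto (fun ε : ℝ => F ε + A * log ε) (𝓝[>] 0) (𝓝 B))
    (h' : Tendsto (fun ε : ℝ => F ε + A' * log ε) (𝓝[>] 0) (𝓝 B')) : A = A' ∧ B = B' := by
  have h1 : Tendsto (fun ε : ℝ => (A - A') * log ε) (𝓝[>] 0) (𝓝 (B - B')) := by
    refine (h.sub h').congr fun ε => ?_
    ring
  have hA : A = A' := by
    by_contra hne
    have h2 : Tendsto (fun ε : ℝ => ‖A - A'‖ * |log ε|) (𝓝[>] 0) atTop :=
      (tendsto_abs_atBot_atTop.comp Real.tendsto_log_nhdsGT_zero).const_mul_atTop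
        (norm_pos_iff.mpr (sub_ne_zero.mpr hne))
    refine not_tendsto_nhds_of_tendsto_atTop h2 ‖B - B'‖ (h1.norm.congr fun ε => ?_)
    rw [norm_mul, Complex.norm_real, Real.norm_eq_abs]
  subst hA
  exact ⟨rfl, tendsto_nhds_unique h h'⟩

lemma tendsto_of_isBigO_sub {F : ℝ → ℂ} {B : ℂ}
    (h : (fun ε : ℝ => F ε - B) =O[𝓝[>] (0 : ℝ)] fun ε : ℝ => ε) :
    Tendsto F (𝓝[>] 0) (𝓝 B) := by
  rw [tendsto_iff_norm_sub_tendsto_zero, ← tendsto_zero_iff_norm_tendsto_zero]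
  exact h.trans_tendsto (tendsto_id.mono_left nhdsWithin_le_nhds)

lemma HasExpansion.tendsto_tubeIntegral {A B : ℂ} (h : HasExpansion lam Ω A B) {θ : ℝ → ℝ}
    (hθ : IsProfile θ) (hθc : Continuous θ) :
    Tendsto (fun ε : ℝ => tubeIntegral θ lam ε Ω + A * log ε) (𝓝[>] 0)
      (𝓝 (B + profileConst θ * A)) :=
  tendsto_of_isBigO_sub (h.2 θ hθ hθc)

lemma HasExpansion.unique {A B A' B' : ℂ} (h : HasExpansion lam Ω A B)
    (h' : HasExpansion lam Ω A' B') : A = A' ∧ B = B' :=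
  coeff_log_unique (tendsto_of_isBigO_sub h.1) (tendsto_of_isBigO_sub h'.1)

variable (hA : HasAdaptedCharts n D)
include hA

/-- The coefficient of the logarithm does not depend on the cut-off function: any two cut-off
functions have a common `TubeCover`. -/
lemma IsPolar.exists_coeff (hΩ : IsPolar D k Ω) :
    ∃ A, ∀ lam, IsCutoff (n + 1) D lam → ∃ B, HasExpansion lam Ω A B := by
  choose G hG using hΩ.2
  by_cases h : ∃ lam₀ : X → ℝ, IsCutoff (n + 1) D lam₀
  · obtain ⟨lam₀, h₀⟩ := h
    have key : ∀ lam, IsCutoff (n + 1) D lam → ∃ A B B₀, HasExpansion lam Ω A B ∧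
        HasExpansion lam₀ Ω A B₀ := by
      intro lam hlam
      have hl : ∀ j, IsCutoff (n + 1) D (![lam₀, lam] j) := by
        intro j; fin_cases j; exacts [h₀, hlam]
      obtain ⟨c⟩ := nonempty_tubeCover hA hl
      obtain ⟨B₀, hB₀⟩ := c.exists_hasExpansion hA hl hΩ.1 (fun i => hG (c.Φ i)) 0
      obtain ⟨B, hB⟩ := c.exists_hasExpansion hA hl hΩ.1 (fun i => hG (c.Φ i)) 1
      exact ⟨_, B, B₀, hB, hB₀⟩
    obtain ⟨A, -, B₀, -, hA₀⟩ := key lam₀ h₀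
    refine ⟨A, fun lam hlam => ?_⟩
    obtain ⟨A', B, B₀', hB, hB₀⟩ := key lam hlam
    obtain rfl := (hA₀.unique hB₀).1
    exact ⟨B, hB⟩
  · exact ⟨0, fun lam hlam => absurd ⟨lam, hlam⟩ h⟩

/-- The dependence of the constant term on the cut-off function. -/
lemma HasExpansion.constant_exp_mul (hΩ : IsPolar D k Ω) {φ : X → ℝ}
    (hφ : ContMDiff 𝓘(ℝ, ℂ^(n + 1)) 𝓘(ℝ, ℝ) ∞ φ) (hlam : IsCutoff (n + 1) D lam)
    (hlam' : IsCutoff (n + 1) D fun x => exp (φ x) * lam x) {A B A' B' A₁ B₁ : ℂ}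
    (h : HasExpansion lam Ω A B) (h' : HasExpansion (fun x => exp (φ x) * lam x) Ω A' B')
    (h₁ : HasExpansion lam (fun x => (φ x : ℂ) • Ω x) A₁ B₁) : B' = B + A₁ := by
  choose G hG using hΩ.2
  have hl : ∀ j, IsCutoff (n + 1) D (![lam, fun x => exp (φ x) * lam x] j) := by
    intro j; fin_cases j; exacts [hlam, hlam']
  obtain ⟨c⟩ := nonempty_tubeCover hA hl
  set G₁ : X → ℂ^(n + 1) → ℂ := fun i z => (φ ((c.Φ i).toX.symm z) : ℂ) * G (c.Φ i) z
    with hG₁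
  have hGφ : ∀ i, IsPolarDensity (c.Φ i) k (fun x => (φ x : ℂ) • Ω x) (G₁ i) := by
    refine fun i => ⟨fun z hz => ?_, fun z hz hz0 => ?_⟩
    · exact ((ofRealCLM.contDiff.contDiffAt.comp z
        (contDiffAt_comp_symm (c.Φ i).memX hz (hφ _))).mul
        ((hG (c.Φ i)).1.contDiffAt ((c.Φ i).toX.open_target.mem_nhds hz))).contDiffWithinAt
    · rw [inChart_smul, ContinuousAlternatingMap.smul_apply, (hG (c.Φ i)).2 z hz hz0, smul_eq_mul,
        hG₁, mul_div_assoc]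
  have hφC : ContMDiff 𝓘(ℝ, ℂ^(n + 1)) 𝓘(ℝ, ℂ) ∞ fun x => (φ x : ℂ) :=
    fun x => contMDiff_ofReal (hφ x)
  have hΩφ : SmoothFormOn (fun x => (φ x : ℂ) • Ω x) Dᶜ := by
    have ho := (isClosed_hypersurface D).isOpen_compl
    have := hΩ.1
    rw [smoothFormOn_iff ho] at this ⊢
    exact fun x hx => (this x hx).smul (hφC x)
  obtain ⟨B₀, hB₀⟩ := c.exists_hasExpansion hA hl hΩ.1 (fun i => hG (c.Φ i)) 0
  obtain ⟨B₂, hB₂⟩ := c.exists_hasExpansion hA hl hΩ.1 (fun i => hG (c.Φ i)) 1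
  obtain ⟨B₃, hB₃⟩ := c.exists_hasExpansion hA hl hΩφ hGφ 0
  obtain ⟨rfl, rfl⟩ := HasExpansion.unique (lam := lam) h hB₀
  obtain ⟨rfl, rfl⟩ := HasExpansion.unique (lam := fun x => exp (φ x) * lam x) h' hB₂
  obtain ⟨rfl, -⟩ := HasExpansion.unique (lam := lam) h₁ hB₃
  have ht := ((HasExpansion.tendsto_tubeIntegral (lam := fun x => exp (φ x) * lam x) hB₂
    isProfile_smoothProfile contDiff_smoothProfile.continuous).sub
    (h.tendsto_tubeIntegral isProfile_smoothProfile contDiff_smoothProfile.continuous))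
  -- where `λ = |z₀| e^{ψ₀}` and `e^φ λ = |z₀| e^{ψ₁}`, the difference `ψ₁ - ψ₀` is `φ`
  have hdens : ∀ i, (fun x => ((c.ψ i 1 x - c.ψ i 0 x : ℝ) : ℂ) * c.density (fun i => G (c.Φ i)) i x) =
      c.density G₁ i := by
    intro i
    have hd : Dense {x : ℂ × ℂ^n | x.1 ≠ 0} :=
      (dense_compl_singleton (0 : ℂ)).preimage isOpenMap_fst
    refine Continuous.ext_on hd ?_ (c.isTest_density hGφ i).1.continuous ?_
    · exact (Complex.continuous_ofReal.comp ((c.contDiff i 1).continuous.sub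
        (c.contDiff i 0).continuous)).mul
        (c.isTest_density (fun i => hG (c.Φ i)) i).1.continuous
    · intro x hx
      have hx0 : x.1 ≠ 0 := hx
      simp only [TubeCover.density]
      by_cases hxt : consL n x ∈ (c.Φ i).toX.target
      · rw [localDensity_of_mem hxt, localDensity_of_mem hxt]
        set y := (c.Φ i).toX.symm (consL n x) with hy
        have hyx : (c.Φ i).toX y = consL n x := (c.Φ i).toX.right_inv hxt
        by_cases hyχ : y ∈ tsupport (c.χ i)
        · have h1 : lam y = _ := c.lam_eq i 0 y hyχ
          have h2 : exp (φ y) * lam y = _ := c.lam_eq i 1 y hyχ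
          rw [hyx, consL_apply_zero, ContinuousLinearEquiv.symm_apply_apply] at h1 h2
          rw [h1, mul_left_comm, ← Real.exp_add] at h2
          have h3 := Real.exp_injective (mul_left_cancel₀ (norm_ne_zero_iff.mpr hx0) h2)
          have h4 : c.ψ i 1 x - c.ψ i 0 x = φ y := by linarith
          rw [h4]
          exact mul_left_comm _ _ _
        · rw [image_eq_zero_of_notMem_tsupport hyχ]; simp
      · rw [localDensity_of_notMem hxt, localDensity_of_notMem hxt, mul_zero]
  have ht' : Tendsto (fun ε => tubeIntegral smoothProfile (fun x => exp (φ x) * lam x) ε Ω -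
      tubeIntegral smoothProfile lam ε Ω) (𝓝[>] 0) (𝓝 (c.coeff k G₁)) := by
    have h1 := tendsto_finsetSum c.s fun i _ => tendsto_tube_difference
      (c.isTest_density (fun i => hG (c.Φ i)) i) (c.contDiff i 0) (c.contDiff i 1) k
    simp only [hdens] at h1
    refine h1.congr' ?_
    filter_upwards [self_mem_nhdsWithin] with ε hε
    have h2 := c.tubeIntegral_eq_sum hA hl hΩ.1 (fun i => hG (c.Φ i)) 0 isProfile_smoothProfile
      contDiff_smoothProfile.continuous hε
    have h3 := c.tubeIntegral_eq_sum hA hl hΩ.1 (fun i => hG (c.Φ i)) 1 isProfile_smoothProfile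
      contDiff_smoothProfile.continuous hε
    refine Eq.trans ?_ (congrArg₂ (· - ·) h3 h2).symm
    rw [← Finset.sum_sub_distrib]
    refine sum_congr rfl fun i _ => ?_
    rw [← integral_sub
      (integrable_tube (c.contDiff i 1) (c.isTest_density (fun i => hG (c.Φ i)) i) k
        isProfile_smoothProfile hε)
      (integrable_tube (c.contDiff i 0) (c.isTest_density (fun i => hG (c.Φ i)) i) k
        isProfile_smoothProfile hε)]
    refine integral_congr_ae (Eventually.of_forall fun x => ?_)
    beta_reduce
    push_cast
    ring
  have h5 := tendsto_nhds_unique (ht.congr fun ε => ?_) ht'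
  · rw [← h5]; ring
  · ring

/-- For a simple pole the coefficient of the logarithm is an integral over `D`. -/
lemma HasExpansion.coeff_eq (hΩ : IsPolar D 0 Ω) (hlam : IsCutoff (n + 1) D lam) {A B : ℂ}
    (h : HasExpansion lam Ω A B) {μ : DForm n (n + n) D} (hμ : SmoothFormOn μ univ) {a : ℂ}
    (hG : ∀ (Φ : AdaptedChart n D) (G), IsPolarDensity Φ 0 Ω G → ∀ w ∈ Φ.toD.target,
      G (hyperIncl n w) = a * inChart Φ.toD μ w (stdFrame n)) :
    A = 2 * π * a * formIntegral μ univ := by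
  choose G hG' using hΩ.2
  have hl : ∀ j, IsCutoff (n + 1) D (![lam, lam] j) := by
    intro j; fin_cases j; exacts [hlam, hlam]
  obtain ⟨c⟩ := nonempty_tubeCover hA hl
  obtain ⟨B₀, hB₀⟩ := c.exists_hasExpansion hA hl hΩ.1 (fun i => hG' (c.Φ i)) 0
  obtain ⟨rfl, -⟩ := HasExpansion.unique (lam := lam) h hB₀
  rw [formIntegral_eq_sum (s := c.s) (fun i => (c.Φ i).memD)
    (χ := fun i q => c.χ i (q : X)) (fun i => (c.smooth i).continuous.comp continuous_subtype_val)
    (fun i q hq => ((c.Φ i).source_iff q).mpr (c.subset_source i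
      (tsupport_comp_subset_preimage (c.χ i) continuous_subtype_val hq)))
    (fun q => c.sum_eq_one q) isClosed_univ (hμ.contFormOn isOpen_univ), TubeCover.coeff,
    mul_sum]
  refine sum_congr rfl fun i _ => ?_
  simp only [logCoeff, wirtCoeff]
  rw [preimage_univ, inter_univ, ← integral_const_mul,
    ← integral_indicator (c.Φ i).toD.open_target.measurableSet]
  refine integral_congr_ae (Eventually.of_forall fun w => ?_)
  beta_reduce
  rw [Function.iterate_zero, id, TubeCover.density]
  by_cases hw : w ∈ (c.Φ i).toD.target
  · have hw' : consL n (0, w) ∈ (c.Φ i).toX.target := by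
      rw [consL_zero_left]; exact (c.Φ i).mem_toD_target_iff.mp hw
    rw [indicator_of_mem hw, localDensity_of_mem hw', consL_zero_left,
      hG _ _ (hG' (c.Φ i)) w hw, (c.Φ i).symm_hyperIncl hw]
    simp only [Nat.factorial_zero, Nat.cast_one, div_one]
    ring
  · have hw' : consL n (0, w) ∉ (c.Φ i).toX.target := by
      rw [consL_zero_left]; exact fun h => hw ((c.Φ i).mem_toD_target_iff.mpr h)
    rw [indicator_of_notMem hw, localDensity_of_notMem hw', mul_zero]

end Expansion

/-! ### Stokes' theorem on the complement of a tube -/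

lemma SmoothFormOn.apply {a : DForm d r M} {U : Set M} {x : M} (ha : SmoothFormOn a U)
    (hU : IsOpen U) (hx : x ∈ U) : SmoothFormAt a x :=
  (smoothFormOn_iff hU).mp ha x hx

lemma SmoothFormOn.wedge {q : ℕ} {a : DForm d r M} {b : DForm d q M} {U : Set M}
    (ha : SmoothFormOn a U) (hb : SmoothFormOn b U) (hU : IsOpen U) :
    SmoothFormOn (fun x => DivInt.wedge (a x) (b x)) U :=
  (smoothFormOn_iff hU).mpr fun _ hx => (ha.apply hU hx).wedge (hb.apply hU hx)

lemma SmoothFormOn.conjForm {a : DForm d r M} {U : Set M} (ha : SmoothFormOn a U)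
    (hU : IsOpen U) : SmoothFormOn (fun x => DivInt.conjForm (a x)) U :=
  (smoothFormOn_iff hU).mpr fun _ hx => (ha.apply hU hx).conjForm

/-- The exterior derivative squares to zero. -/
lemma extD_extD {U : Set M} (hU : IsOpen U) {a : DForm d r M} (ha : SmoothFormOn a U) {x : M}
    (hx : x ∈ U) : extD (extD a) x = 0 := by
  have h1 := (smoothFormOn_iff hU).mp (ha.extD hU) x hx
  have ha' := (smoothFormOn_iff hU).mp ha
  set e := chartAt ℂ^d x with he0
  have he : e ∈ holAtlas d M := chartAt_mem_holAtlas x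
  have hxe : x ∈ e.source := mem_chart_source _ x
  rw [extD_apply_chart _ x h1]
  have h2 : inChart e (extD a) =ᶠ[𝓝 (e x)] extDeriv (inChart e a) := by
    filter_upwards [(e.symm.isOpen_inter_preimage hU).mem_nhds
      (show e x ∈ e.symm.source ∩ e.symm ⁻¹' U from ⟨e.map_source hxe, by
        rw [mem_preimage, e.left_inv hxe]; exact hx⟩)] with z hz
    exact inChart_extD he hz.1 (ha' _ hz.2)
  rw [h2.extDeriv_eq]
  refine extDeriv_extDeriv_apply (r := ∞) ?_ (by
    rw [minSmoothness_of_isRCLikeNormedField]; exact WithTop.coe_le_coe.mpr (le_top (a := (2 : ℕ∞))))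
  exact (smoothFormAt_iff he hxe).mp (ha' x hx)

/-- The chain rule for a real function of a real valued function, with complex values. -/
lemma dFun_comp_real {u : M → ℝ} {x : M}
    (hu : MDifferentiableAt 𝓘(ℝ, ℂ^d) 𝓘(ℝ, ℝ) u x) {g : ℝ → ℝ} {g' : ℝ}
    (hg : HasDerivAt g g' (u x)) :
    dFun (fun y => ((g (u y) : ℝ) : ℂ)) x = (g' : ℂ) • dFun (d := d) (fun y => (u y : ℂ)) x := by
  have h1 : HasMFDerivAt 𝓘(ℝ, ℂ^d) 𝓘(ℝ, ℂ) (fun y => (u y : ℂ)) x _ :=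
    HasMFDerivAt.comp x (ofRealCLM.hasFDerivAt (x := u x)).hasMFDerivAt hu.hasMFDerivAt
  have h2 : HasFDerivAt (fun t : ℝ => ((g t : ℝ) : ℂ)) _ (u x) :=
    (ofRealCLM.hasFDerivAt (x := g (u x))).comp (u x) hg.hasFDerivAt
  have h3 : HasMFDerivAt 𝓘(ℝ, ℂ^d) 𝓘(ℝ, ℂ) (fun y => ((g (u y) : ℝ) : ℂ)) x _ :=
    HasMFDerivAt.comp x h2.hasMFDerivAt hu.hasMFDerivAt
  rw [dFun, dFun, h1.mfderiv, h3.mfderiv]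
  refine ContinuousLinearMap.ext fun v => ?_
  set L : ℂ^d →L[ℝ] ℝ := mfderiv 𝓘(ℝ, ℂ^d) 𝓘(ℝ, ℝ) u x
  change ((L v * g' : ℝ) : ℂ) = (g' : ℂ) * ((L v : ℝ) : ℂ)
  push_cast
  ring

section Stokes

variable {lam : X → ℝ}

/-- The logarithm of a cut-off function, as a complex valued function. -/
def logLam (lam : X → ℝ) (x : X) : ℂ := (log (lam x) : ℂ)

lemma IsCutoff.contMDiffAt (hlam : IsCutoff (n + 1) D lam) {x : X} (hx : x ∉ D) :
    ContMDiffAt 𝓘(ℝ, ℂ^(n + 1)) 𝓘(ℝ, ℝ) ∞ lam x := by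
  have ho := (isClosed_hypersurface D).isOpen_compl
  obtain ⟨h, hh, hpos⟩ := hlam.extends_smoothly _ _ (isLocalEquation_one D)
  refine (hh.contMDiffAt (ho.mem_nhds hx)).congr_of_eventuallyEq ?_
  filter_upwards [ho.mem_nhds hx] with y hy
  rw [(hpos y hy).2]; simp

lemma IsCutoff.contMDiffAt_log (hlam : IsCutoff (n + 1) D lam) {x : X} (hx : x ∉ D) :
    ContMDiffAt 𝓘(ℝ, ℂ^(n + 1)) 𝓘(ℝ, ℝ) ∞ (fun y => log (lam y)) x :=
  (Real.contDiffAt_log.mpr (hlam.pos x hx).ne').contMDiffAt.comp x (hlam.contMDiffAt hx)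

lemma IsCutoff.contMDiffAt_logLam (hlam : IsCutoff (n + 1) D lam) {x : X} (hx : x ∉ D) :
    ContMDiffAt 𝓘(ℝ, ℂ^(n + 1)) 𝓘(ℝ, ℂ) ∞ (logLam lam) x :=
  contMDiff_ofReal (hlam.contMDiffAt_log hx)

lemma IsCutoff.smoothFormOn_dlog (hlam : IsCutoff (n + 1) D lam) {c : DForm (n + 1) r X}
    (hc : SmoothFormOn c Dᶜ) : SmoothFormOn (fun x => wedgeOne (dFun (logLam lam) x) (c x)) Dᶜ :=
  hc.wedgeOne_dFun (isClosed_hypersurface D).isOpen_compl fun _ hx => hlam.contMDiffAt_logLam hx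

lemma IsCutoff.contMDiffAt_profile (hlam : IsCutoff (n + 1) D lam)
    (hA : HasAdaptedCharts n D) {θ : ℝ → ℝ} (hθ : IsProfile θ)
    (hθs : ContDiff ℝ ∞ θ) {ε : ℝ} (hε : 0 < ε) (x : X) :
    ContMDiffAt 𝓘(ℝ, ℂ^(n + 1)) 𝓘(ℝ, ℂ) ∞ (fun y => ((θ (lam y / ε) : ℝ) : ℂ)) x := by
  by_cases hx : x ∈ D
  · refine (contMDiffAt_const (c := (0 : ℂ))).congr_of_eventuallyEq ?_
    have h3 : lam x < ε / 2 := by rw [hlam.eq_zero hA hx]; positivity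
    filter_upwards [(hlam.continuous hA).continuousAt.eventually_lt continuousAt_const h3] with y hy
    rw [hθ.eq_zero _ (by rw [div_lt_iff₀ hε]; linarith), ofReal_zero]
  · exact contMDiff_ofReal ((hθs.comp (contDiff_id.div_const ε)).contDiffAt.contMDiffAt.comp x
      (hlam.contMDiffAt hx))

/-- A form which is smooth off `D` becomes smooth on `X` if it is cut off by a smooth profile. -/
lemma smoothFormAt_profile_smul (hA : HasAdaptedCharts n D)
    (hlam : IsCutoff (n + 1) D lam) {a : DForm (n + 1) r X} (ha : SmoothFormOn a Dᶜ)
    {θ : ℝ → ℝ} (hθ : IsProfile θ) (hθs : ContDiff ℝ ∞ θ) {ε : ℝ} (hε : 0 < ε) (x : X) :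
    SmoothFormAt (fun y => ((θ (lam y / ε) : ℝ) : ℂ) • a y) x := by
  have ho := (isClosed_hypersurface D).isOpen_compl
  by_cases hx : x ∈ D
  · refine (SmoothFormAt.zero (x := x)).congr ?_
    have h3 : lam x < ε / 2 := by rw [hlam.eq_zero hA hx]; positivity
    filter_upwards [(hlam.continuous hA).continuousAt.eventually_lt continuousAt_const h3] with y hy
    rw [hθ.eq_zero _ (by rw [div_lt_iff₀ hε]; linarith), ofReal_zero]
    exact (form_zero_smul _).symm
  · exact (ha.apply ho hx).smul (hlam.contMDiffAt_profile hA hθ hθs hε x)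

/-- The differential of `θ(λ/ε)` is `s θ'(s) dlog λ` with `s = λ/ε`. -/
lemma dFun_profile (hlam : IsCutoff (n + 1) D lam) {θ : ℝ → ℝ} (hθs : ContDiff ℝ ∞ θ) (ε : ℝ)
    {x : X} (hx : x ∉ D) :
    dFun (d := n + 1) (fun y => ((θ (lam y / ε) : ℝ) : ℂ)) x =
      ((lam x / ε * deriv θ (lam x / ε) : ℝ) : ℂ) • dFun (d := n + 1) (logLam lam) x := by
  have ho := (isClosed_hypersurface D).isOpen_compl
  have hpos := hlam.pos x hx
  have h1 := dFun_comp_real (d := n + 1) (g := fun t => θ (exp t / ε))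
    (g' := lam x / ε * deriv θ (lam x / ε))
    ((hlam.contMDiffAt_log hx).mdifferentiableAt (by simp)) (by
      have h2 : HasDerivAt (fun t => exp t / ε) (lam x / ε) (log (lam x)) := by
        have := (Real.hasDerivAt_exp (log (lam x))).div_const ε
        rwa [Real.exp_log hpos] at this
      have h3 : HasDerivAt θ (deriv θ (lam x / ε))
          ((fun t => exp t / ε) (log (lam x))) := by
        beta_reduce
        rw [Real.exp_log hpos]
        exact ((hθs.differentiable (by simp)).differentiableAt).hasDerivAt
      rw [mul_comm]
      exact h3.comp (log (lam x)) h2)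
  refine Eq.trans ?_ h1
  rw [dFun, dFun]
  refine Filter.EventuallyEq.mfderiv_eq ?_
  filter_upwards [ho.mem_nhds hx] with y hy
  rw [Real.exp_log (hlam.pos y hy)]

lemma contFormOn_logDerivProfile_smul (hA : HasAdaptedCharts n D)
    {Ω : DForm (n + 1) (n + 1 + (n + 1)) X} (hΩ : SmoothFormOn Ω Dᶜ)
    (hlam : IsCutoff (n + 1) D lam) {ε : ℝ} (hε : 0 < ε) :
    ContFormOn (fun y => ((logDerivProfile (lam y / ε) : ℝ) : ℂ) • Ω y) univ := by
  have h1 := contFormOn_profile_smul hA hΩ hlam isProfile_add_logDerivProfile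
    (contDiff_smoothProfile.add contDiff_logDerivProfile).continuous hε
  have h2 := contFormOn_profile_smul hA hΩ hlam isProfile_smoothProfile
    contDiff_smoothProfile.continuous hε
  intro e he
  refine ((h1 e he).sub (h2 e he)).congr fun z hz => ?_
  refine Eq.trans ?_ (sub_smul
    ((smoothProfile (lam (e.symm z) / ε) + logDerivProfile (lam (e.symm z) / ε) : ℝ) : ℂ)
    ((smoothProfile (lam (e.symm z) / ε) : ℝ) : ℂ) (inChart e Ω z))
  rw [← ofReal_sub, add_sub_cancel_left]
  rfl

/-- The integrals over shrinking shells around `D` converge to the coefficient of the expansion. -/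
lemma HasExpansion.tendsto_logDerivProfile
    (hA : HasAdaptedCharts n D)
    {Ω : DForm (n + 1) (n + 1 + (n + 1)) X} (hΩ : SmoothFormOn Ω Dᶜ)
    (hlam : IsCutoff (n + 1) D lam) {A B : ℂ} (h : HasExpansion lam Ω A B) :
    Tendsto (fun ε => tubeIntegral logDerivProfile lam ε Ω) (𝓝[>] 0) (𝓝 A) := by
  have h1 := (h.tendsto_tubeIntegral isProfile_add_logDerivProfile
    (contDiff_smoothProfile.add contDiff_logDerivProfile).continuous).sub
    (h.tendsto_tubeIntegral isProfile_smoothProfile contDiff_smoothProfile.continuous)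
  have h2 : (B + profileConst (fun s => smoothProfile s + logDerivProfile s) * A -
      (B + profileConst smoothProfile * A)) = A := by
    have := profileConst_add_logDerivProfile
    rw [sub_eq_iff_eq_add] at this
    rw [this]; push_cast; ring
  rw [h2] at h1
  refine h1.congr' ?_
  filter_upwards [self_mem_nhdsWithin] with ε hε
  rw [add_sub_add_right_eq_sub, sub_eq_iff_eq_add, tubeIntegral, tubeIntegral, tubeIntegral,
    ← formIntegral_add isClosed_univ (contFormOn_logDerivProfile_smul hA hΩ hlam hε)
      (contFormOn_profile_smul hA hΩ hlam isProfile_smoothProfile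
        contDiff_smoothProfile.continuous hε)]
  congr 1
  funext x
  refine Eq.trans ?_ (add_smul ((logDerivProfile (lam x / ε) : ℝ) : ℂ)
    ((smoothProfile (lam x / ε) : ℝ) : ℂ) (Ω x))
  rw [← Complex.ofReal_add, add_comm (logDerivProfile _)]

/-- If `Y` is closed off `D` then the integrals of `dc ∧ Y` and of `dlog λ ∧ c ∧ Y` over smoothed
complements of a tube are related by Stokes' theorem. -/
lemma tubeIntegral_extD_wedge (hA : HasAdaptedCharts n D)
    (hlam : IsCutoff (n + 1) D lam) {c : DForm (n + 1) n X} {Y : DForm (n + 1) (n + 1) X}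
    (hc : SmoothFormOn c Dᶜ) (hY : SmoothFormOn Y Dᶜ) (hdY : ∀ x ∉ D, extD Y x = 0) {ε : ℝ}
    (hε : 0 < ε) :
    tubeIntegral smoothProfile lam ε (fun x => wedge (extD c x) (Y x)) +
      tubeIntegral logDerivProfile lam ε
        (fun x => wedge (wedgeOne (dFun (logLam lam) x) (c x)) (Y x)) = 0 := by
  have ho := (isClosed_hypersurface D).isOpen_compl
  have hθ := isProfile_smoothProfile
  have hθs := contDiff_smoothProfile
  -- cut-offs which make both forms smooth on `X`; the tube for `Z` is so thin that `Z = Y`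
  -- near the support of `C`
  set C : DForm (n + 1) n X := fun y => ((smoothProfile (lam y / ε) : ℝ) : ℂ) • c y with hC
  set Z : DForm (n + 1) (n + 1) X := fun y => ((smoothProfile (lam y / (ε / 4)) : ℝ) : ℂ) • Y y with hZ
  have hCs : ∀ x, SmoothFormAt C x := smoothFormAt_profile_smul hA hlam hc hθ hθs hε
  have hZs : ∀ x, SmoothFormAt Z x := smoothFormAt_profile_smul hA hlam hY hθ hθs (by positivity)
  have hZY : ∀ x, ε / 4 < lam x → Z =ᶠ[𝓝 x] Y := by
    intro x hx
    filter_upwards [(continuousAt_const (y := ε / 4)).eventually_lt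
      (hlam.continuous hA).continuousAt hx] with y hy
    rw [hZ]
    beta_reduce
    rw [hθ.eq_one _ (by rw [le_div_iff₀ (by positivity)]; linarith), ofReal_one]
    exact one_smul ℂ (Y y)
  have hst := formIntegral_wedge_extD_eq_zero hCs hZs fun x => by
    by_cases hx : ε / 2 ≤ lam x
    · right
      have hxD : x ∉ D := fun h => by rw [hlam.eq_zero hA h] at hx; linarith
      rw [extD_congr (hZY x (by linarith))]
      exact hdY x hxD
    · left
      rw [hC]; beta_reduce
      rw [hθ.eq_zero _ (by rw [div_lt_iff₀ hε]; linarith), ofReal_zero]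
      exact form_zero_smul _
  have hΩ₁ : SmoothFormOn (fun x => wedge (extD c x) (Y x)) Dᶜ := 
    (hc.extD ho).wedge hY ho
  have hΩ₂ : SmoothFormOn (fun x => wedge (wedgeOne (dFun (logLam lam) x) (c x)) (Y x)) Dᶜ := 
    (hlam.smoothFormOn_dlog hc).wedge hY ho
  have hcont₁ := contFormOn_profile_smul hA hΩ₁ hlam hθ hθs.continuous hε
  have hcont₂ : ContFormOn (fun y => ((logDerivProfile (lam y / ε) : ℝ) : ℂ) •
      wedge (wedgeOne (dFun (logLam lam) y) (c y)) (Y y)) univ :=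
    contFormOn_logDerivProfile_smul hA hΩ₂ hlam hε
  rw [tubeIntegral, tubeIntegral, ← formIntegral_add isClosed_univ hcont₁ hcont₂, ← hst]
  congr 1
  funext x
  by_cases hx : ε / 2 ≤ lam x
  · have hxD : x ∉ D := fun h => by rw [hlam.eq_zero hA h] at hx; linarith
    have h1 : Z x = Y x := (hZY x (by linarith)).eq_of_nhds
    rw [h1, hC, extD_smul (hlam.contMDiffAt_profile hA hθ hθs hε x)
      (hc.apply ho hxD), dFun_profile hlam hθs ε hxD, wedge_add_left,
      wedge_smul_left, wedgeOne_smul_left, wedge_smul_left]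
    exact add_comm _ _
  · have h1 : lam x / ε < 1 / 2 := by rw [div_lt_iff₀ hε]; linarith
    have h2 : extD C x = 0 := by
      rw [← extD_zero x]
      refine extD_congr ?_
      filter_upwards [(hlam.continuous hA).continuousAt.eventually_lt continuousAt_const
        (not_le.mp hx)] with y hy
      rw [hC]; beta_reduce
      rw [hθ.eq_zero _ (by rw [div_lt_iff₀ hε]; linarith), ofReal_zero]
      exact form_zero_smul _
    rw [h2, wedge_zero_left, hθ.eq_zero _ h1, logDerivProfile_eq_zero (Or.inl h1),
      ofReal_zero]
    ext v
    simp

/-- A form `dc ∧ Y` with poles along `D`, where `Y` is closed, has no logarithmic term. -/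
lemma HasExpansion.coeff_extD_wedge (hA : HasAdaptedCharts n D)
    (hlam : IsCutoff (n + 1) D lam) {c : DForm (n + 1) n X} {Y : DForm (n + 1) (n + 1) X}
    (hc : SmoothFormOn c Dᶜ) (hY : SmoothFormOn Y Dᶜ) (hdY : ∀ x ∉ D, extD Y x = 0)
    {A B A' B' : ℂ} (h : HasExpansion lam (fun x => wedge (extD c x) (Y x)) A B)
    (h' : HasExpansion lam (fun x => wedge (wedgeOne (dFun (logLam lam) x) (c x)) (Y x)) A' B') :
    A = 0 := by
  have ho := (isClosed_hypersurface D).isOpen_compl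
  have h1 := h.tendsto_tubeIntegral isProfile_smoothProfile contDiff_smoothProfile.continuous
  have h2 := h'.tendsto_logDerivProfile hA ((hlam.smoothFormOn_dlog hc).wedge hY ho) hlam
  have h3 : Tendsto (fun ε => tubeIntegral smoothProfile lam ε (fun x => wedge (extD c x) (Y x)) +
      0 * log ε) (𝓝[>] 0) (𝓝 (-A')) := by
    refine h2.neg.congr' ?_
    filter_upwards [self_mem_nhdsWithin] with ε hε
    have := tubeIntegral_extD_wedge hA hlam hc hY hdY hε
    rw [zero_mul, add_zero]
    exact (eq_neg_of_add_eq_zero_left this).symm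
  exact (coeff_log_unique h1 h3).1

/-- If `B` is closed near `D` then `dc ∧ dlog λ ∧ B` has no logarithmic term, no matter how `c`
behaves along `D`. -/
lemma HasExpansion.coeff_extD_wedge_dlog
    (hA : HasAdaptedCharts n D)
    (hlam : IsCutoff (n + 1) D lam) {c B : DForm (n + 1) n X}
    (hc : SmoothFormOn c Dᶜ) (hB : ∀ x, SmoothFormAt B x)
    (hdB : ∀ x ∈ D, ∀ᶠ y in 𝓝 x, extD B y = 0) {A A' : ℂ}
    (h : HasExpansion lam
      (fun x => wedge (extD c x) (wedgeOne (dFun (logLam lam) x) (B x))) A A') :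
    A = 0 := by
  have ho := (isClosed_hypersurface D).isOpen_compl
  have hθ := isProfile_smoothProfile
  have hθs := contDiff_smoothProfile
  have hlc := hlam.continuous hA
  have hBs : SmoothFormOn B Dᶜ := (smoothFormOn_iff ho).mpr fun x _ => hB x
  have hΩ := (hc.extD ho).wedge (hlam.smoothFormOn_dlog hBs) ho
  -- `B` is closed on a tube
  obtain ⟨δ, hδ, hdδ⟩ : ∃ δ > 0, ∀ x, lam x ≤ δ → extD B x = 0 := by
    by_contra hcon
    push Not at hcon
    set W : Set X := {x | ∀ᶠ y in 𝓝 x, extD B y = 0} with hW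
    have hWo : IsOpen W := isOpen_setOfPred_eventually_nhds
    have hWs : ∀ y ∈ W, extD B y = 0 := fun y hy =>
      (show ∀ᶠ z in 𝓝 y, extD B z = 0 from hy).self_of_nhds
    rcases (Wᶜ).eq_empty_or_nonempty with he | hne
    · obtain ⟨x, -, hx⟩ := hcon 1 one_pos
      have : x ∈ W := by
        by_contra h'
        exact (he ▸ (show x ∈ Wᶜ from h') : x ∈ (∅ : Set X)).elim
      exact hx (hWs x this)
    · obtain ⟨x₀, hx₀, hmin⟩ := hWo.isClosed_compl.isCompact.exists_isMinOn hne hlc.continuousOn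
      have hpos : 0 < lam x₀ := hlam.pos x₀ fun hD => hx₀ (hdB x₀ hD)
      obtain ⟨x, hx, hxB⟩ := hcon (lam x₀ / 2) (half_pos hpos)
      have hxW : x ∉ W := fun h' => hxB (hWs x h')
      have : lam x₀ ≤ lam x := hmin hxW
      linarith
  refine tendsto_nhds_unique (h.tendsto_logDerivProfile hA hΩ hlam) ?_
  refine tendsto_const_nhds.congr' ?_
  filter_upwards [Ioo_mem_nhdsGT hδ] with ε hε
  have hε0 : 0 < ε := hε.1
  symm
  -- as `B` is closed where `Θ(λ/ε) ≠ 1`, the form `Z = (Θ(λ/ε) - 1) B` has differential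
  -- `s Θ'(s) dlog λ ∧ B` with `s = λ/ε`; so the integral of `dc ∧ dlog λ ∧ B` over the shell is that
  -- of the exact form `dC ∧ dZ`, where `C = c` on the shell
  set g : X → ℂ := fun y => ((smoothProfile (lam y / ε) : ℝ) : ℂ) - 1 with hg
  set Z : DForm (n + 1) n X := fun y => g y • B y with hZ
  set C : DForm (n + 1) n X := fun y => ((smoothProfile (lam y / (ε / 4)) : ℝ) : ℂ) • c y with hC
  have hCs : ∀ x, SmoothFormAt C x := smoothFormAt_profile_smul hA hlam hc hθ hθs (by positivity)
  have hgs : ∀ x, ContMDiffAt 𝓘(ℝ, ℂ^(n + 1)) 𝓘(ℝ, ℂ) ∞ g x := fun x =>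
    (hlam.contMDiffAt_profile hA hθ hθs hε0 x).sub contMDiffAt_const
  have hZu : SmoothFormOn Z univ := (smoothFormOn_iff isOpen_univ).mpr fun x _ => (hB x).smul (hgs x)
  have hst := formIntegral_wedge_extD_eq_zero hCs (fun x => (hZu.extD isOpen_univ).apply isOpen_univ
    trivial) fun x => Or.inr (extD_extD isOpen_univ hZu trivial)
  have hdZ : ∀ x, extD Z x = wedgeOne (dFun g x) (B x) := fun x => by
    have h : g x • extD B x = 0 := by
      rcases le_or_gt (lam x) δ with hl | hl
      · rw [hdδ x hl]; exact form_smul_zero _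
      · rw [hg]; beta_reduce
        rw [hθ.eq_one _ (by rw [le_div_iff₀ hε0]; linarith [hε.2]), ofReal_one, sub_self]
        exact form_zero_smul _
    rw [hZ, extD_smul (hgs x) (hB x), h]
    exact add_zero _
  rw [← hst, tubeIntegral]
  congr 1
  funext x
  rw [hdZ]
  by_cases hx : ε / 2 ≤ lam x
  · have hxD : x ∉ D := fun h => by rw [hlam.eq_zero hA h] at hx; linarith
    have h1 : extD C x = extD c x := by
      refine extD_congr ?_
      filter_upwards [(continuousAt_const (y := ε / 4)).eventually_lt
        hlc.continuousAt (show ε / 4 < lam x by linarith)] with y hy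
      rw [hC]
      beta_reduce
      rw [hθ.eq_one _ (by rw [le_div_iff₀ (by positivity)]; linarith), ofReal_one]
      exact one_smul ℂ (c y)
    have h2 := dFun_profile hlam (hθs.sub (contDiff_const (c := (1 : ℝ)))) ε hxD
    simp only [ofReal_sub, ofReal_one, deriv_sub_const] at h2
    rw [h1, hg, h2, wedgeOne_smul_left, wedge_smul_right]
    rfl
  · have h1 : lam x / ε < 1 / 2 := by rw [div_lt_iff₀ hε0]; linarith
    have h2 : g =ᶠ[𝓝 x] fun _ => -1 := by
      filter_upwards [hlc.continuousAt.eventually_lt continuousAt_const (not_le.mp hx)] with y hy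
      rw [hg]; beta_reduce
      rw [hθ.eq_zero _ (by rw [div_lt_iff₀ hε0]; linarith), ofReal_zero, zero_sub]
    have h3 : dFun (d := n + 1) g x = (0 : ℂ) • (0 : ℂ^(n + 1) →L[ℝ] ℂ) := by
      rw [dFun, h2.mfderiv_eq, clm_zero_smul]
      exact mfderiv_const
    rw [h3, wedgeOne_smul_left, wedge_smul_right, logDerivProfile_eq_zero (Or.inl h1),
      ofReal_zero, form_zero_smul, form_zero_smul]

end Stokes

/-! ### Contractions with the normal direction -/

section LinearAlgebra

variable {d r : ℕ}

/-- The product with a conjugate linear covector, such as `dz̄₀`, has no part of type `(r + 1, 0)`.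
-/
lemma holPart_wedgeOne_conj {l : ℂ^d →L[ℝ] ℂ}
    (hl : ∀ u, l (I • u) = -(I * l u)) (s : AltForm d r) :
    holPart (wedgeOne l s) = 0 := by
  ext v
  rw [wedgeOne, holPart_alternatize]
  refine Finset.sum_eq_zero fun j _ => ?_
  have h1 : ∀ u, (l.smulRight s) u = l u • s := fun _ => rfl
  rw [h1, h1, holPart_smul, holPart_smul, hl]
  change _ * ((l (v j) * _ - I * (-(I * l (v j)) * _)) / 2) = 0
  linear_combination ((-1) ^ (j : ℕ) * l (v j) * holPart s (j.removeNth v)) / 2 * Complex.I_sq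

lemma IsTypeHol.curryLeft {a : AltForm d (r + 1)} (ha : IsTypeHol a) (u : ℂ^d) :
    IsTypeHol (a.curryLeft u) := by
  intro v i
  have h := ha (Matrix.vecCons u v) i.succ
  have h1 : Function.update (Matrix.vecCons u v) i.succ (I • (Matrix.vecCons u v) i.succ) =
      Matrix.vecCons u (Function.update v i (I • v i)) := by
    rw [Matrix.cons_val_succ]
    exact (Fin.cons_update (α := fun _ => ℂ^d) u v i _).symm
  rw [h1] at h
  exact h

/-- The restriction of `s` to `z₀ = 0` is recovered from `dz₀ ∧ s` by contraction with `∂/∂z₀`. -/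
lemma hyperRestrict_wedgeOne_coordZero_curryLeft {n : ℕ} (S : AltForm (n + 1) r) :
    hyperRestrict ((wedgeOne (coordZero n) S).curryLeft (stdBasis (n + 1) 0)) =
      hyperRestrict S := by
  ext v
  refine Eq.trans ?_ (hyperRestrict_apply S v).symm
  rfl

end LinearAlgebra

/-! ### Numerators of forms with poles -/

section FromChart

variable {S : ℂ^d → AltForm d r}

/-- The pull-back to `M` of a form on the target of a chart, meaningful on the source. -/
def fromChart (e : OpenPartialHomeomorph M ℂ^d) (S : ℂ^d → AltForm d r) :
    DForm d r M := fun x =>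
  (S (e x)).compContinuousLinearMap (mfderiv 𝓘(ℝ, ℂ^d) 𝓘(ℝ, ℂ^d) e x)

lemma inChart_fromChart (he : e ∈ holAtlas d M) {z : ℂ^d} (hz : z ∈ e.target) :
    inChart e (fromChart e S) z = S z := by
  have h1 := mfderiv_comp (I := 𝓘(ℝ, ℂ^d)) (I' := 𝓘(ℝ, ℂ^d))
    (I'' := 𝓘(ℝ, ℂ^d)) z (mdifferentiableAt_chart he (e.map_target hz))
    (mdifferentiableAt_symm he hz)
  have h2 : (e ∘ e.symm) =ᶠ[𝓝 z] id := by
    filter_upwards [e.open_target.mem_nhds hz] with y hy using e.right_inv hy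
  rw [h2.mfderiv_eq, mfderiv_id] at h1
  have h3 : ∀ u : ℂ^d, (mfderiv 𝓘(ℝ, ℂ^d) 𝓘(ℝ, ℂ^d) e (e.symm z) :
      ℂ^d →L[ℝ] ℂ^d) (symmDeriv e z u) = u :=
    fun u => (congrArg (fun L : ℂ^d →L[ℝ] ℂ^d => L u) h1).symm
  ext v
  refine Eq.trans (congrArg (S (e (e.symm z))) (funext fun i => h3 (v i))) ?_
  rw [e.right_inv hz]

lemma smoothFormAt_fromChart (he : e ∈ holAtlas d M) (hS : ∀ z ∈ e.target, ContDiffAt ℝ ∞ S z)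
    {x : M} (hx : x ∈ e.source) : SmoothFormAt (fromChart e S) x :=
  (smoothFormAt_iff he hx).mpr <| (hS _ (e.map_source hx)).congr_of_eventuallyEq <| by
    filter_upwards [e.open_target.mem_nhds (e.map_source hx)] with z hz
      using inChart_fromChart he hz

end FromChart

lemma contDiffAt_curryLeft {d r : ℕ} {b : ℂ^d → AltForm d (r + 1)} {z : ℂ^d}
    (hb : ContDiffAt ℝ ∞ b z) (u : ℂ^d) : ContDiffAt ℝ ∞ (fun ζ => (b ζ).curryLeft u) z :=
  contDiffAt_form fun v => contDiffAt_form_apply hb (Matrix.vecCons u v)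

lemma fderiv_coord {n : ℕ} (z : ℂ^(n + 1)) :
    fderiv ℝ (fun ζ : ℂ^(n + 1) => ζ 0) z = coordZero n :=
  (coordZero n).fderiv

lemma contDiffAt_coord_pow {n : ℕ} (z : ℂ^(n + 1)) (k : ℕ) :
    ContDiffAt ℝ ∞ (fun ζ : ℂ^(n + 1) => ζ 0 ^ k) z := by fun_prop

lemma eventually_coord_ne {n : ℕ} {U : Set ℂ^(n + 1)} (hU : IsOpen U)
    {z : ℂ^(n + 1)} (hz : z ∈ U) (h0 : z 0 ≠ 0) : ∀ᶠ ζ in 𝓝 z, ζ ∈ U ∧ ζ 0 ≠ 0 :=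
  (hU.eventually_mem hz).and ((continuous_apply 0).continuousAt.eventually_ne h0)

section Poles

variable {Φ : AdaptedChart n D} {k : ℕ} {a a' : DForm (n + 1) r X}

/-- `b` is the smooth extension of `z₀ᵏ a` in an adapted chart. -/
def IsNumerator (Φ : AdaptedChart n D) (k : ℕ) (a : DForm (n + 1) r X)
    (b : ℂ^(n + 1) → AltForm (n + 1) r) : Prop :=
  (∀ z ∈ Φ.toX.target, ContDiffAt ℝ ∞ b z) ∧
    ∀ z ∈ Φ.toX.target, z 0 ≠ 0 → b z = z 0 ^ k • inChart Φ.toX a z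

lemma AdaptedChart.symm_notMem (Φ : AdaptedChart n D) {z : ℂ^(n + 1)}
    (hz : z ∈ Φ.toX.target) (h0 : z 0 ≠ 0) : Φ.toX.symm z ∉ D :=
  fun h => h0 ((Φ.mem_D_iff hz).mp h)

lemma AdaptedChart.coord_ne (Φ : AdaptedChart n D) {x : X} (hx : x ∈ Φ.toX.source)
    (hxD : x ∉ D) : Φ.toX x 0 ≠ 0 := fun h => hxD ((Φ.zero_iff x hx).mp h)

lemma HasPoleLE.exists_numerator (h : HasPoleLE D k a) (Φ : AdaptedChart n D) :
    ∃ b, IsNumerator Φ k a b := by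
  obtain ⟨b, hb, hba⟩ := Φ.exists_of_hasPoleLE h
  refine ⟨inChart Φ.toX b, fun z hz => ((smoothFormOn_iff Φ.toX.open_source).mp hb _
    (Φ.toX.map_target hz)).contDiffAt Φ.memX hz, fun z hz h0 => ?_⟩
  rw [inChart_congr (b := fun x => (Φ.toX x 0) ^ k • a x)
    (hba _ (Φ.toX.map_target hz) (Φ.symm_notMem hz h0)), inChart_smul (fun x => (Φ.toX x 0) ^ k),
    Φ.toX.right_inv hz]

lemma HasPoleLE.smoothFormAt (h : HasPoleLE D k a) {x : X} (hx : x ∉ D) : SmoothFormAt a x :=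
  h.smoothFormOn.apply (isClosed_hypersurface D).isOpen_compl hx

lemma IsNumerator.eq_fromChart {b} (hb : IsNumerator Φ k a b) {x : X} (hx : x ∈ Φ.toX.source)
    (hxD : x ∉ D) : fromChart Φ.toX b x = (Φ.toX x 0) ^ k • a x := by
  refine eq_of_inChart_eq Φ.memX (b := fun x => (Φ.toX x 0) ^ k • a x) hx ?_
  have hz := Φ.toX.map_source hx
  rw [inChart_fromChart Φ.memX hz, hb.2 _ hz (Φ.coord_ne hx hxD),
    inChart_smul (fun x => (Φ.toX x 0) ^ k), Φ.toX.left_inv hx]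

lemma IsNumerator.smoothFormAt {b} (hb : IsNumerator Φ k a b) {x : X} (hx : x ∈ Φ.toX.source)
    (hxD : x ∉ D) : SmoothFormAt a x := by
  have hz := Φ.toX.map_source hx
  have h0 := Φ.coord_ne hx hxD
  rw [smoothFormAt_iff Φ.memX hx]
  refine (contDiffAt_form_smul ((contDiffAt_coord_pow _ k).inv (pow_ne_zero k h0))
    (hb.1 _ hz)).congr_of_eventuallyEq ?_
  filter_upwards [eventually_coord_ne Φ.toX.open_target hz h0] with ζ hζ
  rw [hb.2 ζ hζ.1 hζ.2]
  exact (inv_smul_smul₀ (pow_ne_zero k hζ.2) _).symm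

/-- Forms with poles are those which have numerators in all adapted charts. -/
lemma hasPoleLE_of_numerators (hA : HasAdaptedCharts n D)
    (h : ∀ Φ : AdaptedChart n D, ∃ b, IsNumerator Φ k a b) : HasPoleLE D k a := by
  refine hasPoleLE_of_charts hA ((smoothFormOn_iff (isClosed_hypersurface D).isOpen_compl).mpr
    fun x hx => ?_) fun p _ => ?_
  · obtain ⟨Φ, hp⟩ := hA x
    obtain ⟨b, hb⟩ := h Φ
    exact hb.smoothFormAt hp hx
  · obtain ⟨Φ, hp⟩ := hA p
    obtain ⟨b, hb⟩ := h Φ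
    exact ⟨Φ, _, Φ.toX.open_source, hp, subset_rfl, fromChart Φ.toX b,
      (smoothFormOn_iff Φ.toX.open_source).mpr fun x hx => smoothFormAt_fromChart Φ.memX hb.1 hx,
      fun x hx hxD => hb.eq_fromChart hx hxD⟩

/-- Forms supported in an adapted chart have poles as soon as they do so in this chart. -/
lemma IsNumerator.hasPoleLE (hA : HasAdaptedCharts n D) {b}
    (hb : IsNumerator Φ k a b) {K : Set X} (hK : IsClosed K) (hKΦ : K ⊆ Φ.toX.source)
    (h0 : ∀ x ∉ K, a x = 0) : HasPoleLE D k a := by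
  have hz : ∀ x ∉ K, SmoothFormAt a x := fun x hx => SmoothFormAt.zero.congr (by
    filter_upwards [hK.isOpen_compl.mem_nhds hx] with y hy using (h0 y hy).symm)
  refine hasPoleLE_of_charts hA ((smoothFormOn_iff (isClosed_hypersurface D).isOpen_compl).mpr
    fun x hx => ?_) fun p _ => ?_
  · by_cases hxK : x ∈ K
    exacts [hb.smoothFormAt (hKΦ hxK) hx, hz x hxK]
  · by_cases hp : p ∈ K
    · exact ⟨Φ, _, Φ.toX.open_source, hKΦ hp, subset_rfl, fromChart Φ.toX b,
        (smoothFormOn_iff Φ.toX.open_source).mpr fun x hx => smoothFormAt_fromChart Φ.memX hb.1 hx,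
        fun x hx hxD => hb.eq_fromChart hx hxD⟩
    · obtain ⟨Ψ, hpΨ⟩ := hA p
      have ho := Ψ.toX.open_source.inter hK.isOpen_compl
      refine ⟨Ψ, Ψ.toX.source ∩ Kᶜ, ho, ⟨hpΨ, hp⟩, inter_subset_left, fun _ => 0,
        (smoothFormOn_iff ho).mpr fun _ _ => SmoothFormAt.zero, fun x hx _ => ?_⟩
      rw [h0 x hx.2]
      exact (form_smul_zero _).symm

lemma IsNumerator.congr {b} (hb : IsNumerator Φ k a b)
    (h : ∀ x ∈ Φ.toX.source, x ∉ D → a' x = a x) : IsNumerator Φ k a' b :=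
  ⟨hb.1, fun z hz h0 => (hb.2 z hz h0).trans
    (by rw [inChart_congr (h _ (Φ.toX.map_target hz) (Φ.symm_notMem hz h0))])⟩

lemma IsNumerator.add {b b'} (hb : IsNumerator Φ k a b) (hb' : IsNumerator Φ k a' b') :
    IsNumerator Φ k (fun x => a x + a' x) fun z => b z + b' z :=
  ⟨fun z hz => (hb.1 z hz).add (hb'.1 z hz), fun z hz h0 => by
    beta_reduce
    rw [inChart_add, hb.2 z hz h0, hb'.2 z hz h0]; exact (smul_add _ _ _).symm⟩

lemma IsNumerator.mono {b} (hb : IsNumerator Φ k a b) (j : ℕ) :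
    IsNumerator Φ (k + j) a fun z => z 0 ^ j • b z :=
  ⟨fun z hz => contDiffAt_form_smul (contDiffAt_coord_pow z j) (hb.1 z hz), fun z hz h0 => by
    beta_reduce
    rw [hb.2 z hz h0, pow_add, mul_comm]; exact (mul_smul _ _ _).symm⟩

lemma IsNumerator.smul {b} (hb : IsNumerator Φ k a b) {c : X → ℂ}
    (hc : ∀ x ∈ Φ.toX.source, ContMDiffAt 𝓘(ℝ, ℂ^(n + 1)) 𝓘(ℝ, ℂ) ∞ c x) :
    IsNumerator Φ k (fun x => c x • a x) fun z => c (Φ.toX.symm z) • b z :=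
  ⟨fun z hz => contDiffAt_form_smul (contDiffAt_comp_symm Φ.memX hz (hc _ (Φ.toX.map_target hz)))
    (hb.1 z hz), fun z hz h0 => by
    beta_reduce
    rw [inChart_smul, hb.2 z hz h0]; exact smul_comm _ _ _⟩

lemma IsNumerator.holPart {b} (hb : IsNumerator Φ k a b) :
    IsNumerator Φ k (fun x => holPart (a x)) fun z => DivInt.holPart (b z) :=
  ⟨fun z hz => contDiffAt_holPart (hb.1 z hz), fun z hz h0 => by
    beta_reduce
    rw [inChart_holPart Φ.memX hz, hb.2 z hz h0, holPart_smul]⟩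

lemma IsNumerator.wedgeOne_dFun {b} (hb : IsNumerator Φ k a b) {c : X → ℂ}
    (hc : ∀ x ∈ Φ.toX.source, ContMDiffAt 𝓘(ℝ, ℂ^(n + 1)) 𝓘(ℝ, ℂ) ∞ c x) :
    IsNumerator Φ k (fun x => wedgeOne (dFun c x) (a x))
      fun z => wedgeOne (fderiv ℝ (c ∘ Φ.toX.symm) z) (b z) :=
  ⟨fun z hz => contDiffAt_wedgeOne ((contDiffAt_comp_symm Φ.memX hz
    (hc _ (Φ.toX.map_target hz))).fderiv_right (by simp)) (hb.1 z hz), fun z hz h0 => by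
    beta_reduce
    rw [inChart_wedgeOne Φ.memX hz ((hc _ (Φ.toX.map_target hz)).mdifferentiableAt (by simp)),
      hb.2 z hz h0, wedgeOne_smul_right]⟩

/-- The differential of `b = z₀ᵏ a`. -/
lemma IsNumerator.extDeriv_eq {b} (hb : IsNumerator Φ (k + 1) a b) {z : ℂ^(n + 1)}
    (hz : z ∈ Φ.toX.target) (h0 : z 0 ≠ 0) : extDeriv b z =
      ((k + 1 : ℂ) * z 0 ^ k) • wedgeOne (coordZero n) (inChart Φ.toX a z) +
        z 0 ^ (k + 1) • inChart Φ.toX (extD a) z := by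
  have hs := hb.smoothFormAt (Φ.toX.map_target hz) (Φ.symm_notMem hz h0)
  have h1 : b =ᶠ[𝓝 z] fun ζ => ζ 0 ^ (k + 1) • inChart Φ.toX a ζ := by
    filter_upwards [eventually_coord_ne Φ.toX.open_target hz h0] with ζ hζ
      using hb.2 ζ hζ.1 hζ.2
  have h2 : HasFDerivAt (fun ζ : ℂ^(n + 1) => ζ 0 ^ (k + 1))
      (((k + 1 : ℂ) * z 0 ^ k) • coordZero n) z := by
    have := (coordZero n).hasFDerivAt (x := z) |>.pow (k + 1)
    refine this.congr_fderiv ?_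
    ext v
    simp [coordZero_apply]
  rw [h1.extDeriv_eq, extDeriv_fun_smul_form h2.differentiableAt
    ((hs.contDiffAt Φ.memX hz).differentiableAt (by simp)), h2.fderiv, wedgeOne_smul_left,
    inChart_extD Φ.memX hz hs]

lemma HasPoleLE.mono (hA : HasAdaptedCharts n D)
    (h : HasPoleLE D k a) {j : ℕ} (hj : k ≤ j) : HasPoleLE D j a := by
  obtain ⟨i, rfl⟩ := Nat.exists_eq_add_of_le hj
  exact hasPoleLE_of_numerators hA fun Φ =>
    let ⟨b, hb⟩ := h.exists_numerator Φ
    ⟨_, hb.mono i⟩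

lemma HasPoleLE.congr (hA : HasAdaptedCharts n D)
    (h : HasPoleLE D k a) (ha : ∀ x ∉ D, a' x = a x) : HasPoleLE D k a' :=
  hasPoleLE_of_numerators hA fun Φ =>
    let ⟨b, hb⟩ := h.exists_numerator Φ
    ⟨b, hb.congr fun x _ => ha x⟩

lemma HasPoleLE.holPart (hA : HasAdaptedCharts n D)
    (h : HasPoleLE D k a) : HasPoleLE D k (fun x => DivInt.holPart (a x)) :=
  hasPoleLE_of_numerators hA fun Φ =>
    let ⟨_, hb⟩ := h.exists_numerator Φ
    ⟨_, hb.holPart⟩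

lemma HasPoleLE.smul (hA : HasAdaptedCharts n D)
    (h : HasPoleLE D k a) {c : X → ℂ}
    (hc : ∀ x, ContMDiffAt 𝓘(ℝ, ℂ^(n + 1)) 𝓘(ℝ, ℂ) ∞ c x) :
    HasPoleLE D k (fun x => c x • a x) :=
  hasPoleLE_of_numerators hA fun Φ =>
    let ⟨_, hb⟩ := h.exists_numerator Φ
    ⟨_, hb.smul fun x _ => hc x⟩

lemma HasPoleLE.sum (hA : HasAdaptedCharts n D) {ι : Type*}
    (s : Finset ι) {a : ι → DForm (n + 1) r X} (h : ∀ i, HasPoleLE D k (a i)) :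
    HasPoleLE D k (fun x => ∑ i ∈ s, a i x) := by
  refine hasPoleLE_of_numerators hA fun Φ => ?_
  choose b hb using fun i => (h i).exists_numerator Φ
  refine ⟨fun z => ∑ i ∈ s, b i z, fun z hz => ContDiffAt.sum fun i _ => (hb i).1 z hz,
    fun z hz h0 => ?_⟩
  rw [inChart_sum]
  exact (sum_congr rfl fun i _ => (hb i).2 z hz h0).trans Finset.smul_sum.symm

lemma HasPoleLE.add (hA : HasAdaptedCharts n D)
    (h : HasPoleLE D k a) (h' : HasPoleLE D k a') : HasPoleLE D k (fun x => a x + a' x) :=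
  hasPoleLE_of_numerators hA fun Φ =>
    let ⟨_, hb⟩ := h.exists_numerator Φ
    let ⟨_, hb'⟩ := h'.exists_numerator Φ
    ⟨_, hb.add hb'⟩

lemma HasPoleLE.zero (hA : HasAdaptedCharts n D) :
    HasPoleLE D k (fun _ => 0 : DForm (n + 1) r X) := by
  refine hasPoleLE_of_numerators hA fun Φ => ⟨fun _ => 0, fun _ _ => contDiffAt_const,
    fun z _ _ => ?_⟩
  rw [inChart_zero]
  exact (form_smul_zero _).symm

end Poles

/-! ### Holomorphic forms and splittings of numerators -/

lemma HolFormOn.smoothFormOn {a : DForm d r M} {U : Set M} (hU : IsOpen U)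
    (h : HolFormOn a U) : SmoothFormOn a U := fun e he =>
  contDiffOn_form fun v => (contDiffOn_of_differentiableOn (e.symm.isOpen_inter_preimage hU)
    ((evalForm v).differentiable.comp_differentiableOn (h.2 e he))).restrict_scalars ℝ

/-- Holomorphic forms of top degree are closed. -/
lemma extDeriv_eq_zero_of_holomorphic {A : ℂ^d → AltForm d d} {z : ℂ^d}
    (hA : DifferentiableAt ℂ A z) (hT : ∀ᶠ ζ in 𝓝 z, IsTypeHol (A ζ)) : extDeriv A z = 0 := by
  have h1 : fderiv ℝ A z = (fderiv ℂ A z).restrictScalars ℝ :=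
    (hA.hasFDerivAt.restrictScalars ℝ).fderiv
  refine IsTypeHol.eq_zero_of_lt (IsTypeHol.alternatize (T := fderiv ℝ A z) (fun u v i => ?_)
    fun u => ?_) (Nat.lt_succ_self d)
  · have hd := hA.restrictScalars ℝ
    have h2 := hasFDerivAt_form_apply hd (Function.update v i (I • v i))
    have h3 := (hasFDerivAt_form_apply hd v).const_mul I
    have h4 := h2.unique (h3.congr_of_eventuallyEq (hT.mono fun ζ hζ => hζ v i))
    exact congrArg (fun L : ℂ^d →L[ℝ] ℂ => L u) h4
  · rw [h1]
    exact (fderiv ℂ A z).map_smul I u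

lemma extD_eq_zero_of_chart {a : DForm d d M} (he : e ∈ holAtlas d M) {x : M} (hx : x ∈ e.source) (ha : SmoothFormAt a x)
    (hd : DifferentiableAt ℂ (inChart e a) (e x)) (hT : ∀ᶠ y in 𝓝 x, IsTypeHol (a y)) :
    extD a x = 0 := by
  have hz := e.map_source hx
  refine eq_of_inChart_eq he hx (b := fun _ => 0) ?_
  rw [inChart_extD he hz (by rwa [e.left_inv hx]), inChart_zero]
  refine extDeriv_eq_zero_of_holomorphic hd ?_
  have h1 : Tendsto e.symm (𝓝 (e x)) (𝓝 x) := by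
    have := e.continuousAt_symm hz
    rwa [ContinuousAt, e.left_inv hx] at this
  filter_upwards [e.open_target.mem_nhds hz, h1.eventually hT] with ζ hζ h using h.inChart he hζ

lemma HolFormOn.extD_eq_zero {a : DForm d d M} {U : Set M} (hU : IsOpen U)
    (h : HolFormOn a U) {x : M} (hx : x ∈ U) : extD a x = 0 := by
  set e := chartAt ℂ^d x
  have hxe := mem_chart_source ℂ^d x
  refine extD_eq_zero_of_chart (chartAt_mem_holAtlas x) hxe
    ((h.smoothFormOn hU).apply hU hx) ?_
    ((hU.eventually_mem hx).mono fun y hy => h.1 y hy)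
  refine (h.2 e (chart_mem_atlas _ x)).differentiableAt
    ((e.symm.isOpen_inter_preimage hU).mem_nhds ⟨e.map_source hxe, ?_⟩)
  rwa [mem_preimage, e.left_inv hxe]

/-- The exterior derivative commutes with complex conjugation. -/
lemma extD_conjForm {a : DForm d r M} {x : M} (ha : SmoothFormAt a x) :
    extD (fun y => conjForm (a y)) x = conjForm (extD a x) := by
  set e := chartAt ℂ^d x
  have he : e ∈ holAtlas d M := chartAt_mem_holAtlas x
  have hxe : x ∈ e.source := mem_chart_source ℂ^d x
  have hz := e.map_source hxe
  refine eq_of_inChart_eq he hxe (b := fun y => conjForm (extD a y)) ?_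
  have ha' : SmoothFormAt a (e.symm (e x)) := by rwa [e.left_inv hxe]
  rw [inChart_extD he hz ha'.conjForm, inChart_conjForm, inChart_extD he hz ha']
  have hd := (ha'.contDiffAt he hz).differentiableAt (by simp)
  have h1 : inChart e (fun y => conjForm (a y)) = fun z => conjForm (inChart e a z) :=
    funext fun z => inChart_conjForm a
  have hd' := ((ha'.conjForm).contDiffAt he hz).differentiableAt (by simp)
  rw [h1] at hd' ⊢
  ext v
  rw [extDeriv_apply hd', conjForm_apply, extDeriv_apply hd, map_sum]
  refine sum_congr rfl fun i _ => ?_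
  have h2 := (hasFDerivAt_form_apply hd (i.removeNth v))
  have h3 : HasFDerivAt (fun z => conjForm (inChart e a z) (i.removeNth v)) _ (e x) :=
    (Complex.conjCLE : ℂ →L[ℝ] ℂ).hasFDerivAt.comp (e x) h2
  rw [h3.fderiv, h2.fderiv]
  change (-1 : ℤ) ^ (i : ℕ) • conj _ = conj ((-1 : ℤ) ^ (i : ℕ) • _)
  rw [map_zsmul]
  rfl

lemma extD_conjForm_eq_zero {a : DForm d r M} {x : M} (ha : SmoothFormAt a x)
    (h : extD a x = 0) : extD (fun y => conjForm (a y)) x = 0 := by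
  rw [extD_conjForm ha, h]
  ext v
  exact map_zero conj

section Splitting

variable {k : ℕ} {a : DForm (n + 1) (r + 1) X}

lemma IsMeromorphicForm.hasPoleLE {a : DForm (n + 1) r X} (h : IsMeromorphicForm D k a) :
    HasPoleLE D k a := fun U f hf =>
  let ⟨b, hb, hba⟩ := h U f hf
  ⟨b, hb.smoothFormOn hf.isOpen, hba⟩

lemma IsMeromorphicForm.isTypeHol {a : DForm (n + 1) r X} (h : IsMeromorphicForm D k a) {x : X}
    (hx : x ∉ D) : IsTypeHol (a x) := by
  obtain ⟨b, hb, hba⟩ := h _ _ (isLocalEquation_one D)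
  have := hba x hx hx
  rw [one_pow] at this
  have h2 := hb.1 x hx
  rw [this] at h2
  exact (one_smul ℂ (a x)) ▸ h2

lemma IsMeromorphicForm.extD_eq_zero {a : DForm (n + 1) (n + 1) X}
    (h : IsMeromorphicForm D k a) {x : X} (hx : x ∉ D) : extD a x = 0 := by
  have ho := (isClosed_hypersurface D).isOpen_compl
  obtain ⟨b, hb, hba⟩ := h _ _ (isLocalEquation_one D)
  rw [extD_congr (b := b), hb.extD_eq_zero ho hx]
  filter_upwards [ho.mem_nhds hx] with y hy
  rw [hba y hy hy, one_pow]
  exact (one_smul ℂ (a y)).symm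

/-- A numerator `b` of a form is `dz₀ ∧ s + z₀ t`, where `s` is the contraction of `b` with
`∂/∂z₀`. -/
def IsSplit (Φ : AdaptedChart n D) (b T : ℂ^(n + 1) → AltForm (n + 1) (r + 1)) : Prop :=
  (∀ z ∈ Φ.toX.target, ContDiffAt ℝ ∞ T z) ∧ ∀ z ∈ Φ.toX.target, z 0 ≠ 0 →
    b z = wedgeOne (coordZero n) ((b z).curryLeft (stdBasis (n + 1) 0)) + z 0 • T z

lemma coordZero_stdBasis : coordZero n (stdBasis (n + 1) 0) = 1 := by
  rw [coordZero_apply, stdBasis, Pi.single_eq_same]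

/-- For a closed form `a`, the identity `b = z₀ᵏ⁺¹ a` gives `dz₀ ∧ b = z₀ db / (k + 1)`. Contraction
with `∂/∂z₀` yields `b = dz₀ ∧ s + z₀ t`. -/
lemma IsNumerator.exists_isSplit_of_closed {Φ : AdaptedChart n D} {b}
    (hb : IsNumerator Φ (k + 1) a b) (ha : ∀ x ∉ D, DivInt.extD a x = 0) :
    ∃ T, IsSplit Φ b T := by
  refine ⟨fun z => (k + 1 : ℂ)⁻¹ • (extDeriv b z).curryLeft (stdBasis (n + 1) 0),
    fun z hz => contDiffAt_form_smul contDiffAt_const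
      (contDiffAt_curryLeft (contDiffAt_extDeriv (hb.1 z hz)) _), fun z hz h0 => ?_⟩
  have h1 := wedgeOne_curryLeft (coordZero n) (b z) (stdBasis (n + 1) 0)
  rw [coordZero_stdBasis] at h1
  have h2 := hb.extDeriv_eq hz h0
  rw [inChart_congr (b := fun _ => 0) (ha _ (Φ.symm_notMem hz h0)), inChart_zero] at h2
  have h3 : wedgeOne (coordZero n) (b z) = (z 0 * (k + 1 : ℂ)⁻¹) • extDeriv b z := by
    rw [h2, hb.2 z hz h0, wedgeOne_smul_right]
    ext v
    have : (k + 1 : ℂ) ≠ 0 := by exact_mod_cast k.succ_ne_zero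
    have h0' : (0 : AltForm (n + 1) (r + 1 + 1)) v = 0 := rfl
    change _ * _ = _ * (_ * _ + _ * (0 : AltForm (n + 1) (r + 1 + 1)) v)
    rw [h0']
    field_simp
    ring
  refine (one_smul ℂ (b z)).symm.trans (h1.symm.trans (congrArg _ ?_))
  rw [h3]
  ext v
  change (z 0 * (k + 1 : ℂ)⁻¹) * _ = z 0 * ((k + 1 : ℂ)⁻¹ * _)
  rw [mul_assoc]
  rfl

/-- For forms of type `(n + 1, 0)` the product `dz₀ ∧ b` vanishes, and `t = 0`. -/
lemma IsNumerator.exists_isSplit_of_isTypeHol {a : DForm (n + 1) (n + 1) X}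
    {Φ : AdaptedChart n D} {b} (hb : IsNumerator Φ k a b) (ha : ∀ x ∉ D, IsTypeHol (a x)) :
    ∃ T, IsSplit Φ b T := by
  refine ⟨fun _ => 0, fun _ _ => contDiffAt_const, fun z hz h0 => ?_⟩
  have h1 := wedgeOne_curryLeft (coordZero n) (b z) (stdBasis (n + 1) 0)
  have h2 : IsTypeHol (b z) := by
    rw [hb.2 z hz h0]
    exact ((ha _ (Φ.symm_notMem hz h0)).inChart Φ.memX hz).smul _
  rw [coordZero_stdBasis, wedgeOne_eq_zero (fun u => by simp [coordZero_apply]) h2] at h1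
  refine (one_smul ℂ (b z)).symm.trans (h1.symm.trans (congrArg _ ?_))
  ext v
  exact (mul_zero _).symm

end Splitting

/-! ### Lowering the order of a pole -/

section Reduction

variable {k : ℕ} {a : DForm (n + 1) (r + 1) X}

/-- In an adapted chart the form `c = s / ((k+1) z₀ᵏ⁺¹)` removes the pole of order `k + 2` of a form
`(dz₀ ∧ s + z₀ t) / z₀ᵏ⁺²`. -/
lemma IsNumerator.exists_local_primitive {Φ : AdaptedChart n D} {b T}
    (hb : IsNumerator Φ (k + 2) a b) (hT : IsSplit Φ b T) :
    ∃ (c : DForm (n + 1) r X) (b₁ : ℂ^(n + 1) → AltForm (n + 1) r)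
      (b₂ : ℂ^(n + 1) → AltForm (n + 1) (r + 1)),
      IsNumerator Φ (k + 1) c b₁ ∧ IsNumerator Φ (k + 1) (fun x => a x + DivInt.extD c x) b₂ ∧
      ((∀ x ∉ D, IsTypeHol (a x)) → ∀ x ∈ Φ.toX.source, x ∉ D → IsTypeHol (c x)) := by
  have hk : (k + 1 : ℂ) ≠ 0 := by exact_mod_cast k.succ_ne_zero
  set b₁ : ℂ^(n + 1) → AltForm (n + 1) r :=
    fun z => (k + 1 : ℂ)⁻¹ • (b z).curryLeft (stdBasis (n + 1) 0) with hb₁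
  -- `c = s / ((k + 1) z₀ᵏ⁺¹)`
  set c : DForm (n + 1) r X := fun x => ((Φ.toX x 0) ^ (k + 1))⁻¹ • fromChart Φ.toX b₁ x with hc
  have hb₁s : ∀ z ∈ Φ.toX.target, ContDiffAt ℝ ∞ b₁ z := fun z hz =>
    contDiffAt_form_smul contDiffAt_const (contDiffAt_curryLeft (hb.1 z hz) _)
  have hcn : IsNumerator Φ (k + 1) c b₁ := ⟨hb₁s, fun z hz h0 => by
    rw [hc, inChart_smul (fun x => ((Φ.toX x 0) ^ (k + 1))⁻¹), inChart_fromChart Φ.memX hz,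
      Φ.toX.right_inv hz]
    exact (smul_inv_smul₀ (pow_ne_zero _ h0) _).symm⟩
  refine ⟨c, b₁, fun z => T z + extDeriv b₁ z, hcn,
    ⟨fun z hz => (hT.1 z hz).add (contDiffAt_extDeriv (hb₁s z hz)), fun z hz h0 => ?_⟩,
    fun ha x hx hxD => ?_⟩
  · have h1 := hT.2 z hz h0
    have h2 := hcn.2 z hz h0
    have h3 := hb.2 z hz h0
    beta_reduce
    rw [hcn.extDeriv_eq hz h0, inChart_add]
    have h4 : (b z).curryLeft (stdBasis (n + 1) 0) =
        ((k + 1 : ℂ) * z 0 ^ (k + 1)) • inChart Φ.toX c z := by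
      refine (smul_inv_smul₀ hk _).symm.trans ((congrArg _ h2).trans ?_)
      exact (mul_smul _ _ _).symm
    rw [h4, wedgeOne_smul_right, h3] at h1
    ext v
    have h5 := congrArg (fun F : AltForm (n + 1) (r + 1) => F v) h1
    change z 0 ^ (k + 2) * _ = ((k + 1 : ℂ) * z 0 ^ (k + 1)) * _ + z 0 * _ at h5
    change T z v + (((k + 1 : ℂ) * z 0 ^ k) * _ + z 0 ^ (k + 1) * _) = z 0 ^ (k + 1) * (_ + _)
    refine mul_left_cancel₀ h0 ?_
    linear_combination -h5
  · refine isTypeHol_of_inChart Φ.memX hx ?_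
    have hz := Φ.toX.map_source hx
    have h0 := Φ.coord_ne hx hxD
    rw [hc, inChart_smul (fun x => ((Φ.toX x 0) ^ (k + 1))⁻¹), inChart_fromChart Φ.memX hz, hb₁]
    beta_reduce
    rw [hb.2 _ hz h0]
    refine IsTypeHol.smul (IsTypeHol.smul (IsTypeHol.curryLeft (IsTypeHol.smul ?_ _) _) _) _
    exact IsTypeHol.inChart Φ.memX hz (ha _ (Φ.symm_notMem hz h0))

lemma form_smul_add_eq {d r : ℕ} (c : ℂ) (A B W : AltForm d r) :
    c • A + (W + c • B) = c • (A + B) + W := by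
  ext v
  change c * A v + (W v + c * B v) = c * (A v + B v) + W v
  ring

lemma eventually_zero_of_tsupport {χ : X → ℝ} {x : X} (hx : x ∉ tsupport χ) :
    ∀ᶠ y in 𝓝 x, ((χ y : ℝ) : ℂ) = 0 := by
  filter_upwards [(isClosed_tsupport χ).isOpen_compl.mem_nhds hx] with y hy
  rw [image_eq_zero_of_notMem_tsupport hy, ofReal_zero]

variable (hA : HasAdaptedCharts n D)
include hA

/-- The order of a pole can be lowered by adding an exact form with poles. -/
lemma HasPoleLE.exists_reduce (ha : HasPoleLE D (k + 2) a)
    (hs : ∀ (Φ : AdaptedChart n D) (b), IsNumerator Φ (k + 2) a b → ∃ T, IsSplit Φ b T) :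
    ∃ c : DForm (n + 1) r X, HasPoleLE D (k + 1) c ∧
      HasPoleLE D (k + 1) (fun x => a x + extD c x) ∧
      ((∀ x ∉ D, IsTypeHol (a x)) → ∀ x ∉ D, IsTypeHol (c x)) := by
  choose Φ hΦ using hA
  obtain ⟨s, χ, hχ, -, hsub, hsum⟩ := exists_finite_partitionOfUnity (d := n + 1)
    (fun p => (Φ p).toX.source) (fun p => (Φ p).toX.open_source) hΦ
  choose b hb using fun p => ha.exists_numerator (Φ p)
  choose T hT using fun p => hs (Φ p) (b p) (hb p)
  choose c b₁ b₂ hc₁ hc₂ hc₃ using fun p => (hb p).exists_local_primitive (hT p)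
  have hχs : ∀ p x, ContMDiffAt 𝓘(ℝ, ℂ^(n + 1)) 𝓘(ℝ, ℂ) ∞ (fun y => ((χ p y : ℝ) : ℂ)) x :=
    fun p x => contMDiff_ofReal (hχ p x)
  -- glue the local primitives with a partition of unity; the terms `dχ ∧ c` have the lower order
  set c' : X → DForm (n + 1) r X := fun p x => ((χ p x : ℝ) : ℂ) • c p x with hc'
  have hA' : HasAdaptedCharts n D := fun p => ⟨Φ p, hΦ p⟩
  have hz : ∀ p, ∀ x ∉ tsupport (χ p), c' p =ᶠ[𝓝 x] fun _ => 0 := fun p x hx => by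
    filter_upwards [eventually_zero_of_tsupport hx] with y hy
    rw [hc']; beta_reduce
    rw [hy]
    exact form_zero_smul _
  have h1 : ∀ p, HasPoleLE D (k + 1) (c' p) := fun p =>
    ((hc₁ p).smul fun x _ => hχs p x).hasPoleLE hA' (isClosed_tsupport _) (hsub p)
      fun x hx => (hz p x hx).eq_of_nhds
  have h2 : ∀ p, HasPoleLE D (k + 1) (fun x => ((χ p x : ℝ) : ℂ) • a x + extD (c' p) x) := by
    intro p
    refine ((((hc₂ p).smul fun x _ => hχs p x).add ((hc₁ p).wedgeOne_dFun
      fun x _ => hχs p x)).congr fun x hx hxD => ?_).hasPoleLE hA' (isClosed_tsupport (χ p)) (hsub p)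
        fun x hx => ?_
    · rw [hc', extD_smul (hχs p x) ((hc₁ p).smoothFormAt hx hxD)]
      exact form_smul_add_eq _ _ _ _
    · rw [extD_congr (hz p x hx), extD_zero, (eventually_zero_of_tsupport hx).self_of_nhds]
      exact (add_zero _).trans (form_zero_smul _)
  refine ⟨fun x => ∑ p ∈ s, c' p x, HasPoleLE.sum hA' s h1,
    (HasPoleLE.sum hA' s h2).congr hA' fun x hx => ?_, fun ha x hx => IsTypeHol.sum fun p _ => ?_⟩
  · rw [extD_sum fun p _ => (h1 p).smoothFormAt hx]
    refine Eq.trans ?_ Finset.sum_add_distrib.symm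
    refine congrArg (· + _) ?_
    refine ((one_smul ℂ (a x)).symm.trans ?_).trans Finset.sum_smul
    rw [← ofReal_sum, hsum, ofReal_one]
  · by_cases hxp : x ∈ (Φ p).toX.source
    · exact (hc₃ p ha x hxp hx).smul _
    · rw [(hz p x fun h => hxp (hsub p h)).eq_of_nhds]
      exact isTypeHol_zero

/-- Every closed form with poles is cohomologous to one with a simple pole. -/
lemma HasPoleLE.exists_simple_of_closed (ha : HasPoleLE D (k + 1) a)
    (hcl : ∀ x ∉ D, extD a x = 0) :
    ∃ c : DForm (n + 1) r X, (∃ j, HasPoleLE D j c) ∧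
      HasPoleLE D 1 (fun x => a x + extD c x) := by
  have ho := (isClosed_hypersurface D).isOpen_compl
  induction k generalizing a with
  | zero =>
    refine ⟨fun _ => 0, ⟨0, HasPoleLE.zero hA⟩, ha.congr hA fun x _ => ?_⟩
    rw [extD_zero]
    exact add_zero _
  | succ k ih =>
    obtain ⟨c, hc, hac, -⟩ := ha.exists_reduce hA fun Φ b hb => hb.exists_isSplit_of_closed hcl
    have hcs := hc.smoothFormOn
    obtain ⟨c₂, ⟨j, hc₂⟩, h⟩ := ih hac fun x hx => by
      rw [extD_add (ha.smoothFormAt hx) ((hcs.extD ho).apply ho hx), hcl x hx, extD_extD ho hcs hx]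
      exact add_zero _
    refine ⟨fun x => c x + c₂ x, ⟨k + 1 + j, (hc.mono hA (by omega)).add hA
      (hc₂.mono hA (by omega))⟩, h.congr hA fun x hx => ?_⟩
    rw [extD_add (hc.smoothFormAt hx) (hc₂.smoothFormAt hx)]
    exact (add_assoc _ _ _).symm

/-- The analogue for forms of type `(n+1, 0)` and the operator `∂`. -/
lemma HasPoleLE.exists_simple_of_isTypeHol {a : DForm (n + 1) (n + 1) X}
    (ha : HasPoleLE D (k + 1) a) (ht : ∀ x ∉ D, IsTypeHol (a x)) :
    ∃ c : DForm (n + 1) n X, (∃ j, HasPoleLE D j c) ∧ (∀ x ∉ D, IsTypeHol (c x)) ∧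
      HasPoleLE D 1 (fun x => a x + del c x) := by
  induction k generalizing a with
  | zero =>
    refine ⟨fun _ => 0, ⟨0, HasPoleLE.zero hA⟩, fun _ _ => isTypeHol_zero,
      ha.congr hA fun x _ => ?_⟩
    rw [del, extD_zero, holPart_zero]
    exact add_zero _
  | succ k ih =>
    obtain ⟨c, hc, hac, hct⟩ := ha.exists_reduce hA fun Φ b hb => hb.exists_isSplit_of_isTypeHol ht
    obtain ⟨c₂, ⟨j, hc₂⟩, ht₂, h⟩ := ih (a := fun x => a x + del c x)
      ((hac.holPart hA).congr hA fun x hx => by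
        rw [holPart_add, holPart_eq_self (ht x hx)]; rfl)
      fun x hx => (ht x hx).add (isTypeHol_holPart _)
    refine ⟨fun x => c x + c₂ x, ⟨k + 1 + j, (hc.mono hA (by omega)).add hA
      (hc₂.mono hA (by omega))⟩, fun x hx => (hct ht x hx).add (ht₂ x hx),
      h.congr hA fun x hx => ?_⟩
    rw [del, extD_add (hc.smoothFormAt hx) (hc₂.smoothFormAt hx), holPart_add]
    exact (add_assoc _ _ _).symm

/-- A simple pole with numerator `dz₀ ∧ s + z₀ t` has the Poincaré residue `s|_D`. -/
lemma exists_residue_of_split (ha : HasPoleLE D 1 a)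
    (hs : ∀ (Φ : AdaptedChart n D) (b), IsNumerator Φ 1 a b → ∃ T, IsSplit Φ b T) :
    ∃ ρ : DForm n r D, IsPoincareResidue D a ρ := by
  refine exists_poincareResidue fun p => ?_
  obtain ⟨Φ, hp⟩ := hA p
  obtain ⟨b, hb⟩ := ha.exists_numerator Φ
  obtain ⟨T, hT⟩ := hs Φ b hb
  have hf := Φ.isLocalEquation _ Φ.toX.open_source subset_rfl
  refine ⟨Φ, _, _, fromChart Φ.toX fun z => (b z).curryLeft (stdBasis (n + 1) 0),
    fromChart Φ.toX T, hp, subset_rfl, hf,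
    (smoothFormOn_iff Φ.toX.open_source).mpr fun x hx => smoothFormAt_fromChart Φ.memX
      (fun z hz => contDiffAt_curryLeft (hb.1 z hz) _) hx,
    (smoothFormOn_iff Φ.toX.open_source).mpr fun x hx => smoothFormAt_fromChart Φ.memX hT.1 hx,
    fun x hx hxD => ?_⟩
  have hz := Φ.toX.map_source hx
  have h0 := Φ.coord_ne hx hxD
  refine eq_of_inChart_eq Φ.memX (b := fun x => (Φ.toX x 0)⁻¹ • wedgeOne (dFun (fun x => Φ.toX x 0) x)
    (fromChart Φ.toX (fun z => (b z).curryLeft (stdBasis (n + 1) 0)) x) + fromChart Φ.toX T x) hx ?_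
  rw [inChart_add, inChart_smul (fun x => (Φ.toX x 0)⁻¹), inChart_wedgeOne Φ.memX hz
    ((hf.contMDiffAt (Φ.toX.map_target hz)).mdifferentiableAt (by simp)),
    inChart_fromChart Φ.memX hz, inChart_fromChart Φ.memX hz, Φ.toX.left_inv hx]
  have h1 : ((fun x => Φ.toX x 0) ∘ Φ.toX.symm) =ᶠ[𝓝 (Φ.toX x)] fun z => z 0 := by
    filter_upwards [Φ.toX.open_target.mem_nhds hz] with z hz
    rw [Function.comp_apply, Φ.toX.right_inv hz]
  rw [h1.fderiv_eq, fderiv_coord]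
  have h2 := hT.2 _ hz h0
  have h3 := hb.2 _ hz h0
  rw [pow_one] at h3
  have h4 : inChart Φ.toX a (Φ.toX x) = (Φ.toX x 0)⁻¹ • b (Φ.toX x) := by
    rw [h3]; exact (inv_smul_smul₀ h0 _).symm
  rw [h4]
  refine (congrArg _ h2).trans ((smul_add _ _ _).trans (congrArg _ ?_))
  exact inv_smul_smul₀ h0 _

omit hA in
/-- For type `(n + 1, 0)`, simple poles are logarithmic because `df ∧ a = 0`. -/
lemma HasPoleLE.isLogForm {a : DForm (n + 1) (n + 1) X} (ha : HasPoleLE D 1 a)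
    (ht : ∀ x ∉ D, IsTypeHol (a x)) : IsLogForm D a := by
  intro U f hf
  obtain ⟨b, hb, hba⟩ := ha U f hf
  refine ⟨⟨b, hb, fun x hx hxD => by rw [hba x hx hxD, pow_one]⟩, fun _ => 0,
    (smoothFormOn_iff hf.isOpen).mpr fun _ _ => SmoothFormAt.zero, fun x hx hxD => ?_⟩
  set e := chartAt ℂ^(n + 1) x
  have he : e ∈ holAtlas (n + 1) X := chartAt_mem_holAtlas x
  have hxe : x ∈ e.source := mem_chart_source ℂ^(n + 1) x
  have hz := e.map_source hxe
  have hx' : e.symm (e x) = x := e.left_inv hxe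
  refine eq_of_inChart_eq he (a := fun _ => 0) (b := fun x => wedgeOne (dFun f x) (a x)) hxe ?_
  have hd := differentiableAt_comp_symm he hz (hx'.symm ▸ hf.mdifferentiableAt hx)
  rw [inChart_zero, inChart_wedgeOne he hz
    (hx'.symm ▸ (hf.contMDiffAt hx).mdifferentiableAt (by simp)),
    (hd.hasFDerivAt.restrictScalars ℝ).fderiv]
  exact (wedgeOne_eq_zero (fun u => (fderiv ℂ (f ∘ e.symm) (e x)).map_smul I u)
    (IsTypeHol.inChart he hz (hx'.symm ▸ ht x hxD))).symm

end Reduction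

/-! ### Residues of forms of top holomorphic type -/

section HolResidue

/-- Continuous functions which agree off the hyperplane `z₀ = 0` agree. -/
lemma eq_of_coord_ne {n : ℕ} {V : Type*} [TopologicalSpace V] [T2Space V]
    {F G : ℂ^(n + 1) → V} {U : Set ℂ^(n + 1)} (hU : IsOpen U)
    {z : ℂ^(n + 1)} (hz : z ∈ U) (hF : ContinuousAt F z) (hG : ContinuousAt G z)
    (h : ∀ ζ ∈ U, ζ 0 ≠ 0 → F ζ = G ζ) : F z = G z := by
  refine tendsto_nhds_unique (l := 𝓝[{ζ | ζ 0 ≠ 0}] z) (hF.mono_left nhdsWithin_le_nhds)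
    ((hG.mono_left nhdsWithin_le_nhds).congr' ?_)
  filter_upwards [self_mem_nhdsWithin, nhdsWithin_le_nhds (hU.mem_nhds hz)] with ζ h0 hζ
    using (h ζ hζ h0).symm

lemma minSmoothness_two_le : minSmoothness ℝ 2 ≤ ∞ := by
  rw [minSmoothness_of_isRCLikeNormedField]
  exact WithTop.coe_le_coe.mpr (le_top (a := (2 : ℕ∞)))

/-- The restriction to the hyperplane commutes with the exterior derivative. -/
lemma extDeriv_hyperRestrict {n r : ℕ} {S : ℂ^(n + 1) → AltForm (n + 1) r}
    {w : ℂ^n} (hS : DifferentiableAt ℝ S (hyperIncl n w)) :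
    extDeriv (fun w => hyperRestrict (S (hyperIncl n w))) w =
      hyperRestrict (extDeriv S (hyperIncl n w)) := by
  set L := (hyperIncl n).restrictScalars ℝ
  have h := extDeriv_pullback (f := L) (x := w) hS (r := ∞) L.contDiff.contDiffAt minSmoothness_two_le
  simp only [L.fderiv] at h
  exact h

/-- `d(dz₀ ∧ S) = -dz₀ ∧ dS`. -/
lemma extDeriv_wedgeOne_coordZero {n r : ℕ} {S : ℂ^(n + 1) → AltForm (n + 1) r}
    {z : ℂ^(n + 1)} (hS : ContDiffAt ℝ ∞ S z) :
    extDeriv (fun z => wedgeOne (coordZero n) (S z)) z =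
      (-1 : ℂ) • wedgeOne (coordZero n) (extDeriv S z) := by
  have hc : ∀ ζ : ℂ^(n + 1), DifferentiableAt ℝ (fun ζ : ℂ^(n + 1) => ζ 0) ζ :=
    fun ζ => (coordZero n).differentiableAt
  have hev : ∀ᶠ ζ in 𝓝 z, ContDiffAt ℝ 1 S ζ := (hS.of_le (by simp)).eventually (by simp)
  -- `dz₀ ∧ S = d(z₀ S) - z₀ dS`
  have h1 : (fun z => wedgeOne (coordZero n) (S z)) =ᶠ[𝓝 z] fun ζ =>
      extDeriv (fun ζ => ζ 0 • S ζ) ζ + (-ζ 0) • extDeriv S ζ := by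
    filter_upwards [hev] with ζ hζ
    rw [extDeriv_fun_smul_form (hc ζ) (hζ.differentiableAt (by simp)), fderiv_coord]
    ext v
    change wedgeOne (coordZero n) (S ζ) v =
      wedgeOne (coordZero n) (S ζ) v + ζ 0 * extDeriv S ζ v + -ζ 0 * extDeriv S ζ v
    ring
  have hd1 : ContDiffAt ℝ ∞ (fun ζ : ℂ^(n + 1) => ζ 0 • S ζ) z :=
    contDiffAt_form_smul (by fun_prop) hS
  have hd2 := contDiffAt_extDeriv hS
  have hd3 : DifferentiableAt ℝ (fun ζ : ℂ^(n + 1) => -ζ 0) z := (hc z).neg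
  rw [h1.extDeriv_eq]
  have h2 := extDeriv_fun_add ((contDiffAt_extDeriv hd1).differentiableAt (by simp))
    ((contDiffAt_form_smul (c := fun ζ : ℂ^(n + 1) => -ζ 0) (by fun_prop) hd2).differentiableAt
      (by simp))
  rw [h2, extDeriv_extDeriv_apply (r := ∞) hd1 minSmoothness_two_le,
    extDeriv_fun_smul_form hd3 (hd2.differentiableAt (by simp)),
    extDeriv_extDeriv_apply (r := ∞) hS minSmoothness_two_le]
  have h3 : fderiv ℝ (fun ζ : ℂ^(n + 1) => -ζ 0) z = (-1 : ℂ) • coordZero n := by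
    rw [fderiv_fun_neg, fderiv_coord]
    ext v
    change -_ = (-1 : ℂ) * _
    ring
  rw [h3, wedgeOne_smul_left, form_smul_zero]
  exact (zero_add _).trans (add_zero _)

variable {k : ℕ} {Φ : AdaptedChart n D}

lemma IsNumerator.isTypeHol {a : DForm (n + 1) r X} {b} (hb : IsNumerator Φ k a b)
    (ha : ∀ x ∉ D, IsTypeHol (a x)) {z} (hz : z ∈ Φ.toX.target) : IsTypeHol (b z) := by
  rw [← eq_of_coord_ne (F := fun z => DivInt.holPart (b z)) Φ.toX.open_target hz
    (contDiffAt_holPart (hb.1 z hz)).continuousAt (hb.1 z hz).continuousAt fun ζ hζ h0 => ?_]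
  · exact isTypeHol_holPart _
  · rw [hb.2 ζ hζ h0]
    exact holPart_eq_self (((ha _ (Φ.symm_notMem hζ h0)).inChart Φ.memX hζ).smul _)

/-- A form of top holomorphic type is `dz₀` times its contraction with `∂/∂z₀`. -/
lemma wedgeOne_coordZero_curryLeft {b : AltForm (n + 1) (n + 1)} (hb : IsTypeHol b) :
    wedgeOne (coordZero n) (b.curryLeft (stdBasis (n + 1) 0)) = b := by
  have h1 := wedgeOne_curryLeft (coordZero n) b (stdBasis (n + 1) 0)
  rw [coordZero_stdBasis, wedgeOne_eq_zero (fun u => by simp [coordZero_apply]) hb] at h1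
  exact (add_zero _).symm.trans (h1.trans (one_smul ℂ b))

lemma IsNumerator.residue_eq {a : DForm (n + 1) (r + 1) X} {b} (hb : IsNumerator Φ 1 a b)
    {ρ : DForm n r D} (hρ : IsPoincareResidue D a ρ) {w : ℂ^n} (hw : w ∈ Φ.toD.target) :
    ∃ S, b (hyperIncl n w) = wedgeOne (coordZero n) S ∧ inChart Φ.toD ρ w = hyperRestrict S := by
  have hz := Φ.mem_toD_target_iff.mp hw
  have hs : ((Φ.toD.symm w : D) : X) ∈ Φ.toX.source := by
    rw [← Φ.symm_hyperIncl hw]; exact Φ.toX.map_target hz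
  obtain ⟨S, h1, h2⟩ := Φ.residue_eq hρ hw (smoothFormAt_fromChart Φ.memX hb.1 hs) (by
    filter_upwards [Φ.toX.open_source.mem_nhds hs] with x hx hxD
    rw [hb.eq_fromChart hx hxD, pow_one])
  rw [inChart_fromChart Φ.memX hz] at h1
  exact ⟨S, h1, h2.symm⟩

/-- The Poincaré residue is the restriction to `D` of the contraction of the numerator with `∂/∂z₀`.
-/
lemma IsNumerator.residue_eq_curryLeft {a : DForm (n + 1) (r + 1) X} {b}
    (hb : IsNumerator Φ 1 a b) {ρ : DForm n r D} (hρ : IsPoincareResidue D a ρ) {w : ℂ^n}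
    (hw : w ∈ Φ.toD.target) : inChart Φ.toD ρ w =
      hyperRestrict ((b (hyperIncl n w)).curryLeft (stdBasis (n + 1) 0)) := by
  obtain ⟨S, h1, h2⟩ := hb.residue_eq hρ hw
  rw [h1, h2, hyperRestrict_wedgeOne_coordZero_curryLeft]

lemma IsTypeHol.hyperRestrict {a : AltForm (n + 1) r} (ha : IsTypeHol a) :
    IsTypeHol (hyperRestrict a) :=
  ha.comp fun u => (hyperIncl n).map_smul I u

variable {β : DForm (n + 1) (n + 1) X} {ρ : DForm n n D}

lemma exists_chart_at_mem (hA : HasAdaptedCharts n D) (p : D) :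
    ∃ Φ : AdaptedChart n D, p ∈ Φ.toD.source :=
  let ⟨Φ, hp⟩ := hA p
  ⟨Φ, (Φ.source_iff p).mpr hp⟩

/-- The residue of a form of type `(n + 1, 0)` has type `(n, 0)`. -/
lemma IsPoincareResidue.isTypeHol (hA : HasAdaptedCharts n D)
    (hβ : HasPoleLE D 1 β) (ht : ∀ x ∉ D, IsTypeHol (β x)) (hρ : IsPoincareResidue D β ρ) (p : D) :
    IsTypeHol (ρ p) := by
  obtain ⟨Φ, hp⟩ := exists_chart_at_mem hA p
  obtain ⟨b, hb⟩ := hβ.exists_numerator Φ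
  have hw := Φ.toD.map_source hp
  refine isTypeHol_of_inChart Φ.memD hp ?_
  rw [hb.residue_eq_curryLeft hρ hw]
  exact ((hb.isTypeHol ht (Φ.mem_toD_target_iff.mp hw)).curryLeft _).hyperRestrict

/-- The residue of a closed form of type `(n+1, 0)` is closed. -/
lemma IsPoincareResidue.extD_eq_zero (hA : HasAdaptedCharts n D)
    (hDe : IsEmbedding (Subtype.val : D → X)) (hβ : HasPoleLE D 1 β)
    (ht : ∀ x ∉ D, IsTypeHol (β x)) (hcl : ∀ x ∉ D, extD β x = 0) (hρ : IsPoincareResidue D β ρ)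
    (p : D) : extD ρ p = 0 := by
  obtain ⟨Φ, hp⟩ := exists_chart_at_mem hA p
  obtain ⟨b, hb⟩ := hβ.exists_numerator Φ
  have hw := Φ.toD.map_source hp
  have hz := Φ.mem_toD_target_iff.mp hw
  set S := fun z => (b z).curryLeft (stdBasis (n + 1) 0) with hS
  have hSs : ∀ z ∈ Φ.toX.target, ContDiffAt ℝ ∞ S z := fun z hz => contDiffAt_curryLeft (hb.1 z hz) _
  have h0 : extDeriv b (hyperIncl n (Φ.toD p)) = 0 := by
    refine eq_of_coord_ne (G := fun _ => 0) Φ.toX.open_target hz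
      (contDiffAt_extDeriv (hb.1 _ hz)).continuousAt continuousAt_const fun ζ hζ h0 => ?_
    rw [hb.extDeriv_eq (k := 0) hζ h0, wedgeOne_eq_zero (fun u => by simp [coordZero_apply])
      ((ht _ (Φ.symm_notMem hζ h0)).inChart Φ.memX hζ),
      inChart_congr (b := fun _ => 0) (hcl _ (Φ.symm_notMem hζ h0)), inChart_zero, form_smul_zero,
      form_smul_zero]
    exact add_zero _
  have h1 : b =ᶠ[𝓝 (hyperIncl n (Φ.toD p))] fun z => wedgeOne (coordZero n) (S z) := by
    filter_upwards [Φ.toX.open_target.mem_nhds hz] with z hz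
      using (wedgeOne_coordZero_curryLeft (hb.isTypeHol ht hz)).symm
  rw [h1.extDeriv_eq, extDeriv_wedgeOne_coordZero (hSs _ hz)] at h0
  have h2 : wedgeOne (coordZero n) (extDeriv S (hyperIncl n (Φ.toD p))) =
      wedgeOne (coordZero n) ((0 : ℂ) • (0 : AltForm (n + 1) (n + 1))) := by
    rw [wedgeOne_smul_right, form_zero_smul]
    exact (smul_eq_zero.mp h0).resolve_left (by norm_num)
  have h3 := hyperRestrict_eq_of_wedgeOne_eq h2
  refine eq_of_inChart_eq Φ.memD hp (b := fun _ => 0) ?_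
  have hsm := IsPoincareResidue.smoothFormAt hA hDe hρ p
  rw [inChart_extD Φ.memD hw (by rwa [Φ.toD.left_inv hp]), inChart_zero]
  have h4 : inChart Φ.toD ρ =ᶠ[𝓝 (Φ.toD p)] fun w => hyperRestrict (S (hyperIncl n w)) := by
    filter_upwards [Φ.toD.open_target.mem_nhds hw] with w hw using hb.residue_eq_curryLeft hρ hw
  rw [h4.extDeriv_eq, extDeriv_hyperRestrict ((hSs _ hz).differentiableAt (by simp)), h3,
    form_zero_smul]
  rfl

end HolResidue

/-! ### Densities of products of forms with poles -/

section Density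

lemma contDiffAt_wedge_stdFrame {F : Type*} [NormedAddCommGroup F] [NormedSpace ℝ F] {d : ℕ}
    {b c : F → AltForm d d} {z : F} (hb : ContDiffAt ℝ ∞ b z) (hc : ContDiffAt ℝ ∞ c z) :
    ContDiffAt ℝ ∞ (fun z => wedge (b z) (c z) (stdFrame d)) z :=
  contDiffAt_form_apply (contDiffAt_wedge hb hc) _

lemma contDiffAt_conj {F : Type*} [NormedAddCommGroup F] [NormedSpace ℝ F] {g : F → ℂ} {z : F}
    (hg : ContDiffAt ℝ ∞ g z) : ContDiffAt ℝ ∞ (fun z => conj (g z)) z :=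
  (Complex.conjCLE : ℂ →L[ℝ] ℂ).contDiff.contDiffAt.comp z hg

/-- The linear form `dz̄₀`. -/
def conjCoord (n : ℕ) : ℂ^(n + 1) →L[ℝ] ℂ :=
  (Complex.conjCLE : ℂ →L[ℝ] ℂ).comp (coordZero n)

lemma conjCoord_apply {n : ℕ} (v : ℂ^(n + 1)) : conjCoord n v = conj (v 0) := rfl

lemma coordZero_hyperIncl {n : ℕ} (w : ℂ^n) : coordZero n (hyperIncl n w) = 0 := by
  rw [coordZero_apply, hyperIncl_apply, Fin.cons_zero]

lemma conjCoord_hyperIncl {n : ℕ} (w : ℂ^n) : conjCoord n (hyperIncl n w) = 0 := by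
  rw [conjCoord_apply, hyperIncl_apply, Fin.cons_zero, map_zero]

lemma wedge_coordZero_coordZero {n : ℕ} (s b : AltForm (n + 1) n) :
    wedge (wedgeOne (coordZero n) s) (wedgeOne (coordZero n) b) (stdFrame (n + 1)) = 0 := by
  rw [wedge_wedgeOne_stdFrame _ _ coordZero_hyperIncl coordZero_hyperIncl]
  ring

/-- The factor `-2 I` is `dz₀ ∧ dz̄₀` on `(∂/∂x₀, ∂/∂y₀)`. -/
lemma wedge_coordZero_conjCoord {n : ℕ} (s b : AltForm (n + 1) n) :
    wedge (wedgeOne (coordZero n) s) (wedgeOne (conjCoord n) b) (stdFrame (n + 1)) =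
      (-1) ^ n * (-2 * I) * wedge (hyperRestrict s) (hyperRestrict b) (stdFrame n) := by
  rw [wedge_wedgeOne_stdFrame _ _ coordZero_hyperIncl conjCoord_hyperIncl]
  simp only [conjCoord_apply, coordZero_apply, stdBasis, Pi.smul_apply, Pi.single_eq_same,
    smul_eq_mul, mul_one, map_one, Complex.conj_I]
  ring

/-- `dlog |w| = dw / 2w + dw̄ / 2w̄`. -/
lemma hasFDerivAt_log_norm {w : ℂ} (hw : w ≠ 0) :
    HasFDerivAt (fun ζ : ℂ => ((log ‖ζ‖ : ℝ) : ℂ))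
      ((2 * w)⁻¹ • (ContinuousLinearMap.id ℝ ℂ) +
        (2 * conj w)⁻¹ • (Complex.conjCLE : ℂ →L[ℝ] ℂ)) w := by
  have h1 := ((hasStrictFDerivAt_norm_sq (F := ℂ) w).hasFDerivAt.log
    (by positivity)).const_mul (1 / 2 : ℝ)
  have h2 := ofRealCLM.hasFDerivAt.comp w h1
  refine (h2.congr_of_eventuallyEq (Eventually.of_forall fun ζ => ?_)).congr_fderiv ?_
  · simp [Real.log_pow]
  · ext1 v
    have hn : ((‖w‖ ^ 2 : ℝ) : ℂ) = w * conj w := by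
      rw [Complex.mul_conj, Complex.normSq_eq_norm_sq]
    have hw' : conj w ≠ 0 := (map_ne_zero _).mpr hw
    have hi : ((inner ℝ w v : ℝ) : ℂ) = (conj w * v + w * conj v) / 2 := by
      rw [Complex.inner, Complex.re_eq_add_conj]
      simp
      ring
    have : (((1 / 2 : ℝ) * ((‖w‖ ^ 2)⁻¹ * (2 * inner ℝ w v)) : ℝ) : ℂ) =
        (2 * w)⁻¹ * v + (2 * conj w)⁻¹ * conj v := by
      rw [Complex.ofReal_mul, Complex.ofReal_mul, Complex.ofReal_mul, Complex.ofReal_inv, hn, hi]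
      push_cast
      field_simp
    refine Eq.trans ?_ this
    simp [two_smul, two_mul]
    ring

variable {k : ℕ} {Φ : AdaptedChart n D} {lam : X → ℝ}

/-- `dlog λ = dz₀ / 2z₀ + dz̄₀ / 2z̄₀ + dψ` in an adapted chart. -/
lemma IsCutoff.exists_fderiv_logLam (hlam : IsCutoff (n + 1) D lam) (Φ : AdaptedChart n D) :
    ∃ ψ : ℂ^(n + 1) → ℂ, (∀ z ∈ Φ.toX.target, ContDiffAt ℝ ∞ ψ z) ∧
      ∀ z ∈ Φ.toX.target, z 0 ≠ 0 → fderiv ℝ (logLam lam ∘ Φ.toX.symm) z =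
        (2 * z 0)⁻¹ • coordZero n + (2 * conj (z 0))⁻¹ • conjCoord n + fderiv ℝ ψ z := by
  obtain ⟨h, hh, hpos⟩ := hlam.extends_smoothly _ _
    (Φ.isLocalEquation _ Φ.toX.open_source subset_rfl)
  have hψ : ∀ z ∈ Φ.toX.target,
      ContDiffAt ℝ ∞ (fun z => ((log (h (Φ.toX.symm z)) : ℝ) : ℂ)) z := fun z hz =>
    ofRealCLM.contDiff.contDiffAt.comp z ((contDiffAt_comp_symm Φ.memX hz (hh.contMDiffAt
      (Φ.toX.open_source.mem_nhds (Φ.toX.map_target hz)))).log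
        (hpos _ (Φ.toX.map_target hz)).1.ne')
  refine ⟨_, hψ, fun z hz h0 => ?_⟩
  have h1 : (logLam lam ∘ Φ.toX.symm) =ᶠ[𝓝 z] fun ζ =>
      ((log ‖ζ 0‖ : ℝ) : ℂ) + ((log (h (Φ.toX.symm ζ)) : ℝ) : ℂ) := by
    filter_upwards [eventually_coord_ne Φ.toX.open_target hz h0] with ζ hζ
    have h2 := hpos _ (Φ.toX.map_target hζ.1)
    rw [Φ.toX.right_inv hζ.1] at h2
    rw [Function.comp_apply, logLam, h2.2, Real.log_mul h2.1.ne' (norm_ne_zero_iff.mpr hζ.2),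
      Complex.ofReal_add, add_comm]
  have h3 : HasFDerivAt (fun ζ : ℂ^(n + 1) => ((log ‖ζ 0‖ : ℝ) : ℂ)) _ z :=
    HasFDerivAt.comp z (hasFDerivAt_log_norm h0) (coordZero n).hasFDerivAt
  rw [h1.fderiv_eq, fderiv_fun_add h3.differentiableAt ((hψ z hz).differentiableAt (by simp)),
    h3.fderiv]
  rfl

variable {a β : DForm (n + 1) (n + 1) X}

/-- The density of `a ∧ β̄`, where the pole of `β` is simple. -/
lemma IsNumerator.isPolarDensity {b c} (hb : IsNumerator Φ (k + 1) a b)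
    (hcn : IsNumerator Φ 1 β c) :
    IsPolarDensity Φ k (fun x => wedge (a x) (conjForm (β x)))
      fun z => wedge (b z) (conjForm (c z)) (stdFrame (n + 1)) := by
  refine ⟨fun z hz => (contDiffAt_wedge_stdFrame (hb.1 z hz)
    (contDiffAt_conjForm (hcn.1 z hz))).contDiffWithinAt, fun z hz h0 => ?_⟩
  have h0' : conj (z 0) ≠ 0 := (map_ne_zero _).mpr h0
  beta_reduce
  rw [inChart_wedge a (fun x => conjForm (β x)), inChart_conjForm, hb.2 z hz h0, hcn.2 z hz h0,
    conjForm_smul, wedge_smul_left, wedge_smul_right, map_pow, pow_one]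
  change _ = z 0 ^ (k + 1) * (conj (z 0) * _) / _
  field_simp
  rfl

lemma IsPolarDensity.unique {Ω : DForm (n + 1) (n + 1 + (n + 1)) X} {G G'}
    (h : IsPolarDensity Φ k Ω G) (h' : IsPolarDensity Φ k Ω G') {z} (hz : z ∈ Φ.toX.target) :
    G z = G' z := by
  have hn := Φ.toX.open_target.mem_nhds hz
  refine eq_of_coord_ne Φ.toX.open_target hz (h.1.contDiffAt hn).continuousAt
    (h'.1.contDiffAt hn).continuousAt fun ζ hζ h0 => ?_
  have h1 := (h.2 ζ hζ h0).symm.trans (h'.2 ζ hζ h0)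
  exact (div_left_inj' (mul_ne_zero (pow_ne_zero _ h0) ((map_ne_zero _).mpr h0))).mp h1

/-- The density of `dlog λ ∧ c ∧ β̄`; the part of `dlog λ` of type `(0, 1)` does not contribute. -/
lemma IsNumerator.isPolarDensity_dlog (hlam : IsCutoff (n + 1) D lam) {c : DForm (n + 1) n X}
    {b b'} (hb : IsNumerator Φ k c b) (hb' : IsNumerator Φ 1 β b') (ht : ∀ x ∉ D, IsTypeHol (β x)) :
    ∃ G, IsPolarDensity Φ k
      (fun x => wedge (wedgeOne (dFun (logLam lam) x) (c x)) (conjForm (β x))) G := by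
  obtain ⟨ψ, hψ, hψ'⟩ := hlam.exists_fderiv_logLam Φ
  refine ⟨fun z => 1 / 2 * wedge (wedgeOne (coordZero n) (b z)) (conjForm (b' z)) (stdFrame (n + 1)) +
    z 0 * wedge (wedgeOne (fderiv ℝ ψ z) (b z)) (conjForm (b' z)) (stdFrame (n + 1)),
    fun z hz => ?_, fun z hz h0 => ?_⟩
  · have h1 : ContDiffAt ℝ ∞ (fun z : ℂ^(n + 1) => z 0) z := by fun_prop
    have h2 := contDiffAt_conjForm (hb'.1 z hz)
    exact ((contDiffAt_const.mul (contDiffAt_wedge_stdFrame (contDiffAt_wedgeOne contDiffAt_const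
      (hb.1 z hz)) h2)).add (h1.mul (contDiffAt_wedge_stdFrame (contDiffAt_wedgeOne
      ((hψ z hz).fderiv_right (by simp)) (hb.1 z hz)) h2))).contDiffWithinAt
  · have h0' : conj (z 0) ≠ 0 := (map_ne_zero _).mpr h0
    have hx := Φ.symm_notMem hz h0
    have hT := (ht _ hx).inChart Φ.memX hz
    have h1 : wedge (wedgeOne (conjCoord n) (inChart Φ.toX c z)) (conjForm (inChart Φ.toX β z)) =
        0 := by
      rw [← wedge_holPart_conj _ hT, holPart_wedgeOne_conj (fun u => by simp [conjCoord_apply]),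
        wedge_zero_left]
    beta_reduce
    rw [inChart_wedge (fun x => wedgeOne (dFun (logLam lam) x) (c x)) (fun x => conjForm (β x)),
      inChart_conjForm, inChart_wedgeOne Φ.memX hz
        ((hlam.contMDiffAt_logLam hx).mdifferentiableAt (by simp)), hψ' z hz h0, wedgeOne_add_left,
      wedgeOne_add_left, wedgeOne_smul_left, wedgeOne_smul_left, wedge_add_left, wedge_add_left,
      wedge_smul_left, wedge_smul_left, h1, hb.2 z hz h0, hb'.2 z hz h0]
    rw [conjForm_smul, wedgeOne_smul_right, wedgeOne_smul_right, wedge_smul_left, wedge_smul_left,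
      wedge_smul_right, wedge_smul_right, map_pow, pow_one]
    change (2 * z 0)⁻¹ * _ + (2 * conj (z 0))⁻¹ * (0 : ℂ) + _ =
      (1 / 2 * (z 0 ^ k * (conj (z 0) * _)) + z 0 * (z 0 ^ k * (conj (z 0) * _))) / _
    field_simp
    ring

/-- The density of `a ∧ dlog λ ∧ B` for a form `a` with a simple pole and a smooth form `B`. -/
lemma IsNumerator.isPolarDensity_wedge_dlog (hlam : IsCutoff (n + 1) D lam)
    {B : DForm (n + 1) n X} (hB : ∀ x, SmoothFormAt B x) {b T} (hb : IsNumerator Φ 1 a b)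
    (hT : IsSplit Φ b T) :
    ∃ G, IsPolarDensity Φ 0 (fun x => wedge (a x) (wedgeOne (dFun (logLam lam) x) (B x))) G ∧
      ∀ w, hyperIncl n w ∈ Φ.toX.target → G (hyperIncl n w) = 1 / 2 *
        wedge (b (hyperIncl n w)) (wedgeOne (conjCoord n) (inChart Φ.toX B (hyperIncl n w)))
          (stdFrame (n + 1)) := by
  obtain ⟨ψ, hψ, hψ'⟩ := hlam.exists_fderiv_logLam Φ
  set B' := inChart Φ.toX B
  have hB' : ∀ z ∈ Φ.toX.target, ContDiffAt ℝ ∞ B' z := fun z hz => (hB _).contDiffAt Φ.memX hz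
  refine ⟨fun z => 1 / 2 * wedge (b z) (wedgeOne (conjCoord n) (B' z)) (stdFrame (n + 1)) +
    conj (z 0) * (1 / 2 * wedge (T z) (wedgeOne (coordZero n) (B' z)) (stdFrame (n + 1)) +
      wedge (b z) (wedgeOne (fderiv ℝ ψ z) (B' z)) (stdFrame (n + 1))),
    ⟨fun z hz => ?_, fun z hz h0 => ?_⟩, fun w hw => ?_⟩
  · have h1 : ContDiffAt ℝ ∞ (fun z : ℂ^(n + 1) => z 0) z := by fun_prop
    have h2 := fun l => contDiffAt_wedgeOne (contDiffAt_const (c := l)) (hB' z hz)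
    exact ((contDiffAt_const.mul (contDiffAt_wedge_stdFrame (hb.1 z hz) (h2 _))).add
      ((contDiffAt_conj h1).mul ((contDiffAt_const.mul (contDiffAt_wedge_stdFrame (hT.1 z hz)
      (h2 _))).add (contDiffAt_wedge_stdFrame (hb.1 z hz) (contDiffAt_wedgeOne
      ((hψ z hz).fderiv_right (by simp)) (hB' z hz)))))).contDiffWithinAt
  · have h0' : conj (z 0) ≠ 0 := (map_ne_zero _).mpr h0
    have hx := Φ.symm_notMem hz h0
    have h1 := hb.2 z hz h0
    rw [pow_one] at h1
    have h2 : inChart Φ.toX a z = (z 0)⁻¹ • b z := by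
      rw [h1]; exact (inv_smul_smul₀ h0 _).symm
    have h3 : wedge (b z) (wedgeOne (coordZero n) (B' z)) (stdFrame (n + 1)) =
        z 0 * wedge (T z) (wedgeOne (coordZero n) (B' z)) (stdFrame (n + 1)) := by
      have h4 := congrArg (fun F => wedge F (wedgeOne (coordZero n) (B' z)) (stdFrame (n + 1)))
        (hT.2 z hz h0)
      beta_reduce at h4
      rw [h4, wedge_add_left, wedge_smul_left]
      change wedge (wedgeOne (coordZero n) _) (wedgeOne (coordZero n) _) (stdFrame (n + 1)) +
        z 0 * _ = _
      rw [wedge_coordZero_coordZero, zero_add]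
      rfl
    rw [inChart_wedge a (fun x => wedgeOne (dFun (logLam lam) x) (B x)), h2,
      inChart_wedgeOne Φ.memX hz ((hlam.contMDiffAt_logLam hx).mdifferentiableAt (by simp)),
      hψ' z hz h0, wedgeOne_add_left, wedgeOne_add_left, wedgeOne_smul_left, wedgeOne_smul_left,
      wedge_smul_left, wedge_add_right, wedge_add_right, wedge_smul_right, wedge_smul_right]
    change (z 0)⁻¹ * ((2 * z 0)⁻¹ * wedge (b z) (wedgeOne (coordZero n) (B' z)) (stdFrame (n + 1)) +
      (2 * conj (z 0))⁻¹ *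
        wedge (b z) (wedgeOne (conjCoord n) (B' z)) (stdFrame (n + 1)) +
      wedge (b z) (wedgeOne (fderiv ℝ ψ z) (B' z)) (stdFrame (n + 1))) = _
    rw [h3]
    field_simp
    ring
  · have : (hyperIncl n w) 0 = 0 := coordZero_hyperIncl w
    beta_reduce
    rw [this, map_zero, zero_mul, add_zero]

end Density

/-! ### The coefficient of the logarithm and residues -/

section Coefficients

variable {k : ℕ} {lam : X → ℝ} {a β : DForm (n + 1) (n + 1) X} {ρ σ : DForm n n D}
variable (hA : HasAdaptedCharts n D)
include hA

omit hA in
/-- The form `a ∧ β̄` has an expansion. -/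
lemma HasPoleLE.isPolar (ha : HasPoleLE D (k + 1) a) (hβ : HasPoleLE D 1 β) :
    IsPolar D k (fun x => wedge (a x) (conjForm (β x))) := by
  have ho := (isClosed_hypersurface D).isOpen_compl
  refine ⟨ha.smoothFormOn.wedge (hβ.smoothFormOn.conjForm ho) ho, fun Φ => ?_⟩
  obtain ⟨b, hb⟩ := ha.exists_numerator Φ
  obtain ⟨c, hc⟩ := hβ.exists_numerator Φ
  exact ⟨_, hb.isPolarDensity hc⟩

omit hA in
lemma HasPoleLE.isPolar_dlog (hlam : IsCutoff (n + 1) D lam) {c : DForm (n + 1) n X}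
    (hc : HasPoleLE D k c) (hβ : HasPoleLE D 1 β) (ht : ∀ x ∉ D, IsTypeHol (β x)) :
    IsPolar D k (fun x => wedge (wedgeOne (dFun (logLam lam) x) (c x)) (conjForm (β x))) := by
  have ho := (isClosed_hypersurface D).isOpen_compl
  refine ⟨(hlam.smoothFormOn_dlog hc.smoothFormOn).wedge (hβ.smoothFormOn.conjForm ho) ho,
    fun Φ => ?_⟩
  obtain ⟨b, hb⟩ := hc.exists_numerator Φ
  obtain ⟨c, hc⟩ := hβ.exists_numerator Φ
  exact hb.isPolarDensity_dlog hlam hc ht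

/-- The coefficient of a form with a simple pole is the integral of its residue. -/
lemma HasExpansion.coeff_eq_residue (hDe : IsEmbedding (Subtype.val : D → X))
    (hlam : IsCutoff (n + 1) D lam) (ha : HasPoleLE D 1 a) (hβ : HasPoleLE D 1 β)
    (hρ : IsPoincareResidue D a ρ) (hσ : IsPoincareResidue D β σ)
    {A B : ℂ} (h : HasExpansion lam (fun x => wedge (a x) (conjForm (β x))) A B) :
    A = 2 * π * ((-1) ^ n * (-2 * I)) *
      formIntegral (fun p => wedge (ρ p) (conjForm (σ p))) univ := by
  refine h.coeff_eq hA (ha.isPolar hβ) hlam ((smoothFormOn_iff isOpen_univ).mpr fun p _ =>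
    (hρ.smoothFormAt hA hDe p).wedge (hσ.smoothFormAt hA hDe p).conjForm) fun Φ G hG w hw => ?_
  obtain ⟨b, hb⟩ := ha.exists_numerator Φ
  obtain ⟨c, hcn⟩ := hβ.exists_numerator Φ
  rw [hG.unique (hb.isPolarDensity (k := 0) hcn) (Φ.mem_toD_target_iff.mp hw)]
  obtain ⟨S, hS, hS'⟩ := hb.residue_eq hρ hw
  obtain ⟨S', hS₁, hS₁'⟩ := hcn.residue_eq hσ hw
  rw [inChart_wedge ρ (fun p => conjForm (σ p)), inChart_conjForm, hS', hS₁', hS, hS₁,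
    conjForm_wedgeOne]
  exact wedge_coordZero_conjCoord S (conjForm S')

/-- The coefficient of `a ∧ dlog λ ∧ B` is an integral over `D` if `a` is closed with a simple pole.
Only the part `dz̄₀ / 2z̄₀` of `dlog λ` contributes. -/
lemma HasExpansion.coeff_eq_residue_dlog (hDe : IsEmbedding (Subtype.val : D → X))
    (hlam : IsCutoff (n + 1) D lam) (ha : HasPoleLE D 1 a) (hcl : ∀ x ∉ D, extD a x = 0)
    (hρ : IsPoincareResidue D a ρ) {B : DForm (n + 1) n X} (hB : ∀ x, SmoothFormAt B x) :
    ∃ E, HasExpansion lam (fun x => wedge (a x) (wedgeOne (dFun (logLam lam) x) (B x)))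
      (2 * π * (1 / 2 * ((-1) ^ n * (-2 * I))) *
        formIntegral (fun p => wedge (ρ p) (restrictForm D B p)) univ) E := by
  have ho := (isClosed_hypersurface D).isOpen_compl
  have hG : ∀ Φ : AdaptedChart n D, ∃ G, IsPolarDensity Φ 0
      (fun x => wedge (a x) (wedgeOne (dFun (logLam lam) x) (B x))) G ∧ ∀ w ∈ Φ.toD.target,
      G (hyperIncl n w) = (1 / 2 * ((-1) ^ n * (-2 * I))) *
        inChart Φ.toD (fun p => wedge (ρ p) (restrictForm D B p)) w (stdFrame n) := by
    intro Φ
    obtain ⟨b, hb⟩ := ha.exists_numerator Φ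
    obtain ⟨T, hT⟩ := hb.exists_isSplit_of_closed (k := 0) hcl
    obtain ⟨G, hG, hG'⟩ := hb.isPolarDensity_wedge_dlog hlam hB hT
    refine ⟨G, hG, fun w hw => ?_⟩
    obtain ⟨S, hS, hS'⟩ := hb.residue_eq hρ hw
    rw [hG' w (Φ.mem_toD_target_iff.mp hw), hS, wedge_coordZero_conjCoord,
      inChart_wedge ρ (restrictForm D B), hS', Φ.inChart_restrictForm _ hw]
    ring
  have hΩ : IsPolar D 0 (fun x => wedge (a x) (wedgeOne (dFun (logLam lam) x) (B x))) :=
    ⟨ha.smoothFormOn.wedge (hlam.smoothFormOn_dlog ((smoothFormOn_iff ho).mpr fun x _ => hB x)) ho,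
      fun Φ => let ⟨G, hG, _⟩ := hG Φ; ⟨G, hG⟩⟩
  obtain ⟨A, hAe⟩ := hΩ.exists_coeff hA
  obtain ⟨E, hE⟩ := hAe lam hlam
  refine ⟨E, (hE.coeff_eq hA hΩ hlam ((smoothFormOn_iff isOpen_univ).mpr fun p _ => ?_)
    fun Φ G hG₁ w hw => ?_) ▸ hE⟩
  · obtain ⟨Φ, hp⟩ := exists_chart_at_mem hA p
    exact (hρ.smoothFormAt hA hDe p).wedge (smoothFormAt_restrictForm Φ hp (hB p))
  · obtain ⟨G', hG', hG''⟩ := hG Φ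
    rw [hG₁.unique hG' (Φ.mem_toD_target_iff.mp hw), hG'' w hw]

/-- Exact forms `dc ∧ β̄` with poles have no logarithmic term. -/
lemma HasPoleLE.coeff_extD_wedge_conj (hlam : IsCutoff (n + 1) D lam) {c : DForm (n + 1) n X}
    (hc : HasPoleLE D k c) (hβ : HasPoleLE D 1 β) (ht : ∀ x ∉ D, IsTypeHol (β x))
    (hcl : ∀ x ∉ D, extD β x = 0) {A B : ℂ}
    (h : HasExpansion lam (fun x => wedge (extD c x) (conjForm (β x))) A B) : A = 0 := by
  have ho := (isClosed_hypersurface D).isOpen_compl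
  obtain ⟨A', hA'⟩ := (hc.isPolar_dlog hlam hβ ht).exists_coeff hA
  obtain ⟨B', hB'⟩ := hA' lam hlam
  exact h.coeff_extD_wedge hA hlam hc.smoothFormOn (hβ.smoothFormOn.conjForm ho)
    (fun x hx => extD_conjForm_eq_zero (hβ.smoothFormAt hx) (hcl x hx)) hB'

end Coefficients

/-! ### Extension of closed forms from the hypersurface -/

section Squash

/-- The map `z ↦ ((1 - χ) z₀, z')`. -/
def squash {n : ℕ} (χ : ℂ^(n + 1) → ℝ) (z : ℂ^(n + 1)) : ℂ^(n + 1) :=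
  z - (χ z * z 0 : ℂ) • stdBasis (n + 1) 0

/-- The projection `z ↦ z'` of `ℂⁿ⁺¹` to the hyperplane `z₀ = 0`. -/
def tailL (n : ℕ) : ℂ^(n + 1) →L[ℝ] ℂ^n :=
  ContinuousLinearMap.pi fun j => ContinuousLinearMap.proj j.succ

variable {n : ℕ} {χ : ℂ^(n + 1) → ℝ}

lemma squash_zero (z : ℂ^(n + 1)) : squash χ z 0 = (1 - χ z) * z 0 := by
  simp [squash, stdBasis]; ring

lemma squash_succ (z : ℂ^(n + 1)) (j : Fin n) : squash χ z j.succ = z j.succ := by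
  simp [squash, stdBasis]

lemma squash_eq_self {z : ℂ^(n + 1)} (h : χ z = 0 ∨ z 0 = 0) : squash χ z = z := by
  rcases h with h | h <;> simp [squash, h]

lemma squash_eq_of_one {z : ℂ^(n + 1)} (h : χ z = 1) :
    squash χ z = hyperIncl n (tailL n z) := by
  ext j
  refine Fin.cases ?_ (fun j => ?_) j
  · rw [squash_zero, h, hyperIncl_apply]; simp
  · rw [squash_succ, hyperIncl_apply]; rfl

lemma contDiff_squash (hχ : ContDiff ℝ ∞ χ) : ContDiff ℝ ∞ (squash χ) := by
  have h1 : ContDiff ℝ ∞ (fun z => ((χ z : ℝ) : ℂ)) := ofRealCLM.contDiff.comp hχ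
  exact contDiff_id.sub ((h1.mul (by fun_prop)).smul contDiff_const)

/-- Squashing towards `z₀ = 0` preserves balls centred on the hyperplane. -/
lemma squash_mem_closedBall {p : ℂ^(n + 1)} (hp : p 0 = 0) {R : ℝ} {z : ℂ^(n + 1)}
    (hz : z ∈ Metric.closedBall p R) (h0 : 0 ≤ χ z) (h1 : χ z ≤ 1) :
    squash χ z ∈ Metric.closedBall p R := by
  have hR : 0 ≤ R := dist_nonneg.trans hz
  rw [Metric.mem_closedBall, dist_pi_le_iff hR] at hz ⊢
  refine Fin.cases ?_ fun j => ?_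
  · have h2 := hz 0
    rw [hp, dist_zero_right] at h2 ⊢
    rw [squash_zero, norm_mul, ← ofReal_one, ← ofReal_sub, Complex.norm_real,
      norm_of_nonneg (by linarith)]
    exact (mul_le_of_le_one_left (norm_nonneg _) (by linarith)).trans h2
  · rw [squash_succ]; exact hz _

end Squash

section Extension

variable {μ : DForm n r D}

lemma SmoothFormOn.smul_of_tsupport {U : Set X} (hU : IsOpen U) {s : DForm (n + 1) r X}
    (hs : SmoothFormOn s U) {χ : X → ℝ} (hχ : ContMDiff 𝓘(ℝ, ℂ^(n + 1)) 𝓘(ℝ, ℝ) ∞ χ)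
    (hsub : tsupport χ ⊆ U) (x : X) : SmoothFormAt (fun y => ((χ y : ℝ) : ℂ) • s y) x := by
  by_cases hx : x ∈ tsupport χ
  · exact SmoothFormAt.smul (contMDiff_ofReal (hχ x)) ((smoothFormOn_iff hU).mp hs x (hsub hx))
  · refine SmoothFormAt.zero.congr ?_
    filter_upwards [eventually_zero_of_tsupport hx] with y hy
    rw [hy]
    exact (form_zero_smul _).symm

/-- Poincaré residues extend to smooth forms on `X`. -/
lemma IsPoincareResidue.exists_extension {a : DForm (n + 1) (r + 1) X}
    (hμ : IsPoincareResidue D a μ) :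
    ∃ B : DForm (n + 1) r X, (∀ x, SmoothFormAt B x) ∧ restrictForm D B = μ := by
  have hloc : ∀ x : X, ∃ (U : Set X) (s : DForm (n + 1) r X), IsOpen U ∧ x ∈ U ∧ SmoothFormOn s U ∧
      ∀ q : D, (q : X) ∈ U → restrictForm D s q = μ q := by
    intro x
    by_cases hx : x ∈ D
    · obtain ⟨U, f, s, t, hxU, hf, hs, -, -, h⟩ := hμ ⟨x, hx⟩
      exact ⟨U, s, hf.isOpen, hxU, hs, fun q hq => (h q hq).symm⟩
    · have ho := (isClosed_hypersurface D).isOpen_compl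
      exact ⟨Dᶜ, fun _ => 0, ho, hx, (smoothFormOn_iff ho).mpr fun _ _ => SmoothFormAt.zero,
        fun q hq => absurd q.2 hq⟩
  choose U s hU hxU hs hsμ using hloc
  obtain ⟨t, χ, hχ, -, hsub, hsum⟩ := exists_finite_partitionOfUnity (d := n + 1) U hU hxU
  refine ⟨fun x => ∑ p ∈ t, ((χ p x : ℝ) : ℂ) • s p x, fun x => SmoothFormAt.sum fun p _ =>
    (hs p).smul_of_tsupport (hU p) (hχ p) (hsub p) x, funext fun q => ?_⟩
  have h1 : restrictForm D (fun x => ∑ p ∈ t, ((χ p x : ℝ) : ℂ) • s p x) q =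
      ∑ p ∈ t, ((χ p q : ℝ) : ℂ) • restrictForm D (s p) q := by
    ext v
    rw [ContinuousAlternatingMap.sum_apply]
    exact ContinuousAlternatingMap.sum_apply ..
  rw [h1, sum_congr rfl (g := fun p => ((χ p q : ℝ) : ℂ) • μ q) fun p _ => ?_]
  · refine (Finset.sum_smul (R := ℂ)).symm.trans ?_
    rw [← ofReal_sum, hsum, ofReal_one]
    exact one_smul ℂ (μ q)
  · by_cases hq : (q : X) ∈ U p
    · rw [hsμ p q hq]
    · rw [image_eq_zero_of_notMem_tsupport fun h => hq (hsub p h), ofReal_zero,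
        form_zero_smul, form_zero_smul]

/-- The pull-back of a form by `squash χ`, in an adapted chart. -/
def squashForm (Φ : AdaptedChart n D) (χ : ℂ^(n + 1) → ℝ) (B : DForm (n + 1) r X) :
    DForm (n + 1) r X :=
  open Classical in fun x => if x ∈ Φ.toX.source then fromChart Φ.toX
    (fun z => (inChart Φ.toX B (squash χ z)).compContinuousLinearMap (fderiv ℝ (squash χ) z)) x
  else B x

variable {Φ : AdaptedChart n D} {χ : ℂ^(n + 1) → ℝ} {B : DForm (n + 1) r X}
  (hχ : ContDiff ℝ ∞ χ) (hmaps : ∀ z ∈ Φ.toX.target, squash χ z ∈ Φ.toX.target)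
  (hc : HasCompactSupport χ) (hsup : tsupport χ ⊆ Φ.toX.target) (hB : ∀ x, SmoothFormAt B x)

lemma inChart_squashForm {z : ℂ^(n + 1)} (hz : z ∈ Φ.toX.target) :
    inChart Φ.toX (squashForm Φ χ B) z =
      (inChart Φ.toX B (squash χ z)).compContinuousLinearMap (fderiv ℝ (squash χ) z) := by
  rw [inChart_congr (b := fromChart Φ.toX _) (if_pos (Φ.toX.map_target hz)),
    inChart_fromChart Φ.memX hz]

include hc hsup in
/-- Squashing only changes a form inside of the chart, as `χ` has compact support there. -/
lemma squashForm_eventuallyEq {x : X} (hx : x ∉ Φ.toX.source) : squashForm Φ χ B =ᶠ[𝓝 x] B := by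
  have hK : IsClosed (Φ.toX.symm '' tsupport χ) :=
    (hc.isCompact.image_of_continuousOn (Φ.toX.continuousOn_symm.mono hsup)).isClosed
  have hxK : x ∉ Φ.toX.symm '' tsupport χ := by
    rintro ⟨z, hz, rfl⟩
    exact hx (Φ.toX.map_target (hsup hz))
  filter_upwards [hK.isOpen_compl.mem_nhds hxK] with y hy
  by_cases hys : y ∈ Φ.toX.source
  · refine eq_of_inChart_eq Φ.memX hys ?_
    have hz := Φ.toX.map_source hys
    have h0 : Φ.toX y ∉ tsupport χ := fun h => hy ⟨_, h, Φ.toX.left_inv hys⟩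
    have h1 : squash χ =ᶠ[𝓝 (Φ.toX y)] id := by
      filter_upwards [(isClosed_tsupport χ).isOpen_compl.mem_nhds h0] with z hz
        using squash_eq_self (Or.inl (image_eq_zero_of_notMem_tsupport hz))
    rw [inChart_squashForm hz, h1.fderiv_eq, h1.self_of_nhds, fderiv_id]
    rfl
  · exact if_neg hys

include hχ hmaps hB in
lemma contDiffAt_squash_pullback {z : ℂ^(n + 1)} (hz : z ∈ Φ.toX.target) :
    ContDiffAt ℝ ∞ (fun z => (inChart Φ.toX B (squash χ z)).compContinuousLinearMap
      (fderiv ℝ (squash χ) z)) z := by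
  have hg := (contDiff_squash hχ).contDiffAt (x := z)
  exact contDiffAt_compCLM ((SmoothFormAt.contDiffAt Φ.memX (hmaps z hz) (hB _)).comp z hg)
    (hg.fderiv_right (by simp))

include hχ hmaps hc hsup hB in
lemma smoothFormAt_squashForm (x : X) : SmoothFormAt (squashForm Φ χ B) x := by
  by_cases hx : x ∈ Φ.toX.source
  · refine (smoothFormAt_fromChart Φ.memX (fun z hz =>
      contDiffAt_squash_pullback hχ hmaps hB hz) hx).congr ?_
    filter_upwards [Φ.toX.open_source.mem_nhds hx] with y hy using (if_pos hy).symm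
  · exact (hB x).congr (squashForm_eventuallyEq hc hsup hx).symm

include hχ in
/-- Squashing does not change the restriction to `D`, which is fixed pointwise. -/
lemma restrictForm_squashForm : restrictForm D (squashForm Φ χ B) = restrictForm D B := by
  funext q
  by_cases hq : q ∈ Φ.toD.source
  · refine eq_of_inChart_eq Φ.memD hq ?_
    have hw := Φ.toD.map_source hq
    have hz := Φ.mem_toD_target_iff.mp hw
    set w := Φ.toD q
    have h0 : ∀ w : ℂ^n, squash χ (hyperIncl n w) = hyperIncl n w := fun w =>
      squash_eq_self (Or.inr (coordZero_hyperIncl w))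
    set L := (hyperIncl n).restrictScalars ℝ
    have h1 : HasFDerivAt (squash χ ∘ L) ((fderiv ℝ (squash χ) (L w)).comp L) w :=
      (((contDiff_squash hχ).differentiable (by simp)) (L w)).hasFDerivAt.comp w L.hasFDerivAt
    have h2 : squash χ ∘ L = L := funext h0
    rw [h2] at h1
    have h3 := h1.unique L.hasFDerivAt
    rw [Φ.inChart_restrictForm _ hw, Φ.inChart_restrictForm _ hw, inChart_squashForm hz, h0]
    ext v
    change inChart Φ.toX B (hyperIncl n w) (fun i => ((fderiv ℝ (squash χ) (L w)).comp L) (v i)) = _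
    rw [h3]
    rfl
  · have h1 : squashForm Φ χ B (q : X) = B q := if_neg fun h => hq ((Φ.source_iff q).mpr h)
    rw [restrictForm, restrictForm, h1]

include hχ hmaps hc hsup hB in
/-- The exterior derivative commutes with the pull-back by `squash χ`. -/
lemma inChart_extD_squashForm {z : ℂ^(n + 1)} (hz : z ∈ Φ.toX.target) :
    inChart Φ.toX (extD (squashForm Φ χ B)) z =
      (extDeriv (inChart Φ.toX B) (squash χ z)).compContinuousLinearMap
        (fderiv ℝ (squash χ) z) := by
  have h1 : inChart Φ.toX (squashForm Φ χ B) =ᶠ[𝓝 z] fun z =>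
      (inChart Φ.toX B (squash χ z)).compContinuousLinearMap (fderiv ℝ (squash χ) z) := by
    filter_upwards [Φ.toX.open_target.mem_nhds hz] with ζ hζ using inChart_squashForm hζ
  rw [inChart_extD Φ.memX hz (smoothFormAt_squashForm hχ hmaps hc hsup hB _), h1.extDeriv_eq,
    extDeriv_pullback ((SmoothFormAt.contDiffAt Φ.memX (hmaps z hz) (hB _)).differentiableAt
      (by simp)) (contDiff_squash hχ).contDiffAt minSmoothness_two_le]

include hχ hmaps hc hsup hB in
/-- If `B` restricts to a closed form on `D` then squashing makes it closed where `χ = 1`. -/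
lemma extD_squashForm_eq_zero_of_one (hcl : ∀ p, extD (restrictForm D B) p = 0) {x : X}
    (hx : x ∈ Φ.toX.source) (h1 : ∀ᶠ z in 𝓝 (Φ.toX x), χ z = 1) :
    extD (squashForm Φ χ B) x = 0 := by
  have hz := Φ.toX.map_source hx
  refine eq_of_inChart_eq Φ.memX hx (b := fun _ => 0) ?_
  set L := (hyperIncl n).restrictScalars ℝ
  have hg : squash χ =ᶠ[𝓝 (Φ.toX x)] L.comp (tailL n) :=
    h1.mono fun z hz => squash_eq_of_one hz
  have hw : tailL n (Φ.toX x) ∈ Φ.toD.target := by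
    rw [Φ.mem_toD_target_iff, ← squash_eq_of_one h1.self_of_nhds]
    exact hmaps _ hz
  have hw' := Φ.mem_toD_target_iff.mp hw
  rw [inChart_extD_squashForm hχ hmaps hc hsup hB hz, inChart_zero, hg.fderiv_eq,
    ContinuousLinearMap.fderiv, hg.self_of_nhds]
  have h2 : hyperRestrict (extDeriv (inChart Φ.toX B) (hyperIncl n (tailL n (Φ.toX x)))) = 0 := by
    rw [← extDeriv_hyperRestrict (((hB _).contDiffAt Φ.memX hw').differentiableAt (by simp))]
    have h3 : inChart Φ.toD (restrictForm D B) =ᶠ[𝓝 (tailL n (Φ.toX x))]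
        fun w => hyperRestrict (inChart Φ.toX B (hyperIncl n w)) := by
      filter_upwards [Φ.toD.open_target.mem_nhds hw] with w hw using Φ.inChart_restrictForm _ hw
    rw [← h3.extDeriv_eq, ← inChart_extD Φ.memD hw (smoothFormAt_restrictForm Φ
      (Φ.toD.map_target hw) (hB _)), inChart_congr (b := fun _ => 0) (hcl _), inChart_zero]
  ext v
  exact congrArg (fun F : AltForm n (r + 1) => F fun i => tailL n (v i)) h2

include hχ hmaps hc hsup hB in
/-- Squashing preserves closedness near points of `D`. -/
lemma eventually_extD_squashForm {x : X} (hxD : x ∈ D) (h : ∀ᶠ y in 𝓝 x, extD B y = 0) :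
    ∀ᶠ y in 𝓝 x, extD (squashForm Φ χ B) y = 0 := by
  by_cases hx : x ∈ Φ.toX.source
  · have hz := Φ.toX.map_source hx
    have h0 : squash χ (Φ.toX x) = Φ.toX x := squash_eq_self (Or.inr ((Φ.zero_iff x hx).mpr hxD))
    have h1 : Tendsto (fun y => Φ.toX.symm (squash χ (Φ.toX y))) (𝓝 x) (𝓝 x) := by
      have h2 : ContinuousAt (fun y => Φ.toX.symm (squash χ (Φ.toX y))) x := by
        refine ContinuousAt.comp ?_ ((contDiff_squash hχ).continuous.continuousAt.comp
          (Φ.toX.continuousAt hx))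
        rw [h0]
        exact Φ.toX.continuousAt_symm hz
      rwa [ContinuousAt, h0, Φ.toX.left_inv hx] at h2
    filter_upwards [Φ.toX.open_source.mem_nhds hx, h1.eventually h] with y hy hy'
    refine eq_of_inChart_eq Φ.memX hy (b := fun _ => 0) ?_
    have hgz := hmaps _ (Φ.toX.map_source hy)
    rw [inChart_extD_squashForm hχ hmaps hc hsup hB (Φ.toX.map_source hy), inChart_zero,
      ← inChart_extD Φ.memX hgz (hB _), inChart_congr (b := fun _ => 0) hy', inChart_zero]
    rfl
  · filter_upwards [h, (squashForm_eventuallyEq (B := B) hc hsup hx).eventuallyEq_nhds] with y hy hy'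
    rw [extD_congr hy', hy]

/-- A closed form on `D` which extends to a smooth form on `X` extends to a smooth form on `X` which
is closed near `D`. -/
lemma exists_extension_closed_near (hA : HasAdaptedCharts n D)
    (hμ : ∀ p, extD μ p = 0) {B₀ : DForm (n + 1) r X} (hB₀ : ∀ x, SmoothFormAt B₀ x)
    (hB₀μ : restrictForm D B₀ = μ) :
    ∃ B : DForm (n + 1) r X, (∀ x, SmoothFormAt B x) ∧ restrictForm D B = μ ∧
      ∀ x ∈ D, ∀ᶠ y in 𝓝 x, extD B y = 0 := by
  -- squashing near a point makes an extension closed near this point, and keeps it closed near the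
  -- points where it already was
  have hstep : ∀ p : D, ∃ W : Set X, IsOpen W ∧ (p : X) ∈ W ∧ ∀ B : DForm (n + 1) r X,
      (∀ x, SmoothFormAt B x) → restrictForm D B = μ → ∃ B' : DForm (n + 1) r X,
      (∀ x, SmoothFormAt B' x) ∧ restrictForm D B' = μ ∧ (∀ x ∈ W, extD B' x = 0) ∧
      ∀ x ∈ D, (∀ᶠ y in 𝓝 x, extD B y = 0) → ∀ᶠ y in 𝓝 x, extD B' y = 0 := by
    intro p
    obtain ⟨Φ, hp⟩ := hA p
    have hz := Φ.toX.map_source hp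
    obtain ⟨R, hR, hball⟩ := Metric.nhds_basis_closedBall.mem_iff.mp (Φ.toX.open_target.mem_nhds hz)
    let f : ContDiffBump (Φ.toX p) := ⟨R / 2, R, half_pos hR, half_lt_self hR⟩
    have hsup : tsupport f ⊆ Φ.toX.target := by rw [f.tsupport_eq]; exact hball
    have hmaps : ∀ z ∈ Φ.toX.target, squash f z ∈ Φ.toX.target := by
      intro z hz'
      by_cases h : z ∈ Metric.closedBall (Φ.toX p) R
      · exact hball (squash_mem_closedBall ((Φ.zero_iff _ hp).mpr p.2) h f.nonneg f.le_one)
      · rw [squash_eq_self (Or.inl (f.zero_of_le_dist (not_le.mp h).le))]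
        exact hz'
    refine ⟨Φ.toX.source ∩ Φ.toX ⁻¹' Metric.ball (Φ.toX p) (R / 2),
      Φ.toX.isOpen_inter_preimage Metric.isOpen_ball, ⟨hp, Metric.mem_ball_self (half_pos hR)⟩,
      fun B hB hBμ => ⟨squashForm Φ f B,
        smoothFormAt_squashForm f.contDiff hmaps f.hasCompactSupport hsup hB,
        (restrictForm_squashForm f.contDiff).trans hBμ, fun x hx =>
        extD_squashForm_eq_zero_of_one f.contDiff hmaps f.hasCompactSupport hsup hB
          (by rwa [hBμ]) hx.1 ?_, fun x hx =>
        eventually_extD_squashForm f.contDiff hmaps f.hasCompactSupport hsup hB hx⟩⟩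
    filter_upwards [Metric.isOpen_ball.mem_nhds hx.2] with z hz
      using f.one_of_mem_closedBall (Metric.ball_subset_closedBall hz)
  choose W hW hpW hstep using hstep
  have hfin : ∀ t : Finset D, ∃ B : DForm (n + 1) r X, (∀ x, SmoothFormAt B x) ∧
      restrictForm D B = μ ∧ ∀ x ∈ D, (∃ p ∈ t, x ∈ W p) → ∀ᶠ y in 𝓝 x, extD B y = 0 := by
    classical
    intro t
    induction t using Finset.induction with
    | empty => exact ⟨B₀, hB₀, hB₀μ, fun x _ ⟨p, hp, _⟩ => absurd hp (Finset.notMem_empty p)⟩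
    | insert p t _ ih =>
      obtain ⟨B, hB, hBμ, h⟩ := ih
      obtain ⟨B', hB', hBμ', h₁, h₂⟩ := hstep p B hB hBμ
      refine ⟨B', hB', hBμ', fun x hx ⟨q, hq, hxq⟩ => ?_⟩
      rcases Finset.mem_insert.mp hq with rfl | hq
      · filter_upwards [(hW q).mem_nhds hxq] with y hy using h₁ y hy
      · exact h₂ x hx (h x hx ⟨q, hq, hxq⟩)
  obtain ⟨t, ht⟩ := isCompact_univ.elim_finite_subcover (fun p : D => Subtype.val ⁻¹' W p)
    (fun p => (hW p).preimage continuous_subtype_val)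
    (fun p _ => mem_iUnion.mpr ⟨p, hpW p⟩)
  obtain ⟨B, hB, hBμ, h⟩ := hfin t
  refine ⟨B, hB, hBμ, fun x hx => h x hx ?_⟩
  obtain ⟨p, hp, hxp⟩ := mem_iUnion₂.mp (ht (mem_univ (⟨x, hx⟩ : D)))
  exact ⟨p, hp, hxp⟩

end Extension

/-! ### Independence of the representatives of the residues -/

lemma extD_neg_one_smul {c : DForm d r M} {x : M} (hc : SmoothFormAt c x) :
    extD (fun y => (-1 : ℂ) • c y) x = (-1 : ℂ) • extD c x := by
  rw [extD_smul (c := fun _ => (-1 : ℂ)) contMDiffAt_const hc]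
  have h : dFun (d := d) (fun _ : M => (-1 : ℂ)) x = (0 : ℂ) • (0 : ℂ^d →L[ℝ] ℂ) := by
    rw [clm_zero_smul]
    exact mfderiv_const
  rw [h, wedgeOne_smul_left, form_zero_smul]
  exact zero_add _

lemma isDExact_zero : IsDExact (0 : DForm d r M) := by
  cases r with
  | zero => rfl
  | succ r =>
    exact ⟨fun _ => 0, (smoothFormOn_iff isOpen_univ).mpr fun _ _ => SmoothFormAt.zero,
      funext fun x => (extD_zero x).symm⟩

lemma isDelExact_zero : IsDelExact (0 : DForm d r M) := by
  cases r with
  | zero => rfl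
  | succ r =>
    refine ⟨fun _ => 0, (smoothFormOn_iff isOpen_univ).mpr fun _ _ => SmoothFormAt.zero,
      fun _ => isTypeHol_zero, funext fun x => ?_⟩
    rw [del, extD_zero, holPart_zero]
    rfl

variable [T2Space M] [CompactSpace M] {ρ ρ' Y : DForm d d M}

lemma formIntegral_wedge_add (hρ : ∀ p, SmoothFormAt ρ p) (hρ' : ∀ p, SmoothFormAt ρ' p)
    (hY : ∀ p, SmoothFormAt Y p) : formIntegral (fun p => wedge (ρ p + ρ' p) (Y p)) univ =
      formIntegral (fun p => wedge (ρ p) (Y p)) univ +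
        formIntegral (fun p => wedge (ρ' p) (Y p)) univ := by
  rw [← formIntegral_add isClosed_univ
    (((smoothFormOn_iff isOpen_univ).mpr fun p _ => (hρ p).wedge (hY p)).contFormOn isOpen_univ)
    (((smoothFormOn_iff isOpen_univ).mpr fun p _ => (hρ' p).wedge (hY p)).contFormOn isOpen_univ)]
  simp only [wedge_add_left]

/-- Pairings with a closed form on `D` only depend on the class modulo exact forms. -/
lemma formIntegral_eq_of_isDExact (hρ' : ∀ p, SmoothFormAt ρ' p) (hY : ∀ p, SmoothFormAt Y p)
    (hdY : ∀ p, extD Y p = 0) (h : IsDExact (ρ - ρ')) :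
    formIntegral (fun p => wedge (ρ p) (Y p)) univ =
      formIntegral (fun p => wedge (ρ' p) (Y p)) univ := by
  cases d with
  | zero => rw [sub_eq_zero.mp (show ρ - ρ' = 0 from h)]
  | succ d =>
    obtain ⟨b, hb, hbρ⟩ := h
    have hb' := fun p => hb.apply isOpen_univ (mem_univ p)
    have hdb := fun p => (hb.extD isOpen_univ).apply isOpen_univ (mem_univ p)
    have h1 : ρ = fun p => ρ' p + extD b p := by
      rw [eq_add_of_sub_eq' hbρ]; rfl
    rw [h1, formIntegral_wedge_add hρ' hdb hY,
      formIntegral_wedge_extD_eq_zero hb' hY fun p => Or.inr (hdY p),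
      add_zero]

/-- Pairings with the conjugate of a closed form of top holomorphic type only depend on the class
modulo the image of `∂`, since `∂b ∧ Ȳ = db ∧ Ȳ`. -/
lemma formIntegral_eq_of_isDelExact (hρ' : ∀ p, SmoothFormAt ρ' p) (hY : ∀ p, SmoothFormAt Y p)
    (ht : ∀ p, IsTypeHol (Y p)) (hdY : ∀ p, extD Y p = 0) (h : IsDelExact (ρ - ρ')) :
    formIntegral (fun p => wedge (ρ p) (conjForm (Y p))) univ =
      formIntegral (fun p => wedge (ρ' p) (conjForm (Y p))) univ := by
  cases d with
  | zero => rw [sub_eq_zero.mp (show ρ - ρ' = 0 from h)]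
  | succ d =>
    obtain ⟨b, hb, -, hbρ⟩ := h
    have hb' := fun p => hb.apply isOpen_univ (mem_univ p)
    have hdb := fun p => (hb.extD isOpen_univ).apply isOpen_univ (mem_univ p)
    have h1 : ρ = fun p => ρ' p + holPart (extD b p) := by
      rw [eq_add_of_sub_eq' hbρ]; rfl
    rw [h1, formIntegral_wedge_add hρ' (fun p => (hdb p).holPart)
      fun p => (hY p).conjForm]
    simp only [wedge_holPart_conj _ (ht _)]
    rw [formIntegral_wedge_extD_eq_zero hb' (fun p => (hY p).conjForm)
      fun p => Or.inr (extD_conjForm_eq_zero (hY p) (hdY p)), add_zero]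

section Expansion

variable {k : ℕ} {lam : X → ℝ} {a α β : DForm (n + 1) (n + 1) X} {ρ σ : DForm n n D}

lemma IsCutoff.exp_mul (hlam : IsCutoff (n + 1) D lam) {φ : X → ℝ}
    (hφ : ContMDiff 𝓘(ℝ, ℂ^(n + 1)) 𝓘(ℝ, ℝ) ∞ φ) :
    IsCutoff (n + 1) D fun x => exp (φ x) * lam x where
  nonneg x := mul_nonneg (Real.exp_nonneg _) (hlam.nonneg x)
  pos x hx := mul_pos (exp_pos _) (hlam.pos x hx)
  extends_smoothly U f hf := by
    obtain ⟨h, hh, hpos⟩ := hlam.extends_smoothly U f hf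
    have he : ContMDiff 𝓘(ℝ, ℂ^(n + 1)) 𝓘(ℝ, ℝ) ∞ fun x => exp (φ x) :=
      Real.contDiff_exp.contMDiff.comp hφ
    refine ⟨fun x => exp (φ x) * h x, fun x hx => ?_, fun x hx =>
      ⟨mul_pos (exp_pos _) (hpos x hx).1, by rw [(hpos x hx).2, mul_assoc]⟩⟩
    have h1 : ContDiff ℝ ∞ fun p : ℝ × ℝ => p.1 * p.2 := contDiff_fst.mul contDiff_snd
    exact h1.contMDiff.contMDiffAt.comp_contMDiffWithinAt x
      (((he x).contMDiffWithinAt).prodMk_space (hh x hx))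

variable (hA : HasAdaptedCharts n D)
include hA

lemma IsCutoff.superlevel_subset (hlam : IsCutoff (n + 1) D lam) {ε : ℝ} (hε : 0 < ε) :
    {x | ε ≤ lam x} ⊆ Dᶜ := fun x hx hD => by
  rw [mem_ofPred_eq, hlam.eq_zero hA hD] at hx
  linarith

/-- Expansions are additive. -/
lemma HasExpansion.sub_of_eq (hlam : IsCutoff (n + 1) D lam)
    {Ω Ω₁ Ω₂ : DForm (n + 1) (n + 1 + (n + 1)) X} (hΩ : SmoothFormOn Ω Dᶜ)
    (hΩ₂ : SmoothFormOn Ω₂ Dᶜ) (heq : ∀ x ∉ D, Ω₁ x = Ω₂ x + Ω x) {A₁ A₂ B₁ B₂ : ℂ}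
    (h₁ : HasExpansion lam Ω₁ A₁ B₁) (h₂ : HasExpansion lam Ω₂ A₂ B₂) :
    HasExpansion lam Ω (A₁ - A₂) (B₁ - B₂) := by
  have ho := (isClosed_hypersurface D).isOpen_compl
  refine ⟨(h₁.1.sub h₂.1).congr' ?_ EventuallyEq.rfl, fun θ hθ hθc =>
    ((h₁.2 θ hθ hθc).sub (h₂.2 θ hθ hθc)).congr' ?_ EventuallyEq.rfl⟩
  · filter_upwards [self_mem_nhdsWithin] with ε hε
    have hS : IsClosed {x | ε ≤ lam x} := isClosed_le continuous_const (hlam.continuous hA)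
    have hsub := hlam.superlevel_subset hA hε
    rw [formIntegral_congr (b := fun x => Ω₂ x + Ω x) (fun x hx => heq x (hsub hx)) hS,
      formIntegral_add hS ((hΩ₂.contFormOn ho).mono hsub) ((hΩ.contFormOn ho).mono hsub)]
    ring
  · filter_upwards [self_mem_nhdsWithin] with ε hε
    have h3 : tubeIntegral θ lam ε Ω₁ = tubeIntegral θ lam ε Ω₂ + tubeIntegral θ lam ε Ω := by
      rw [tubeIntegral, tubeIntegral, tubeIntegral, ← formIntegral_add isClosed_univ
        (contFormOn_profile_smul hA hΩ₂ hlam hθ hθc hε) (contFormOn_profile_smul hA hΩ hlam hθ hθc hε)]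
      refine formIntegral_congr (fun x _ => ?_) isClosed_univ
      by_cases hx : x ∈ D
      · rw [hlam.eq_zero hA hx, zero_div, hθ.eq_zero 0 (by norm_num), ofReal_zero,
          form_zero_smul, form_zero_smul, form_zero_smul]
        exact (add_zero _).symm
      · rw [heq x hx]
        exact smul_add _ _ _
    rw [h3]
    ring

/-- The integral over `D` of the residue of a form with a simple pole only depends on the cohomology
class of the form on the complement of `D`. -/
lemma formIntegral_residue_eq (hlam : IsCutoff (n + 1) D lam) (hβ : HasPoleLE D 1 β)
    (ht : ∀ x ∉ D, IsTypeHol (β x)) (hclβ : ∀ x ∉ D, extD β x = 0) (hσ : IsPoincareResidue D β σ)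
    {a₁ a₂ : DForm (n + 1) (n + 1) X} {c : DForm (n + 1) n X} {ρ₁ ρ₂ : DForm n n D}
    (ha₁ : HasPoleLE D 1 a₁) (ha₂ : HasPoleLE D 1 a₂) (hcl₁ : ∀ x ∉ D, extD a₁ x = 0)
    (hcl₂ : ∀ x ∉ D, extD a₂ x = 0) (hc : SmoothFormOn c Dᶜ)
    (hac : ∀ x ∉ D, a₁ x = a₂ x + extD c x) (hρ₁ : IsPoincareResidue D a₁ ρ₁)
    (hρ₂ : IsPoincareResidue D a₂ ρ₂) :
    formIntegral (fun p => wedge (ρ₁ p) (conjForm (σ p))) univ =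
      formIntegral (fun p => wedge (ρ₂ p) (conjForm (σ p))) univ := by
  have ho := (isClosed_hypersurface D).isOpen_compl
  have hDe : IsEmbedding (Subtype.val : D → X) := IsEmbedding.subtypeVal
  -- extend the conjugate of the residue of `β` to a form closed near `D`
  obtain ⟨B₀, hB₀, hB₀σ⟩ := hσ.exists_extension
  obtain ⟨B, hB, hBσ, hBcl⟩ := exists_extension_closed_near hA (μ := fun p => conjForm (σ p))
    (fun p => extD_conjForm_eq_zero (hσ.smoothFormAt hA hDe p) (hσ.extD_eq_zero hA hDe hβ ht hclβ p))
    (B₀ := fun x => conjForm (B₀ x)) (fun x => (hB₀ x).conjForm) (by rw [← hB₀σ]; rfl)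
  obtain ⟨E₁, h₁⟩ := HasExpansion.coeff_eq_residue_dlog hA hDe hlam ha₁ hcl₁ hρ₁ hB
  obtain ⟨E₂, h₂⟩ := HasExpansion.coeff_eq_residue_dlog hA hDe hlam ha₂ hcl₂ hρ₂ hB
  have hd := hlam.smoothFormOn_dlog ((smoothFormOn_iff ho).mpr fun x _ => hB x)
  have h3 := HasExpansion.coeff_extD_wedge_dlog hA hlam hc hB hBcl
    (HasExpansion.sub_of_eq hA hlam ((hc.extD ho).wedge hd ho)
      (ha₂.smoothFormOn.wedge hd ho)
      (fun x hx => by rw [hac x hx, wedge_add_left]) h₁ h₂)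
  rw [hBσ, ← mul_sub] at h3
  refine sub_eq_zero.mp ((mul_eq_zero.mp h3).resolve_left ?_)
  simp [Real.pi_ne_zero]

/-- The coefficient of the logarithmic term in terms of the Leray residue. -/
lemma HasExpansion.coeff_eq_leray (hlam : IsCutoff (n + 1) D lam) (hα : HasPoleLE D (k + 1) α)
    (hclα : ∀ x ∉ D, extD α x = 0) (hβ : HasPoleLE D 1 β) (ht : ∀ x ∉ D, IsTypeHol (β x))
    (hclβ : ∀ x ∉ D, extD β x = 0) (hρ : IsLerayResidue D α ρ) (hσ : IsPoincareResidue D β σ)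
    {A B : ℂ} (h : HasExpansion lam (fun x => wedge (α x) (conjForm (β x))) A B) :
    A = 2 * π * ((-1) ^ n * (-2 * I)) *
      formIntegral (fun p => wedge (ρ p) (conjForm (σ p))) univ := by
  have ho := (isClosed_hypersurface D).isOpen_compl
  have hDe : IsEmbedding (Subtype.val : D → X) := IsEmbedding.subtypeVal
  obtain ⟨c₀, ⟨j, hc₀⟩, ha₀⟩ := hα.exists_simple_of_closed hA hclα
  obtain ⟨a', c, ρ', ha', hc, hac, hρ', hex⟩ := hρ
  have hcl : ∀ {c : DForm (n + 1) n X}, SmoothFormOn c Dᶜ → ∀ x ∉ D,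
      extD (fun x => α x + extD c x) x = 0 := fun {c} hc x hx => by
    rw [extD_add (hα.smoothFormAt hx) ((hc.extD ho).apply ho hx), hclα x hx,
      extD_extD ho hc hx]
    exact add_zero _
  have hcl' : ∀ x ∉ D, extD a' x = 0 := fun x hx => by
    rw [← hcl hc x hx]
    refine extD_congr ?_
    filter_upwards [ho.mem_nhds hx] with y hy using hac y hy
  obtain ⟨ρ₀, hρ₀⟩ := exists_residue_of_split hA ha₀ fun Φ b hb =>
    hb.exists_isSplit_of_closed (k := 0) (hcl hc₀.smoothFormOn)
  -- the form with a simple pole obtained by adding an exact form with poles has the same coefficient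
  obtain ⟨A₀, hA₀⟩ := (ha₀.isPolar (k := 0) hβ).exists_coeff hA
  obtain ⟨B₀, hB₀⟩ := hA₀ lam hlam
  have h1 := hc₀.coeff_extD_wedge_conj hA hlam hβ ht hclβ (HasExpansion.sub_of_eq hA hlam
    ((hc₀.smoothFormOn.extD ho).wedge (hβ.smoothFormOn.conjForm ho) ho)
    (hα.isPolar hβ).1 (fun x _ => wedge_add_left _ _ _) hB₀ h)
  rw [← sub_eq_zero.mp h1, hB₀.coeff_eq_residue hA hDe hlam ha₀ hβ hρ₀ hσ]
  -- the difference of the two forms with simple poles is exact on the complement of `D`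
  have hs : ∀ x ∉ D, SmoothFormAt (fun y => (-1 : ℂ) • c₀ y) x := fun x hx =>
    SmoothFormAt.smul (c := fun _ => (-1 : ℂ)) contMDiffAt_const (hc₀.smoothFormAt hx)
  have h2 := formIntegral_residue_eq hA hlam hβ ht hclβ hσ ha' ha₀ hcl' (hcl hc₀.smoothFormOn)
    ((smoothFormOn_iff ho).mpr fun x hx => (hc.apply ho hx).add (hs x hx)) (fun x hx => by
      rw [hac x hx, extD_add (hc.apply ho hx) (hs x hx), extD_neg_one_smul (hc₀.smoothFormAt hx)]
      ext v
      change α x v + extD c x v = α x v + extD c₀ x v + (extD c x v + -1 * extD c₀ x v)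
      ring) hρ' hρ₀
  have hσs := hσ.smoothFormAt hA hDe
  rw [← h2, formIntegral_eq_of_isDExact (hρ'.smoothFormAt hA hDe) (fun p => (hσs p).conjForm)
    (fun p => extD_conjForm_eq_zero (hσs p) (hσ.extD_eq_zero hA hDe hβ ht hclβ p)) hex]

/-- The coefficient of the logarithmic term in terms of the Dolbeault residue. -/
lemma HasExpansion.coeff_eq_dolbeault (hlam : IsCutoff (n + 1) D lam)
    (hβ : HasPoleLE D 1 β) (ht : ∀ x ∉ D, IsTypeHol (β x))
    (hclβ : ∀ x ∉ D, extD β x = 0) (hρ : IsDolbeaultResidue D α ρ) (hσ : IsPoincareResidue D β σ)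
    {A B : ℂ} (h : HasExpansion lam (fun x => wedge (α x) (conjForm (β x))) A B) :
    A = 2 * π * ((-1) ^ n * (-2 * I)) *
      formIntegral (fun p => wedge (ρ p) (conjForm (σ p))) univ := by
  have ho := (isClosed_hypersurface D).isOpen_compl
  have hDe : IsEmbedding (Subtype.val : D → X) := IsEmbedding.subtypeVal
  obtain ⟨a', c, ρ', hlog, -, ⟨j, hc⟩, -, hac, hρ', hex⟩ := hρ
  have ha' : HasPoleLE D 1 a' := fun U f hf =>
    let ⟨b, hb, hba⟩ := (hlog U f hf).1
    ⟨b, hb, fun x hx hxD => by rw [hba x hx hxD, pow_one]⟩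
  obtain ⟨A₀, hA₀⟩ := (ha'.isPolar (k := 0) hβ).exists_coeff hA
  obtain ⟨B₀, hB₀⟩ := hA₀ lam hlam
  have h1 := hc.coeff_extD_wedge_conj hA hlam hβ ht hclβ (HasExpansion.sub_of_eq hA hlam
    ((hc.smoothFormOn.extD ho).wedge (hβ.smoothFormOn.conjForm ho) ho)
    (ha'.isPolar (k := 0) hβ).1 (fun x hx => by
      -- `∂c` may be replaced by `dc` in the product with the form `β̄` of type `(0, n + 1)`
      rw [hac x hx, wedge_add_left, del, wedge_holPart_conj _ (ht x hx)]) h hB₀)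
  rw [sub_eq_zero.mp h1, hB₀.coeff_eq_residue hA hDe hlam ha' hβ hρ' hσ,
    formIntegral_eq_of_isDelExact (hρ'.smoothFormAt hA hDe) (hσ.smoothFormAt hA hDe)
      (hσ.isTypeHol hA hβ ht) (hσ.extD_eq_zero hA hDe hβ ht hclβ) hex]

/-- Lower the order of the pole by exact forms and take the Poincaré residue. -/
lemma exists_isLerayResidue (hα : HasPoleLE D (k + 1) α) (hclα : ∀ x ∉ D, extD α x = 0) :
    ∃ ρ : DForm n n D, IsLerayResidue D α ρ := by
  have ho := (isClosed_hypersurface D).isOpen_compl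
  obtain ⟨c, ⟨j, hc⟩, ha⟩ := hα.exists_simple_of_closed hA hclα
  obtain ⟨ρ, hρ⟩ := exists_residue_of_split hA ha fun Φ b hb =>
    hb.exists_isSplit_of_closed (k := 0) fun x hx => by
      rw [extD_add (hα.smoothFormAt hx) ((hc.smoothFormOn.extD ho).apply ho hx), hclα x hx, extD_extD ho hc.smoothFormOn hx]
      exact add_zero _
  exact ⟨ρ, _, c, ρ, ha, hc.smoothFormOn, fun _ _ => rfl, hρ, by
    rw [sub_self]; exact isDExact_zero⟩

/-- Lower the order of the pole by forms `∂c` and take the Poincaré residue. -/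
lemma exists_isDolbeaultResidue (ha : HasPoleLE D (k + 1) α) (ht : ∀ x ∉ D, IsTypeHol (α x)) :
    ∃ ρ : DForm n n D, IsDolbeaultResidue D α ρ := by
  obtain ⟨c, ⟨j, hc⟩, hct, h⟩ := ha.exists_simple_of_isTypeHol hA ht
  have ht' : ∀ x ∉ D, IsTypeHol (α x + del c x) := fun x hx => (ht x hx).add (isTypeHol_holPart _)
  obtain ⟨ρ, hρ⟩ := exists_residue_of_split hA h fun Φ b hb => hb.exists_isSplit_of_isTypeHol ht'
  refine ⟨ρ, _, fun x => (-1 : ℂ) • c x, ρ, h.isLogForm ht', ht', ⟨j, hc.smul hA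
    fun _ => contMDiffAt_const⟩, fun x hx => (hct x hx).smul _, fun x hx => ?_, hρ, by
      rw [sub_self]; exact isDelExact_zero⟩
  rw [del, del, extD_neg_one_smul (hc.smoothFormAt hx), holPart_smul]
  ext v
  change α x v = α x v + holPart (extD c x) v + -1 * holPart (extD c x) v
  ring

end Expansion

/-! ### Normalization, and the case of an empty hypersurface -/

section Conclusion

variable {k : ℕ} {lam : X → ℝ} {α β : DForm (n + 1) (n + 1) X} {ρ σ : DForm n n D}

lemma inv_two_pi_I_mul_coeff (J : ℂ) : (2 * π * I)⁻¹ *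
    (2 * π * ((-1) ^ n * (-2 * I)) * J) = -(2 * (-1) ^ n * J) := by
  have := Complex.ofReal_ne_zero.mpr Real.pi_ne_zero
  field_simp

/-- The expansion after multiplication with `1 / (2πi)`, where the coefficient of `log ε` becomes
`2 (-1)ⁿ J`. -/
lemma HasExpansion.normalize {Ω : DForm (n + 1) (n + 1 + (n + 1)) X} {A B J : ℂ}
    (h : HasExpansion lam Ω A B) (hA : A = 2 * π * ((-1) ^ n * (-2 * I)) * J) :
    (fun ε : ℝ => (2 * π * I)⁻¹ * formIntegral Ω {x | ε ≤ lam x} -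
      (2 * (-1) ^ n * J * log ε + (2 * π * I)⁻¹ * B)) =O[𝓝[>] (0 : ℝ)]
        (fun ε : ℝ => ε) := by
  refine (h.1.const_mul_left (2 * π * I)⁻¹).congr_left fun ε => ?_
  have := inv_two_pi_I_mul_coeff (n := n) J
  rw [← hA] at this
  linear_combination (log ε : ℂ) * this

section Empty

variable [IsEmpty D]

lemma hasPoleLE_of_isEmpty {r : ℕ} {a : DForm (n + 1) r X} (ha : ∀ x, SmoothFormAt a x) :
    HasPoleLE D k a := fun _ f hf =>
  ⟨fun x => f x ^ k • a x, (smoothFormOn_iff hf.isOpen).mpr fun x hx =>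
    SmoothFormAt.smul
      ((contDiff_id.pow k : ContDiff ℝ ∞ fun z : ℂ => z ^ k).contMDiff.contMDiffAt.comp x
        (hf.contMDiffAt hx)) (ha x), fun _ _ _ => rfl⟩

lemma isPoincareResidue_of_isEmpty {r : ℕ} (a : DForm (n + 1) (r + 1) X) (ρ : DForm n r D) :
    IsPoincareResidue D a ρ := fun p => isEmptyElim p

/-- Integrals over an empty manifold vanish. -/
lemma formIntegral_of_isEmpty {M : Type*} [TopologicalSpace M] [ChartedSpace ℂ^n M]
    [T2Space M] [CompactSpace M] [IsEmpty M] (a : DForm n (n + n) M) (S : Set M) :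
    formIntegral a S = 0 := by
  rw [formIntegral, finsum_of_isEmpty]

/-- If `D` is empty then a cut-off function is bounded below, and the integral is eventually
constant. -/
lemma eventually_superlevel_eq_univ (hlam : IsCutoff (n + 1) D lam) :
    ∀ᶠ ε in 𝓝[>] (0 : ℝ), {x | ε ≤ lam x} = univ := by
  have hc : Continuous lam := continuous_iff_continuousAt.mpr fun x =>
    (hlam.contMDiffAt fun hx => isEmptyElim (⟨x, hx⟩ : D)).continuousAt
  rcases isEmpty_or_nonempty X with hX | hX
  · exact Eventually.of_forall fun ε => Subsingleton.elim _ _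
  obtain ⟨x₀, -, h₀⟩ := isCompact_univ.exists_isMinOn univ_nonempty hc.continuousOn
  filter_upwards [Ioo_mem_nhdsGT (hlam.pos x₀ fun hx => isEmptyElim (⟨x₀, hx⟩ : D))] with ε hε
  exact eq_univ_of_forall fun x => hε.2.le.trans (h₀ (mem_univ x))

end Empty

end Conclusion

end DivInt

end

theorem theorem3p2 (n : ℕ) {X : Type*} [TopologicalSpace X] [T2Space X] [CompactSpace X]
    [ChartedSpace (Fin (n + 1) → ℂ) X] [IsManifold 𝓘(ℂ, Fin (n + 1) → ℂ) ω X]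
    (D : Set X) [CompactSpace D] [ChartedSpace (Fin n → ℂ) D] [IsManifold 𝓘(ℂ, Fin n → ℂ) ω D]
    (hD : IsSmoothEmbedding 𝓘(ℂ, Fin n → ℂ) 𝓘(ℂ, Fin (n + 1) → ℂ) ω (Subtype.val : D → X))
    (m : ℕ) (α β : DForm (n + 1) (n + 1) X)
    (hα : IsMeromorphicForm D m α) (hβ : IsMeromorphicForm D 1 β) :
    -- the residues exist
    (∃ ρβ : DForm n n D, IsPoincareResidue D β ρβ) ∧
    (∃ ρα : DForm n n D, IsLerayResidue D α ρα) ∧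
    (∀ φ : X → ℝ, ContMDiff 𝓘(ℝ, Fin (n + 1) → ℂ) 𝓘(ℝ, ℝ) ∞ φ →
      ∃ ρ : DForm n n D, IsDolbeaultResidue D (fun x => (φ x : ℂ) • α x) ρ) ∧
    ∃ I₁ : (X → ℝ) → ℂ,
      -- the asymptotic expansion
      (∀ lam : X → ℝ, IsCutoff (n + 1) D lam →
        (∀ ε : ℝ, 0 < ε →
          FormIntegrableOn (fun x => wedge (α x) (conjForm (β x))) {x | ε ≤ lam x}) ∧
        ∀ ρα ρβ : DForm n n D, IsLerayResidue D α ρα → IsPoincareResidue D β ρβ →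
          (fun ε : ℝ =>
            (2 * Real.pi * Complex.I)⁻¹ *
                formIntegral (fun x => wedge (α x) (conjForm (β x))) {x | ε ≤ lam x}
              - ((2 * (-1) ^ n * formIntegral (fun p => wedge (ρα p) (conjForm (ρβ p))) univ)
                  * Real.log ε + I₁ lam))
            =O[𝓝[>] (0 : ℝ)] (fun ε : ℝ => ε)) ∧
      -- the dependence on the cut-off function
      (∀ (lam φ : X → ℝ), IsCutoff (n + 1) D lam →
        ContMDiff 𝓘(ℝ, Fin (n + 1) → ℂ) 𝓘(ℝ, ℝ) ∞ φ →
        ∀ ρ ρβ : DForm n n D, IsDolbeaultResidue D (fun x => (φ x : ℂ) • α x) ρ →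
          IsPoincareResidue D β ρβ →
          I₁ (fun x => Real.exp (φ x) * lam x) = I₁ lam -
            2 * (-1) ^ n * formIntegral (fun p => wedge (ρ p) (conjForm (ρβ p))) univ) := by
  have hβ' : HasPoleLE D 1 β := hβ.hasPoleLE
  have htα : ∀ x ∉ D, IsTypeHol (α x) := fun x hx => hα.isTypeHol hx
  have htβ : ∀ x ∉ D, IsTypeHol (β x) := fun x hx => hβ.isTypeHol hx
  have hclα : ∀ x ∉ D, extD α x = 0 := fun x hx => hα.extD_eq_zero hx
  have hclβ : ∀ x ∉ D, extD β x = 0 := fun x hx => hβ.extD_eq_zero hx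
  rcases isEmpty_or_nonempty D with hE | hE
  · have hDx : ∀ x, x ∉ D := fun x hx => isEmptyElim (⟨x, hx⟩ : D)
    have ho := (isClosed_hypersurface D).isOpen_compl
    replace hα : ∀ x, SmoothFormAt α x := fun x =>
      (smoothFormOn_iff ho).mp hα.hasPoleLE.smoothFormOn x (hDx x)
    replace hβ : ∀ x, SmoothFormAt β x := fun x =>
      (smoothFormOn_iff ho).mp hβ'.smoothFormOn x (hDx x)
    have ht : ∀ x, IsTypeHol (α x) := fun x => htα x (hDx x)
    have h0 : ∀ (k r : ℕ), HasPoleLE D k (fun _ => 0 : DForm (n + 1) r X) := fun k r =>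
      hasPoleLE_of_isEmpty fun _ => SmoothFormAt.zero
    have hz : SmoothFormOn (fun _ => 0 : DForm (n + 1) n X) Dᶜ :=
      (smoothFormOn_iff (isClosed_hypersurface D).isOpen_compl).mpr fun x _ => SmoothFormAt.zero
    refine ⟨⟨0, isPoincareResidue_of_isEmpty _ _⟩, ⟨0, α, fun _ => 0, 0, hasPoleLE_of_isEmpty hα, hz,
      fun x _ => ?_, isPoincareResidue_of_isEmpty _ _, ?_⟩, fun φ hφ => ⟨0, fun x => (φ x : ℂ) • α x,
      fun _ => 0, 0, (hasPoleLE_of_isEmpty fun x => (SmoothFormAt.smul (contMDiff_ofReal (hφ x))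
        (hα x))).isLogForm fun x _ => (ht x).smul _, fun x _ => (ht x).smul _, ⟨0, h0 0 n⟩,
      fun x _ => isTypeHol_zero, fun x _ => ?_, isPoincareResidue_of_isEmpty _ _, ?_⟩,
      fun _ => (2 * Real.pi * Complex.I)⁻¹ *
        formIntegral (fun x => wedge (α x) (conjForm (β x))) univ,
      fun lam hlam => ⟨fun ε _ => formIntegrableOn_of_cont ?_ (SmoothFormOn.contFormOn isOpen_univ
        ((smoothFormOn_iff isOpen_univ).mpr fun x _ => (hα x).wedge (hβ x).conjForm) |>.mono
          (subset_univ _)), fun ρα ρβ _ _ => ?_⟩, fun lam φ _ _ ρ ρβ _ _ => ?_⟩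
    · rw [extD_zero]; exact (add_zero _).symm
    · rw [sub_self]; exact isDExact_zero
    · rw [del, extD_zero]
      exact ((add_zero _).symm).trans (congrArg _ holPart_zero.symm)
    · rw [sub_self]; exact isDelExact_zero
    · exact isClosed_le continuous_const (continuous_iff_continuousAt.mpr fun x =>
        (hlam.contMDiffAt (hDx x)).continuousAt)
    · beta_reduce
      refine EventuallyEq.trans_isBigO ?_ (Asymptotics.isBigO_zero (E' := ℂ) _ _)
      filter_upwards [eventually_superlevel_eq_univ hlam] with ε hε
      rw [hε, formIntegral_of_isEmpty (M := D)]
      simp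
    · simp only [formIntegral_of_isEmpty (M := D), mul_zero, sub_zero]
  · have hA := exists_adaptedChart hD
    have hα' : HasPoleLE D (m + 1) α := hα.hasPoleLE.mono hA m.le_succ
    have hφα : ∀ φ : X → ℝ, ContMDiff 𝓘(ℝ, Fin (n + 1) → ℂ) 𝓘(ℝ, ℝ) ∞ φ →
        HasPoleLE D (m + 1) fun x => (φ x : ℂ) • α x := fun φ hφ =>
      hα'.smul hA fun x => contMDiff_ofReal (hφ x)
    have hΩ := hα'.isPolar hβ'
    obtain ⟨A, hAB⟩ := hΩ.exists_coeff hA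
    choose! B hB using hAB
    refine ⟨exists_residue_of_split hA hβ' fun Φ b hb => hb.exists_isSplit_of_isTypeHol htβ,
      exists_isLerayResidue hA hα' hclα, fun φ hφ => exists_isDolbeaultResidue hA (hφα φ hφ)
        fun x hx => (htα x hx).smul _, fun lam => (2 * Real.pi * Complex.I)⁻¹ * B lam,
      fun lam hlam => ⟨fun ε hε => formIntegrableOn_of_cont
        (isClosed_le continuous_const (hlam.continuous hA)) ((hΩ.1.contFormOn
          (isClosed_hypersurface D).isOpen_compl).mono (hlam.superlevel_subset hA hε)),
        fun ρα ρβ hρα hρβ => (hB lam hlam).normalize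
          ((hB lam hlam).coeff_eq_leray hA hlam hα' hclα hβ' htβ hclβ hρα hρβ)⟩,
      fun lam φ hlam hφ ρ ρβ hρ hρβ => ?_⟩
    obtain ⟨A₁, hA₁⟩ := ((hφα φ hφ).isPolar hβ').exists_coeff hA
    obtain ⟨B₁, hB₁⟩ := hA₁ lam hlam
    have hlam' := hlam.exp_mul hφ
    have h := HasExpansion.constant_exp_mul hA hΩ hφ hlam hlam' (hB _ hlam) (hB _ hlam')
      (by simpa only [wedge_smul_left] using hB₁)
    have hJ := hB₁.coeff_eq_dolbeault hA hlam hβ' htβ hclβ hρ hρβ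
    beta_reduce
    rw [h, hJ, mul_add, inv_two_pi_I_mul_coeff, sub_eq_add_neg]
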